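/- There are absolute constants $C_1,C_2>0$ such that the following holds. Let $m\ge 1$ be an integer, let $\delta\in(0,1)$ and $\varepsilon\in(0,\delta)$ be real numbers, and let $s$ be an integer with $s\ge C_1m^2/\varepsilon^{2m}$ (for instance $s=\lceil C_1m^2/\varepsilon^{2m}\rceil=O(m^2/\varepsilon^{2m})$). Let $\mathbb F_q$ be any finite field with $q\ge s$, let $\mathbb K=\mathbb F_{q^3}$, let $Q$ be a generator of the multiplicative group $\mathbb K^\times$, let $A\subseteq\mathbb F_q^\times$ be nonempty, and let $k=\lceil(1-\delta)s|A|\rceil$. For $f\in\mathbb K[X_1,\dots,X_m]$ let $$D_{X_i}f=\frac{f(X_1,\dots,QX_i,\dots,X_m)-f(X_1,\dots,X_m)}{(Q-1)X_i},\qquad D^\gamma=D_{X_1}^{\gamma_1}\cdots D_{X_m}^{\gamma_m}\quad(\gamma\in\mathbb N^m),$$ and let $$\mathrm{Qmult}_{m,s}(A;k)=\Big\{\big([D^\gamma f(a)]_{|\gamma|<s}\big)_{a\in A^m}:\ f\in\mathbb K[X_1,\dots,X_m],\ \deg f<k\Big\},$$ a code of length $|A|^m$ over the alphabet $\mathbb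 K^{\binom{m+s-1}{s-1}}$, where $|\gamma|=\gamma_1+\dots+\gamma_m$. The distance of two words is the fraction of the points $a\in A^m$ at which their symbols differ. Then: (i) $\mathrm{Qmult}_{m,s}(A;k)$ is efficiently list decodable up to radius $\delta-\varepsilon$: there are a program for a random access machine over a field and an integer $c$, both depending only on $m,\delta,\varepsilon,s$ (not on $q,Q,A$), such that, given $|A|$, $k$, $\lfloor(\delta-\varepsilon)|A|^m\rfloor$, $Q$, the elements of $A$ in any order, and any received word $w$, the program outputs exactly the list of all codewords at distance at most $\delta-\varepsilon$ from $w$, within $c\,(|A|^m)^c$ steps. A step is one operation of $\mathbb K$, one zero test, one addition or truncated subtraction of natural numbers, the setting of a register to a constant, or one memory access. (ii) For every received word $w$, the list of all codewords at distance at most $\delta-\varepsilon$ from $w$ is contained in a $\mathbb K$-affine subspace of dimension at most $C_2m^2/\varepsilon$. -/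

import Mathlib

/-! ## The `Q`-derivative and the multivariate `Q`-multiplicity code -/

section Code

variable {K : Type*} [Field K] {m : ℕ}

/-- The substitution `X_i ↦ Q X_i` (all other variables are left unchanged). -/
noncomputable def qScale (Q : K) (i : Fin m) (f : MvPolynomial (Fin m) K) :
    MvPolynomial (Fin m) K :=
  MvPolynomial.aeval
    (fun j => if j = i then MvPolynomial.C Q * MvPolynomial.X j else MvPolynomial.X j) f

/-- The `Q`-derivative in the variable `X_i`,
`(f(X_1, …, Q X_i, …, X_m) - f(X)) / ((Q - 1) X_i)`.
The division by the monomial `X_i` is exact, see `qDeriv_spec`. -/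
noncomputable def qDeriv (Q : K) (i : Fin m) (f : MvPolynomial (Fin m) K) :
    MvPolynomial (Fin m) K :=
  MvPolynomial.C (Q - 1)⁻¹ * (qScale Q i f - f).divMonomial (Finsupp.single i 1)

theorem X_dvd_qScale_sub (Q : K) (i : Fin m) (f : MvPolynomial (Fin m) K) :
    MvPolynomial.X i ∣ qScale Q i f - f := by
  induction f using MvPolynomial.induction_on with
  | C a => simp [qScale]
  | add p q hp hq =>
    have h : qScale Q i (p + q) - (p + q) = (qScale Q i p - p) + (qScale Q i q - q) := by
      simp only [qScale, map_add]; ring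
    rw [h]
    exact dvd_add hp hq
  | mul_X p j hp =>
    by_cases hj : j = i
    · subst hj
      have h : qScale Q j (p * MvPolynomial.X j) =
          qScale Q j p * (MvPolynomial.C Q * MvPolynomial.X j) := by
        simp [qScale]
      rw [h]
      exact dvd_sub (Dvd.intro_left (qScale Q j p * MvPolynomial.C Q) (by ring))
        (Dvd.intro_left p rfl)
    · have h : qScale Q i (p * MvPolynomial.X j) = qScale Q i p * MvPolynomial.X j := by
        simp [qScale, hj]
      rw [h, ← sub_mul]
      exact Dvd.dvd.mul_right hp _

theorem qDeriv_spec (Q : K) (hQ : Q ≠ 1) (i : Fin m) (f : MvPolynomial (Fin m) K) :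
    MvPolynomial.C (Q - 1) * MvPolynomial.X i * qDeriv Q i f = qScale Q i f - f := by
  obtain ⟨g, hg⟩ := X_dvd_qScale_sub Q i f
  have h1 : (qScale Q i f - f).divMonomial (Finsupp.single i 1) = g := by
    rw [hg]
    exact MvPolynomial.X_mul_divMonomial i g
  have h2 : (MvPolynomial.C (Q - 1) * MvPolynomial.C (Q - 1)⁻¹ : MvPolynomial (Fin m) K) = 1 := by
    rw [← MvPolynomial.C_mul, mul_inv_cancel₀ (sub_ne_zero.mpr hQ), MvPolynomial.C_1]
  rw [qDeriv, h1, hg]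
  linear_combination (MvPolynomial.X i * g) * h2

/-- The iterated `Q`-derivative `D_{X_1}^{α_1} ⋯ D_{X_m}^{α_m} f`. -/
noncomputable def qDerivIter (Q : K) (α : Fin m → ℕ) (f : MvPolynomial (Fin m) K) :
    MvPolynomial (Fin m) K :=
  (List.finRange m).foldr (fun i g => (qDeriv Q i)^[α i] g) f

/-- The multi-indices `γ ∈ ℕ^m` with `|γ| < s` (every entry of such a `γ` is automatically
smaller than `s`). -/
abbrev MultiIdx (m s : ℕ) : Type := {γ : Fin m → Fin s // ∑ i, (γ i : ℕ) < s}

/-- Words of the code: one symbol in `K^{γ : |γ| < s}` for every point of the grid `A^m`. -/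
abbrev QWord {F : Type*} (K : Type*) (m s : ℕ) (A : Finset F) : Type _ :=
  (Fin m → A) → MultiIdx m s → K

/-- The encoding `f ↦ [[D^γ f(a)]_{|γ| < s}]_{a ∈ A^m}`. -/
noncomputable def qEncode {F : Type*} [Field F] [Algebra F K] (Q : K) (s : ℕ) (A : Finset F)
    (f : MvPolynomial (Fin m) K) : QWord K m s A :=
  fun a γ => MvPolynomial.eval (fun i => algebraMap F K (a i))
    (qDerivIter Q (fun i => (γ.1 i : ℕ)) f)

/-- The `m`-variate multiplicity-`s` degree-`k` `Q`-multiplicity code on the grid `A^m`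
(for `k ≥ 1`). -/
def qMultCode {F : Type*} [Field F] [Algebra F K] (Q : K) (m s : ℕ) (A : Finset F) (k : ℕ) :
    Set (QWord K m s A) :=
  {u | ∃ f : MvPolynomial (Fin m) K, f.totalDegree < k ∧ qEncode Q s A f = u}

/-- The relative blockwise Hamming distance: the fraction of the points `a ∈ A^m` at which the
symbols differ. -/
noncomputable def relDist {F : Type*} {s : ℕ} {A : Finset F} (u v : QWord K m s A) : ℝ :=
  ({a : Fin m → A | u a ≠ v a}.ncard : ℝ) / (A.card : ℝ) ^ m

end Code

/-! ## A random access machine over a field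

The machine has registers and a memory for natural numbers (used for counting and addressing), and
registers and a memory for elements of `K`.  A program addresses registers directly, and memory
cells through the contents of registers.  Every elementary instruction and every test has cost one.
Natural numbers can only be added, subtracted and tested for zero; on elements of `K` the field
operations and the test for zero are available.  A program is a finite object which does not depend
on the field. -/

/-- Elementary instructions.  `N[x]` and `F[x]` denote the registers for natural numbers and for
field elements, `NM[a]` and `FM[a]` the cells of the corresponding memories. -/
inductive RamInstr : Type
  /-- `N[x] := c` -/
  | natConst (x c : ℕ)
  /-- `N[x] := N[y] + N[z]` -/
  | natAdd (x y z : ℕ)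
  /-- `N[x] := N[y] - N[z]` (truncated) -/
  | natSub (x y z : ℕ)
  /-- `N[x] := NM[N[y]]` -/
  | natLoad (x y : ℕ)
  /-- `NM[N[x]] := N[y]` -/
  | natStore (x y : ℕ)
  /-- `F[x] := 0` -/
  | fldZero (x : ℕ)
  /-- `F[x] := 1` -/
  | fldOne (x : ℕ)
  /-- `F[x] := F[y] + F[z]` -/
  | fldAdd (x y z : ℕ)
  /-- `F[x] := F[y] - F[z]` -/
  | fldSub (x y z : ℕ)
  /-- `F[x] := F[y] * F[z]` -/
  | fldMul (x y z : ℕ)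
  /-- `F[x] := F[y]⁻¹` (with `0⁻¹ = 0`) -/
  | fldInv (x y : ℕ)
  /-- `F[x] := FM[N[y]]` -/
  | fldLoad (x y : ℕ)
  /-- `FM[N[x]] := F[y]` -/
  | fldStore (x y : ℕ)
  /-- `N[x] := 1` if `F[y] = 0`, and `N[x] := 0` otherwise -/
  | fldTest (x y : ℕ)

/-- Programs. -/
inductive RamProg : Type
  | instr (i : RamInstr)
  | seq (p q : RamProg)
  /-- if `N[x] ≠ 0` then `p` else `q` -/
  | cond (x : ℕ) (p q : RamProg)
  /-- while `N[x] ≠ 0` do `p` -/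
  | loop (x : ℕ) (p : RamProg)

/-- The contents of the registers and of the memories. -/
@[ext] structure RamState (K : Type*) where
  nat : ℕ → ℕ
  natMem : ℕ → ℕ
  fld : ℕ → K
  fldMem : ℕ → K

open Classical in
/-- The effect of an elementary instruction. -/
noncomputable def RamInstr.step {K : Type*} [Field K] (σ : RamState K) : RamInstr → RamState K
  | natConst x c => { σ with nat := Function.update σ.nat x c }
  | natAdd x y z => { σ with nat := Function.update σ.nat x (σ.nat y + σ.nat z) }
  | natSub x y z => { σ with nat := Function.update σ.nat x (σ.nat y - σ.nat z) }
  | natLoad x y => { σ with nat := Function.update σ.nat x (σ.natMem (σ.nat y)) }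
  | natStore x y => { σ with natMem := Function.update σ.natMem (σ.nat x) (σ.nat y) }
  | fldZero x => { σ with fld := Function.update σ.fld x 0 }
  | fldOne x => { σ with fld := Function.update σ.fld x 1 }
  | fldAdd x y z => { σ with fld := Function.update σ.fld x (σ.fld y + σ.fld z) }
  | fldSub x y z => { σ with fld := Function.update σ.fld x (σ.fld y - σ.fld z) }
  | fldMul x y z => { σ with fld := Function.update σ.fld x (σ.fld y * σ.fld z) }
  | fldInv x y => { σ with fld := Function.update σ.fld x (σ.fld y)⁻¹ }
  | fldLoad x y => { σ with fld := Function.update σ.fld x (σ.fldMem (σ.nat y)) }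
  | fldStore x y => { σ with fldMem := Function.update σ.fldMem (σ.nat x) (σ.fld y) }
  | fldTest x y => { σ with nat := Function.update σ.nat x (if σ.fld y = 0 then 1 else 0) }

/-- `RamExec p σ T σ'`: started in the state `σ`, the program `p` halts after exactly `T` steps,
in the state `σ'`. -/
inductive RamExec {K : Type*} [Field K] : RamProg → RamState K → ℕ → RamState K → Prop
  | instr (i : RamInstr) (σ : RamState K) : RamExec (.instr i) σ 1 (i.step σ)
  | seq {p q : RamProg} {σ σ' σ'' : RamState K} {T T' : ℕ} :
      RamExec p σ T σ' → RamExec q σ' T' σ'' → RamExec (.seq p q) σ (T + T') σ''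
  | condTrue {x : ℕ} {p q : RamProg} {σ σ' : RamState K} {T : ℕ} :
      σ.nat x ≠ 0 → RamExec p σ T σ' → RamExec (.cond x p q) σ (T + 1) σ'
  | condFalse {x : ℕ} {p q : RamProg} {σ σ' : RamState K} {T : ℕ} :
      σ.nat x = 0 → RamExec q σ T σ' → RamExec (.cond x p q) σ (T + 1) σ'
  | loopDone {x : ℕ} {p : RamProg} {σ : RamState K} :
      σ.nat x = 0 → RamExec (.loop x p) σ 1 σ
  | loopStep {x : ℕ} {p : RamProg} {σ σ' σ'' : RamState K} {T T' : ℕ} :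
      σ.nat x ≠ 0 → RamExec p σ T σ' → RamExec (.loop x p) σ' T' σ'' →
      RamExec (.loop x p) σ (T + T' + 1) σ''

/-! ## List decoding by a program -/

section Decoding

variable {F K : Type*} [Field F] [Field K] [Algebra F K] {m s : ℕ} {A : Finset F}

/-- The position of the entry `(a, γ)` in the memory representation of a word, for a given
enumeration of `A`: the entry at the point with indices `i_0, …, i_{m-1} < |A|` and multi-index
`γ` is at position `(∑ i_j |A|^j) s^m + ∑ γ_j s^j`. -/
def wordPos (e : Fin A.card ≃ A) (a : Fin m → A) (γ : MultiIdx m s) : ℕ :=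
  (finFunctionFinEquiv (fun j => e.symm (a j)) : ℕ) * s ^ m + (finFunctionFinEquiv γ.1 : ℕ)

/-- `σ` holds the input of the decoder: the numbers `|A|`, `k` (the degree parameter) and `t` (the
number of errors to be corrected), the element `Q`, the elements of `A`, and the received word
`w`.  Nothing is assumed about the other registers and memory cells. -/
def HoldsInput (Q : K) (k t : ℕ) (e : Fin A.card ≃ A) (w : QWord K m s A) (σ : RamState K) :
    Prop :=
  σ.nat 0 = A.card ∧ σ.nat 1 = k ∧ σ.nat 2 = t ∧ σ.fld 0 = Q ∧
  (∀ i : Fin A.card, σ.fldMem i = algebraMap F K (e i)) ∧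
  ∀ a γ, σ.fldMem (A.card + wordPos e a γ) = w a γ

/-- The words which `σ` holds as output: `N[0]` words, stored in consecutive blocks of
`|A|^m s^m` memory cells. -/
def outputWords (m s : ℕ) (e : Fin A.card ≃ A) (σ : RamState K) : Set (QWord K m s A) :=
  {u | ∃ j < σ.nat 0, ∀ a γ, u a γ = σ.fldMem (j * (A.card ^ m * s ^ m) + wordPos e a γ)}

/-- Within `T` steps, the program `p` list decodes the code `qMultCode Q m s A k` up to the
relative radius `ρ`: for every received word `w` it outputs exactly the list of all codewords at
distance at most `ρ` from `w`.  (Relative distance at most `ρ` means at most `⌊ρ |A|^m⌋` symbol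
errors.) -/
def ListDecodes (p : RamProg) (Q : K) (m s : ℕ) (A : Finset F) (k : ℕ) (ρ : ℝ) (T : ℕ) : Prop :=
  ∀ (e : Fin A.card ≃ A) (w : QWord K m s A) (σ : RamState K),
    HoldsInput Q k ⌊ρ * (A.card : ℝ) ^ m⌋₊ e w σ →
    ∃ T' ≤ T, ∃ σ' : RamState K, RamExec p σ T' σ' ∧
      outputWords m s e σ' = {u | u ∈ qMultCode Q m s A k ∧ relDist u w ≤ ρ}

end Decoding

/-! ## Dimension counts along a filtration -/

section DimensionCounts

open Module

variable {K M W : Type*} [Field K] [AddCommGroup M] [Module K M] [AddCommGroup W] [Module K W]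

theorem finrank_map_add_finrank_inf_ker (φ : M →ₗ[K] W) (H : Submodule K M)
    [FiniteDimensional K H] :
    finrank K (H.map φ) + finrank K (H ⊓ LinearMap.ker φ : Submodule K M) = finrank K H := by
  have h := LinearMap.finrank_range_add_finrank_ker (φ.domRestrict H)
  rw [← h, LinearMap.range_domRestrict, LinearMap.ker_domRestrict]
  congr 1
  exact (Submodule.finrank_map_subtype_eq H _).symm.trans
    (by rw [Submodule.map_comap_subtype]) |>.symm

theorem finrank_inf_le_map_add_ker (φ : M →ₗ[K] W) (H X : Submodule K M) (Y : Submodule K W)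
    [FiniteDimensional K H] (hXY : ∀ f ∈ X, φ f ∈ Y) :
    finrank K (H ⊓ X : Submodule K M) ≤ finrank K (H.map φ ⊓ Y : Submodule K W) +
      finrank K (H ⊓ LinearMap.ker φ ⊓ X : Submodule K M) := by
  have : FiniteDimensional K (H ⊓ X : Submodule K M) :=
    Submodule.finiteDimensional_of_le inf_le_left
  rw [← finrank_map_add_finrank_inf_ker φ (H ⊓ X), inf_right_comm]
  have : FiniteDimensional K (H.map φ ⊓ Y : Submodule K W) :=
    Submodule.finiteDimensional_of_le inf_le_left
  refine Nat.add_le_add_right (Submodule.finrank_mono ?_) _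
  rintro _ ⟨f, ⟨hf, hf'⟩, rfl⟩
  exact ⟨⟨f, hf, rfl⟩, hXY f hf'⟩

/-- The sum of the jumps of the filtration `F` on `H`. -/
noncomputable def jumpSum (F : ℕ → Submodule K M) (J : ℕ) (H : Submodule K M) : ℕ :=
  ∑ j ∈ Finset.range J, (finrank K H - finrank K (H ⊓ F j : Submodule K M))

theorem jumpSum_map_add_ker_le (φ : M →ₗ[K] W) (F : ℕ → Submodule K M) (F' : ℕ → Submodule K W)
    (hF : ∀ j, ∀ f ∈ F j, φ f ∈ F' j) (J : ℕ) (H : Submodule K M) [FiniteDimensional K H] :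
    jumpSum F' J (H.map φ) + jumpSum F J (H ⊓ LinearMap.ker φ) ≤ jumpSum F J H := by
  rw [jumpSum, jumpSum, jumpSum, ← Finset.sum_add_distrib]
  refine Finset.sum_le_sum fun j _ => ?_
  have h1 := finrank_map_add_finrank_inf_ker φ H
  have h2 := finrank_inf_le_map_add_ker φ H (F j) (F' j) (hF j)
  have : FiniteDimensional K (H ⊓ LinearMap.ker φ : Submodule K M) :=
    Submodule.finiteDimensional_of_le inf_le_left
  have h3 : finrank K (H ⊓ LinearMap.ker φ ⊓ F j : Submodule K M) ≤
    finrank K (H ⊓ LinearMap.ker φ : Submodule K M) := Submodule.finrank_mono inf_le_left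
  have h4 : finrank K (H.map φ ⊓ F' j : Submodule K W) ≤ finrank K (H.map φ) :=
    Submodule.finrank_mono inf_le_left
  omega

/-- Splitting off the top step of the filtration. -/
theorem jumpSum_eq_of_top (φ : M →ₗ[K] W) (F : ℕ → Submodule K M) {e J : ℕ} (he : e ≤ J)
    (H : Submodule K M) [FiniteDimensional K H]
    (hφ : ∀ j < e, ∀ f ∈ F j, φ f = 0) (hH : ∀ j, e ≤ j → H ≤ F j) :
    jumpSum F J H = e * finrank K (H.map φ) + jumpSum F J (H ⊓ LinearMap.ker φ) := by
  have key : ∀ j, finrank K H - finrank K (H ⊓ F j : Submodule K M) =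
      (if j < e then finrank K (H.map φ) else 0) +
      (finrank K (H ⊓ LinearMap.ker φ : Submodule K M) -
        finrank K (H ⊓ LinearMap.ker φ ⊓ F j : Submodule K M)) := by
    intro j
    have h1 := finrank_map_add_finrank_inf_ker φ H
    have : FiniteDimensional K (H ⊓ LinearMap.ker φ : Submodule K M) :=
      Submodule.finiteDimensional_of_le inf_le_left
    have h3 : finrank K (H ⊓ LinearMap.ker φ ⊓ F j : Submodule K M) ≤
      finrank K (H ⊓ LinearMap.ker φ : Submodule K M) := Submodule.finrank_mono inf_le_left
    split_ifs with hj
    · have : (H ⊓ LinearMap.ker φ ⊓ F j : Submodule K M) = H ⊓ F j := by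
        apply le_antisymm
        · exact fun f hf => ⟨hf.1.1, hf.2⟩
        · exact fun f hf => ⟨⟨hf.1, hφ j hj f hf.2⟩, hf.2⟩
      rw [this] at h3 ⊢
      omega
    · have h5 : (H ⊓ F j : Submodule K M) = H := inf_eq_left.mpr (hH j (not_lt.mp hj))
      have h6 : (H ⊓ LinearMap.ker φ ⊓ F j : Submodule K M) = H ⊓ LinearMap.ker φ :=
        inf_eq_left.mpr (inf_le_left.trans (hH j (not_lt.mp hj)))
      rw [h5, h6]; omega
  rw [jumpSum, Finset.sum_congr rfl fun j _ => key j, Finset.sum_add_distrib, jumpSum]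
  congr 1
  rw [← Finset.sum_filter, Finset.sum_const, smul_eq_mul]
  congr 1
  have : (Finset.range J).filter (· < e) = Finset.range e := by
    ext j; simp only [Finset.mem_filter, Finset.mem_range]; omega
  rw [this, Finset.card_range]

end DimensionCounts

/-! ## The univariate dimension bound -/

section Univariate

open Module

variable {K : Type*} [Field K]

theorem exists_echelon_basis (J : ℕ) : ∀ V : Submodule K (Polynomial K),
    V ≤ Polynomial.degreeLT K J → ∃ (E : Finset ℕ) (v : ℕ → Polynomial K),
      (∀ e ∈ E, v e ∈ V ∧ (v e).natDegree ≤ e ∧ (v e).coeff e = 1) ∧ E.card = finrank K V ∧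
      ∑ e ∈ E, e = jumpSum (fun j => Polynomial.degreeLT K (j + 1)) J V ∧ E ⊆ Finset.range J := by
  induction J with
  | zero =>
    intro V hV
    have : V = ⊥ := by
      rw [eq_bot_iff]
      intro f hf
      have := Polynomial.mem_degreeLT.mp (hV hf)
      simpa using this
    subst this
    exact ⟨∅, fun _ => 0, by simp, by simp, by simp [jumpSum], by simp⟩
  | succ J ih =>
    intro V hV
    have : FiniteDimensional K V := Submodule.finiteDimensional_of_le hV
    have hker : ∀ f ∈ V, Polynomial.lcoeff K J f = 0 ↔ f ∈ Polynomial.degreeLT K J := by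
      intro f hf
      have h1 := Polynomial.mem_degreeLT.mp (hV hf)
      rw [Polynomial.mem_degreeLT, Polynomial.lcoeff_apply]
      constructor
      · intro h
        rw [Polynomial.degree_lt_iff_coeff_zero] at h1 ⊢
        intro m hm
        rcases Nat.eq_or_lt_of_le hm with rfl | hm'
        · exact h
        · exact h1 m hm'
      · intro h
        exact Polynomial.coeff_eq_zero_of_degree_lt h
    have htop := jumpSum_eq_of_top (Polynomial.lcoeff K J)
      (fun j => Polynomial.degreeLT K (j + 1)) (show J ≤ J + 1 by omega) V
      (fun j hj f hf => Polynomial.coeff_eq_zero_of_degree_lt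
        (lt_of_lt_of_le (Polynomial.mem_degreeLT.mp hf) (by exact_mod_cast hj)))
      (fun j hj => hV.trans (Polynomial.degreeLT_mono (by omega)))
    set V' := V ⊓ LinearMap.ker (Polynomial.lcoeff K J) with hV'
    have hV'J : V' ≤ Polynomial.degreeLT K J := fun f hf => (hker f hf.1).mp hf.2
    obtain ⟨E, v, h1, h2, h3, h4⟩ := ih V' hV'J
    have hlast : jumpSum (fun j => Polynomial.degreeLT K (j + 1)) (J + 1) V' =
        jumpSum (fun j => Polynomial.degreeLT K (j + 1)) J V' := by
      rw [jumpSum, Finset.sum_range_succ, jumpSum, inf_eq_left.mpr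
        (hV'J.trans (Polynomial.degreeLT_mono (Nat.le_succ J))), Nat.sub_self, add_zero]
    have hdim := finrank_map_add_finrank_inf_ker (Polynomial.lcoeff K J) V
    rw [← hV'] at hdim
    by_cases hall : ∀ f ∈ V, f.coeff J = 0
    · have : V.map (Polynomial.lcoeff K J) = ⊥ := by
        rw [eq_bot_iff]
        rintro _ ⟨f, hf, rfl⟩
        exact hall f hf
      rw [this, finrank_bot] at htop hdim
      refine ⟨E, v, fun e he => ⟨(h1 e he).1.1, (h1 e he).2⟩, by omega, by omega, ?_⟩
      exact h4.trans (Finset.range_mono (Nat.le_succ J))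
    · push Not at hall
      obtain ⟨f, hf, hfJ⟩ := hall
      have h1d : V.map (Polynomial.lcoeff K J) = ⊤ := by
        rw [eq_top_iff]
        intro c _
        exact ⟨(c / f.coeff J) • f, V.smul_mem _ hf, by simp [hfJ]⟩
      rw [h1d, finrank_top, finrank_self] at htop hdim
      have hJE : J ∉ E := fun h => by simpa using h4 h
      refine ⟨insert J E, Function.update v J ((f.coeff J)⁻¹ • f), ?_, ?_, ?_, ?_⟩
      · intro e he
        rcases Finset.mem_insert.mp he with rfl | he'
        · rw [Function.update_self]
          refine ⟨V.smul_mem _ hf, ?_, by simp [hfJ]⟩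
          refine (Polynomial.natDegree_smul_le _ _).trans ?_
          have hfV := hV hf
          rw [Polynomial.degreeLT_succ_eq_degreeLE, Polynomial.mem_degreeLE] at hfV
          exact Polynomial.natDegree_le_of_degree_le hfV
        · rw [Function.update_of_ne (fun h : e = J => hJE (h ▸ he'))]
          exact ⟨(h1 e he').1.1, (h1 e he').2⟩
      · rw [Finset.card_insert_of_notMem hJE]; omega
      · rw [Finset.sum_insert hJE]; omega
      · intro e he
        rcases Finset.mem_insert.mp he with rfl | he
        · simp
        · have := h4 he
          simp only [Finset.mem_range] at this ⊢; omega

theorem Polynomial.coeff_prod_sum_of_natDegree_le {ι : Type*} (t : Finset ι)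
    (f : ι → Polynomial K) (d : ι → ℕ) (h : ∀ i ∈ t, (f i).natDegree ≤ d i) :
    (∏ i ∈ t, f i).natDegree ≤ ∑ i ∈ t, d i ∧
      (∏ i ∈ t, f i).coeff (∑ i ∈ t, d i) = ∏ i ∈ t, (f i).coeff (d i) := by
  classical
  refine ⟨(Polynomial.natDegree_prod_le _ _).trans (Finset.sum_le_sum h), ?_⟩
  induction t using Finset.induction_on with
  | empty => simp
  | insert a t ha ih =>
    rw [Finset.prod_insert ha, Finset.sum_insert ha, Finset.prod_insert ha,
      Polynomial.coeff_mul_add_eq_of_natDegree_le (h a (Finset.mem_insert_self _ _))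
        ((Polynomial.natDegree_prod_le _ _).trans
          (Finset.sum_le_sum fun i hi => h i (Finset.mem_insert_of_mem hi))),
      ih fun i hi => h i (Finset.mem_insert_of_mem hi)]

theorem Matrix.natDegree_det_le_and_coeff {p : ℕ} (A : Matrix (Fin p) (Fin p) (Polynomial K))
    (d : Fin p → ℕ) (h : ∀ i j, (A i j).natDegree ≤ d j) :
    A.det.natDegree ≤ ∑ j, d j ∧
      A.det.coeff (∑ j, d j) = (Matrix.of fun i j => (A i j).coeff (d j)).det := by
  have hp : ∀ σ : Equiv.Perm (Fin p), ∀ i ∈ (Finset.univ : Finset (Fin p)),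
      (A (σ i) i).natDegree ≤ d i := fun σ i _ => h _ _
  constructor
  · rw [Matrix.det_apply]
    refine Polynomial.natDegree_sum_le_of_forall_le _ _ fun σ _ => ?_
    refine (Polynomial.natDegree_smul_le _ _).trans ?_
    exact (Polynomial.coeff_prod_sum_of_natDegree_le _ _ _ (hp σ)).1
  · rw [Matrix.det_apply, Matrix.det_apply, Polynomial.finsetSum_coeff]
    refine Finset.sum_congr rfl fun σ _ => ?_
    rw [Polynomial.coeff_smul,
      (Polynomial.coeff_prod_sum_of_natDegree_le _ _ _ (hp σ)).2]
    rfl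

theorem pow_finrank_ker_dvd_det {p : ℕ} (A : Matrix (Fin p) (Fin p) (Polynomial K)) (x : K)
    (Z : Submodule K (Fin p → K)) (hZ : ∀ c ∈ Z, ∀ i, ∑ j, (A i j).eval x * c j = 0) :
    (Polynomial.X - Polynomial.C x) ^ finrank K Z ∣ A.det := by
  classical
  obtain ⟨Z', hZ'⟩ := Submodule.exists_isCompl Z
  let b : Basis (Fin (finrank K Z) ⊕ Fin (finrank K Z')) K (Fin p → K) :=
    ((finBasis K Z).prod (finBasis K Z')).map (Submodule.prodEquivOfIsCompl Z Z' hZ')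
  have hcard : Fintype.card (Fin (finrank K Z) ⊕ Fin (finrank K Z')) = Fintype.card (Fin p) := by
    rw [← finrank_eq_card_basis b, finrank_fintype_fun_eq_card]
  let σ : (Fin (finrank K Z) ⊕ Fin (finrank K Z')) ≃ Fin p := Fintype.equivOfCardEq hcard
  let c : Basis (Fin p) K (Fin p → K) := b.reindex σ
  let C : Matrix (Fin p) (Fin p) K := (Pi.basisFun K (Fin p)).toMatrix c
  have hC : IsUnit C.det := by
    have : Invertible C := Basis.invertibleToMatrix _ _
    exact Matrix.isUnit_det_of_invertible C
  let d : Fin p → Polynomial K := fun j =>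
    Sum.elim (fun _ => Polynomial.X - Polynomial.C x) (fun _ => 1) (σ.symm j)
  have hdvd : ∀ i j, d j ∣ (A * C.map Polynomial.C) i j := by
    intro i j
    rcases hj : σ.symm j with z | z
    · simp only [d, hj, Sum.elim_inl]
      rw [Polynomial.dvd_iff_isRoot, Polynomial.IsRoot, Matrix.mul_apply,
        Polynomial.eval_finsetSum]
      have hcz : c j ∈ Z := by
        simp only [c, Basis.reindex_apply, hj, b, Basis.map_apply]
        simp [Submodule.coe_prodEquivOfIsCompl']
      refine Eq.trans (Finset.sum_congr rfl fun l _ => ?_) (hZ _ hcz i)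
      simp [C, Basis.toMatrix_apply]
    · simp [d, hj]
  choose B hB using hdvd
  have h1 : A * C.map Polynomial.C = Matrix.of fun i j => d j * B i j := by
    ext1 i j; exact hB i j
  have h2 : A.det * Polynomial.C C.det = (∏ j, d j) * (Matrix.of B).det := by
    have := congrArg Matrix.det h1
    rw [Matrix.det_mul] at this
    rw [show Polynomial.C C.det = (C.map Polynomial.C).det from RingHom.map_det _ _, this]
    exact Matrix.det_mul_row d (Matrix.of B)
  have h3 : ∏ j, d j = (Polynomial.X - Polynomial.C x) ^ finrank K Z := by
    rw [← Equiv.prod_comp σ, Fintype.prod_sum_type]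
    simp [d]
  have hu : IsUnit (Polynomial.C C.det) := hC.map Polynomial.C
  rw [← h3]
  exact (hu.dvd_mul_right).mp (h2 ▸ dvd_mul_right _ _)

/-- Univariate polynomials which vanish at `b, Qb, …, Q^{r-1}b`. -/
def uniVanish (Q b : K) (r : ℕ) : Submodule K (Polynomial K) where
  carrier := {f | ∀ j < r, f.eval (Q ^ j * b) = 0}
  add_mem' {f g} hf hg j hj := by rw [Polynomial.eval_add, hf j hj, hg j hj, add_zero]
  zero_mem' j _ := Polynomial.eval_zero
  smul_mem' c f hf j hj := by rw [Polynomial.eval_smul, hf j hj, smul_zero]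

theorem sum_finrank_uniVanish_le_wronskian {Q : K} {J : ℕ}
    (hQ : ∀ i < J, ∀ j < J, Q ^ i = Q ^ j → i = j) (V : Submodule K (Polynomial K))
    (hV : V ≤ Polynomial.degreeLT K J) (P : Finset K) :
    ∑ x ∈ P, finrank K (V ⊓ uniVanish Q x (finrank K V) : Submodule K (Polynomial K)) ≤
      jumpSum (fun j => Polynomial.degreeLT K (j + 1)) J V := by
  classical
  have : FiniteDimensional K V := Submodule.finiteDimensional_of_le hV
  obtain ⟨E, v, h1, h2, h3, h4⟩ := exists_echelon_basis J V hV
  set p := finrank K V with hp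
  let e : Fin p → ℕ := fun i => E.orderEmbOfFin h2 i
  have heE : ∀ i, e i ∈ E := fun i => Finset.orderEmbOfFin_mem E h2 i
  have he : Function.Injective e := (E.orderEmbOfFin h2).injective
  have hesum : ∑ i, e i = jumpSum (fun j => Polynomial.degreeLT K (j + 1)) J V := by
    rw [← h3]
    have : E = Finset.univ.image e := by
      ext y
      simp only [Finset.mem_image, Finset.mem_univ, true_and]
      have := Finset.range_orderEmbOfFin E h2
      constructor
      · intro hy
        have : y ∈ Set.range (E.orderEmbOfFin h2) := by rw [this]; exact hy
        exact this
      · rintro ⟨i, rfl⟩; exact heE i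
    conv_rhs => rw [this]
    rw [Finset.sum_image fun i _ j _ h => he h]
  let A : Matrix (Fin p) (Fin p) (Polynomial K) :=
    Matrix.of fun l i => (v (e i)).comp (Polynomial.C (Q ^ (l : ℕ)) * Polynomial.X)
  have hAc : ∀ l i n, (A l i).coeff n = (v (e i)).coeff n * (Q ^ (l : ℕ)) ^ n := by
    intro l i n
    exact Polynomial.comp_C_mul_X_coeff
  have hAd : ∀ l i, (A l i).natDegree ≤ e i := by
    intro l i
    refine Polynomial.natDegree_le_iff_coeff_eq_zero.mpr fun n hn => ?_
    rw [hAc, Polynomial.coeff_eq_zero_of_natDegree_lt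
      (lt_of_le_of_lt (h1 _ (heE i)).2.1 hn), zero_mul]
  obtain ⟨hdeg, hcoeff⟩ := Matrix.natDegree_det_le_and_coeff A e hAd
  have hA0 : A.det ≠ 0 := by
    intro h0
    rw [h0, Polynomial.coeff_zero] at hcoeff
    have hvan : (Matrix.of fun l i => (A l i).coeff (e i)) =
        (Matrix.vandermonde fun i => Q ^ e i).transpose := by
      ext l i
      rw [Matrix.of_apply, hAc, (h1 _ (heE i)).2.2, one_mul, Matrix.transpose_apply,
        Matrix.vandermonde_apply, ← pow_mul, ← pow_mul, mul_comm]
    rw [hvan, Matrix.det_transpose] at hcoeff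
    refine Matrix.det_vandermonde_ne_zero_iff.mpr (fun i j hij => he ?_) hcoeff.symm
    exact hQ _ (Finset.mem_range.mp (h4 (heE i))) _ (Finset.mem_range.mp (h4 (heE j))) hij
  -- the coordinates with respect to the echelon basis
  let T : (Fin p → K) →ₗ[K] Polynomial K := Fintype.linearCombination K fun i => v (e i)
  have hTi : Function.Injective T := by
    rw [← LinearMap.ker_eq_bot]
    rw [eq_bot_iff]
    intro c hc
    by_contra hc0
    have hne : (Finset.univ.filter fun i => c i ≠ 0).Nonempty := by
      by_contra hem
      rw [Finset.not_nonempty_iff_eq_empty, Finset.filter_eq_empty_iff] at hem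
      exact hc0 (funext fun i => not_not.mp (hem (Finset.mem_univ i)))
    obtain ⟨i, hi, hmax⟩ := Finset.exists_max_image _ (fun i => i) hne
    rw [LinearMap.mem_ker, Fintype.linearCombination_apply] at hc
    have h := congrArg (fun f => Polynomial.coeff f (e i)) hc
    simp only [Polynomial.finsetSum_coeff, Polynomial.coeff_smul, Polynomial.coeff_zero] at h
    rw [Finset.sum_eq_single i, (h1 _ (heE i)).2.2, smul_eq_mul, mul_one] at h
    · exact (Finset.mem_filter.mp hi).2 h
    · intro j _ hji
      by_cases hcj : c j = 0
      · rw [hcj, zero_smul]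
      · have hlt : j < i :=
          lt_of_le_of_ne (hmax j (Finset.mem_filter.mpr ⟨Finset.mem_univ _, hcj⟩)) hji
        rw [Polynomial.coeff_eq_zero_of_natDegree_lt (lt_of_le_of_lt (h1 _ (heE j)).2.1
          ((E.orderEmbOfFin h2).strictMono hlt)), smul_zero]
    · simp
  have hTr : LinearMap.range T = V := by
    refine Submodule.eq_of_le_of_finrank_le ?_ ?_
    · rintro _ ⟨c, rfl⟩
      rw [Fintype.linearCombination_apply]
      exact V.sum_mem fun i _ => V.smul_mem _ (h1 _ (heE i)).1
    · rw [LinearMap.finrank_range_of_inj hTi, finrank_fintype_fun_eq_card, Fintype.card_fin]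
  have hroot : ∀ x, finrank K (V ⊓ uniVanish Q x p : Submodule K (Polynomial K)) ≤
      A.det.rootMultiplicity x := by
    intro x
    rw [Polynomial.le_rootMultiplicity_iff hA0]
    have hfr : finrank K ((V ⊓ uniVanish Q x p).comap T : Submodule K (Fin p → K)) =
        finrank K (V ⊓ uniVanish Q x p : Submodule K (Polynomial K)) := by
      have := LinearEquiv.finrank_eq (Submodule.equivMapOfInjective T hTi
        ((V ⊓ uniVanish Q x p).comap T))
      rw [this, Submodule.map_comap_eq, hTr, ← inf_assoc, inf_idem]
    rw [← hfr]
    refine pow_finrank_ker_dvd_det A x _ fun c hc l => ?_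
    have hc2 := hc.2 l l.2
    rw [Fintype.linearCombination_apply, Polynomial.eval_finsetSum] at hc2
    rw [← hc2]
    refine Finset.sum_congr rfl fun i _ => ?_
    simp only [A, Matrix.of_apply, Polynomial.eval_comp, Polynomial.eval_mul, Polynomial.eval_C,
      Polynomial.eval_X, Polynomial.eval_smul, smul_eq_mul, mul_comm]
  calc ∑ x ∈ P, finrank K (V ⊓ uniVanish Q x p : Submodule K (Polynomial K))
      ≤ ∑ x ∈ P, A.det.roots.count x := Finset.sum_le_sum fun x _ => by
        rw [Polynomial.count_roots]; exact hroot x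
    _ ≤ ∑ x ∈ P ∪ A.det.roots.toFinset, A.det.roots.count x :=
        Finset.sum_le_sum_of_subset Finset.subset_union_left
    _ = Multiset.card A.det.roots :=
        Multiset.sum_count_eq_card fun x hx => Finset.mem_union_right _ (by simpa using hx)
    _ ≤ A.det.natDegree := Polynomial.card_roots' _
    _ ≤ _ := hdeg
    _ = _ := hesum

theorem sum_sum_finrank_uniVanish_le {ι : Type*} [Fintype ι] {Q : K} {J s : ℕ}
    (hQ : ∀ i < J, ∀ j < J, Q ^ i = Q ^ j → i = j) (x : ι → K)
    (hx : ∀ i < s, ∀ j < s, ∀ a b, Q ^ i * x a = Q ^ j * x b → i = j ∧ a = b)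
    (V : Submodule K (Polynomial K)) (hV : V ≤ Polynomial.degreeLT K J) :
    ∑ b, ∑ r ∈ Finset.Icc 1 s, finrank K (V ⊓ uniVanish Q (x b) r : Submodule K (Polynomial K)) ≤
      jumpSum (fun j => Polynomial.degreeLT K (j + 1)) J V +
        Fintype.card ι * (finrank K V * (finrank K V - 1)) := by
  classical
  have : FiniteDimensional K V := Submodule.finiteDimensional_of_le hV
  set p := finrank K V with hp
  have hle : ∀ (b : ι) (r : ℕ),
      finrank K (V ⊓ uniVanish Q (x b) r : Submodule K (Polynomial K)) ≤ p :=
    fun b r => Submodule.finrank_mono inf_le_left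
  have hsplit : ∀ b : ι, ∑ r ∈ Finset.Icc 1 s,
      finrank K (V ⊓ uniVanish Q (x b) r : Submodule K (Polynomial K)) ≤
      ∑ j ∈ Finset.range s, finrank K (V ⊓ uniVanish Q (Q ^ j * x b) p : Submodule K _) +
        p * (p - 1) := by
    intro b
    have hstep : ∀ r ∈ Finset.Icc 1 s,
        finrank K (V ⊓ uniVanish Q (x b) r : Submodule K (Polynomial K)) ≤
        (if p ≤ r then finrank K (V ⊓ uniVanish Q (Q ^ (r - p) * x b) p : Submodule K _) else 0) +
          (if r < p then p else 0) := by
      intro r _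
      rcases lt_or_ge r p with h | h
      · rw [if_neg (not_le.mpr h), if_pos h, zero_add]; exact hle b r
      · rw [if_pos h, if_neg (not_lt.mpr h), add_zero]
        refine Submodule.finrank_mono (inf_le_inf_left _ fun f hf j hj => ?_)
        rw [← mul_assoc, ← pow_add]
        exact hf _ (by omega)
    refine (Finset.sum_le_sum hstep).trans ?_
    rw [Finset.sum_add_distrib]
    refine Nat.add_le_add ?_ ?_
    · rw [← Finset.sum_filter]
      rcases Nat.eq_zero_or_pos p with h0 | hpos
      · refine (Finset.sum_nonpos fun r _ => ?_).trans (Nat.zero_le _)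
        exact h0 ▸ Submodule.finrank_mono inf_le_left
      · refine le_trans (le_of_eq ?_) (Finset.sum_le_sum_of_subset
          (s := ((Finset.Icc 1 s).filter (p ≤ ·)).image (· - p)) ?_)
        · rw [Finset.sum_image]
          intro a ha b hb hab
          simp only [Finset.coe_filter, Set.mem_ofPred_eq] at ha hb
          have h : a - p = b - p := hab
          omega
        · intro j hj
          simp only [Finset.mem_image, Finset.mem_filter, Finset.mem_Icc, Finset.mem_range] at hj ⊢
          omega
    · rw [← Finset.sum_filter, Finset.sum_const, smul_eq_mul, mul_comm]
      refine Nat.mul_le_mul_left _ ?_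
      calc ((Finset.Icc 1 s).filter (· < p)).card ≤ (Finset.Ico 1 p).card := by
            refine Finset.card_le_card fun r hr => ?_
            simp only [Finset.mem_filter, Finset.mem_Icc, Finset.mem_Ico] at hr ⊢
            omega
        _ = p - 1 := by simp
  refine (Finset.sum_le_sum fun b _ => hsplit b).trans ?_
  rw [Finset.sum_add_distrib, Finset.sum_const, Finset.card_univ, smul_eq_mul]
  refine Nat.add_le_add_right ?_ _
  rw [← Finset.sum_product' (f := fun b j =>
    finrank K (V ⊓ uniVanish Q (Q ^ j * x b) p : Submodule K (Polynomial K)))]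
  have hinj : Set.InjOn (fun bj : ι × ℕ => Q ^ bj.2 * x bj.1)
      (Finset.univ ×ˢ Finset.range s : Finset (ι × ℕ)) := by
    rintro ⟨b, j⟩ h1 ⟨b', j'⟩ h2 h
    simp only [Finset.coe_product, Set.mem_prod, Finset.coe_range, Set.mem_Iio] at h1 h2
    obtain ⟨h3, h4⟩ := hx j h1.2 j' h2.2 b b' h
    simp [h3, h4]
  refine le_trans (le_of_eq ?_) (sum_finrank_uniVanish_le_wronskian hQ V hV
    ((Finset.univ ×ˢ Finset.range s).image fun bj : ι × ℕ => Q ^ bj.2 * x bj.1))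
  rw [Finset.sum_image hinj]

end Univariate

/-! ## The dimension bound for spaces of multivariate polynomials -/

section Multivariate

open Module

variable {K : Type*} [Field K]

/-- Polynomials which vanish at the points `Q^β a` with `|β| < r`. -/
def mvVanish {ι : Type*} {m : ℕ} (Q : K) (x : ι → K) (a : Fin m → ι) (r : ℕ) :
    Submodule K (MvPolynomial (Fin m) K) where
  carrier := {f | ∀ β : Fin m → ℕ, ∑ i, β i < r →
    MvPolynomial.eval (fun i => Q ^ β i * x (a i)) f = 0}
  add_mem' {f g} hf hg β hβ := by rw [map_add, hf β hβ, hg β hβ, add_zero]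
  zero_mem' β _ := map_zero _
  smul_mem' c f hf β hβ := by rw [MvPolynomial.smul_eval, hf β hβ, mul_zero]

/-- Restriction to a line parallel to the first coordinate axis. -/
noncomputable def lineRestrict {m : ℕ} (y : Fin m → K) :
    MvPolynomial (Fin (m + 1)) K →ₗ[K] Polynomial K :=
  (Polynomial.mapAlgHom (MvPolynomial.aeval y : MvPolynomial (Fin m) K →ₐ[K] K)).toLinearMap ∘ₗ
    (MvPolynomial.finSuccEquiv K m).toLinearMap

theorem lineRestrict_apply {m : ℕ} (y : Fin m → K) (f : MvPolynomial (Fin (m + 1)) K) :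
    lineRestrict y f = Polynomial.map (MvPolynomial.eval y) (MvPolynomial.finSuccEquiv K m f) := rfl

theorem eval_lineRestrict {m : ℕ} (y : Fin m → K) (b : K) (f : MvPolynomial (Fin (m + 1)) K) :
    (lineRestrict y f).eval b = MvPolynomial.eval (Fin.cons b y : Fin (m + 1) → K) f := by
  rw [lineRestrict_apply, MvPolynomial.eval_eq_eval_mv_eval']

/-- The coefficient of `X_0^e`. -/
noncomputable def headCoeff (K : Type*) [Field K] (m e : ℕ) :
    MvPolynomial (Fin (m + 1)) K →ₗ[K] MvPolynomial (Fin m) K :=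
  ((Polynomial.lcoeff (MvPolynomial (Fin m) K) e).restrictScalars K) ∘ₗ
    (MvPolynomial.finSuccEquiv K m).toLinearMap

theorem headCoeff_apply {m e : ℕ} (f : MvPolynomial (Fin (m + 1)) K) :
    headCoeff K m e f = (MvPolynomial.finSuccEquiv K m f).coeff e := rfl

/-- Polynomials of degree at most `j` in `X_0`. -/
noncomputable def headDegLE (K : Type*) [Field K] (m j : ℕ) :
    Submodule K (MvPolynomial (Fin (m + 1)) K) :=
  ⨅ i : {i // j < i}, LinearMap.ker (headCoeff K m i)

theorem mem_headDegLE {m j : ℕ} {f : MvPolynomial (Fin (m + 1)) K} :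
    f ∈ headDegLE K m j ↔ ∀ i, j < i → headCoeff K m i f = 0 := by
  simp [headDegLE]

theorem lineRestrict_mem_degreeLT {m j : ℕ} (y : Fin m → K) {f : MvPolynomial (Fin (m + 1)) K}
    (hf : f ∈ headDegLE K m j) : lineRestrict y f ∈ Polynomial.degreeLT K (j + 1) := by
  rw [Polynomial.mem_degreeLT, Polynomial.degree_lt_iff_coeff_zero]
  intro i hi
  rw [lineRestrict_apply, Polynomial.coeff_map, ← headCoeff_apply,
    mem_headDegLE.mp hf i (by omega), map_zero]

/-- Polynomials which vanish on the lines in direction `X_0` through the points `Q^β a`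
with `|β| < o`. -/
noncomputable def lineVanish {ι : Type*} {m : ℕ} (Q : K) (x : ι → K) (a : Fin m → ι) (o : ℕ) :
    Submodule K (MvPolynomial (Fin (m + 1)) K) :=
  ⨅ β : {β : Fin m → ℕ // ∑ i, β i < o},
    LinearMap.ker (lineRestrict fun i => Q ^ β.1 i * x (a i))

theorem mem_lineVanish {ι : Type*} {m o : ℕ} {Q : K} {x : ι → K} {a : Fin m → ι}
    {f : MvPolynomial (Fin (m + 1)) K} : f ∈ lineVanish Q x a o ↔
      ∀ β : Fin m → ℕ, ∑ i, β i < o → lineRestrict (fun i => Q ^ β i * x (a i)) f = 0 := by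
  simp [lineVanish]

theorem lineVanish_anti {ι : Type*} {m o o' : ℕ} {Q : K} {x : ι → K} {a : Fin m → ι}
    (h : o ≤ o') : lineVanish Q x a o' ≤ lineVanish Q x a o := fun _ hf =>
  mem_lineVanish.mpr fun β hβ => mem_lineVanish.mp hf β (hβ.trans_le h)

theorem mul_pred_add_mul_pred_le {p d : ℕ} (h : p ≤ d) :
    (d - p) * (d - p - 1) + p * (p - 1) ≤ d * (d - 1) := by
  obtain ⟨u, rfl⟩ := Nat.exists_eq_add_of_le h
  rw [Nat.add_sub_cancel_left]
  rcases u with _ | u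
  · simp
  · rcases p with _ | p
    · simp
    · rw [Nat.add_sub_cancel, Nat.add_sub_cancel,
        show p + 1 + (u + 1) - 1 = p + 1 + u by omega]
      nlinarith

variable {ι : Type*} [Fintype ι] {Q : K} {x : ι → K} {s : ℕ}

theorem sum_finrank_mvVanish_line_le {m J : ℕ}
    (hQ : ∀ i < J + 1, ∀ j < J + 1, Q ^ i = Q ^ j → i = j)
    (hx : ∀ i < s, ∀ j < s, ∀ a b, Q ^ i * x a = Q ^ j * x b → i = j ∧ a = b) (a : Fin m → ι)
    (d : ℕ) : ∀ H : Submodule K (MvPolynomial (Fin (m + 1)) K), FiniteDimensional K H →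
      finrank K H = d → H ≤ headDegLE K m J →
      ∑ b, ∑ r ∈ Finset.Icc 1 s, finrank K (H ⊓ mvVanish Q x (Fin.cons b a) r :
          Submodule K (MvPolynomial (Fin (m + 1)) K)) ≤
        jumpSum (headDegLE K m) (J + 1) H + Fintype.card ι * (∑ o ∈ Finset.Icc 1 s,
          finrank K (H ⊓ lineVanish Q x a o : Submodule K (MvPolynomial (Fin (m + 1)) K)) +
          d * (d - 1)) := by
  classical
  induction d using Nat.strong_induction_on with
  | _ d ih =>
  intro H hfin hd hJ
  by_cases hall : H ≤ lineVanish Q x a s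
  · refine le_trans ?_ (Nat.le_add_left _ _)
    rw [← Finset.card_univ, ← smul_eq_mul, ← Finset.sum_const]
    refine Finset.sum_le_sum fun b _ => le_trans ?_ (Nat.le_add_right _ _)
    refine Finset.sum_le_sum fun r hr => Submodule.finrank_mono (inf_le_left.trans ?_)
    exact le_inf le_rfl (hall.trans (lineVanish_anti (Finset.mem_Icc.mp hr).2))
  · have hex : ∃ o, ¬ H ≤ lineVanish Q x a (o + 1) := by
      rcases s with _ | s
      · exact absurd (fun f _ => mem_lineVanish.mpr fun β hβ => absurd hβ (by omega)) hall
      · exact ⟨s, hall⟩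
    obtain ⟨o, ho, hmin⟩ : ∃ o, ¬ H ≤ lineVanish Q x a (o + 1) ∧ H ≤ lineVanish Q x a o := by
      refine ⟨Nat.find hex, Nat.find_spec hex, ?_⟩
      rcases hk : Nat.find hex with _ | k
      · exact fun f _ => mem_lineVanish.mpr fun β hβ => absurd hβ (by omega)
      · exact not_not.mp (Nat.find_min hex (m := k) (by omega))
    have hos : o < s := by
      by_contra h
      exact hall (hmin.trans (lineVanish_anti (by omega)))
    obtain ⟨f₀, hf₀, hf₀'⟩ := SetLike.not_le_iff_exists.mp ho
    rw [mem_lineVanish] at hf₀'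
    push Not at hf₀'
    obtain ⟨β, hβ, hβ0⟩ := hf₀'
    have hβo : ∑ i, β i = o := by
      by_contra h
      exact hβ0 (mem_lineVanish.mp (hmin hf₀) β (by omega))
    set φ := lineRestrict (fun i => Q ^ β i * x (a i)) with hφ
    set V := H.map φ with hV
    set H' := H ⊓ LinearMap.ker φ with hH'
    have hdim := finrank_map_add_finrank_inf_ker φ H
    rw [← hH', ← hV, hd] at hdim
    have hVpos : 0 < finrank K V := by
      rw [Nat.pos_iff_ne_zero]
      intro h
      have : V = ⊥ := Submodule.finrank_eq_zero.mp h
      have h0 : φ f₀ ∈ V := ⟨f₀, hf₀, rfl⟩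
      rw [this] at h0
      exact hβ0 h0
    have hfin' : FiniteDimensional K H' := Submodule.finiteDimensional_of_le inf_le_left
    have hVJ : V ≤ Polynomial.degreeLT K (J + 1) := by
      rintro _ ⟨f, hf, rfl⟩
      exact lineRestrict_mem_degreeLT _ (hJ hf)
    have hVle : ∀ (b : ι) (r : ℕ),
        finrank K (V ⊓ uniVanish Q (x b) r : Submodule K (Polynomial K)) ≤ finrank K V :=
      fun b r => Submodule.finrank_mono inf_le_left
    have ih' := ih (d - finrank K V) (by omega) H' hfin' (by omega) (inf_le_left.trans hJ)
    have huni := sum_sum_finrank_uniVanish_le hQ x hx V hVJ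
    have hjump := jumpSum_map_add_ker_le φ (headDegLE K m)
      (fun j => Polynomial.degreeLT K (j + 1)) (fun j f hf => lineRestrict_mem_degreeLT _ hf)
      (J + 1) H
    rw [← hH', ← hV] at hjump
    have hterm : ∀ b : ι, ∑ r ∈ Finset.Icc 1 s, finrank K (H ⊓ mvVanish Q x (Fin.cons b a) r :
          Submodule K (MvPolynomial (Fin (m + 1)) K)) ≤
        ∑ r ∈ Finset.Icc 1 s, finrank K (H' ⊓ mvVanish Q x (Fin.cons b a) r :
          Submodule K (MvPolynomial (Fin (m + 1)) K)) + (o * finrank K V +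
        ∑ r ∈ Finset.Icc 1 s, finrank K (V ⊓ uniVanish Q (x b) r :
          Submodule K (Polynomial K))) := by
      intro b
      have h1 : ∀ r ∈ Finset.Icc 1 s, finrank K (H ⊓ mvVanish Q x (Fin.cons b a) r :
          Submodule K (MvPolynomial (Fin (m + 1)) K)) ≤
          finrank K (H' ⊓ mvVanish Q x (Fin.cons b a) r :
            Submodule K (MvPolynomial (Fin (m + 1)) K)) +
          finrank K (V ⊓ uniVanish Q (x b) (r - o) : Submodule K (Polynomial K)) := by
        intro r _
        rw [add_comm (finrank K _)]
        refine finrank_inf_le_map_add_ker φ H _ _ fun f hf j hj => ?_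
        rw [hφ, eval_lineRestrict]
        have := hf (Fin.cons j β) (by rw [Fin.sum_univ_succ]; simp; omega)
        rw [← this]
        congr 1
        congr 1
        ext i
        refine Fin.cases ?_ (fun i => ?_) i <;> simp
      refine (Finset.sum_le_sum h1).trans ?_
      rw [Finset.sum_add_distrib]
      refine Nat.add_le_add_left ?_ _
      have h2 : Finset.Icc 1 s = Finset.Icc 1 o ∪ Finset.Ioc o s := by
        ext r; simp only [Finset.mem_union, Finset.mem_Icc, Finset.mem_Ioc]; omega
      rw [h2, Finset.sum_union (Finset.disjoint_left.mpr fun r h h' => by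
        simp only [Finset.mem_Icc, Finset.mem_Ioc] at h h'; omega), ← h2]
      refine Nat.add_le_add ?_ ?_
      · refine (Finset.sum_le_card_nsmul _ _ _ fun r _ => hVle b _).trans ?_
        simp
      · have hinj : Set.InjOn (fun r => r - o) (Finset.Ioc o s : Set ℕ) := by
          intro r hr r' hr' h
          simp only [Finset.coe_Ioc, Set.mem_Ioc] at hr hr'
          have : r - o = r' - o := h
          omega
        rw [← Finset.sum_image (f := fun r => finrank K (V ⊓ uniVanish Q (x b) r :
          Submodule K (Polynomial K))) hinj]
        refine Finset.sum_le_sum_of_subset fun r hr => ?_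
        simp only [Finset.mem_image, Finset.mem_Ioc, Finset.mem_Icc] at hr ⊢
        omega
    have hN : o * finrank K V + ∑ o ∈ Finset.Icc 1 s, finrank K (H' ⊓ lineVanish Q x a o :
        Submodule K (MvPolynomial (Fin (m + 1)) K)) ≤ ∑ o ∈ Finset.Icc 1 s,
          finrank K (H ⊓ lineVanish Q x a o : Submodule K (MvPolynomial (Fin (m + 1)) K)) := by
      have h1 : o * finrank K V = ∑ o' ∈ Finset.Icc 1 s, if o' ≤ o then finrank K V else 0 := by
        rw [← Finset.sum_filter, Finset.sum_const, smul_eq_mul]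
        congr 1
        have : (Finset.Icc 1 s).filter (· ≤ o) = Finset.Icc 1 o := by
          ext r; simp only [Finset.mem_filter, Finset.mem_Icc]; omega
        rw [this]; simp
      rw [h1, ← Finset.sum_add_distrib]
      refine Finset.sum_le_sum fun o' _ => ?_
      split_ifs with h
      · rw [inf_eq_left.mpr (hmin.trans (lineVanish_anti h)), hd, ← hdim]
        exact Nat.add_le_add_left (Submodule.finrank_mono inf_le_left) _
      · rw [zero_add]
        have : FiniteDimensional K (H ⊓ lineVanish Q x a o' :
            Submodule K (MvPolynomial (Fin (m + 1)) K)) :=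
          Submodule.finiteDimensional_of_le inf_le_left
        exact Submodule.finrank_mono (inf_le_inf_right _ inf_le_left)
    have hsum := Finset.sum_le_sum fun b (_ : b ∈ Finset.univ) => hterm b
    rw [Finset.sum_add_distrib, Finset.sum_add_distrib, Finset.sum_const, Finset.card_univ,
      smul_eq_mul] at hsum
    have hN' := Nat.mul_le_mul_left (Fintype.card ι) hN
    have hdd := mul_pred_add_mul_pred_le (show finrank K V ≤ d by omega)
    have hdd' := Nat.mul_le_mul_left (Fintype.card ι) hdd
    simp only [Nat.mul_add] at *
    linarith

theorem sum_jumpSum_add_finrank_lineVanish_le {m D : ℕ} {C : ℕ}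
    (hC : ∀ (H : Submodule K (MvPolynomial (Fin m) K)) (D' : ℕ), D' ≤ D → FiniteDimensional K H →
      (∀ f ∈ H, f.totalDegree ≤ D') →
      Fintype.card ι * ∑ a : Fin m → ι, ∑ r ∈ Finset.Icc 1 s, finrank K (H ⊓ mvVanish Q x a r :
        Submodule K (MvPolynomial (Fin m) K)) ≤
      finrank K H * D' * Fintype.card ι ^ m + finrank K H * (finrank K H - 1) * C)
    (J : ℕ) (hJ : J ≤ D + 1) : ∀ H : Submodule K (MvPolynomial (Fin (m + 1)) K),
      FiniteDimensional K H → (∀ f ∈ H, f.totalDegree ≤ D) →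
      (∀ f ∈ H, ∀ i, J ≤ i → headCoeff K m i f = 0) →
      ∑ a : Fin m → ι, (jumpSum (headDegLE K m) (D + 1) H + Fintype.card ι *
        ∑ o ∈ Finset.Icc 1 s, finrank K (H ⊓ lineVanish Q x a o :
          Submodule K (MvPolynomial (Fin (m + 1)) K))) ≤
      finrank K H * D * Fintype.card ι ^ m + finrank K H * (finrank K H - 1) * C := by
  classical
  induction J with
  | zero =>
    intro H _ _ hH
    have : H = ⊥ := by
      rw [eq_bot_iff]
      intro f hf
      have : MvPolynomial.finSuccEquiv K m f = 0 := Polynomial.ext fun i => hH f hf i (Nat.zero_le i)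
      simpa using this
    subst this
    simp [jumpSum]
  | succ J ih =>
    intro H hfin hD hH
    set φ := headCoeff K m J with hφ
    have hdim := finrank_map_add_finrank_inf_ker φ H
    have hV' : FiniteDimensional K (H.map φ) := inferInstance
    have hH'fin : FiniteDimensional K (H ⊓ LinearMap.ker φ :
      Submodule K (MvPolynomial (Fin (m + 1)) K)) := Submodule.finiteDimensional_of_le inf_le_left
    have ih' := ih (by omega) (H ⊓ LinearMap.ker φ) hH'fin (fun f hf => hD f hf.1) (by
      intro f hf i hi
      rcases Nat.eq_or_lt_of_le hi with rfl | hi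
      · exact hf.2
      · exact hH f hf.1 i hi)
    have hV := hC (H.map φ) (D - J) (Nat.sub_le _ _) hV' (by
      rintro _ ⟨f, hf, rfl⟩
      by_cases h0 : φ f = 0
      · simp [h0]
      · have := MvPolynomial.totalDegree_coeff_finSuccEquiv_add_le f J h0
        have h1 := hD f hf
        rw [hφ, headCoeff_apply]
        omega)
    have hjump := jumpSum_eq_of_top φ (headDegLE K m) (show J ≤ D + 1 by omega) H
      (fun j hj f hf => mem_headDegLE.mp hf J hj)
      (fun j hj f hf => mem_headDegLE.mpr fun i hi => hH f hf i (by omega))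
    have hline : ∀ (a : Fin m → ι) (o : ℕ), finrank K (H ⊓ lineVanish Q x a o :
        Submodule K (MvPolynomial (Fin (m + 1)) K)) ≤ finrank K (H.map φ ⊓ mvVanish Q x a o :
        Submodule K (MvPolynomial (Fin m) K)) + finrank K (H ⊓ LinearMap.ker φ ⊓ lineVanish Q x a o :
        Submodule K (MvPolynomial (Fin (m + 1)) K)) := by
      intro a o
      refine finrank_inf_le_map_add_ker φ H _ _ fun f hf β hβ => ?_
      have := congrArg (fun g => Polynomial.coeff g J) (mem_lineVanish.mp hf β hβ)
      rw [hφ, headCoeff_apply]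
      simpa [lineRestrict_apply, Polynomial.coeff_map] using this
    set V := H.map φ with hVdef
    set H' := H ⊓ LinearMap.ker φ with hH'def
    calc ∑ a : Fin m → ι, (jumpSum (headDegLE K m) (D + 1) H + Fintype.card ι *
          ∑ o ∈ Finset.Icc 1 s, finrank K (H ⊓ lineVanish Q x a o :
          Submodule K (MvPolynomial (Fin (m + 1)) K)))
        ≤ ∑ a : Fin m → ι, (J * finrank K V + Fintype.card ι * (∑ o ∈ Finset.Icc 1 s,
            finrank K (V ⊓ mvVanish Q x a o : Submodule K (MvPolynomial (Fin m) K))) +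
          (jumpSum (headDegLE K m) (D + 1) H' + Fintype.card ι *
            ∑ o ∈ Finset.Icc 1 s, finrank K (H' ⊓ lineVanish Q x a o :
            Submodule K (MvPolynomial (Fin (m + 1)) K)))) := by
          refine Finset.sum_le_sum fun a _ => ?_
          have h1 := Finset.sum_le_sum fun o (_ : o ∈ Finset.Icc 1 s) => hline a o
          rw [Finset.sum_add_distrib] at h1
          have h2 := Nat.mul_le_mul_left (Fintype.card ι) h1
          rw [Nat.mul_add] at h2
          rw [hjump]
          linarith
      _ = Fintype.card ι ^ m * (J * finrank K V) + Fintype.card ι * (∑ a : Fin m → ι,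
            ∑ o ∈ Finset.Icc 1 s,
            finrank K (V ⊓ mvVanish Q x a o : Submodule K (MvPolynomial (Fin m) K))) +
          ∑ a : Fin m → ι, (jumpSum (headDegLE K m) (D + 1) H' + Fintype.card ι *
            ∑ o ∈ Finset.Icc 1 s, finrank K (H' ⊓ lineVanish Q x a o :
            Submodule K (MvPolynomial (Fin (m + 1)) K))) := by
          rw [Finset.sum_add_distrib, Finset.sum_add_distrib, Finset.sum_const, Finset.card_univ,
            smul_eq_mul, Fintype.card_fun, Fintype.card_fin, ← Finset.mul_sum]
      _ ≤ Fintype.card ι ^ m * (J * finrank K V) +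
          (finrank K V * (D - J) * Fintype.card ι ^ m + finrank K V * (finrank K V - 1) * C) +
          (finrank K H' * D * Fintype.card ι ^ m + finrank K H' * (finrank K H' - 1) * C) :=
          Nat.add_le_add (Nat.add_le_add_left hV _) ih'
      _ ≤ _ := by
          have hdd := Nat.mul_le_mul_right C
            (mul_pred_add_mul_pred_le (show finrank K V ≤ finrank K H by omega))
          rw [show finrank K H - finrank K V = finrank K H' by omega] at hdd
          obtain ⟨u, hu⟩ := Nat.exists_eq_add_of_le (show J ≤ D by omega)
          rw [show D - J = u by omega]
          have h3 : finrank K H * D * Fintype.card ι ^ m =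
            Fintype.card ι ^ m * (J * finrank K V) + finrank K V * u * Fintype.card ι ^ m +
              finrank K H' * D * Fintype.card ι ^ m := by
            rw [← hdim, hu]; ring
          rw [h3]
          linarith

/-- The dimension bound: on average over the points `a`, a `d`-dimensional space of polynomials of
degree at most `D` contains few polynomials vanishing to high order at `a`. -/
theorem card_mul_sum_finrank_mvVanish_le
    (hx : ∀ i < s, ∀ j < s, ∀ a b, Q ^ i * x a = Q ^ j * x b → i = j ∧ a = b) (m : ℕ) :
    ∀ (D : ℕ), (∀ i < D + 1, ∀ j < D + 1, Q ^ i = Q ^ j → i = j) →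
      ∀ H : Submodule K (MvPolynomial (Fin m) K), FiniteDimensional K H →
      (∀ f ∈ H, f.totalDegree ≤ D) →
      Fintype.card ι * ∑ a : Fin m → ι, ∑ r ∈ Finset.Icc 1 s, finrank K (H ⊓ mvVanish Q x a r :
        Submodule K (MvPolynomial (Fin m) K)) ≤
      finrank K H * D * Fintype.card ι ^ m +
        finrank K H * (finrank K H - 1) * (m * Fintype.card ι ^ (m + 1)) := by
  classical
  induction m with
  | zero =>
    intro D _ H _ _
    have : ∀ (a : Fin 0 → ι), ∀ r ∈ Finset.Icc 1 s, finrank K (H ⊓ mvVanish Q x a r :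
        Submodule K (MvPolynomial (Fin 0) K)) = 0 := by
      intro a r hr
      have hbot : H ⊓ mvVanish Q x a r = ⊥ := by
        rw [eq_bot_iff]
        rintro f ⟨-, hf⟩
        have h := hf (fun _ => 0) (by simp at hr ⊢; omega)
        rw [MvPolynomial.eq_C_of_isEmpty f, MvPolynomial.eval_C] at h
        rw [Submodule.mem_bot, MvPolynomial.eq_C_of_isEmpty f, h, MvPolynomial.C_0]
      rw [hbot, finrank_bot]
    rw [Finset.sum_eq_zero fun a _ => Finset.sum_eq_zero (this a)]
    simp
  | succ m ih =>
    intro D hQ H hfin hD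
    have hHJ : ∀ f ∈ H, ∀ i, D + 1 ≤ i → headCoeff K m i f = 0 := by
      intro f hf i hi
      by_contra h0
      have := MvPolynomial.totalDegree_coeff_finSuccEquiv_add_le f i h0
      have := hD f hf
      omega
    have h1 := sum_jumpSum_add_finrank_lineVanish_le (Q := Q) (x := x) (s := s) (D := D)
      (C := m * Fintype.card ι ^ (m + 1))
      (fun H' D' hD' hfin' hdeg => ih D' (fun i hi j hj => hQ i (by omega) j (by omega)) H' hfin'
        hdeg) (D + 1) le_rfl H hfin hD hHJ
    have h2 : ∀ a : Fin m → ι, _ := fun a => sum_finrank_mvVanish_line_le (J := D) hQ hx a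
      (finrank K H) H hfin rfl
      (fun f hf => mem_headDegLE.mpr fun i hi => hHJ f hf i (by omega))
    have h3 : ∑ a : Fin (m + 1) → ι, ∑ r ∈ Finset.Icc 1 s, finrank K (H ⊓ mvVanish Q x a r :
        Submodule K (MvPolynomial (Fin (m + 1)) K)) = ∑ a : Fin m → ι, ∑ b : ι,
        ∑ r ∈ Finset.Icc 1 s, finrank K (H ⊓ mvVanish Q x (Fin.cons b a) r :
        Submodule K (MvPolynomial (Fin (m + 1)) K)) := by
      rw [← (Fin.consEquiv fun _ : Fin (m + 1) => ι).sum_comp, Fintype.sum_prod_type_right]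
      rfl
    rw [h3]
    refine (Nat.mul_le_mul_left _ (Finset.sum_le_sum fun a _ => h2 a)).trans ?_
    have h4 : ∑ a : Fin m → ι, (jumpSum (headDegLE K m) (D + 1) H + Fintype.card ι *
        (∑ o ∈ Finset.Icc 1 s, finrank K (H ⊓ lineVanish Q x a o :
          Submodule K (MvPolynomial (Fin (m + 1)) K)) + finrank K H * (finrank K H - 1))) =
        ∑ a : Fin m → ι, (jumpSum (headDegLE K m) (D + 1) H + Fintype.card ι *
        ∑ o ∈ Finset.Icc 1 s, finrank K (H ⊓ lineVanish Q x a o :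
          Submodule K (MvPolynomial (Fin (m + 1)) K))) +
        Fintype.card ι ^ m * (Fintype.card ι * (finrank K H * (finrank K H - 1))) := by
      rw [← Finset.sum_congr rfl fun a _ => (by ring :
        jumpSum (headDegLE K m) (D + 1) H + Fintype.card ι *
        ∑ o ∈ Finset.Icc 1 s, finrank K (H ⊓ lineVanish Q x a o :
          Submodule K (MvPolynomial (Fin (m + 1)) K)) +
          Fintype.card ι * (finrank K H * (finrank K H - 1)) = _), Finset.sum_add_distrib,
        Finset.sum_const, Finset.card_univ, Fintype.card_fun, Fintype.card_fin, smul_eq_mul]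
    rw [h4]
    refine (Nat.mul_le_mul_left _ (Nat.add_le_add_right h1 _)).trans (le_of_eq ?_)
    ring

end Multivariate

/-! ## Calculus of the `Q`-derivative -/

section QDerivative

variable {K : Type*} [Field K] {m : ℕ}

theorem eval_qScale (Q : K) (i : Fin m) (f : MvPolynomial (Fin m) K) (y : Fin m → K) :
    MvPolynomial.eval y (qScale Q i f) = MvPolynomial.eval (Function.update y i (Q * y i)) f := by
  rw [qScale, MvPolynomial.aeval_def, MvPolynomial.eval₂_eq', map_sum, MvPolynomial.eval_eq']
  refine Finset.sum_congr rfl fun d _ => ?_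
  rw [map_mul, map_prod, MvPolynomial.algebraMap_eq, MvPolynomial.eval_C]
  congr 1
  refine Finset.prod_congr rfl fun j _ => ?_
  by_cases hj : j = i
  · subst hj; simp
  · simp [hj]

theorem eval_update_mul {Q : K} (hQ : Q ≠ 1) (i : Fin m) (f : MvPolynomial (Fin m) K)
    (y : Fin m → K) : MvPolynomial.eval (Function.update y i (Q * y i)) f =
      MvPolynomial.eval y f + (Q - 1) * y i * MvPolynomial.eval y (qDeriv Q i f) := by
  have := congrArg (MvPolynomial.eval y) (qDeriv_spec Q hQ i f)
  rw [map_mul, map_mul, MvPolynomial.eval_C, MvPolynomial.eval_X, map_sub, eval_qScale] at this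
  rw [this]; ring

theorem qDeriv_add (Q : K) (i : Fin m) (f g : MvPolynomial (Fin m) K) :
    qDeriv Q i (f + g) = qDeriv Q i f + qDeriv Q i g := by
  have : qScale Q i (f + g) - (f + g) = (qScale Q i f - f) + (qScale Q i g - g) := by
    simp only [qScale, map_add]; ring
  rw [qDeriv, this, MvPolynomial.add_divMonomial, mul_add]; rfl

theorem qDeriv_smul (Q c : K) (i : Fin m) (f : MvPolynomial (Fin m) K) :
    qDeriv Q i (c • f) = c • qDeriv Q i f := by
  have h : qScale Q i (c • f) - c • f = c • (qScale Q i f - f) := by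
    simp only [qScale, map_smul, smul_sub]
  have h2 : ∀ g : MvPolynomial (Fin m) K,
      (c • g).divMonomial (Finsupp.single i 1) = c • g.divMonomial (Finsupp.single i 1) := by
    intro g
    ext d
    simp [MvPolynomial.coeff_divMonomial]
  rw [qDeriv, h, h2, mul_smul_comm]; rfl

theorem qDeriv_monomial (Q : K) (i : Fin m) (e : Fin m →₀ ℕ) (c : K) :
    qDeriv Q i (MvPolynomial.monomial e c) =
      MvPolynomial.monomial (e - Finsupp.single i 1) ((Q - 1)⁻¹ * ((Q ^ e i - 1) * c)) := by
  have h1 : qScale Q i (MvPolynomial.monomial e c) = MvPolynomial.monomial e (Q ^ e i * c) := by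
    rw [qScale, MvPolynomial.aeval_monomial, MvPolynomial.algebraMap_eq,
      MvPolynomial.monomial_eq (s := e) (a := Q ^ e i * c)]
    have : (e.prod fun j k => (if j = i then MvPolynomial.C Q * MvPolynomial.X j
        else MvPolynomial.X j : MvPolynomial (Fin m) K) ^ k) =
        MvPolynomial.C (Q ^ e i) * e.prod fun j k => MvPolynomial.X j ^ k := by
      rw [Finsupp.prod_fintype _ _ (by simp), Finsupp.prod_fintype _ _ (by simp)]
      have h : ∀ j, (if j = i then MvPolynomial.C Q * MvPolynomial.X j
          else MvPolynomial.X j : MvPolynomial (Fin m) K) ^ e j =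
          (if j = i then MvPolynomial.C (Q ^ e i) else 1) * MvPolynomial.X j ^ e j := by
        intro j
        split_ifs with hj
        · subst hj; rw [mul_pow, MvPolynomial.C_pow]
        · rw [one_mul]
      rw [Finset.prod_congr rfl fun j _ => h j, Finset.prod_mul_distrib]
      simp
    rw [this, MvPolynomial.C_mul]; ring
  rw [qDeriv, h1, ← map_sub, show Q ^ e i * c - c = (Q ^ e i - 1) * c by ring,
    ← MvPolynomial.C_mul_monomial (s := e - Finsupp.single i 1)]
  congr 1
  ext d
  rw [MvPolynomial.coeff_divMonomial, MvPolynomial.coeff_monomial, MvPolynomial.coeff_monomial]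
  by_cases he : e i = 0
  · simp [he]
  · have : e = Finsupp.single i 1 + d ↔ e - Finsupp.single i 1 = d := by
      constructor
      · rintro rfl; ext j; simp
      · rintro rfl
        ext j
        by_cases hj : j = i
        · subst hj; simp; omega
        · simp [Ne.symm hj]
    simp [this]

/-- The `Q`-derivative as a linear map. -/
noncomputable def qDerivLin (Q : K) (i : Fin m) :
    MvPolynomial (Fin m) K →ₗ[K] MvPolynomial (Fin m) K where
  toFun := qDeriv Q i
  map_add' := qDeriv_add Q i
  map_smul' c f := qDeriv_smul Q c i f

theorem qDeriv_comm (Q : K) (i j : Fin m) (f : MvPolynomial (Fin m) K) :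
    qDeriv Q i (qDeriv Q j f) = qDeriv Q j (qDeriv Q i f) := by
  have : qDerivLin Q i ∘ₗ qDerivLin Q j = qDerivLin Q j ∘ₗ qDerivLin Q i := by
    refine MvPolynomial.linearMap_ext fun e => LinearMap.ext fun c => ?_
    change qDeriv Q i (qDeriv Q j (MvPolynomial.monomial e c)) =
      qDeriv Q j (qDeriv Q i (MvPolynomial.monomial e c))
    simp only [qDeriv_monomial]
    by_cases hij : i = j
    · subst hij; rfl
    · rw [tsub_right_comm]
      congr 1
      simp only [Finsupp.tsub_apply, Finsupp.single_apply, if_neg hij, if_neg (Ne.symm hij),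
        tsub_zero]
      ring
  exact LinearMap.congr_fun this f

/-- The list in which `i` occurs `α i` times. -/
def idxList (α : Fin m → ℕ) : List (Fin m) :=
  (List.finRange m).flatMap fun i => List.replicate (α i) i

theorem count_idxList (α : Fin m → ℕ) (i : Fin m) : (idxList α).count i = α i := by
  rw [idxList, List.count_flatMap]
  have : ∀ j, (List.count i ∘ fun j => List.replicate (α j) j) j = if j = i then α i else 0 := by
    intro j
    simp only [Function.comp_apply, List.count_replicate, beq_iff_eq]
    split_ifs with h
    · rw [h]
    · rfl
  rw [List.map_congr_left fun j _ => this j, ← List.ofFn_eq_map, List.sum_ofFn]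
  simp

theorem length_idxList (α : Fin m → ℕ) : (idxList α).length = ∑ i, α i := by
  rw [idxList, List.length_flatMap]
  simp [← List.ofFn_eq_map, List.sum_ofFn]

theorem qDerivIter_eq_foldr (Q : K) (α : Fin m → ℕ) (f : MvPolynomial (Fin m) K) :
    qDerivIter Q α f = (idxList α).foldr (qDeriv Q) f := by
  rw [qDerivIter, idxList]
  induction List.finRange m with
  | nil => rfl
  | cons i l ih =>
    rw [List.foldr_cons, List.flatMap_cons, List.foldr_append, ih]
    induction α i with
    | zero => rfl
    | succ n ih => rw [Function.iterate_succ_apply', ih, List.replicate_succ, List.foldr_cons]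

theorem qDerivIter_eq_foldr_of_count (Q : K) {α : Fin m → ℕ} {l : List (Fin m)}
    (h : ∀ i, l.count i = α i) (f : MvPolynomial (Fin m) K) :
    qDerivIter Q α f = l.foldr (qDeriv Q) f := by
  rw [qDerivIter_eq_foldr]
  have : LeftCommutative (qDeriv Q : Fin m → MvPolynomial (Fin m) K → _) :=
    ⟨fun i j f => qDeriv_comm Q i j f⟩
  exact List.Perm.foldr_eq (List.perm_iff_count.mpr fun i => by rw [count_idxList, h]) f

theorem count_cons_eq (j : Fin m) (l : List (Fin m)) (i : Fin m) :
    (j :: l).count i = ((fun i => l.count i) + Pi.single j 1 : Fin m → ℕ) i := by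
  rw [List.count_cons, Pi.add_apply, Pi.single_apply]
  by_cases h : j = i
  · simp [h]
  · simp [h, Ne.symm h]

theorem qDerivIter_add_single (Q : K) (γ : Fin m → ℕ) (j : Fin m) (f : MvPolynomial (Fin m) K) :
    qDerivIter Q (γ + Pi.single j 1) f = qDeriv Q j (qDerivIter Q γ f) := by
  rw [qDerivIter_eq_foldr Q γ, ← List.foldr_cons (f := qDeriv Q)]
  refine qDerivIter_eq_foldr_of_count Q (fun i => ?_) f
  rw [count_cons_eq, Pi.add_apply, Pi.add_apply, count_idxList]

/-- The `Q`-derivatives as linear maps. -/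
noncomputable def qDerivIterLin (Q : K) (γ : Fin m → ℕ) :
    MvPolynomial (Fin m) K →ₗ[K] MvPolynomial (Fin m) K :=
  (idxList γ).foldr (fun i φ => qDerivLin Q i ∘ₗ φ) LinearMap.id

theorem qDerivIterLin_apply (Q : K) (γ : Fin m → ℕ) (f : MvPolynomial (Fin m) K) :
    qDerivIterLin Q γ f = qDerivIter Q γ f := by
  rw [qDerivIter_eq_foldr, qDerivIterLin]
  induction idxList γ with
  | nil => rfl
  | cons i l ih => rw [List.foldr_cons, List.foldr_cons, ← ih]; rfl

/-- The point `Q^β a`. -/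
def qPoint (Q : K) (β : Fin m → ℕ) (a : Fin m → K) : Fin m → K := fun i => Q ^ β i * a i

theorem qPoint_zero (Q : K) (a : Fin m → K) : qPoint Q 0 a = a := by
  ext i; simp [qPoint]

theorem qDerivIter_zero (Q : K) (f : MvPolynomial (Fin m) K) : qDerivIter Q 0 f = f :=
  qDerivIter_eq_foldr_of_count Q (l := []) (fun _ => rfl) f

theorem qPoint_add_single (Q : K) (β : Fin m → ℕ) (j : Fin m) (a : Fin m → K) :
    qPoint Q (β + Pi.single j 1) a =
      Function.update (qPoint Q β a) j (Q * qPoint Q β a j) := by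
  ext i
  by_cases h : i = j
  · subst h; simp [qPoint, pow_succ]; ring
  · simp [qPoint, h]

theorem qPoint_cons (Q : K) (j : Fin m) (l : List (Fin m)) (a : Fin m → K) :
    qPoint Q (fun i => (j :: l).count i) a = Function.update (qPoint Q (fun i => l.count i) a) j
      (Q * qPoint Q (fun i => l.count i) a j) := by
  rw [← qPoint_add_single]
  congr 1
  ext i
  exact count_cons_eq j l i

/-- The values of the derivatives at the shifted points, in terms of those at the point `a`. -/
noncomputable def shiftVal (Q : K) (a : Fin m → K) (w : (Fin m → ℕ) → K) :
    List (Fin m) → (Fin m → ℕ) → K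
  | [], γ => w γ
  | j :: l, γ => shiftVal Q a w l γ +
      (Q - 1) * qPoint Q (fun i => l.count i) a j * shiftVal Q a w l (γ + Pi.single j 1)

theorem shiftVal_eq {Q : K} (hQ : Q ≠ 1) {a : Fin m → K} {w : (Fin m → ℕ) → K} {s : ℕ}
    {f : MvPolynomial (Fin m) K}
    (hw : ∀ γ : Fin m → ℕ, ∑ i, γ i < s → w γ = MvPolynomial.eval a (qDerivIter Q γ f)) :
    ∀ (l : List (Fin m)) (γ : Fin m → ℕ), l.length + ∑ i, γ i < s → shiftVal Q a w l γ =
      MvPolynomial.eval (qPoint Q (fun i => l.count i) a) (qDerivIter Q γ f) := by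
  intro l
  induction l with
  | nil => intro γ hγ; rw [shiftVal, hw γ (by simpa using hγ)]; exact congrArg₂ _ (congrArg _ (qPoint_zero Q a).symm) rfl
  | cons j l ih =>
    intro γ hγ
    rw [List.length_cons] at hγ
    have hs : ∑ i, (γ + Pi.single j 1 : Fin m → ℕ) i = ∑ i, γ i + 1 := by
      simp [Finset.sum_add_distrib]
    rw [shiftVal, ih γ (by omega), ih _ (by omega), qPoint_cons, eval_update_mul hQ,
      qDerivIter_add_single]

theorem mem_mvVanish_of_forall_qDerivIter {ι : Type*} {Q : K} (hQ : Q ≠ 1) {x : ι → K} {s : ℕ}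
    {a : Fin m → ι} {f : MvPolynomial (Fin m) K} (hf : ∀ γ : Fin m → ℕ, ∑ i, γ i < s →
      MvPolynomial.eval (fun i => x (a i)) (qDerivIter Q γ f) = 0) : f ∈ mvVanish Q x a s := by
  intro β hβ
  have h1 := shiftVal_eq hQ (w := fun _ => 0) (a := fun i => x (a i)) (f := f) (s := s)
    (fun γ hγ => (hf γ hγ).symm) (idxList β) 0 (by rw [length_idxList]; simpa using hβ)
  have h2 : ∀ (l : List (Fin m)) (γ : Fin m → ℕ),
      shiftVal Q (fun i => x (a i)) (fun _ => 0) l γ = 0 := by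
    intro l
    induction l with
    | nil => intro γ; rfl
    | cons j l ih => intro γ; rw [shiftVal, ih, ih]; ring
  rw [h2] at h1
  simp only [count_idxList] at h1
  rw [qDerivIter_zero] at h1
  exact h1.symm

/-- The value at `Q^β a` of the derivative along a list of the monomial `X^e`. -/
noncomputable def monoDerivVal (Q : K) (a : Fin m → K) (e : Fin m → ℕ) :
    List (Fin m) → (Fin m → ℕ) → K
  | [], β => ∏ i, qPoint Q β a i ^ e i
  | j :: l, β => (monoDerivVal Q a e l (β + Pi.single j 1) - monoDerivVal Q a e l β) *
      ((Q - 1) * qPoint Q β a j)⁻¹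

theorem monoDerivVal_eq {Q : K} (hQ0 : Q ≠ 0) (hQ : Q ≠ 1) {a : Fin m → K} (ha : ∀ i, a i ≠ 0)
    (e : Fin m →₀ ℕ) : ∀ (l : List (Fin m)) (β : Fin m → ℕ), monoDerivVal Q a e l β =
      MvPolynomial.eval (qPoint Q β a) (l.foldr (qDeriv Q) (MvPolynomial.monomial e 1)) := by
  intro l
  induction l with
  | nil =>
    intro β
    rw [monoDerivVal, List.foldr_nil, MvPolynomial.eval_monomial, one_mul,
      Finsupp.prod_fintype _ _ (by simp)]
  | cons j l ih =>
    intro β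
    have h0 : (Q - 1) * qPoint Q β a j ≠ 0 :=
      mul_ne_zero (sub_ne_zero.mpr hQ) (mul_ne_zero (pow_ne_zero _ hQ0) (ha j))
    rw [monoDerivVal, ih, ih, qPoint_add_single, eval_update_mul hQ, List.foldr_cons]
    rw [add_sub_cancel_left, mul_comm _ (MvPolynomial.eval _ _), mul_assoc, mul_inv_cancel₀ h0,
      mul_one]

end QDerivative

/-! ## Separation of the evaluation points -/

section Separation

variable {F K : Type*} [Field F] [Fintype F] [Field K] [Algebra F K]

theorem orderOf_generator (h3 : Module.finrank F K = 3) (Q : Kˣ)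
    (hQ : ∀ x : Kˣ, x ∈ Subgroup.zpowers Q) : orderOf Q = Fintype.card F ^ 3 - 1 := by
  have : Module.Finite F K := Module.finite_of_finrank_pos (by omega)
  have : Finite K := Module.finite_of_finite F
  rw [orderOf_eq_card_of_forall_mem_zpowers hQ, Nat.card_units,
    Module.natCard_eq_pow_finrank (K := F) (V := K), h3, Nat.card_eq_fintype_card]

theorem sub_mul_lt_cube_sub_one {q i : ℕ} (hq : 2 ≤ q) (hi : i ≤ q) :
    i * (q - 1) < q ^ 3 - 1 := by
  obtain ⟨u, rfl⟩ := Nat.exists_eq_add_of_le hq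
  have h1 : i * (2 + u - 1) ≤ (2 + u) * (1 + u) := Nat.mul_le_mul hi (by omega)
  have h2 : (2 + u) * (1 + u) + 1 < (2 + u) ^ 3 := by nlinarith [Nat.zero_le (u ^ 3)]
  omega

theorem generator_pow_injOn (h3 : Module.finrank F K = 3) (Q : Kˣ)
    (hQ : ∀ x : Kˣ, x ∈ Subgroup.zpowers Q) {s : ℕ} (hs : s ≤ Fintype.card F) (A : Finset F)
    (hA : (0 : F) ∉ A) : ∀ i < s * A.card + 1, ∀ j < s * A.card + 1,
      (Q : K) ^ i = (Q : K) ^ j → i = j := by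
  classical
  have hq : 2 ≤ Fintype.card F := Fintype.one_lt_card
  have hcard : A.card ≤ Fintype.card F - 1 := by
    have : A ⊆ Finset.univ.erase 0 := fun a ha =>
      Finset.mem_erase.mpr ⟨fun h => hA (h ▸ ha), Finset.mem_univ _⟩
    simpa [Finset.card_erase_of_mem] using Finset.card_le_card this
  have hlt : s * A.card < Fintype.card F ^ 3 - 1 :=
    lt_of_le_of_lt (Nat.mul_le_mul_left _ hcard) (sub_mul_lt_cube_sub_one hq hs)
  intro i hi j hj hij
  have : Q ^ i = Q ^ j := Units.ext (by simpa using hij)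
  refine pow_injOn_Iio_orderOf ?_ ?_ this <;>
  · rw [orderOf_generator h3 Q hQ, Set.mem_Iio]; omega

theorem generator_pow_mul_injective (h3 : Module.finrank F K = 3) (Q : Kˣ)
    (hQ : ∀ x : Kˣ, x ∈ Subgroup.zpowers Q) {s : ℕ} (hs : s ≤ Fintype.card F) (A : Finset F)
    (hA : (0 : F) ∉ A) : ∀ i < s, ∀ j < s, ∀ a b : A,
      (Q : K) ^ i * algebraMap F K a = (Q : K) ^ j * algebraMap F K b → i = j ∧ a = b := by
  have hq : 2 ≤ Fintype.card F := Fintype.one_lt_card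
  have h0 : ∀ a : A, (a : F) ≠ 0 := fun a h => hA (h ▸ a.2)
  have key : ∀ i j, i ≤ j → j < s → ∀ a b : A,
      (Q : K) ^ i * algebraMap F K a = (Q : K) ^ j * algebraMap F K b → i = j := by
    intro i j hij hj a b h
    obtain ⟨u, rfl⟩ := Nat.exists_eq_add_of_le hij
    have h1 : algebraMap F K a = (Q : K) ^ u * algebraMap F K b := by
      rw [pow_add, mul_assoc] at h
      exact mul_left_cancel₀ (pow_ne_zero _ Q.ne_zero) h
    have h2 : ∀ a : A, (algebraMap F K a) ^ (Fintype.card F - 1) = 1 := fun a => by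
      rw [← map_pow, FiniteField.pow_card_sub_one_eq_one _ (h0 a), map_one]
    have h3' : (Q : K) ^ (u * (Fintype.card F - 1)) = 1 := by
      have := congrArg (· ^ (Fintype.card F - 1)) h1
      simp only [mul_pow, h2, mul_one] at this
      rw [pow_mul, ← this]
    have h4 : Q ^ (u * (Fintype.card F - 1)) = 1 := Units.ext (by simpa using h3')
    have h5 := orderOf_dvd_of_pow_eq_one h4
    rw [orderOf_generator h3 Q hQ] at h5
    have h6 := Nat.eq_zero_of_dvd_of_lt h5 (sub_mul_lt_cube_sub_one hq (by omega))
    rcases Nat.mul_eq_zero.mp h6 with h | h <;> omega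
  intro i hi j hj a b h
  have hij : i = j := by
    rcases le_total i j with h' | h'
    · exact key i j h' hj a b h
    · exact (key j i h' hi b a h.symm).symm
  subst hij
  refine ⟨rfl, Subtype.ext ((algebraMap F K).injective ?_)⟩
  exact mul_left_cancel₀ (pow_ne_zero _ Q.ne_zero) h

theorem generator_ne_one (h3 : Module.finrank F K = 3) (Q : Kˣ)
    (hQ : ∀ x : Kˣ, x ∈ Subgroup.zpowers Q) : (Q : K) ≠ 1 := by
  intro h
  have h1 : Q = 1 := Units.ext h
  have h2 := orderOf_generator h3 Q hQ
  have hq : 2 ≤ Fintype.card F := Fintype.one_lt_card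
  have := sub_mul_lt_cube_sub_one hq hq
  have : 2 * (2 - 1) ≤ Fintype.card F * (Fintype.card F - 1) := Nat.mul_le_mul hq (by omega)
  rw [h1, orderOf_one] at h2
  omega

end Separation

/-! ## The number of zeros, and the dimension of lists -/

section ListDimension

open Module

variable {K : Type*} [Field K] {ι : Type*} [Fintype ι] {Q : K} {x : ι → K} {s m D : ℕ}

open Classical in
theorem card_mul_card_mvVanish_le
    (hx : ∀ i < s, ∀ j < s, ∀ a b, Q ^ i * x a = Q ^ j * x b → i = j ∧ a = b)
    (hQ : ∀ i < D + 1, ∀ j < D + 1, Q ^ i = Q ^ j → i = j)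
    {f : MvPolynomial (Fin m) K} (hf : f ≠ 0) (hD : f.totalDegree ≤ D) :
    Fintype.card ι * (s * (Finset.univ.filter fun a : Fin m → ι => f ∈ mvVanish Q x a s).card) ≤
      D * Fintype.card ι ^ m := by
  have h := card_mul_sum_finrank_mvVanish_le hx m D hQ (K ∙ f) inferInstance (by
    intro g hg
    obtain ⟨c, rfl⟩ := Submodule.mem_span_singleton.mp hg
    exact (MvPolynomial.totalDegree_smul_le c f).trans hD)
  rw [finrank_span_singleton hf, Nat.sub_self, mul_zero, zero_mul, add_zero, one_mul] at h
  refine le_trans (Nat.mul_le_mul_left _ ?_) h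
  rw [mul_comm, ← smul_eq_mul, ← Finset.sum_const, Finset.sum_filter]
  refine Finset.sum_le_sum fun a _ => ?_
  split_ifs with ha
  · calc s = ∑ r ∈ Finset.Icc 1 s, 1 := by simp
      _ ≤ _ := Finset.sum_le_sum fun r hr => by
        have : K ∙ f ⊓ mvVanish Q x a r = K ∙ f := by
          rw [inf_eq_left, Submodule.span_singleton_le_iff_mem]
          exact fun β hβ => ha β (hβ.trans_le (Finset.mem_Icc.mp hr).2)
        rw [this, finrank_span_singleton hf]
  · exact Nat.zero_le _

open Classical in
theorem card_mul_sum_agree_le {d τ : ℕ}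
    (hx : ∀ i < s, ∀ j < s, ∀ a b, Q ^ i * x a = Q ^ j * x b → i = j ∧ a = b)
    (hQ : ∀ i < D + 1, ∀ j < D + 1, Q ^ i = Q ^ j → i = j)
    {f : Fin (d + 1) → MvPolynomial (Fin m) K} (hf : AffineIndependent K f)
    (hD : ∀ i, (f i).totalDegree ≤ D) (T : Fin (d + 1) → Finset (Fin m → ι))
    (hT : ∀ i j a, a ∈ T i → a ∈ T j → f i - f j ∈ mvVanish Q x a s) (hτ : ∀ i, τ ≤ (T i).card) :
    Fintype.card ι * (s * ((d + 1) * τ)) ≤ Fintype.card ι * (s * Fintype.card ι ^ m) +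
      (d * D * Fintype.card ι ^ m + d * (d - 1) * (m * Fintype.card ι ^ (m + 1))) := by
  set H := vectorSpan K (Set.range f) with hH
  have hHfin : FiniteDimensional K H := finiteDimensional_vectorSpan_range K f
  have hHd : finrank K H = d := hf.finrank_vectorSpan (Fintype.card_fin _)
  have hmem : ∀ i j, f i - f j ∈ H := fun i j =>
    vsub_mem_vectorSpan K (Set.mem_range_self i) (Set.mem_range_self j)
  have h := card_mul_sum_finrank_mvVanish_le hx m D hQ H hHfin (by
    intro g hg
    rw [hH, vectorSpan_def] at hg
    induction hg using Submodule.span_induction with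
    | mem g hg =>
      obtain ⟨_, ⟨i, rfl⟩, _, ⟨j, rfl⟩, rfl⟩ := hg
      exact (MvPolynomial.totalDegree_sub _ _).trans (max_le (hD i) (hD j))
    | zero => simp
    | add g g' _ _ h h' => exact (MvPolynomial.totalDegree_add _ _).trans (max_le h h')
    | smul c g _ h => exact (MvPolynomial.totalDegree_smul_le c g).trans h)
  rw [hHd] at h
  have hcount : ∀ a : Fin m → ι, s * (Finset.univ.filter fun i => a ∈ T i).card ≤
      s + ∑ r ∈ Finset.Icc 1 s, finrank K (H ⊓ mvVanish Q x a r :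
        Submodule K (MvPolynomial (Fin m) K)) := by
    intro a
    have hfin : ∀ r, FiniteDimensional K (H ⊓ mvVanish Q x a r :
      Submodule K (MvPolynomial (Fin m) K)) := fun r => Submodule.finiteDimensional_of_le inf_le_left
    have h1 : (Finset.univ.filter fun i => a ∈ T i).card ≤
        1 + finrank K (H ⊓ mvVanish Q x a s : Submodule K (MvPolynomial (Fin m) K)) := by
      rcases (Finset.univ.filter fun i => a ∈ T i).eq_empty_or_nonempty with h0 | ⟨i₀, hi₀⟩
      · rw [h0]; simp
      · have hi₀' : a ∈ T i₀ := (Finset.mem_filter.mp hi₀).2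
        have hli := (affineIndependent_iff_linearIndependent_vsub K f i₀).mp hf
        let v : {i // i ≠ i₀ ∧ a ∈ T i} → (H ⊓ mvVanish Q x a s :
            Submodule K (MvPolynomial (Fin m) K)) := fun i =>
          ⟨f i.1 - f i₀, hmem _ _, hT _ _ _ i.2.2 hi₀'⟩
        have hv : LinearIndependent K v := by
          refine LinearIndependent.of_comp (Submodule.subtype _) ?_
          exact hli.comp (fun i : {i // i ≠ i₀ ∧ a ∈ T i} => (⟨i.1, i.2.1⟩ : {i // i ≠ i₀}))
            (fun i j hij => Subtype.ext (by simpa using hij))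
        have h2 := hv.fintype_card_le_finrank
        rw [Fintype.card_subtype] at h2
        have h3 : (Finset.univ.filter fun i => a ∈ T i) ⊆
            insert i₀ (Finset.univ.filter fun i => i ≠ i₀ ∧ a ∈ T i) := by
          intro i hi
          by_cases h : i = i₀
          · simp [h]
          · simp [h, (Finset.mem_filter.mp hi).2]
        have h4 := (Finset.card_le_card h3).trans (Finset.card_insert_le _ _)
        omega
    have h2 : s * finrank K (H ⊓ mvVanish Q x a s : Submodule K (MvPolynomial (Fin m) K)) ≤
        ∑ r ∈ Finset.Icc 1 s, finrank K (H ⊓ mvVanish Q x a r :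
          Submodule K (MvPolynomial (Fin m) K)) := by
      have : s = (Finset.Icc 1 s).card := by simp
      conv_lhs => rw [this, ← smul_eq_mul, ← Finset.sum_const]
      rw [← this]
      refine Finset.sum_le_sum fun r hr => ?_
      have := hfin r
      exact Submodule.finrank_mono (inf_le_inf_left _ fun g hg β hβ =>
        hg β (hβ.trans_le (Finset.mem_Icc.mp hr).2))
    nlinarith [Nat.mul_le_mul_left s h1]
  have h5 : (d + 1) * τ ≤ ∑ a : Fin m → ι, (Finset.univ.filter fun i => a ∈ T i).card := by
    calc (d + 1) * τ = ∑ _i : Fin (d + 1), τ := by simp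
      _ ≤ ∑ i, (T i).card := Finset.sum_le_sum fun i _ => hτ i
      _ = ∑ i, ∑ a, if a ∈ T i then 1 else 0 := by simp
      _ = _ := by rw [Finset.sum_comm]; simp
  have h6 := Finset.sum_le_sum fun a (_ : a ∈ Finset.univ) => hcount a
  rw [← Finset.mul_sum, Finset.sum_add_distrib, Finset.sum_const, Finset.card_univ,
    Fintype.card_fun, Fintype.card_fin, smul_eq_mul] at h6
  have h7 := Nat.mul_le_mul_left (Fintype.card ι) ((Nat.mul_le_mul_left s h5).trans h6)
  rw [Nat.mul_add, mul_comm (_ ^ m) s] at h7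
  exact h7.trans (Nat.add_le_add_left h _)

end ListDimension

section RelativeDistance

variable {F K : Type*} {m s : ℕ} {A : Finset F}

open Classical in
theorem relDist_le_iff (hA : A.Nonempty) (u w : QWord K m s A) (ρ : ℝ) :
    relDist u w ≤ ρ ↔ ((Finset.univ.filter fun a => u a ≠ w a).card : ℝ) ≤
      ρ * (A.card : ℝ) ^ m := by
  have hpos : (0 : ℝ) < (A.card : ℝ) ^ m := pow_pos (by exact_mod_cast hA.card_pos) m
  rw [relDist, div_le_iff₀ hpos, Set.ncard_eq_toFinset_card']
  simp

open Classical in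
theorem card_agree_of_relDist_le (hA : A.Nonempty) {u w : QWord K m s A} {ρ : ℝ}
    (h : relDist u w ≤ ρ) : (1 - ρ) * (A.card : ℝ) ^ m ≤
      ((Finset.univ.filter fun a => u a = w a).card : ℝ) := by
  rw [relDist_le_iff hA] at h
  have h1 := Finset.card_filter_add_card_filter_not (s := (Finset.univ : Finset (Fin m → A)))
    (fun a => u a = w a)
  rw [Finset.card_univ, Fintype.card_fun, Fintype.card_fin, Fintype.card_coe] at h1
  have h2 : ((Finset.univ.filter fun a => u a = w a).card : ℝ) +
    ((Finset.univ.filter fun a => u a ≠ w a).card : ℝ) = (A.card : ℝ) ^ m := by exact_mod_cast h1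
  linarith

end RelativeDistance

theorem not_card_agree_bound {n N s m d τ D δ ε : ℝ} (hn : 0 < n) (hN : 0 < N) (hs : 0 ≤ s)
    (hm : 0 < m) (hd : 0 ≤ d) (hδ : δ < 1) (hε : 0 < ε) (hs' : 100 * m / ε ^ 2 ≤ s)
    (hd1 : 2 / ε ≤ d) (hd3 : d ≤ 3 / ε) (hD : D ≤ (1 - δ) * (s * n))
    (hτ : (1 - (δ - ε)) * N ≤ τ) :
    ¬ n * (s * ((d + 1) * τ)) ≤ n * (s * N) + (d * D * N + d * d * (m * (N * n))) := by
  intro hmain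
  have h1 : n * (s * ((d + 1) * ((1 - (δ - ε)) * N))) ≤ n * (s * N) +
      (d * ((1 - δ) * (s * n)) * N + d * d * (m * (N * n))) := by
    refine le_trans ?_ (hmain.trans ?_) <;> gcongr
  have h2 : s * (d * ε - 1) ≤ d * d * m := by
    have hnN : 0 < n * N := mul_pos hn hN
    have : (n * N) * (s * (d * ε - 1)) ≤ (n * N) * (d * d * m) := by
      have h3 : 0 ≤ (n * N) * (s * (1 - (δ - ε))) := by
        have : 0 ≤ 1 - (δ - ε) := by linarith
        positivity
      linarith
    exact le_of_mul_le_mul_left this hnN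
  have h3 : 2 ≤ d * ε := by rwa [div_le_iff₀ hε] at hd1
  have h4 : d * d * m ≤ 9 * (m / ε ^ 2) := by
    calc d * d * m ≤ (3 / ε) * (3 / ε) * m := by gcongr
      _ = 9 * (m / ε ^ 2) := by field_simp; ring
  have h5 : 0 < m / ε ^ 2 := by positivity
  have h6 : 100 * m / ε ^ 2 = 100 * (m / ε ^ 2) := by ring
  nlinarith

section Encoding

open Module

variable {F K : Type*} [Field F] [Field K] [Algebra F K] {m s : ℕ} {A : Finset F}

/-- The encoding as a linear map. -/
noncomputable def qEncodeLin (Q : K) (m s : ℕ) (A : Finset F) :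
    MvPolynomial (Fin m) K →ₗ[K] QWord K m s A where
  toFun := qEncode Q s A
  map_add' f g := by
    ext a γ
    simp only [qEncode, ← qDerivIterLin_apply, map_add, Pi.add_apply]
  map_smul' c f := by
    ext a γ
    simp only [qEncode, ← qDerivIterLin_apply, map_smul, Pi.smul_apply, MvPolynomial.smul_eval,
      smul_eq_mul, RingHom.id_apply]

/-- The multi-index with the entries of `γ`. -/
def MultiIdx.ofSumLt (γ : Fin m → ℕ) (h : ∑ i, γ i < s) : MultiIdx m s :=
  ⟨fun i => ⟨γ i, (Finset.single_le_sum (fun _ _ => Nat.zero_le _) (Finset.mem_univ i)).trans_lt h⟩,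
    h⟩

theorem sub_mem_mvVanish_of_qEncode_eq {Q : K} (hQ : Q ≠ 1) {f g : MvPolynomial (Fin m) K}
    {a : Fin m → A} (h : qEncode Q s A f a = qEncode Q s A g a) :
    f - g ∈ mvVanish Q (fun b : A => algebraMap F K b) a s := by
  refine mem_mvVanish_of_forall_qDerivIter hQ fun γ hγ => ?_
  have := congrFun h (MultiIdx.ofSumLt γ hγ)
  rw [← qDerivIterLin_apply, map_sub, map_sub, qDerivIterLin_apply, qDerivIterLin_apply,
    sub_eq_zero]
  exact this

theorem le_of_const_le {m s : ℕ} (hm : 1 ≤ m) {ε : ℝ} (hε : 0 < ε) (hε1 : ε < 1)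
    (hs : 100 * (m : ℝ) ^ 2 / ε ^ (2 * m) ≤ s) : 100 * (m : ℝ) / ε ^ 2 ≤ s := by
  refine le_trans ?_ hs
  have hm' : (1 : ℝ) ≤ m := by exact_mod_cast hm
  have : ε ^ (2 * m) ≤ ε ^ 2 := pow_le_pow_of_le_one hε.le hε1.le (by omega)
  gcongr
  nlinarith

theorem exists_affineSubspace_of_list (hA : A.Nonempty) {Q : K} (hQ1 : Q ≠ 1)
    (hx : ∀ i < s, ∀ j < s, ∀ a b : A,
      Q ^ i * algebraMap F K a = Q ^ j * algebraMap F K b → i = j ∧ a = b)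
    (hQ : ∀ i < s * A.card + 1, ∀ j < s * A.card + 1, Q ^ i = Q ^ j → i = j)
    (hm : 1 ≤ m) {δ ε : ℝ} (hδ0 : 0 < δ) (hδ : δ < 1) (hε : 0 < ε) (hεδ : ε < δ)
    (hs : 100 * (m : ℝ) ^ 2 / ε ^ (2 * m) ≤ s) {k : ℕ}
    (hk : k = ⌈(1 - δ) * ((s : ℝ) * (A.card : ℝ))⌉₊) (w : QWord K m s A) :
    ∃ V : AffineSubspace K (QWord K m s A),
      (finrank K V.direction : ℝ) ≤ 3 * (m : ℝ) ^ 2 / ε ∧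
      ∀ u ∈ qMultCode Q m s A k, relDist u w ≤ δ - ε → u ∈ V := by
  classical
  have hm' : (1 : ℝ) ≤ m := by exact_mod_cast hm
  have hs' := le_of_const_le hm hε (hεδ.trans hδ) hs
  have hspos : (0 : ℝ) < s := lt_of_lt_of_le (by positivity) hs'
  have hn : (0 : ℝ) < A.card := by exact_mod_cast hA.card_pos
  set S : Set (QWord K m s A) := {u | u ∈ qMultCode Q m s A k ∧ relDist u w ≤ δ - ε} with hS
  refine ⟨affineSpan K S, ?_, fun u hu hd => subset_affineSpan K S ⟨hu, hd⟩⟩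
  set d := ⌈2 / ε⌉₊ with hd
  have hd1 : 2 / ε ≤ d := Nat.le_ceil _
  have hd2 : (d : ℝ) < 2 / ε + 1 := Nat.ceil_lt_add_one (by positivity)
  have hd3 : (d : ℝ) ≤ 3 / ε := by
    have : 1 ≤ 1 / ε := by rw [le_div_iff₀ hε]; linarith
    have e3 : 3 / ε = 2 / ε + 1 / ε := by ring
    linarith
  suffices hlt : finrank K (affineSpan K S).direction < d by
    calc (finrank K (affineSpan K S).direction : ℝ) ≤ d := by exact_mod_cast hlt.le
      _ ≤ 3 / ε := hd3
      _ ≤ _ := by gcongr; nlinarith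
  by_contra hcon
  rw [not_lt] at hcon
  obtain ⟨t, htS, hspan, hind⟩ := exists_affineIndependent K (QWord K m s A) S
  have hSne : t.Nonempty := by
    by_contra h0
    rw [Set.not_nonempty_iff_eq_empty] at h0
    rw [← hspan, h0, AffineSubspace.span_empty, AffineSubspace.direction_bot, finrank_bot] at hcon
    have : (0 : ℝ) < d := lt_of_lt_of_le (by positivity) hd1
    have : 0 < d := by exact_mod_cast this
    omega
  have htfin : Finite t := (finite_set_of_fin_dim_affineIndependent K hind)
  have := Fintype.ofFinite t
  have hcard : d + 1 ≤ Fintype.card t := by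
    have : Nonempty t := hSne.to_subtype
    have h1 := hind.finrank_vectorSpan_add_one
    rw [Subtype.range_coe, ← direction_affineSpan, hspan] at h1
    rw [← h1]
    exact Nat.add_le_add_right hcon 1
  obtain ⟨g⟩ : Nonempty (Fin (d + 1) ↪ t) :=
    Function.Embedding.nonempty_of_card_le (by simpa using hcard)
  have hu : ∀ i, ∃ f : MvPolynomial (Fin m) K, f.totalDegree < k ∧ qEncode Q s A f = (g i : _) :=
    fun i => (htS (g i).2).1
  choose f hfk hfu using hu
  have hfind : AffineIndependent K f := by
    refine AffineIndependent.of_comp (qEncodeLin Q m s A).toAffineMap ?_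
    have : (qEncodeLin Q m s A).toAffineMap ∘ f = (fun p : t => (p : QWord K m s A)) ∘ g :=
      funext fun i => hfu i
    rw [this]
    exact hind.comp_embedding g
  have hkD : ((k - 1 : ℕ) : ℝ) ≤ (1 - δ) * (s * A.card) := by
    have h1 := Nat.ceil_lt_add_one (a := (1 - δ) * ((s : ℝ) * (A.card : ℝ)))
      (mul_nonneg (by linarith) (by positivity))
    have hk1 : 1 ≤ k := by
      have := hfk 0; omega
    rw [← hk] at h1
    push_cast [Nat.cast_sub hk1]
    linarith
  have hkD' : k - 1 ≤ s * A.card := by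
    have : ((k - 1 : ℕ) : ℝ) ≤ ((s * A.card : ℕ) : ℝ) := by
      push_cast
      refine hkD.trans ?_
      nlinarith [mul_pos hspos hn]
    exact_mod_cast this
  set τ := ⌈(1 - (δ - ε)) * (A.card : ℝ) ^ m⌉₊ with hτ
  have hmain := card_mul_sum_agree_le (D := k - 1) (d := d) (τ := τ) hx
    (fun i hi j hj => hQ i (by omega) j (by omega)) hfind
    (fun i => by have := hfk i; omega)
    (fun i => Finset.univ.filter fun a => qEncode Q s A (f i) a = w a)
    (fun i j a hi hj => sub_mem_mvVanish_of_qEncode_eq hQ1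
      ((Finset.mem_filter.mp hi).2.trans (Finset.mem_filter.mp hj).2.symm))
    (fun i => by
      rw [hτ, Nat.ceil_le]
      refine card_agree_of_relDist_le hA ?_
      rw [hfu i]
      exact (htS (g i).2).2)
  have hτ' : (1 - (δ - ε)) * (A.card : ℝ) ^ m ≤ τ := Nat.le_ceil _
  rw [Fintype.card_coe] at hmain
  have hmainR : (A.card : ℝ) * (s * ((d + 1) * τ)) ≤ A.card * (s * (A.card : ℝ) ^ m) +
      (d * ((k - 1 : ℕ) : ℝ) * (A.card : ℝ) ^ m +
        d * ((d - 1 : ℕ) : ℝ) * (m * (A.card : ℝ) ^ (m + 1))) := by exact_mod_cast hmain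
  have hdm : ((d - 1 : ℕ) : ℝ) ≤ d := by exact_mod_cast Nat.sub_le d 1
  refine not_card_agree_bound hn (pow_pos hn m) hspos.le (by linarith) (Nat.cast_nonneg d) hδ hε
    hs' hd1 hd3 hkD hτ' (hmainR.trans ?_)
  rw [← pow_succ]
  gcongr

end Encoding

/-! ## Counting monomials -/

section Simplex

/-- The multi-indices of order less than `T`. -/
def simplex (m T : ℕ) : Finset (Fin m → ℕ) :=
  (Fintype.piFinset fun _ => Finset.range T).filter fun γ => ∑ i, γ i < T

theorem mem_simplex {m T : ℕ} {γ : Fin m → ℕ} : γ ∈ simplex m T ↔ ∑ i, γ i < T := by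
  simp only [simplex, Finset.mem_filter, Fintype.mem_piFinset, Finset.mem_range, and_iff_right_iff_imp]
  exact fun h i => (Finset.single_le_sum (fun _ _ => Nat.zero_le _) (Finset.mem_univ i)).trans_lt h

theorem card_simplex (m T : ℕ) : (simplex m (T + 1)).card = (T + m).choose m := by
  have h : (simplex m (T + 1)).card =
      ((Finset.univ : Finset (Fin (m + 1))).finsuppAntidiag T).card := by
    refine Finset.card_bij'
      (fun γ _ => Finsupp.equivFunOnFinite.symm (Fin.cons (T - ∑ i, γ i) γ : Fin (m + 1) → ℕ))
      (fun g _ => fun i => g i.succ) ?_ ?_ ?_ ?_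
    · intro γ hγ
      rw [mem_simplex] at hγ
      rw [Finset.mem_finsuppAntidiag]
      refine ⟨?_, Finset.subset_univ _⟩
      rw [Fin.sum_univ_succ]
      simp only [Finsupp.equivFunOnFinite_symm_apply_apply, Fin.cons_zero, Fin.cons_succ]
      omega
    · intro g hg
      rw [Finset.mem_finsuppAntidiag, Fin.sum_univ_succ] at hg
      rw [mem_simplex]
      omega
    · intro γ _
      ext i
      simp
    · intro g hg
      rw [Finset.mem_finsuppAntidiag, Fin.sum_univ_succ] at hg
      ext i
      refine Fin.cases ?_ (fun i => ?_) i
      · simp only [Finsupp.equivFunOnFinite_symm_apply_apply, Fin.cons_zero]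
        omega
      · simp
  rw [h, Finset.card_finsuppAntidiag_nat_eq_choose, Finset.card_univ, Fintype.card_fin,
    show m + 1 + T - 1 = T + m by omega, ← Nat.choose_symm_add]

theorem card_simplex_lt {m n s r Δ M : ℕ} (hm : 1 ≤ m) (hn : 1 ≤ n) (hM : 1 ≤ M) (hMs : M ≤ s)
    (h : (s + m) ^ m ≤ r * Δ ^ m) :
    n ^ m * (simplex m M).card < r * (simplex m (Δ * n + 1)).card := by
  obtain ⟨M, rfl⟩ := Nat.exists_eq_add_of_le' hM
  rw [card_simplex, card_simplex]
  have h1 : m.factorial * (M + m).choose m ≤ (M + m) ^ m := by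
    rw [← Nat.descFactorial_eq_factorial_mul_choose]
    exact Nat.descFactorial_le_pow _ _
  have h2 : (Δ * n) ^ m ≤ m.factorial * (Δ * n + m).choose m := by
    rw [← Nat.ascFactorial_eq_factorial_mul_choose]
    exact (Nat.pow_le_pow_left (Nat.le_succ _) m).trans (Nat.pow_succ_le_ascFactorial _ _)
  have h3 : (M + m) ^ m < (s + m) ^ m := Nat.pow_lt_pow_left (by omega) (by omega)
  refine Nat.lt_of_mul_lt_mul_left (a := m.factorial) ?_
  calc m.factorial * (n ^ m * (M + m).choose m) = n ^ m * (m.factorial * (M + m).choose m) := by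
        ring
    _ ≤ n ^ m * (M + m) ^ m := Nat.mul_le_mul_left _ h1
    _ < n ^ m * (s + m) ^ m := Nat.mul_lt_mul_of_pos_left h3 (Nat.pow_pos hn)
    _ ≤ n ^ m * (r * Δ ^ m) := Nat.mul_le_mul_left _ h
    _ = r * (Δ * n) ^ m := by rw [mul_pow]; ring
    _ ≤ r * (m.factorial * (Δ * n + m).choose m) := Nat.mul_le_mul_left _ h2
    _ = _ := by ring

theorem exists_interpolation_params {m s : ℕ} (hm : 1 ≤ m) {ε : ℝ} (hε : 0 < ε) (hε1 : ε < 1)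
    (hs : 100 * (m : ℝ) ^ 2 / ε ^ (2 * m) ≤ s) :
    ∃ r Δ : ℕ, 1 ≤ r ∧ r ≤ s ∧ (Δ : ℝ) + r ≤ ε * s ∧ (s + m) ^ m ≤ r * Δ ^ m := by
  have hm' : (1 : ℝ) ≤ m := by exact_mod_cast hm
  set X : ℝ := 1 / ε ^ m with hX
  have hεm : 0 < ε ^ m := pow_pos hε m
  have hX1 : 1 ≤ X := by
    rw [hX, le_div_iff₀ hεm, one_mul]
    exact pow_le_one₀ hε.le hε1.le
  have hXε : 1 ≤ X * ε := by
    rw [hX, div_mul_eq_mul_div, one_mul, le_div_iff₀ hεm, one_mul]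
    calc ε ^ m ≤ ε ^ 1 := pow_le_pow_of_le_one hε.le hε1.le hm
      _ = ε := pow_one ε
  have hs1 : 100 * (m : ℝ) ^ 2 * X ^ 2 ≤ s := by
    refine le_trans (le_of_eq ?_) hs
    rw [hX, div_pow, one_pow, ← pow_mul, mul_comm m 2]; ring
  have hm2 : (m : ℝ) ≤ (m : ℝ) ^ 2 := by nlinarith
  have hs2 : 100 * (m : ℝ) * m ≤ s := by
    have : 1 ≤ X ^ 2 := one_le_pow₀ hX1
    nlinarith [sq_nonneg (m : ℝ)]
  have hs0 : (0 : ℝ) < s := by nlinarith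
  have hεs : 100 * (m : ℝ) * X ≤ ε * s := by
    have h1 : ε * (100 * (m : ℝ) ^ 2 * X ^ 2) ≤ ε * s := mul_le_mul_of_nonneg_left hs1 hε.le
    have h2 : 100 * (m : ℝ) * X ≤ 100 * (m : ℝ) ^ 2 * X * (X * ε) := by
      have h3 : 100 * (m : ℝ) * X ≤ 100 * (m : ℝ) ^ 2 * X := by
        have := mul_le_mul_of_nonneg_right hm2 (show 0 ≤ 100 * X by linarith)
        linarith
      have h4 : 0 ≤ 100 * (m : ℝ) ^ 2 * X := by positivity
      nlinarith
    nlinarith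
  set r := ⌈5 * X⌉₊ with hr
  have hr1 : 5 * X ≤ r := Nat.le_ceil _
  have hr2 : (r : ℝ) < 5 * X + 1 := Nat.ceil_lt_add_one (by linarith)
  have hεs' : ε * s ≤ s := by nlinarith
  have hmX : X ≤ m * X := by nlinarith
  have hrs : (r : ℝ) ≤ ε * s := by nlinarith
  have hfl : (⌊ε * s⌋₊ : ℝ) ≤ ε * s := Nat.floor_le (by positivity)
  have hfl' : ε * s < ⌊ε * s⌋₊ + 1 := Nat.lt_floor_add_one _
  have hrfl : r ≤ ⌊ε * s⌋₊ := Nat.le_floor hrs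
  refine ⟨r, ⌊ε * s⌋₊ - r, ?_, ?_, ?_, ?_⟩
  · have : (0 : ℝ) < r := by linarith
    exact_mod_cast this
  · exact_mod_cast hrs.trans hεs'
  · rw [Nat.cast_sub hrfl]; linarith
  · have hΔ : ε * s * (1 - 1 / (10 * m)) ≤ ((⌊ε * s⌋₊ - r : ℕ) : ℝ) := by
      rw [Nat.cast_sub hrfl]
      have h1 : ε * s * (1 - 1 / (10 * m)) = ε * s - (ε * s) / (10 * m) := by ring
      have h2 : 10 * X ≤ (ε * s) / (10 * m) := by
        rw [le_div_iff₀ (by positivity)]; linarith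
      rw [h1]; linarith
    have hb : (9 / 10 : ℝ) ≤ (1 - 1 / (10 * m)) ^ m := by
      have h1 : (1 : ℝ) / (10 * m) ≤ 1 := by
        rw [div_le_iff₀ (by positivity)]; linarith
      have h2 := one_add_mul_le_pow (a := -(1 / (10 * (m : ℝ)))) (by linarith) m
      have h3 : (m : ℝ) * -(1 / (10 * (m : ℝ))) = -(1 / 10) := by field_simp
      rw [h3] at h2
      rw [sub_eq_add_neg]; linarith
    have hnn : 0 ≤ (1 : ℝ) - 1 / (10 * m) := by
      have h1 : (1 : ℝ) / (10 * m) ≤ 1 := by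
        rw [div_le_iff₀ (by positivity)]; linarith
      linarith
    have hup : ((s : ℝ) + m) ^ m ≤ 3 * (s : ℝ) ^ m := by
      have h1 : (s : ℝ) + m ≤ s * Real.exp (1 / (100 * m)) := by
        have h2 := Real.add_one_le_exp (1 / (100 * (m : ℝ)))
        have h3 : (m : ℝ) ≤ s * (1 / (100 * m)) := by
          rw [mul_one_div, le_div_iff₀ (by positivity)]; linarith
        nlinarith
      calc ((s : ℝ) + m) ^ m ≤ (s * Real.exp (1 / (100 * m))) ^ m := by gcongr
        _ = (s : ℝ) ^ m * Real.exp (m * (1 / (100 * m))) := by rw [mul_pow, Real.exp_nat_mul]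
        _ ≤ (s : ℝ) ^ m * 3 := by
          gcongr
          have h4 : (m : ℝ) * (1 / (100 * m)) ≤ 1 := by
            rw [mul_one_div, div_le_iff₀ (by positivity)]; linarith
          have := Real.exp_one_lt_d9
          linarith [Real.exp_le_exp.mpr h4]
        _ = _ := by ring
    have hfin : ((s : ℝ) + m) ^ m ≤ r * ((⌊ε * s⌋₊ - r : ℕ) : ℝ) ^ m := by
      calc ((s : ℝ) + m) ^ m ≤ 3 * (s : ℝ) ^ m := hup
        _ ≤ (5 * X) * ((ε * s) ^ m * (9 / 10)) := by
          rw [mul_pow, hX]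
          have : 5 * (1 / ε ^ m) * (ε ^ m * (s : ℝ) ^ m * (9 / 10)) = 5 * (9 / 10) * (s : ℝ) ^ m := by
            field_simp
          rw [this]
          have : 0 ≤ (s : ℝ) ^ m := by positivity
          linarith
        _ ≤ r * ((ε * s) ^ m * (1 - 1 / (10 * m)) ^ m) := by gcongr
        _ = r * (ε * s * (1 - 1 / (10 * m))) ^ m := by rw [← mul_pow]
        _ ≤ _ := by gcongr
    exact_mod_cast hfin

end Simplex

/-! ## Linear recurrences satisfied by the codewords -/

section Recurrence

open Module

variable {K : Type*} [Field K] {m : ℕ}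

/-- `f ↦ ∑_{i<r} A_i(X) f(X_1, …, Q^i X_l, …, X_m)`. -/
noncomputable def recurLin (Q : K) (l : Fin m) (r : ℕ) (A : ℕ → MvPolynomial (Fin m) K) :
    MvPolynomial (Fin m) K →ₗ[K] MvPolynomial (Fin m) K where
  toFun f := ∑ i ∈ Finset.range r, A i * qScale (Q ^ i) l f
  map_add' f g := by
    rw [← Finset.sum_add_distrib]
    exact Finset.sum_congr rfl fun i _ => by rw [qScale, map_add, mul_add]; rfl
  map_smul' c f := by
    rw [Finset.smul_sum]
    exact Finset.sum_congr rfl fun i _ => by rw [qScale, map_smul, mul_smul_comm]; rfl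

theorem recurLin_apply (Q : K) (l : Fin m) (r : ℕ) (A : ℕ → MvPolynomial (Fin m) K)
    (f : MvPolynomial (Fin m) K) :
    recurLin Q l r A f = ∑ i ∈ Finset.range r, A i * qScale (Q ^ i) l f := rfl

theorem eval_recurLin (Q : K) (l : Fin m) (r : ℕ) (A : ℕ → MvPolynomial (Fin m) K)
    (f : MvPolynomial (Fin m) K) (y : Fin m → K) : MvPolynomial.eval y (recurLin Q l r A f) =
      ∑ i ∈ Finset.range r, MvPolynomial.eval y (A i) *
        MvPolynomial.eval (qPoint Q (Pi.single l i) y) f := by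
  rw [recurLin_apply, map_sum]
  refine Finset.sum_congr rfl fun i _ => ?_
  rw [map_mul, eval_qScale]
  congr 2
  congr 1
  ext j
  by_cases h : j = l
  · subst h; simp [qPoint]
  · simp [qPoint, h]

theorem qScale_monomial (c : K) (l : Fin m) (e : Fin m →₀ ℕ) (b : K) :
    qScale c l (MvPolynomial.monomial e b) = MvPolynomial.monomial e (c ^ e l * b) := by
  rw [qScale, MvPolynomial.aeval_monomial, MvPolynomial.algebraMap_eq,
    MvPolynomial.monomial_eq (s := e) (a := c ^ e l * b),
    Finsupp.prod_fintype _ _ (by simp), Finsupp.prod_fintype _ _ (by simp)]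
  have h : ∀ j, (if j = l then MvPolynomial.C c * MvPolynomial.X j
      else MvPolynomial.X j : MvPolynomial (Fin m) K) ^ e j =
      (if j = l then MvPolynomial.C (c ^ e l) else 1) * MvPolynomial.X j ^ e j := by
    intro j
    split_ifs with hj
    · subst hj; rw [mul_pow, MvPolynomial.C_pow]
    · rw [one_mul]
  rw [Finset.prod_congr rfl fun j _ => h j, Finset.prod_mul_distrib]
  simp only [Finset.prod_ite_eq', Finset.mem_univ, if_true, MvPolynomial.C_mul]
  ring

theorem coeff_qScale (c : K) (l : Fin m) (f : MvPolynomial (Fin m) K) (e : Fin m →₀ ℕ) :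
    (qScale c l f).coeff e = c ^ e l * f.coeff e := by
  induction f using MvPolynomial.induction_on' with
  | monomial u a =>
    rw [qScale_monomial, MvPolynomial.coeff_monomial, MvPolynomial.coeff_monomial]
    split_ifs with h
    · rw [h]
    · rw [mul_zero]
  | add p q hp hq =>
    have : qScale c l (p + q) = qScale c l p + qScale c l q := by rw [qScale, map_add]; rfl
    rw [this, MvPolynomial.coeff_add, hp, hq, MvPolynomial.coeff_add, mul_add]

theorem support_qScale_subset (c : K) (l : Fin m) (f : MvPolynomial (Fin m) K) :
    (qScale c l f).support ⊆ f.support := by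
  intro e he
  rw [MvPolynomial.mem_support_iff, coeff_qScale] at he
  exact MvPolynomial.mem_support_iff.mpr (right_ne_zero_of_mul he)

theorem totalDegree_recurLin_le {Q : K} {l : Fin m} {r D E : ℕ} {A : ℕ → MvPolynomial (Fin m) K}
    (hA : ∀ i < r, (A i).totalDegree ≤ D) {f : MvPolynomial (Fin m) K} (hf : f.totalDegree ≤ E) :
    (recurLin Q l r A f).totalDegree ≤ D + E := by
  rw [recurLin_apply]
  refine MvPolynomial.totalDegree_finsetSum_le fun i hi => ?_
  refine (MvPolynomial.totalDegree_mul _ _).trans (Nat.add_le_add (hA i (Finset.mem_range.mp hi)) ?_)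
  exact (MvPolynomial.totalDegree_le_of_support_subset (support_qScale_subset _ _ _)).trans hf

theorem finrank_le_card_of_degree_mem (V : Submodule K (MvPolynomial (Fin m) K))
    (T : Finset (Fin m →₀ ℕ))
    (hT : ∀ f ∈ V, f ≠ 0 → MonomialOrder.lex.degree f ∈ T) :
    FiniteDimensional K V ∧ finrank K V ≤ T.card := by
  let φ : V →ₗ[K] (T → K) := LinearMap.pi fun e => (MvPolynomial.lcoeff K e.1) ∘ₗ V.subtype
  have hφ : Function.Injective φ := by
    rw [← LinearMap.ker_eq_bot, eq_bot_iff]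
    intro f hf
    by_contra h0
    have hf0 : (f : MvPolynomial (Fin m) K) ≠ 0 := fun h => h0 (by simpa using h)
    have h1 := congrFun (LinearMap.mem_ker.mp hf) ⟨_, hT f f.2 hf0⟩
    exact MonomialOrder.lex.coeff_degree_ne_zero_iff.mpr hf0 h1
  have : FiniteDimensional K V := FiniteDimensional.of_injective φ hφ
  exact ⟨this, (LinearMap.finrank_le_finrank_of_injective hφ).trans (by simp)⟩

/-- The polynomials of degree less than `k` which satisfy all the given recurrences. -/
noncomputable def recurSpace (Q : K) (r k : ℕ) (A : Fin m → ℕ → MvPolynomial (Fin m) K) :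
    Submodule K (MvPolynomial (Fin m) K) :=
  MvPolynomial.restrictTotalDegree (Fin m) K (k - 1) ⊓ ⨅ l, LinearMap.ker (recurLin Q l r (A l))

theorem mem_recurSpace {Q : K} {r k : ℕ} (hk : 1 ≤ k) {A : Fin m → ℕ → MvPolynomial (Fin m) K}
    {f : MvPolynomial (Fin m) K} :
    f ∈ recurSpace Q r k A ↔ f.totalDegree < k ∧ ∀ l, recurLin Q l r (A l) f = 0 := by
  rw [recurSpace, Submodule.mem_inf, MvPolynomial.mem_restrictTotalDegree, Submodule.mem_iInf,
    Nat.le_sub_one_iff_lt hk]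
  simp

theorem finrank_recurSpace_le {Q : K} {r k : ℕ} (hk : 1 ≤ k)
    (hQ : ∀ i < k, ∀ j < k, Q ^ i = Q ^ j → i = j) {A : Fin m → ℕ → MvPolynomial (Fin m) K}
    (hA : ∀ l, ∃ i < r, A l i ≠ 0) :
    FiniteDimensional K (recurSpace Q r k A) ∧ finrank K (recurSpace Q r k A) ≤ r ^ m := by
  classical
  let O := (MonomialOrder.lex : MonomialOrder (Fin m))
  have hdom : ∀ l, ∃ i₀ < r, A l i₀ ≠ 0 ∧
      ∀ i < r, O.toSyn (O.degree (A l i)) ≤ O.toSyn (O.degree (A l i₀)) := by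
    intro l
    obtain ⟨i₁, hi₁, h₁⟩ := hA l
    have hne : ((Finset.range r).filter fun i => A l i ≠ 0).Nonempty :=
      ⟨i₁, Finset.mem_filter.mpr ⟨Finset.mem_range.mpr hi₁, h₁⟩⟩
    obtain ⟨i₀, hi₀, hmax⟩ := Finset.exists_max_image _ (fun i => O.toSyn (O.degree (A l i))) hne
    rw [Finset.mem_filter, Finset.mem_range] at hi₀
    refine ⟨i₀, hi₀.1, hi₀.2, fun i hi => ?_⟩
    by_cases h0 : A l i = 0
    · rw [h0, MonomialOrder.degree_zero, map_zero]
      exact bot_le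
    · exact hmax i (Finset.mem_filter.mpr ⟨Finset.mem_range.mpr hi, h0⟩)
  choose i₀ hi₀r hi₀ hmax using hdom
  let χ : Fin m → Polynomial K := fun l => ∑ i ∈ Finset.range r,
    Polynomial.monomial i ((A l i).coeff (O.degree (A l (i₀ l))))
  have hχc : ∀ l, ∀ i < r, (χ l).coeff i = (A l i).coeff (O.degree (A l (i₀ l))) := by
    intro l i hi
    simp only [χ, Polynomial.finsetSum_coeff, Polynomial.coeff_monomial]
    rw [Finset.sum_eq_single i]
    · simp
    · intro j _ hji; simp [hji]
    · intro h; exact absurd (Finset.mem_range.mpr hi) h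
  have hχ0 : ∀ l, χ l ≠ 0 := by
    intro l h0
    have := hχc l (i₀ l) (hi₀r l)
    rw [h0, Polynomial.coeff_zero] at this
    exact O.coeff_degree_ne_zero_iff.mpr (hi₀ l) this.symm
  have hχd : ∀ l, (χ l).natDegree ≤ r := by
    intro l
    refine Polynomial.natDegree_sum_le_of_forall_le _ _ fun i hi => ?_
    exact (Polynomial.natDegree_monomial_le _).trans (Finset.mem_range.mp hi).le
  let T₁ : Fin m → Finset ℕ := fun l =>
    (Finset.range k).filter fun t => (χ l).IsRoot (Q ^ t)
  have hT₁ : ∀ l, (T₁ l).card ≤ r := by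
    intro l
    have hinj : Set.InjOn (fun t => Q ^ t) (T₁ l) := by
      intro i hi j hj h
      exact hQ i (Finset.mem_range.mp (Finset.mem_filter.mp hi).1) j
        (Finset.mem_range.mp (Finset.mem_filter.mp hj).1) h
    rw [← Finset.card_image_of_injOn hinj]
    calc ((T₁ l).image fun t => Q ^ t).card ≤ (χ l).roots.toFinset.card := by
          refine Finset.card_le_card fun z hz => ?_
          obtain ⟨t, ht, rfl⟩ := Finset.mem_image.mp hz
          rw [Multiset.mem_toFinset, Polynomial.mem_roots (hχ0 l)]
          exact (Finset.mem_filter.mp ht).2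
      _ ≤ Multiset.card (χ l).roots := Multiset.toFinset_card_le _
      _ ≤ (χ l).natDegree := Polynomial.card_roots' _
      _ ≤ r := hχd l
  let T : Finset (Fin m →₀ ℕ) := (Fintype.piFinset T₁).image Finsupp.equivFunOnFinite.symm
  have hTc : T.card ≤ r ^ m := by
    refine Finset.card_image_le.trans ?_
    rw [Fintype.card_piFinset]
    exact (Finset.prod_le_pow_card _ _ r fun l _ => hT₁ l).trans (by simp)
  have key := finrank_le_card_of_degree_mem (recurSpace Q r k A) T (by
    intro f hf hf0
    rw [mem_recurSpace hk] at hf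
    set e := O.degree f with he
    have hesupp : e ∈ f.support := O.degree_mem_support hf0
    refine Finset.mem_image.mpr ⟨e, ?_, by ext; simp⟩
    rw [Fintype.mem_piFinset]
    intro l
    rw [Finset.mem_filter, Finset.mem_range]
    constructor
    · have h1 : ∑ i, e i ≤ f.totalDegree := by
        have := MvPolynomial.le_totalDegree hesupp
        rwa [Finsupp.sum_fintype _ _ (by simp)] at this
      have h2 : e l ≤ ∑ i, e i :=
        Finset.single_le_sum (fun _ _ => Nat.zero_le _) (Finset.mem_univ l)
      omega
    · have h1 := congrArg (fun g => MvPolynomial.coeff (O.degree (A l (i₀ l)) + e) g) (hf.2 l)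
      simp only [recurLin_apply, MvPolynomial.coeff_sum, MvPolynomial.coeff_zero] at h1
      have h2 : ∀ i ∈ Finset.range r,
          (A l i * qScale (Q ^ i) l f).coeff (O.degree (A l (i₀ l)) + e) =
          (χ l).coeff i * (Q ^ e l) ^ i * f.coeff e := by
        intro i hi
        rw [O.coeff_mul_of_add_of_degree_le (hmax l i (Finset.mem_range.mp hi)) ?_,
          hχc l i (Finset.mem_range.mp hi), coeff_qScale, ← pow_mul, ← pow_mul, mul_comm i, mul_assoc]
        rw [O.degree_le_iff]
        exact fun c hc => O.le_degree (support_qScale_subset _ _ _ hc)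
      rw [Finset.sum_congr rfl h2, ← Finset.sum_mul] at h1
      rcases mul_eq_zero.mp h1 with h1 | h1
      · rw [Polynomial.IsRoot.def, Polynomial.eval_eq_sum_range' (Nat.lt_succ_of_le (hχd l)),
          Finset.sum_range_succ, h1, zero_add]
        have : (χ l).coeff r = 0 := by
          simp only [χ, Polynomial.finsetSum_coeff, Polynomial.coeff_monomial]
          exact Finset.sum_eq_zero fun i hi => if_neg (Finset.mem_range.mp hi).ne
        rw [this, zero_mul]
      · exact absurd h1 (MvPolynomial.mem_support_iff.mp hesupp))
  exact ⟨key.1, key.2.trans hTc⟩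

/-- In a space of dimension at most `D`, a family of subspaces with trivial intersection has `D`
members with trivial intersection. -/
theorem exists_fin_iInf_eq_bot {M ι : Type*} [AddCommGroup M] [Module K M] [Nonempty ι]
    (W : ι → Submodule K M) (D : ℕ) : ∀ V : Submodule K M, FiniteDimensional K V →
      finrank K V ≤ D → (∀ f ∈ V, (∀ i, f ∈ W i) → f = 0) →
      ∃ y : Fin D → ι, ∀ f ∈ V, (∀ τ, f ∈ W (y τ)) → f = 0 := by
  induction D with
  | zero =>
    intro V _ h _
    refine ⟨Fin.elim0, fun f hf _ => ?_⟩
    have : V = ⊥ := Submodule.finrank_eq_zero.mp (Nat.le_zero.mp h)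
    simpa [this] using hf
  | succ D ih =>
    intro V hfin hD hV
    by_cases h : ∃ i, ¬ V ≤ W i
    · obtain ⟨i, hi⟩ := h
      have hlt : V ⊓ W i < V := lt_of_le_of_ne inf_le_left fun h => hi (inf_eq_left.mp h)
      have h1 := Submodule.finrank_lt_finrank_of_lt hlt
      obtain ⟨y, hy⟩ := ih (V ⊓ W i) (Submodule.finiteDimensional_of_le inf_le_left) (by omega)
        (fun f hf => hV f hf.1)
      refine ⟨Fin.cons i y, fun f hf hall => hy f ⟨hf, by simpa using hall 0⟩ fun τ => ?_⟩
      simpa using hall τ.succ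
    · push Not at h
      exact ⟨fun _ => Classical.arbitrary ι, fun f hf _ => hV f hf fun i => h i hf⟩

theorem recurLin_eq_zero_of_agree {ι : Type*} [Fintype ι] {Q : K} {x : ι → K} {M r D E : ℕ}
    {l : Fin m}
    (hx : ∀ i < M, ∀ j < M, ∀ a b, Q ^ i * x a = Q ^ j * x b → i = j ∧ a = b)
    (hQ : ∀ i < D + E + 1, ∀ j < D + E + 1, Q ^ i = Q ^ j → i = j)
    {A : ℕ → MvPolynomial (Fin m) K} (hA : ∀ i < r, (A i).totalDegree ≤ D)
    {f : MvPolynomial (Fin m) K} (hf : f.totalDegree ≤ E) (S : Finset (Fin m → ι))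
    (hS : ∀ a ∈ S, ∀ β : Fin m → ℕ, ∑ i, β i < M → ∑ i ∈ Finset.range r,
      MvPolynomial.eval (qPoint Q β fun j => x (a j)) (A i) *
        MvPolynomial.eval (qPoint Q (β + Pi.single l i) fun j => x (a j)) f = 0)
    (hcard : (D + E) * Fintype.card ι ^ m < Fintype.card ι * (M * S.card)) :
    recurLin Q l r A f = 0 := by
  classical
  by_contra h0
  have h1 := card_mul_card_mvVanish_le hx hQ h0 (totalDegree_recurLin_le hA hf)
  refine absurd (hcard.trans_le (le_trans ?_ h1)) (lt_irrefl _)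
  refine Nat.mul_le_mul_left _ (Nat.mul_le_mul_left _ (Finset.card_le_card fun a ha => ?_))
  refine Finset.mem_filter.mpr ⟨Finset.mem_univ _, fun β hβ => ?_⟩
  have h2 := hS a ha β hβ
  have h3 := eval_recurLin Q l r A f (qPoint Q β fun j => x (a j))
  have h4 : ∀ i, qPoint Q (Pi.single l i) (qPoint Q β fun j => x (a j)) =
      qPoint Q (β + Pi.single l i) fun j => x (a j) := by
    intro i; ext j; simp only [qPoint, Pi.add_apply, pow_add]; ring
  simp only [h4] at h3
  rw [h2] at h3
  exact h3

end Recurrence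

/-! ## Execution of programs -/

section Exec

variable {K : Type*}

/-- Overwriting a register for natural numbers. -/
def RamState.setN (σ : RamState K) (x v : ℕ) : RamState K :=
  { σ with nat := Function.update σ.nat x v }

/-- Overwriting a register for field elements. -/
def RamState.setF (σ : RamState K) (x : ℕ) (v : K) : RamState K :=
  { σ with fld := Function.update σ.fld x v }

/-- Overwriting a memory cell for field elements. -/
def RamState.setM (σ : RamState K) (x : ℕ) (v : K) : RamState K :=
  { σ with fldMem := Function.update σ.fldMem x v }

namespace RamState

variable (σ : RamState K) (x y v : ℕ) (c : K)

theorem setN_nat_self : (σ.setN x v).nat x = v := Function.update_self ..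
theorem setN_nat_ne (h : y ≠ x) : (σ.setN x v).nat y = σ.nat y := Function.update_of_ne h ..
theorem setN_fld : (σ.setN x v).fld = σ.fld := rfl
theorem setF_fld_self : (σ.setF x c).fld x = c := Function.update_self ..
theorem setF_fld_ne (h : y ≠ x) : (σ.setF x c).fld y = σ.fld y := Function.update_of_ne h ..

end RamState

variable [Field K]

theorem exec_natConst (σ : RamState K) (x c : ℕ) :
    RamExec (.instr (.natConst x c)) σ 1 (σ.setN x c) := .instr _ _
theorem exec_natAdd (σ : RamState K) (x y z : ℕ) :
    RamExec (.instr (.natAdd x y z)) σ 1 (σ.setN x (σ.nat y + σ.nat z)) := .instr _ _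
theorem exec_natSub (σ : RamState K) (x y z : ℕ) :
    RamExec (.instr (.natSub x y z)) σ 1 (σ.setN x (σ.nat y - σ.nat z)) := .instr _ _
theorem exec_fldZero (σ : RamState K) (x : ℕ) :
    RamExec (.instr (.fldZero x)) σ 1 (σ.setF x 0) := .instr _ _
theorem exec_fldOne (σ : RamState K) (x : ℕ) :
    RamExec (.instr (.fldOne x)) σ 1 (σ.setF x 1) := .instr _ _
theorem exec_fldAdd (σ : RamState K) (x y z : ℕ) :
    RamExec (.instr (.fldAdd x y z)) σ 1 (σ.setF x (σ.fld y + σ.fld z)) := .instr _ _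
theorem exec_fldSub (σ : RamState K) (x y z : ℕ) :
    RamExec (.instr (.fldSub x y z)) σ 1 (σ.setF x (σ.fld y - σ.fld z)) := .instr _ _
theorem exec_fldMul (σ : RamState K) (x y z : ℕ) :
    RamExec (.instr (.fldMul x y z)) σ 1 (σ.setF x (σ.fld y * σ.fld z)) := .instr _ _
theorem exec_fldInv (σ : RamState K) (x y : ℕ) :
    RamExec (.instr (.fldInv x y)) σ 1 (σ.setF x (σ.fld y)⁻¹) := .instr _ _
theorem exec_fldLoad (σ : RamState K) (x y : ℕ) :
    RamExec (.instr (.fldLoad x y)) σ 1 (σ.setF x (σ.fldMem (σ.nat y))) := .instr _ _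
theorem exec_fldStore (σ : RamState K) (x y : ℕ) :
    RamExec (.instr (.fldStore x y)) σ 1 (σ.setM (σ.nat x) (σ.fld y)) := .instr _ _
open Classical in
theorem exec_fldTest (σ : RamState K) (x y : ℕ) :
    RamExec (.instr (.fldTest x y)) σ 1 (σ.setN x (if σ.fld y = 0 then 1 else 0)) := .instr _ _

/-- Executing `p` as often as the register `c` says, with `one` as an auxiliary register. -/
def RamProg.repeat (c one : ℕ) (p : RamProg) : RamProg :=
  .loop c (.seq p (.seq (.instr (.natConst one 1)) (.instr (.natSub c c one))))

theorem exec_repeat {c one : ℕ} (hc : c ≠ one) {p : RamProg} (I : ℕ → RamState K → Prop) (N B : ℕ)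
    (hstep : ∀ i < N, ∀ σ, I i σ → ∃ T ≤ B, ∃ σ', RamExec p σ T σ' ∧ σ'.nat c = σ.nat c ∧
      ∀ v w, I (i + 1) ((σ'.setN one v).setN c w)) (σ : RamState K) (h0 : I 0 σ)
    (hN : σ.nat c = N) :
    ∃ T ≤ N * (B + 3) + 1, ∃ σ', RamExec (p.repeat c one) σ T σ' ∧ I N σ' := by
  have key : ∀ n i, i + n = N → ∀ σ : RamState K, I i σ → σ.nat c = n →
      ∃ T ≤ n * (B + 3) + 1, ∃ σ', RamExec (p.repeat c one) σ T σ' ∧ I N σ' := by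
    intro n
    induction n with
    | zero =>
      intro i hi σ hσ hc
      exact ⟨1, by omega, σ, .loopDone hc, by rw [← hi]; simpa using hσ⟩
    | succ n ih =>
      intro i hi σ hσ hcn
      obtain ⟨T, hT, σ', hex, hcc, hI⟩ := hstep i (by omega) σ hσ
      have h1 := exec_natConst σ' one 1
      have h2 := exec_natSub (σ'.setN one 1) c c one
      rw [RamState.setN_nat_self, RamState.setN_nat_ne _ _ _ _ hc, hcc, hcn,
        Nat.add_sub_cancel] at h2
      obtain ⟨T', hT', σ'', hex', hI'⟩ := ih (i + 1) (by omega) _ (hI 1 n)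
        (RamState.setN_nat_self ..)
      refine ⟨_, ?_, σ'', .loopStep (by omega) (.seq hex (.seq h1 h2)) hex', hI'⟩
      rw [Nat.succ_mul]; omega
  exact key N 0 (by omega) σ h0 hN

end Exec

/-! ## Polynomial bounds -/

/-- `g` is bounded by a polynomial. -/
def PolyBdd (g : ℕ → ℕ) : Prop := ∃ c, ∀ L, g L ≤ c * (L + 1) ^ c

namespace PolyBdd

theorem const (a : ℕ) : PolyBdd fun _ => a :=
  ⟨a, fun L => Nat.le_mul_of_pos_right _ (Nat.pow_pos (Nat.succ_pos L))⟩

theorem id : PolyBdd fun L => L := ⟨1, fun L => by simp⟩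

theorem add {g h : ℕ → ℕ} (hg : PolyBdd g) (hh : PolyBdd h) : PolyBdd fun L => g L + h L := by
  obtain ⟨c, hc⟩ := hg
  obtain ⟨c', hc'⟩ := hh
  refine ⟨c + c', fun L => ?_⟩
  have h1 : (L + 1) ^ c ≤ (L + 1) ^ (c + c') := Nat.pow_le_pow_right (Nat.succ_pos L) (by omega)
  have h2 : (L + 1) ^ c' ≤ (L + 1) ^ (c + c') := Nat.pow_le_pow_right (Nat.succ_pos L) (by omega)
  calc g L + h L ≤ c * (L + 1) ^ (c + c') + c' * (L + 1) ^ (c + c') :=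
        Nat.add_le_add ((hc L).trans (Nat.mul_le_mul_left _ h1))
          ((hc' L).trans (Nat.mul_le_mul_left _ h2))
    _ = _ := by ring

theorem mul {g h : ℕ → ℕ} (hg : PolyBdd g) (hh : PolyBdd h) : PolyBdd fun L => g L * h L := by
  obtain ⟨c, hc⟩ := hg
  obtain ⟨c', hc'⟩ := hh
  refine ⟨c * c' + c + c', fun L => ?_⟩
  calc g L * h L ≤ (c * (L + 1) ^ c) * (c' * (L + 1) ^ c') := Nat.mul_le_mul (hc L) (hc' L)
    _ = (c * c') * (L + 1) ^ (c + c') := by ring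
    _ ≤ (c * c' + c + c') * (L + 1) ^ (c * c' + c + c') :=
        Nat.mul_le_mul (by omega) (Nat.pow_le_pow_right (Nat.succ_pos L) (by omega))

end PolyBdd

/-! ## Structured states -/

/-- A structured view of the state of the machine: the size parameter `len` (which bounds all loops
and array indices), the element `q`, numerical variables and square arrays of field elements. -/
structure MState (K : Type*) where
  len : ℕ
  q : K
  var : ℕ → ℕ
  arr : ℕ → ℕ → ℕ → K

/-- Assignment to a variable. -/
def MState.set {K : Type*} (S : MState K) (x v : ℕ) : MState K :=
  { S with var := Function.update S.var x v }

namespace MState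

variable {K : Type*} (S : MState K) (x y v : ℕ)

@[simp] theorem set_len : (S.set x v).len = S.len := rfl
@[simp] theorem set_arr : (S.set x v).arr = S.arr := rfl
@[simp] theorem set_var_self : (S.set x v).var x = v := Function.update_self ..
theorem set_var_ne (h : y ≠ x) : (S.set x v).var y = S.var y := Function.update_of_ne h ..

end MState

/-- The register which holds the `d`-th temporary natural number. -/
def tmp (d : ℕ) : ℕ := 2 * d + 1

section Representation

variable {K : Type*}

/-- The machine state `σ` represents the structured state `S`. -/
structure Represents (σ : RamState K) (S : MState K) : Prop where
  len : σ.nat 1 = S.len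
  q : σ.fld 0 = S.q
  var : ∀ x, σ.nat (2 * x) = S.var x
  arr : ∀ k i j, i < S.len → j < S.len →
    σ.fldMem ((k * S.len + i) * S.len + j) = S.arr k i j

/-- Nothing but temporary registers from the `d`-th on has changed. -/
structure Keep (d : ℕ) (σ σ' : RamState K) : Prop where
  var : ∀ x, σ'.nat (2 * x) = σ.nat (2 * x)
  tmp : ∀ i < d, σ'.nat (2 * i + 1) = σ.nat (2 * i + 1)
  fld : ∀ i < d, σ'.fld i = σ.fld i
  mem : σ'.fldMem = σ.fldMem

theorem Keep.refl (d : ℕ) (σ : RamState K) : Keep d σ σ :=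
  ⟨fun _ => rfl, fun _ _ => rfl, fun _ _ => rfl, rfl⟩

theorem Keep.trans {d : ℕ} {σ σ' σ'' : RamState K} (h : Keep d σ σ') (h' : Keep d σ' σ'') :
    Keep d σ σ'' :=
  ⟨fun x => (h'.var x).trans (h.var x), fun i hi => (h'.tmp i hi).trans (h.tmp i hi),
    fun i hi => (h'.fld i hi).trans (h.fld i hi), h'.mem.trans h.mem⟩

theorem Keep.mono {d d' : ℕ} (hd : d ≤ d') {σ σ' : RamState K} (h : Keep d' σ σ') :
    Keep d σ σ' :=
  ⟨h.var, fun i hi => h.tmp i (hi.trans_le hd), fun i hi => h.fld i (hi.trans_le hd), h.mem⟩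

theorem Keep.tmp' {d i : ℕ} {σ σ' : RamState K} (h : Keep d σ σ') (hi : i < d) :
    σ'.nat (_root_.tmp i) = σ.nat (_root_.tmp i) := h.tmp i hi

theorem Represents.keep {d : ℕ} (hd : 1 ≤ d) {σ σ' : RamState K} {S : MState K} (h : Represents σ S)
    (hk : Keep d σ σ') : Represents σ' S :=
  ⟨(hk.tmp 0 hd).trans h.len, (hk.fld 0 hd).trans h.q, fun x => (hk.var x).trans (h.var x),
    fun k i j hi hj => by rw [hk.mem]; exact h.arr k i j hi hj⟩

theorem Keep.setN {d e : ℕ} (hd : d ≤ e) (v : ℕ) {σ σ' : RamState K} (h : Keep d σ σ') :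
    Keep d σ (σ'.setN (_root_.tmp e) v) :=
  ⟨fun x => (RamState.setN_nat_ne _ _ _ _ (by rw [_root_.tmp]; omega)).trans (h.var x),
    fun i hi => (RamState.setN_nat_ne _ _ _ _ (by rw [_root_.tmp]; omega)).trans (h.tmp i hi),
    h.fld, h.mem⟩

theorem Keep.setF {d e : ℕ} (hd : d ≤ e) (v : K) {σ σ' : RamState K} (h : Keep d σ σ') :
    Keep d σ (σ'.setF e v) :=
  ⟨h.var, h.tmp, fun i hi => (RamState.setF_fld_ne _ _ _ _ (by omega)).trans (h.fld i hi), h.mem⟩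

/-- A changed variable stays as it is, and so does everything else. -/
theorem Keep.setVar {d x : ℕ} {v v' : ℕ} {σ σ' : RamState K} (h : Keep d (σ.setN (2 * x) v) σ') :
    Keep d (σ.setN (2 * x) v') (σ'.setN (2 * x) v') := by
  refine ⟨fun y => ?_, fun i hi => ?_, h.fld, h.mem⟩
  · by_cases hy : y = x
    · subst hy; rw [RamState.setN_nat_self, RamState.setN_nat_self]
    · have := h.var y
      rw [RamState.setN_nat_ne _ _ _ _ (by omega)] at this
      rw [RamState.setN_nat_ne _ _ _ _ (by omega), RamState.setN_nat_ne _ _ _ _ (by omega), this]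
  · have := h.tmp i hi
    rw [RamState.setN_nat_ne _ _ _ _ (by omega)] at this
    rw [RamState.setN_nat_ne _ _ _ _ (by omega), RamState.setN_nat_ne _ _ _ _ (by omega), this]

theorem RamState.setN_eq_self (σ : RamState K) (x : ℕ) : σ.setN x (σ.nat x) = σ := by
  rw [RamState.setN, Function.update_eq_self]

theorem Represents.setVar {σ : RamState K} {S : MState K} (h : Represents σ S) (x v : ℕ) :
    Represents (σ.setN (2 * x) v) (S.set x v) := by
  refine ⟨?_, h.q, fun y => ?_, h.arr⟩
  · rw [RamState.setN_nat_ne _ _ _ _ (by omega)]; exact h.len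
  · by_cases hy : y = x
    · subst hy; rw [RamState.setN_nat_self, MState.set_var_self]
    · rw [RamState.setN_nat_ne _ _ _ _ (by omega), MState.set_var_ne _ _ _ _ hy]
      exact h.var y

end Representation

/-! ## Computable functions of the state -/

/-- The number `f S` can be computed in polynomial time. -/
def ImplN.{u} (f : ∀ (K : Type u) [Field K], MState K → ℕ) : Prop :=
  ∀ d, 1 ≤ d → ∃ (p : RamProg) (g : ℕ → ℕ), PolyBdd g ∧
    ∀ (K : Type u) [Field K] (σ : RamState K) (S : MState K), Represents σ S →
      ∃ T ≤ g S.len, ∃ σ', RamExec p σ T σ' ∧ Keep d σ σ' ∧ σ'.nat (tmp d) = f K S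

/-- The field element `f S` can be computed in polynomial time. -/
def ImplF.{u} (f : ∀ (K : Type u) [Field K], MState K → K) : Prop :=
  ∀ d, 1 ≤ d → ∃ (p : RamProg) (g : ℕ → ℕ), PolyBdd g ∧
    ∀ (K : Type u) [Field K] (σ : RamState K) (S : MState K), Represents σ S →
      ∃ T ≤ g S.len, ∃ σ', RamExec p σ T σ' ∧ Keep d σ σ' ∧ σ'.fld d = f K S

namespace ImplN

universe u

variable {f g h : ∀ (K : Type u) [Field K], MState K → ℕ}

theorem const (c : ℕ) : ImplN.{u} fun _ _ _ => c := fun d _ =>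
  ⟨.instr (.natConst (tmp d) c), fun _ => 1, .const 1, fun _ _ σ _ _ =>
    ⟨1, le_rfl, _, exec_natConst σ _ _, (Keep.refl d σ).setN le_rfl _,
      RamState.setN_nat_self ..⟩⟩

theorem ofReg (x : ℕ) (hf : ∀ (K : Type u) [Field K] (σ : RamState K) (S : MState K), Represents σ S →
    σ.nat x = f K S) (hx : ∀ d, 1 ≤ d → x ≠ tmp d) : ImplN f := fun d hd =>
  ⟨.seq (.instr (.natConst (tmp d) 0)) (.instr (.natAdd (tmp d) x (tmp d))), fun _ => 2, .const 2,
    fun K _ σ S hS => ⟨2, le_rfl, _, .seq (exec_natConst σ _ _) (exec_natAdd _ _ _ _),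
      ((Keep.refl d σ).setN le_rfl _).setN le_rfl _, by
        rw [RamState.setN_nat_self, RamState.setN_nat_self,
          RamState.setN_nat_ne _ _ _ _ (hx d hd), hf K σ S hS, add_zero]⟩⟩

theorem var (x : ℕ) : ImplN.{u} fun _ _ S => S.var x :=
  ofReg (2 * x) (fun _ _ _ _ hS => hS.var x) fun d _ => by rw [tmp]; omega

theorem len : ImplN.{u} fun _ _ S => S.len :=
  ofReg 1 (fun _ _ _ _ hS => hS.len) fun d hd => by rw [tmp]; omega

/-- Evaluating two arguments. -/
theorem args (hf : ImplN f) (hg : ImplN g) (d : ℕ) (hd : 1 ≤ d) :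
    ∃ (p : RamProg) (b : ℕ → ℕ), PolyBdd b ∧
    ∀ (K : Type u) [Field K] (σ : RamState K) (S : MState K), Represents σ S →
      ∃ T ≤ b S.len, ∃ σ', RamExec p σ T σ' ∧ Keep d σ σ' ∧ σ'.nat (tmp d) = f K S ∧
        σ'.nat (tmp (d + 1)) = g K S := by
  obtain ⟨p, b, hb, hp⟩ := hf d hd
  obtain ⟨p', b', hb', hp'⟩ := hg (d + 1) (by omega)
  refine ⟨.seq p p', _, hb.add hb', fun K _ σ S hS => ?_⟩
  obtain ⟨T, hT, σ', hex, hk, hv⟩ := hp K σ S hS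
  obtain ⟨T', hT', σ'', hex', hk', hv'⟩ := hp' K σ' S (hS.keep hd hk)
  exact ⟨_, Nat.add_le_add hT hT', σ'', .seq hex hex', hk.trans (hk'.mono (Nat.le_succ d)),
    (hk'.tmp' (Nat.lt_succ_self d)).trans hv, hv'⟩

theorem add (hf : ImplN f) (hg : ImplN g) : ImplN fun K _ S => f K S + g K S := fun d hd => by
  obtain ⟨p, b, hb, hp⟩ := args hf hg d hd
  refine ⟨.seq p (.instr (.natAdd (tmp d) (tmp d) (tmp (d + 1)))), _, hb.add (.const 1),
    fun K _ σ S hS => ?_⟩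
  obtain ⟨T, hT, σ', hex, hk, hv, hv'⟩ := hp K σ S hS
  exact ⟨_, Nat.add_le_add hT le_rfl, _, .seq hex (exec_natAdd _ _ _ _), hk.setN le_rfl _, by
    rw [RamState.setN_nat_self, hv, hv']⟩

theorem sub (hf : ImplN f) (hg : ImplN g) : ImplN fun K _ S => f K S - g K S := fun d hd => by
  obtain ⟨p, b, hb, hp⟩ := args hf hg d hd
  refine ⟨.seq p (.instr (.natSub (tmp d) (tmp d) (tmp (d + 1)))), _, hb.add (.const 1),
    fun K _ σ S hS => ?_⟩
  obtain ⟨T, hT, σ', hex, hk, hv, hv'⟩ := hp K σ S hS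
  exact ⟨_, Nat.add_le_add hT le_rfl, _, .seq hex (exec_natSub _ _ _ _), hk.setN le_rfl _, by
    rw [RamState.setN_nat_self, hv, hv']⟩

theorem mul (hf : ImplN f) (hg : ImplN g) : ImplN fun K _ S => f K S * min (g K S) S.len :=
    fun d hd => by
  obtain ⟨p, b, hb, hp⟩ := args hf hg d hd
  refine ⟨.seq p (.seq (.instr (.natConst (tmp (d + 2)) 0))
    (.seq (.instr (.natAdd (tmp (d + 3)) 1 (tmp (d + 2))))
    (.seq (RamProg.repeat (tmp (d + 3)) (tmp (d + 4)) (.cond (tmp (d + 1))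
      (.seq (.instr (.natAdd (tmp (d + 2)) (tmp (d + 2)) (tmp d)))
        (.seq (.instr (.natConst (tmp (d + 4)) 1))
          (.instr (.natSub (tmp (d + 1)) (tmp (d + 1)) (tmp (d + 4))))))
      (.instr (.natConst (tmp (d + 4)) 0))))
    (.seq (.instr (.natConst (tmp (d + 4)) 0))
      (.instr (.natAdd (tmp d) (tmp (d + 2)) (tmp (d + 4)))))))), _,
    hb.add ((PolyBdd.const 2).add (((PolyBdd.id).mul (.const (4 + 3))).add (.const 3))),
    fun K _ σ S hS => ?_⟩
  obtain ⟨T, hT, σ', hex, hk, hv, hv'⟩ := hp K σ S hS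
  have hlen : σ'.nat 1 = S.len := (hS.keep hd hk).len
  obtain ⟨T', hT', σ'', hex', hI⟩ := exec_repeat (c := tmp (d + 3)) (one := tmp (d + 4))
    (by simp only [tmp]; omega)
    (p := .cond (tmp (d + 1))
      (.seq (.instr (.natAdd (tmp (d + 2)) (tmp (d + 2)) (tmp d)))
        (.seq (.instr (.natConst (tmp (d + 4)) 1))
          (.instr (.natSub (tmp (d + 1)) (tmp (d + 1)) (tmp (d + 4))))))
      (.instr (.natConst (tmp (d + 4)) 0)))
    (fun i τ => Keep d σ τ ∧ τ.nat (tmp d) = f K S ∧ τ.nat (tmp (d + 1)) = g K S - i ∧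
      τ.nat (tmp (d + 2)) = f K S * min (g K S) i) S.len 4 (by
      rintro i - τ ⟨h1, h2, h3, h4⟩
      by_cases h0 : τ.nat (tmp (d + 1)) = 0
      · refine ⟨2, by omega, _, .condFalse h0 (exec_natConst _ _ _), ?_, fun v w => ⟨?_, ?_, ?_, ?_⟩⟩
        · rw [RamState.setN_nat_ne _ _ _ _ (by simp only [tmp]; omega)]
        · exact ((h1.setN (by omega) _).setN (by omega) _).setN (by omega) _
        · simp (disch := (simp only [tmp]; omega)) only [RamState.setN_nat_ne, h2]
        · simp (disch := (simp only [tmp]; omega)) only [RamState.setN_nat_ne]; omega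
        · simp (disch := (simp only [tmp]; omega)) only [RamState.setN_nat_ne, h4]
          rw [min_eq_left (by omega), min_eq_left (by omega)]
      · refine ⟨_, ?_, _, .condTrue h0 (.seq (exec_natAdd _ _ _ _) (.seq (exec_natConst _ _ _)
          (exec_natSub _ _ _ _))), ?_, fun v w => ⟨?_, ?_, ?_, ?_⟩⟩
        · omega
        · simp (disch := (simp only [tmp]; omega)) only [RamState.setN_nat_ne]
        · exact ((((h1.setN (by omega) _).setN (by omega) _).setN (by omega) _).setN
            (by omega) _).setN (by omega) _
        · simp (disch := (simp only [tmp]; omega)) only [RamState.setN_nat_ne, h2]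
        · simp (disch := (simp only [tmp]; omega)) only [RamState.setN_nat_ne,
            RamState.setN_nat_self]; omega
        · simp (disch := (simp only [tmp]; omega)) only [RamState.setN_nat_ne,
            RamState.setN_nat_self, h4, h2]
          rw [min_eq_right (by omega), min_eq_right (by omega), Nat.mul_succ])
    ((σ'.setN (tmp (d + 2)) 0).setN (tmp (d + 3)) S.len)
    ⟨(hk.setN (by omega) _).setN (by omega) _, by
      simp (disch := (simp only [tmp]; omega)) only [RamState.setN_nat_ne, hv], by
      simp (disch := (simp only [tmp]; omega)) only [RamState.setN_nat_ne, hv']; omega, by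
      simp (disch := (simp only [tmp]; omega)) only [RamState.setN_nat_ne,
        RamState.setN_nat_self]; simp⟩
    (RamState.setN_nat_self ..)
  have hadd := exec_natAdd (σ'.setN (tmp (d + 2)) 0) (tmp (d + 3)) 1 (tmp (d + 2))
  rw [RamState.setN_nat_self, RamState.setN_nat_ne _ _ _ _ (by simp only [tmp]; omega), hlen,
    add_zero] at hadd
  refine ⟨_, ?_, _, .seq hex (.seq (exec_natConst _ _ _) (.seq hadd (.seq hex'
    (.seq (exec_natConst _ _ _) (exec_natAdd _ _ _ _))))), ?_, ?_⟩
  · omega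
  · exact (hI.1.setN (by omega) _).setN le_rfl _
  · simp (disch := (simp only [tmp]; omega)) only [RamState.setN_nat_ne,
      RamState.setN_nat_self, hI.2.2.2, add_zero]

theorem div (hf : ImplN f) (hg : ImplN g) :
    ImplN fun K _ S => if g K S = 0 then S.len else min (f K S / g K S) S.len := fun d hd => by
  obtain ⟨p, b, hb, hp⟩ := args hf hg d hd
  let body : RamProg := .seq (.instr (.natSub (tmp (d + 4)) (tmp (d + 1)) (tmp d)))
    (.cond (tmp (d + 4)) (.instr (.natConst (tmp (d + 4)) 0))
      (.seq (.instr (.natSub (tmp d) (tmp d) (tmp (d + 1))))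
        (.seq (.instr (.natConst (tmp (d + 4)) 1))
          (.instr (.natAdd (tmp (d + 2)) (tmp (d + 2)) (tmp (d + 4)))))))
  refine ⟨.seq p (.seq (.instr (.natConst (tmp (d + 2)) 0))
    (.seq (.instr (.natAdd (tmp (d + 3)) 1 (tmp (d + 2))))
    (.seq (RamProg.repeat (tmp (d + 3)) (tmp (d + 4)) body)
    (.seq (.instr (.natConst (tmp (d + 4)) 0))
      (.instr (.natAdd (tmp d) (tmp (d + 2)) (tmp (d + 4)))))))), _,
    hb.add ((PolyBdd.const 2).add (((PolyBdd.id).mul (.const (5 + 3))).add (.const 3))),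
    fun K _ σ S hS => ?_⟩
  obtain ⟨T, hT, σ', hex, hk, hv, hv'⟩ := hp K σ S hS
  have hlen : σ'.nat 1 = S.len := (hS.keep hd hk).len
  obtain ⟨T', hT', σ'', hex', hI⟩ := exec_repeat (c := tmp (d + 3)) (one := tmp (d + 4))
    (by simp only [tmp]; omega) (p := body)
    (fun i τ => Keep d σ τ ∧ τ.nat (tmp (d + 1)) = g K S ∧
      τ.nat (tmp d) + g K S * τ.nat (tmp (d + 2)) = f K S ∧ τ.nat (tmp (d + 2)) ≤ i ∧
      (τ.nat (tmp (d + 2)) = i ∨ τ.nat (tmp d) < g K S)) S.len 5 (by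
      rintro i - τ ⟨h1, h2, h3, h4, h5⟩
      have e1 := exec_natSub τ (tmp (d + 4)) (tmp (d + 1)) (tmp d)
      by_cases h0 : τ.nat (tmp (d + 1)) - τ.nat (tmp d) = 0
      · refine ⟨_, ?_, _, .seq e1 (.condFalse ?_ (.seq (exec_natSub _ _ _ _)
          (.seq (exec_natConst _ _ _) (exec_natAdd _ _ _ _)))), ?_, fun v w => ⟨?_, ?_, ?_, ?_, ?_⟩⟩
        · omega
        · rw [RamState.setN_nat_self, h0]
        · simp (disch := (simp only [tmp]; omega)) only [RamState.setN_nat_ne]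
        · exact (((((h1.setN (by omega) _).setN (by omega) _).setN (by omega) _).setN
            (by omega) _).setN (by omega) _).setN (by omega) _
        · simp (disch := (simp only [tmp]; omega)) only [RamState.setN_nat_ne, h2]
        · simp (disch := (simp only [tmp]; omega)) only [RamState.setN_nat_ne,
            RamState.setN_nat_self, Nat.mul_succ]
          omega
        · simp (disch := (simp only [tmp]; omega)) only [RamState.setN_nat_ne,
            RamState.setN_nat_self]; omega
        · simp (disch := (simp only [tmp]; omega)) only [RamState.setN_nat_ne,
            RamState.setN_nat_self]; omega
      · refine ⟨_, ?_, _, .seq e1 (.condTrue ?_ (exec_natConst _ _ _)), ?_,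
          fun v w => ⟨?_, ?_, ?_, ?_, ?_⟩⟩
        · omega
        · rw [RamState.setN_nat_self]; exact h0
        · simp (disch := (simp only [tmp]; omega)) only [RamState.setN_nat_ne]
        · exact (((h1.setN (by omega) _).setN (by omega) _).setN (by omega) _).setN (by omega) _
        · simp (disch := (simp only [tmp]; omega)) only [RamState.setN_nat_ne, h2]
        · simp (disch := (simp only [tmp]; omega)) only [RamState.setN_nat_ne]
          omega
        · simp (disch := (simp only [tmp]; omega)) only [RamState.setN_nat_ne]; omega
        · simp (disch := (simp only [tmp]; omega)) only [RamState.setN_nat_ne]; omega)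
    ((σ'.setN (tmp (d + 2)) 0).setN (tmp (d + 3)) S.len)
    ⟨(hk.setN (by omega) _).setN (by omega) _, by
      simp (disch := (simp only [tmp]; omega)) only [RamState.setN_nat_ne, hv'], by
      simp (disch := (simp only [tmp]; omega)) only [RamState.setN_nat_ne, hv,
        RamState.setN_nat_self]; simp, by
      simp (disch := (simp only [tmp]; omega)) only [RamState.setN_nat_ne,
        RamState.setN_nat_self]; simp, by
      simp (disch := (simp only [tmp]; omega)) only [RamState.setN_nat_ne,
        RamState.setN_nat_self]; simp⟩
    (RamState.setN_nat_self ..)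
  have hadd := exec_natAdd (σ'.setN (tmp (d + 2)) 0) (tmp (d + 3)) 1 (tmp (d + 2))
  rw [RamState.setN_nat_self, RamState.setN_nat_ne _ _ _ _ (by simp only [tmp]; omega), hlen,
    add_zero] at hadd
  refine ⟨_, ?_, _, .seq hex (.seq (exec_natConst _ _ _) (.seq hadd (.seq hex'
    (.seq (exec_natConst _ _ _) (exec_natAdd _ _ _ _))))), ?_, ?_⟩
  · omega
  · exact (hI.1.setN (by omega) _).setN le_rfl _
  · simp (disch := (simp only [tmp]; omega)) only [RamState.setN_nat_ne,
      RamState.setN_nat_self, add_zero]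
    obtain ⟨-, -, h3, h4, h5⟩ := hI
    split_ifs with h0
    · omega
    · have hq : f K S / g K S = σ''.nat (tmp d) / g K S + σ''.nat (tmp (d + 2)) := by
        rw [← h3, Nat.add_mul_div_left _ _ (Nat.pos_of_ne_zero h0)]
      rcases h5 with h5 | h5
      · rw [hq, h5, min_eq_right (Nat.le_add_left _ _)]
      · rw [Nat.div_eq_of_lt h5] at hq
        rw [hq, min_eq_left (by omega), zero_add]

theorem ite (hf : ImplN f) (hg : ImplN g) (hh : ImplN h) :
    ImplN fun K _ S => if f K S ≠ 0 then g K S else h K S := fun d hd => by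
  obtain ⟨p, b, hb, hp⟩ := hf d hd
  obtain ⟨p₁, b₁, hb₁, hp₁⟩ := hg d hd
  obtain ⟨p₂, b₂, hb₂, hp₂⟩ := hh d hd
  refine ⟨.seq p (.cond (tmp d) p₁ p₂), _, hb.add ((hb₁.add hb₂).add (.const 1)),
    fun K _ σ S hS => ?_⟩
  obtain ⟨T, hT, σ', hex, hk, hv⟩ := hp K σ S hS
  have hS' := hS.keep hd hk
  by_cases h0 : f K S ≠ 0
  · obtain ⟨T', hT', σ'', hex', hk', hv'⟩ := hp₁ K σ' S hS'
    exact ⟨_, by omega, σ'', .seq hex (.condTrue (by rwa [hv]) hex'), hk.trans hk',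
      hv'.trans (if_pos h0).symm⟩
  · obtain ⟨T', hT', σ'', hex', hk', hv'⟩ := hp₂ K σ' S hS'
    exact ⟨_, by omega, σ'', .seq hex (.condFalse (by rw [hv]; exact not_not.1 h0) hex'),
      hk.trans hk', hv'.trans (if_neg h0).symm⟩

end ImplN

namespace ImplF

universe u

variable {f g : ∀ (K : Type u) [Field K], MState K → K}
  {e : ∀ (K : Type u) [Field K], MState K → ℕ}

theorem zero : ImplF.{u} fun _ _ _ => 0 := fun d _ =>
  ⟨.instr (.fldZero d), fun _ => 1, .const 1, fun _ _ σ _ _ =>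
    ⟨1, le_rfl, _, exec_fldZero σ _, (Keep.refl d σ).setF le_rfl _, RamState.setF_fld_self ..⟩⟩

theorem one : ImplF.{u} fun _ _ _ => 1 := fun d _ =>
  ⟨.instr (.fldOne d), fun _ => 1, .const 1, fun _ _ σ _ _ =>
    ⟨1, le_rfl, _, exec_fldOne σ _, (Keep.refl d σ).setF le_rfl _, RamState.setF_fld_self ..⟩⟩

theorem q : ImplF.{u} fun _ _ S => S.q := fun d hd =>
  ⟨.seq (.instr (.fldZero d)) (.instr (.fldAdd d 0 d)), fun _ => 2, .const 2,
    fun _ _ σ _ hS => ⟨2, le_rfl, _, .seq (exec_fldZero σ _) (exec_fldAdd _ _ _ _),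
      ((Keep.refl d σ).setF le_rfl _).setF le_rfl _, by
      rw [RamState.setF_fld_self, RamState.setF_fld_self, RamState.setF_fld_ne _ _ _ _ (by omega),
        add_zero, hS.q]⟩⟩

/-- Evaluating two arguments. -/
theorem args (hf : ImplF f) (hg : ImplF g) (d : ℕ) (hd : 1 ≤ d) :
    ∃ (p : RamProg) (b : ℕ → ℕ), PolyBdd b ∧
    ∀ (K : Type u) [Field K] (σ : RamState K) (S : MState K), Represents σ S →
      ∃ T ≤ b S.len, ∃ σ', RamExec p σ T σ' ∧ Keep d σ σ' ∧ σ'.fld d = f K S ∧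
        σ'.fld (d + 1) = g K S := by
  obtain ⟨p, b, hb, hp⟩ := hf d hd
  obtain ⟨p', b', hb', hp'⟩ := hg (d + 1) (by omega)
  refine ⟨.seq p p', _, hb.add hb', fun K _ σ S hS => ?_⟩
  obtain ⟨T, hT, σ', hex, hk, hv⟩ := hp K σ S hS
  obtain ⟨T', hT', σ'', hex', hk', hv'⟩ := hp' K σ' S (hS.keep hd hk)
  exact ⟨_, Nat.add_le_add hT hT', σ'', .seq hex hex', hk.trans (hk'.mono (Nat.le_succ d)),
    (hk'.fld d (Nat.lt_succ_self d)).trans hv, hv'⟩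

/-- Applying one instruction to two arguments. -/
theorem binary (hf : ImplF f) (hg : ImplF g) (i : ℕ → ℕ → ℕ → RamInstr)
    (op : ∀ (K : Type u) [Field K], K → K → K)
    (hi : ∀ (K : Type u) [Field K] (σ : RamState K) (x y z : ℕ),
      RamExec (.instr (i x y z)) σ 1 (σ.setF x (op K (σ.fld y) (σ.fld z)))) :
    ImplF fun K _ S => op K (f K S) (g K S) := fun d hd => by
  obtain ⟨p, b, hb, hp⟩ := args hf hg d hd
  refine ⟨.seq p (.instr (i d d (d + 1))), _, hb.add (.const 1), fun K _ σ S hS => ?_⟩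
  obtain ⟨T, hT, σ', hex, hk, hv, hv'⟩ := hp K σ S hS
  exact ⟨_, Nat.add_le_add hT le_rfl, _, .seq hex (hi _ _ _ _ _), hk.setF le_rfl _, by
    rw [RamState.setF_fld_self, hv, hv']⟩

theorem add (hf : ImplF f) (hg : ImplF g) : ImplF fun K _ S => f K S + g K S :=
  binary hf hg .fldAdd (fun _ _ a b => a + b) fun _ _ => exec_fldAdd

theorem sub (hf : ImplF f) (hg : ImplF g) : ImplF fun K _ S => f K S - g K S :=
  binary hf hg .fldSub (fun _ _ a b => a - b) fun _ _ => exec_fldSub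

theorem mul (hf : ImplF f) (hg : ImplF g) : ImplF fun K _ S => f K S * g K S :=
  binary hf hg .fldMul (fun _ _ a b => a * b) fun _ _ => exec_fldMul

theorem inv (hf : ImplF f) : ImplF fun K _ S => (f K S)⁻¹ := fun d hd => by
  obtain ⟨p, b, hb, hp⟩ := hf d hd
  refine ⟨.seq p (.instr (.fldInv d d)), _, hb.add (.const 1), fun K _ σ S hS => ?_⟩
  obtain ⟨T, hT, σ', hex, hk, hv⟩ := hp K σ S hS
  exact ⟨_, Nat.add_le_add hT le_rfl, _, .seq hex (exec_fldInv _ _ _), hk.setF le_rfl _, by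
    rw [RamState.setF_fld_self, hv]⟩

theorem ite (he : ImplN e) (hf : ImplF f) (hg : ImplF g) :
    ImplF fun K _ S => if e K S ≠ 0 then f K S else g K S := fun d hd => by
  obtain ⟨p, b, hb, hp⟩ := he d hd
  obtain ⟨p₁, b₁, hb₁, hp₁⟩ := hf d hd
  obtain ⟨p₂, b₂, hb₂, hp₂⟩ := hg d hd
  refine ⟨.seq p (.cond (tmp d) p₁ p₂), _, hb.add ((hb₁.add hb₂).add (.const 1)),
    fun K _ σ S hS => ?_⟩
  obtain ⟨T, hT, σ', hex, hk, hv⟩ := hp K σ S hS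
  have hS' := hS.keep hd hk
  by_cases h0 : e K S ≠ 0
  · obtain ⟨T', hT', σ'', hex', hk', hv'⟩ := hp₁ K σ' S hS'
    exact ⟨_, by omega, σ'', .seq hex (.condTrue (by rwa [hv]) hex'), hk.trans hk',
      hv'.trans (if_pos h0).symm⟩
  · obtain ⟨T', hT', σ'', hex', hk', hv'⟩ := hp₂ K σ' S hS'
    exact ⟨_, by omega, σ'', .seq hex (.condFalse (by rw [hv]; exact not_not.1 h0) hex'),
      hk.trans hk', hv'.trans (if_neg h0).symm⟩

theorem pow (hf : ImplF f) (he : ImplN e) : ImplF fun K _ S => f K S ^ min (e K S) S.len :=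
    fun d hd => by
  obtain ⟨p, b, hb, hp⟩ := he d hd
  obtain ⟨p', b', hb', hp'⟩ := hf (d + 1) (by omega)
  refine ⟨.seq p (.seq (.instr (.natSub (tmp (d + 1)) (tmp d) 1))
    (.seq (.instr (.natSub (tmp d) (tmp d) (tmp (d + 1)))) (.seq p' (.seq (.instr (.fldOne d))
      (RamProg.repeat (tmp d) (tmp (d + 1)) (.instr (.fldMul d d (d + 1)))))))), _,
    (hb.add hb').add ((PolyBdd.const 3).add (((PolyBdd.id).mul (.const (1 + 3))).add (.const 1))),
    fun K _ σ S hS => ?_⟩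
  obtain ⟨T, hT, σ₁, hex, hk, hv⟩ := hp K σ S hS
  have e1 := exec_natSub σ₁ (tmp (d + 1)) (tmp d) 1
  have e2 := exec_natSub (σ₁.setN (tmp (d + 1)) (σ₁.nat (tmp d) - σ₁.nat 1)) (tmp d) (tmp d)
    (tmp (d + 1))
  rw [RamState.setN_nat_ne _ _ _ _ (by simp only [tmp]; omega), RamState.setN_nat_self, hv,
    (hS.keep hd hk).len] at e2
  rw [hv, (hS.keep hd hk).len] at e1
  have hk2 : Keep d σ ((σ₁.setN (tmp (d + 1)) (e K S - S.len)).setN (tmp d)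
      (e K S - (e K S - S.len))) := (hk.setN (by omega) _).setN le_rfl _
  obtain ⟨T', hT', σ₂, hex', hk', hv'⟩ := hp' K _ S (hS.keep hd hk2)
  have hn : σ₂.nat (tmp d) = min (e K S) S.len := by
    rw [hk'.tmp' (by omega), RamState.setN_nat_self]; omega
  obtain ⟨T'', hT'', σ₃, hex'', hI⟩ := exec_repeat (c := tmp d) (one := tmp (d + 1))
    (by simp only [tmp]; omega) (p := .instr (.fldMul d d (d + 1)))
    (fun i τ => Keep d σ τ ∧ τ.fld (d + 1) = f K S ∧ τ.fld d = f K S ^ i)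
    (min (e K S) S.len) 1 (by
      rintro i - τ ⟨h1, h2, h3⟩
      refine ⟨1, le_rfl, _, exec_fldMul _ _ _ _, rfl, fun v w =>
        ⟨((h1.setF le_rfl _).setN (by omega) _).setN le_rfl _, ?_, ?_⟩⟩
      · rw [RamState.setN_fld, RamState.setN_fld, RamState.setF_fld_ne _ _ _ _ (by omega), h2]
      · rw [RamState.setN_fld, RamState.setN_fld, RamState.setF_fld_self, h2, h3, pow_succ])
    (σ₂.setF d 1) ⟨(hk2.trans (hk'.mono (by omega))).setF le_rfl _, by
      rw [RamState.setF_fld_ne _ _ _ _ (by omega), hv'], by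
      rw [RamState.setF_fld_self, pow_zero]⟩ hn
  refine ⟨_, ?_, _, .seq hex (.seq e1 (.seq e2 (.seq hex' (.seq (exec_fldOne _ _) hex'')))),
    hI.1, hI.2.2⟩
  have : min (e K S) S.len * (1 + 3) ≤ S.len * (1 + 3) := Nat.mul_le_mul_right _ (min_le_right _ _)
  omega

open Classical in
theorem isz (hf : ImplF f) : ImplN fun K _ S => if f K S = 0 then 1 else 0 := fun d hd => by
  obtain ⟨p, b, hb, hp⟩ := hf d hd
  refine ⟨.seq p (.instr (.fldTest (tmp d) d)), _, hb.add (.const 1), fun K _ σ S hS => ?_⟩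
  obtain ⟨T, hT, σ', hex, hk, hv⟩ := hp K σ S hS
  exact ⟨_, Nat.add_le_add hT le_rfl, _, .seq hex (exec_fldTest _ _ _), hk.setN le_rfl _, by
    rw [RamState.setN_nat_self, hv]⟩

end ImplF

/-! ## Loops over a variable -/

/-- Executing `p` for all values of the variable `x` below the size parameter; the old value of `x`
is restored at the end. -/
def RamProg.sweep (d x : ℕ) (p : RamProg) : RamProg :=
  .seq (.instr (.natConst (tmp (d + 1)) 0)) (.seq (.instr (.natAdd (tmp d) (2 * x) (tmp (d + 1))))
    (.seq (.instr (.natAdd (tmp (d + 1)) 1 (tmp (d + 1)))) (.seq (.instr (.natConst (2 * x) 0))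
      (.seq (RamProg.repeat (tmp (d + 1)) (tmp (d + 2)) (.seq p
        (.seq (.instr (.natConst (tmp (d + 2)) 1))
          (.instr (.natAdd (2 * x) (2 * x) (tmp (d + 2)))))))
        (.seq (.instr (.natConst (tmp (d + 2)) 0))
          (.instr (.natAdd (2 * x) (tmp d) (tmp (d + 2)))))))))

theorem exec_sweep {K : Type*} [Field K] {d x : ℕ} (hd : 1 ≤ d) {p : RamProg} {σ : RamState K}
    {S : MState K} (hS : Represents σ S) (B : ℕ) (J : ℕ → ℕ → K → Prop)
    (hstep : ∀ i < S.len, ∀ τ, Represents τ (S.set x i) →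
      J i (τ.nat (tmp (d + 3))) (τ.fld (d + 3)) → ∃ T ≤ B, ∃ τ', RamExec p τ T τ' ∧
        Keep (d + 3) τ τ' ∧ J (i + 1) (τ'.nat (tmp (d + 3))) (τ'.fld (d + 3)))
    (h0 : J 0 (σ.nat (tmp (d + 3))) (σ.fld (d + 3))) :
    ∃ T ≤ S.len * (B + 5) + 7, ∃ σ', RamExec (.sweep d x p) σ T σ' ∧ Keep d σ σ' ∧
      J S.len (σ'.nat (tmp (d + 3))) (σ'.fld (d + 3)) := by
  have e1 := exec_natConst σ (tmp (d + 1)) 0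
  set σ₁ := σ.setN (tmp (d + 1)) 0 with hσ₁
  have e2 := exec_natAdd σ₁ (tmp d) (2 * x) (tmp (d + 1))
  rw [RamState.setN_nat_self, RamState.setN_nat_ne _ _ _ _ (by simp only [tmp]; omega),
    add_zero] at e2
  set σ₂ := σ₁.setN (tmp d) (σ.nat (2 * x)) with hσ₂
  have e3 := exec_natAdd σ₂ (tmp (d + 1)) 1 (tmp (d + 1))
  have k2 : Keep d σ σ₂ := ((Keep.refl d σ).setN (by omega) _).setN le_rfl _
  have h3 : σ₂.nat (tmp (d + 1)) = 0 := by
    rw [RamState.setN_nat_ne _ _ _ _ (by simp only [tmp]; omega), RamState.setN_nat_self]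
  rw [h3, add_zero, (hS.keep hd k2).len] at e3
  set σ₃ := σ₂.setN (tmp (d + 1)) S.len with hσ₃
  have k3 : Keep d σ σ₃ := k2.setN (by omega) _
  have e4 := exec_natConst σ₃ (2 * x) 0
  obtain ⟨T, hT, σ', hex, hk, hs, hJ⟩ := exec_repeat (c := tmp (d + 1)) (one := tmp (d + 2))
    (by simp only [tmp]; omega) (p := .seq p (.seq (.instr (.natConst (tmp (d + 2)) 1))
          (.instr (.natAdd (2 * x) (2 * x) (tmp (d + 2))))))
    (fun i τ => Keep d (σ.setN (2 * x) i) τ ∧ τ.nat (tmp d) = σ.nat (2 * x) ∧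
      J i (τ.nat (tmp (d + 3))) (τ.fld (d + 3))) S.len (B + 2) (by
      rintro i hi τ ⟨h1, h2, h3⟩
      obtain ⟨T, hT, τ', hex, hk, hJ⟩ := hstep i hi τ ((hS.setVar x i).keep hd h1) h3
      have f1 := exec_natConst τ' (tmp (d + 2)) 1
      have f2 := exec_natAdd (τ'.setN (tmp (d + 2)) 1) (2 * x) (2 * x) (tmp (d + 2))
      have hx : τ'.nat (2 * x) = i := by
        rw [hk.var, h1.var, RamState.setN_nat_self]
      rw [RamState.setN_nat_self, RamState.setN_nat_ne _ _ _ _ (by simp only [tmp]; omega), hx] at f2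
      refine ⟨_, Nat.add_le_add hT le_rfl, _, .seq hex (.seq f1 f2), ?_, fun v w => ⟨?_, ?_, ?_⟩⟩
      · simp (disch := (simp only [tmp]; omega)) only [RamState.setN_nat_ne]
        exact hk.tmp' (by omega)
      · exact ((((h1.trans (hk.mono (by omega))).setN (by omega) _).setVar).setN
          (by omega) _).setN (by omega) _
      · simp (disch := (simp only [tmp]; omega)) only [RamState.setN_nat_ne]
        exact (hk.tmp' (by omega)).trans h2
      · simp (disch := (simp only [tmp]; omega)) only [RamState.setN_nat_ne, RamState.setN_fld]
        exact hJ) (σ₃.setN (2 * x) 0)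
    ⟨by
      have : Keep d (σ.setN (2 * x) (σ.nat (2 * x))) σ₃ := by rwa [RamState.setN_eq_self]
      exact this.setVar, by
      simp (disch := (simp only [tmp]; omega)) only [RamState.setN_nat_ne, hσ₃, hσ₂,
        RamState.setN_nat_self], by
      simp (disch := (simp only [tmp]; omega)) only [RamState.setN_nat_ne, hσ₃, hσ₂, hσ₁,
        RamState.setN_fld]
      exact h0⟩ (by
      simp (disch := (simp only [tmp]; omega)) only [RamState.setN_nat_ne, hσ₃,
        RamState.setN_nat_self])
  have e5 := exec_natConst σ' (tmp (d + 2)) 0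
  have e6 := exec_natAdd (σ'.setN (tmp (d + 2)) 0) (2 * x) (tmp d) (tmp (d + 2))
  rw [RamState.setN_nat_self, RamState.setN_nat_ne _ _ _ _ (by simp only [tmp]; omega), hs,
    add_zero] at e6
  refine ⟨_, ?_, _, .seq e1 (.seq e2 (.seq e3 (.seq e4 (.seq hex (.seq e5 e6))))), ?_, ?_⟩
  · have : S.len * (B + 2 + 3) = S.len * (B + 5) := rfl
    omega
  · have := (hk.setN (show d ≤ d + 2 by omega) 0).setVar (v' := σ.nat (2 * x))
    rwa [RamState.setN_eq_self] at this
  · simp (disch := (simp only [tmp]; omega)) only [RamState.setN_nat_ne, RamState.setN_fld]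
    exact hJ

namespace ImplN

universe u

variable {f i j : ∀ (K : Type u) [Field K], MState K → ℕ}

theorem sum (x : ℕ) (hf : ImplN f) :
    ImplN fun K _ S => ∑ z ∈ Finset.range S.len, f K (S.set x z) := fun d hd => by
  obtain ⟨p, b, hb, hp⟩ := hf (d + 4) (by omega)
  refine ⟨.seq (.instr (.natConst (tmp (d + 3)) 0)) (.seq (.sweep d x (.seq p
    (.instr (.natAdd (tmp (d + 3)) (tmp (d + 3)) (tmp (d + 4))))))
    (.seq (.instr (.natConst (tmp d) 0)) (.instr (.natAdd (tmp d) (tmp (d + 3)) (tmp d))))), _,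
    (PolyBdd.id.mul ((hb.add (.const 1)).add (.const 5))).add (.const 10), fun K _ σ S hS => ?_⟩
  have k1 : Keep d σ (σ.setN (tmp (d + 3)) 0) := (Keep.refl d σ).setN (by omega) _
  obtain ⟨T, hT, σ', hex, hk, hJ⟩ := exec_sweep hd (x := x) (p := .seq p
    (.instr (.natAdd (tmp (d + 3)) (tmp (d + 3)) (tmp (d + 4))))) (hS.keep hd k1) (b S.len + 1)
    (fun i a _ => a = ∑ z ∈ Finset.range i, f K (S.set x z)) (by
      intro i hi τ hτ ha
      obtain ⟨T, hT, τ', hex, hk, hv⟩ := hp K τ _ hτ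
      refine ⟨_, Nat.add_le_add hT le_rfl, _, .seq hex (exec_natAdd _ _ _ _),
        (hk.mono (by omega)).setN le_rfl _, ?_⟩
      rw [RamState.setN_nat_self, hk.tmp' (by omega), ha, hv, Finset.sum_range_succ])
    (by rw [RamState.setN_nat_self]; simp)
  refine ⟨_, ?_, _, .seq (exec_natConst _ _ _) (.seq hex (.seq (exec_natConst _ _ _)
    (exec_natAdd _ _ _ _))), ((k1.trans hk).setN le_rfl _).setN le_rfl _, ?_⟩
  · omega
  · rw [RamState.setN_nat_self, RamState.setN_nat_self,
      RamState.setN_nat_ne _ _ _ _ (by simp only [tmp]; omega), hJ, add_zero]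

/-- A number which is nonzero if and only if the indices `i` and `j` are in range. -/
theorem guard (hi : ImplN i) (hj : ImplN j) :
    ImplN fun K _ S => (S.len - i K S) * min (S.len - j K S) S.len :=
  mul (sub len hi) (sub len hj)

theorem guard_ne_zero (i j L : ℕ) : (L - i) * min (L - j) L ≠ 0 ↔ i < L ∧ j < L := by
  rw [mul_ne_zero_iff]; omega

/-- The address of an entry of an array. -/
theorem address (k : ℕ) (hi : ImplN i) (hj : ImplN j) :
    ImplN fun K _ S => (k * S.len + i K S) * S.len + j K S := by
  have h := add (mul (add (mul (const k) len) hi) len) hj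
  simp only [min_self] at h
  exact h

end ImplN

namespace ImplF

universe u

variable {f : ∀ (K : Type u) [Field K], MState K → K} {i j : ∀ (K : Type u) [Field K], MState K → ℕ}

theorem sum (x : ℕ) (hf : ImplF f) :
    ImplF fun K _ S => ∑ z ∈ Finset.range S.len, f K (S.set x z) := fun d hd => by
  obtain ⟨p, b, hb, hp⟩ := hf (d + 4) (by omega)
  refine ⟨.seq (.instr (.fldZero (d + 3))) (.seq (.sweep d x (.seq p
    (.instr (.fldAdd (d + 3) (d + 3) (d + 4)))))
    (.seq (.instr (.fldZero d)) (.instr (.fldAdd d (d + 3) d)))), _,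
    (PolyBdd.id.mul ((hb.add (.const 1)).add (.const 5))).add (.const 10), fun K _ σ S hS => ?_⟩
  have k1 : Keep d σ (σ.setF (d + 3) 0) := (Keep.refl d σ).setF (by omega) _
  obtain ⟨T, hT, σ', hex, hk, hJ⟩ := exec_sweep hd (x := x) (p := .seq p
    (.instr (.fldAdd (d + 3) (d + 3) (d + 4)))) (hS.keep hd k1) (b S.len + 1)
    (fun i _ a => a = ∑ z ∈ Finset.range i, f K (S.set x z)) (by
      intro i hi τ hτ ha
      obtain ⟨T, hT, τ', hex, hk, hv⟩ := hp K τ _ hτ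
      refine ⟨_, Nat.add_le_add hT le_rfl, _, .seq hex (exec_fldAdd _ _ _ _),
        (hk.mono (by omega)).setF le_rfl _, ?_⟩
      rw [RamState.setF_fld_self, hk.fld _ (by omega), ha, hv, Finset.sum_range_succ])
    (by rw [RamState.setF_fld_self]; simp)
  refine ⟨_, ?_, _, .seq (exec_fldZero _ _) (.seq hex (.seq (exec_fldZero _ _)
    (exec_fldAdd _ _ _ _))), ((k1.trans hk).setF le_rfl _).setF le_rfl _, ?_⟩
  · omega
  · rw [RamState.setF_fld_self, RamState.setF_fld_self,
      RamState.setF_fld_ne _ _ _ _ (by omega), hJ, add_zero]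

theorem load (k : ℕ) (hi : ImplN i) (hj : ImplN j) :
    ImplF fun K _ S => if i K S < S.len ∧ j K S < S.len then S.arr k (i K S) (j K S) else 0 :=
    fun d hd => by
  obtain ⟨p, b, hb, hp⟩ := ImplN.guard hi hj d hd
  obtain ⟨p', b', hb', hp'⟩ := ImplN.address k hi hj d hd
  refine ⟨.seq p (.cond (tmp d) (.seq p' (.instr (.fldLoad d (tmp d)))) (.instr (.fldZero d))), _,
    (hb.add hb').add (.const 2), fun K _ σ S hS => ?_⟩
  obtain ⟨T, hT, σ', hex, hk, hv⟩ := hp K σ S hS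
  have hS' := hS.keep hd hk
  by_cases h0 : σ'.nat (tmp d) = 0
  · have h1 : ¬(i K S < S.len ∧ j K S < S.len) := fun h =>
      (ImplN.guard_ne_zero _ _ _).2 h (hv.symm.trans h0)
    exact ⟨_, by omega, _, .seq hex (.condFalse h0 (exec_fldZero _ _)), hk.setF le_rfl _,
      (RamState.setF_fld_self ..).trans (if_neg h1).symm⟩
  · have h1 : i K S < S.len ∧ j K S < S.len := 
      (ImplN.guard_ne_zero _ _ _).1 fun h => h0 (hv.trans h)
    obtain ⟨T', hT', σ'', hex', hk', hv'⟩ := hp' K σ' S hS'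
    refine ⟨_, ?_, _, .seq hex (.condTrue h0 (.seq hex' (exec_fldLoad _ _ _))),
      (hk.trans hk').setF le_rfl _, ?_⟩
    · omega
    · rw [RamState.setF_fld_self, hv', (hS'.keep hd hk').arr _ _ _ h1.1 h1.2]
      exact (if_pos h1).symm

end ImplF

/-! ## Computable transformations of the state -/

/-- Overwriting an entry of an array, if the indices are in range. -/
def MState.store {K : Type*} (S : MState K) (k i j : ℕ) (c : K) : MState K :=
  { S with arr := fun k' i' j' =>
      if k' = k ∧ i' = i ∧ j' = j ∧ i < S.len ∧ j < S.len then c else S.arr k' i' j' }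

/-- Iterating a transformation, for the values `0, …, n - 1` of the variable `x`. -/
def MState.iter {K : Type*} (x : ℕ) (F : MState K → MState K) (S : MState K) : ℕ → MState K
  | 0 => S
  | n + 1 => F ((MState.iter x F S n).set x n)

/-- The transformation `F` can be carried out in polynomial time. -/
def ImplS.{u} (F : ∀ (K : Type u) [Field K], MState K → MState K) : Prop :=
  ∀ d, 1 ≤ d → ∃ (p : RamProg) (g : ℕ → ℕ), PolyBdd g ∧
    ∀ (K : Type u) [Field K] (σ : RamState K) (S : MState K), Represents σ S →
      ∃ T ≤ g S.len, ∃ σ', RamExec p σ T σ' ∧ (∀ i < d, σ'.nat (tmp i) = σ.nat (tmp i)) ∧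
        (∀ i < d, σ'.fld i = σ.fld i) ∧ Represents σ' (F K S)

namespace ImplS

universe u

variable {F G : ∀ (K : Type u) [Field K], MState K → MState K}
  {f : ∀ (K : Type u) [Field K], MState K → K} {e i j : ∀ (K : Type u) [Field K], MState K → ℕ}

theorem assign (x : ℕ) (he : ImplN e) : ImplS fun K _ S => S.set x (e K S) := fun d hd => by
  obtain ⟨p, b, hb, hp⟩ := he d hd
  refine ⟨.seq p (.seq (.instr (.natConst (tmp (d + 1)) 0))
    (.instr (.natAdd (2 * x) (tmp d) (tmp (d + 1))))), _, hb.add (.const 2), fun K _ σ S hS => ?_⟩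
  obtain ⟨T, hT, σ', hex, hk, hv⟩ := hp K σ S hS
  have e2 := exec_natAdd (σ'.setN (tmp (d + 1)) 0) (2 * x) (tmp d) (tmp (d + 1))
  rw [RamState.setN_nat_self, RamState.setN_nat_ne _ _ _ _ (by simp only [tmp]; omega), hv,
    add_zero] at e2
  have k1 : Keep d σ (σ'.setN (tmp (d + 1)) 0) := hk.setN (by omega) _
  refine ⟨_, Nat.add_le_add hT le_rfl, _, .seq hex (.seq (exec_natConst _ _ _) e2),
    fun i hi => ?_, k1.fld, (hS.keep hd k1).setVar x _⟩
  rw [RamState.setN_nat_ne _ _ _ _ (by simp only [tmp]; omega)]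
  exact k1.tmp' hi

theorem seq (hF : ImplS F) (hG : ImplS G) : ImplS fun K _ S => G K (F K S) := fun d hd => by
  obtain ⟨p, b, hb, hp⟩ := hF d hd
  obtain ⟨p', b', hb', hp'⟩ := hG d hd
  refine ⟨.seq p p', _, hb.add hb', fun K _ σ S hS => ?_⟩
  obtain ⟨T, hT, σ', hex, h1, h2, h3⟩ := hp K σ S hS
  obtain ⟨T', hT', σ'', hex', h1', h2', h3'⟩ := hp' K σ' _ h3
  have hlen : (F K S).len = S.len := by rw [← h3.len, ← hS.len]; exact h1 0 hd
  rw [hlen] at hT'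
  exact ⟨_, Nat.add_le_add hT hT', σ'', .seq hex hex', fun i hi => (h1' i hi).trans (h1 i hi),
    fun i hi => (h2' i hi).trans (h2 i hi), h3'⟩

theorem address_inj {k i j k' i' j' L : ℕ} (hi : i < L) (hj : j < L) (hi' : i' < L) (hj' : j' < L)
    (h : (k * L + i) * L + j = (k' * L + i') * L + j') : k = k' ∧ i = i' ∧ j = j' := by
  have hL : 0 < L := by omega
  have h1 : k * L + i = k' * L + i' := by
    have := congrArg (· / L) h
    simpa [Nat.add_comm _ j, Nat.add_comm _ j', Nat.add_mul_div_right _ _ hL,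
      Nat.div_eq_of_lt hj, Nat.div_eq_of_lt hj'] using this
  have h2 : k = k' := by
    have := congrArg (· / L) h1
    simpa [Nat.add_comm _ i, Nat.add_comm _ i', Nat.add_mul_div_right _ _ hL,
      Nat.div_eq_of_lt hi, Nat.div_eq_of_lt hi'] using this
  subst h2
  have h3 : i = i' := by omega
  subst h3
  exact ⟨rfl, rfl, by omega⟩

theorem store (k : ℕ) (hi : ImplN i) (hj : ImplN j) (hf : ImplF f) :
    ImplS fun K _ S => S.store k (i K S) (j K S) (f K S) := fun d hd => by
  obtain ⟨p, b, hb, hp⟩ := ImplN.guard hi hj d hd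
  obtain ⟨p', b', hb', hp'⟩ := ImplN.address k hi hj d hd
  obtain ⟨p'', b'', hb'', hp''⟩ := hf (d + 1) (by omega)
  refine ⟨.seq p (.cond (tmp d) (.seq p' (.seq p'' (.instr (.fldStore (tmp d) (d + 1)))))
    (.instr (.natConst (tmp d) 0))), _, ((hb.add hb').add hb'').add (.const 2),
    fun K _ σ S hS => ?_⟩
  obtain ⟨T, hT, σ', hex, hk, hv⟩ := hp K σ S hS
  have hS' := hS.keep hd hk
  by_cases h0 : σ'.nat (tmp d) = 0
  · have h1 : ¬(i K S < S.len ∧ j K S < S.len) := fun h =>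
      (ImplN.guard_ne_zero _ _ _).2 h (hv.symm.trans h0)
    have k1 : Keep d σ (σ'.setN (tmp d) 0) := hk.setN le_rfl _
    have h2 : S.store k (i K S) (j K S) (f K S) = S := by
      simp only [MState.store]
      congr 1
      funext k' i' j'
      rw [if_neg fun h => h1 h.2.2.2]
    exact ⟨_, by omega, _, .seq hex (.condFalse h0 (exec_natConst _ _ _)), k1.tmp, k1.fld, by
      change Represents _ (S.store k (i K S) (j K S) (f K S))
      rw [h2]
      exact hS.keep hd k1⟩
  · have h1 : i K S < S.len ∧ j K S < S.len := 
      (ImplN.guard_ne_zero _ _ _).1 fun h => h0 (hv.trans h)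
    obtain ⟨T', hT', σ₂, hex', hk', hv'⟩ := hp' K σ' S hS'
    have hS₂ := hS'.keep hd hk'
    obtain ⟨T'', hT'', σ₃, hex'', hk'', hv''⟩ := hp'' K σ₂ S hS₂
    have k1 : Keep d σ σ₃ := (hk.trans hk').trans (hk''.mono (by omega))
    have e1 := exec_fldStore σ₃ (tmp d) (d + 1)
    rw [hk''.tmp' (Nat.lt_succ_self d), hv', hv''] at e1
    refine ⟨_, ?_, _, .seq hex (.condTrue h0 (.seq hex' (.seq hex'' e1))), k1.tmp, k1.fld, ?_⟩
    · omega
    · have h3 := hS.keep hd k1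
      refine ⟨h3.len, h3.q, h3.var, fun k' i' j' hi' hj' => ?_⟩
      simp only [MState.store, RamState.setM]
      by_cases h4 : k' = k ∧ i' = i K S ∧ j' = j K S ∧ i K S < S.len ∧ j K S < S.len
      · rw [if_pos h4, h4.1, h4.2.1, h4.2.2.1, Function.update_self]
      · rw [if_neg h4, Function.update_of_ne, h3.arr k' i' j' hi' hj']
        intro h5
        obtain ⟨h6, h7, h8⟩ := address_inj hi' hj' h1.1 h1.2 h5
        exact h4 ⟨h6, h7, h8, h1⟩

theorem loop (x : ℕ) (hF : ImplS F) :
    ImplS fun K _ S => (MState.iter x (F K) S S.len).set x (S.var x) := fun d hd => by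
  obtain ⟨p, b, hb, hp⟩ := hF (d + 4) (by omega)
  let body : RamProg := .seq (.instr (.natConst (tmp (d + 2)) 0))
    (.seq (.instr (.natAdd (2 * x) (tmp (d + 3)) (tmp (d + 2)))) (.seq p
      (.seq (.instr (.natConst (tmp (d + 2)) 1))
        (.instr (.natAdd (tmp (d + 3)) (tmp (d + 3)) (tmp (d + 2)))))))
  refine ⟨.seq (.instr (.natConst (tmp (d + 3)) 0))
    (.seq (.instr (.natAdd (tmp d) (2 * x) (tmp (d + 3))))
    (.seq (.instr (.natAdd (tmp (d + 1)) 1 (tmp (d + 3))))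
    (.seq (RamProg.repeat (tmp (d + 1)) (tmp (d + 2)) body)
    (.seq (.instr (.natConst (tmp (d + 2)) 0))
      (.instr (.natAdd (2 * x) (tmp d) (tmp (d + 2)))))))), _,
    (PolyBdd.id.mul ((hb.add (.const 4)).add (.const 3))).add (.const 6), fun K _ σ S hS => ?_⟩
  have e1 := exec_natConst σ (tmp (d + 3)) 0
  have e2 := exec_natAdd (σ.setN (tmp (d + 3)) 0) (tmp d) (2 * x) (tmp (d + 3))
  rw [RamState.setN_nat_self, RamState.setN_nat_ne _ _ _ _ (by simp only [tmp]; omega), hS.var,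
    add_zero] at e2
  have k2 : Keep d σ ((σ.setN (tmp (d + 3)) 0).setN (tmp d) (S.var x)) :=
    ((Keep.refl d σ).setN (by omega) _).setN le_rfl _
  have e3 := exec_natAdd ((σ.setN (tmp (d + 3)) 0).setN (tmp d) (S.var x)) (tmp (d + 1)) 1
    (tmp (d + 3))
  rw [(hS.keep hd k2).len, RamState.setN_nat_ne _ _ _ _ (by simp only [tmp]; omega),
    RamState.setN_nat_self, add_zero] at e3
  have k3 := k2.setN (show d ≤ d + 1 by omega) S.len
  obtain ⟨T, hT, σ', hex, h1, h2, h3, h4, h5⟩ := exec_repeat (c := tmp (d + 1))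
    (one := tmp (d + 2)) (by simp only [tmp]; omega) (p := body)
    (fun i τ => (∀ i < d, τ.nat (tmp i) = σ.nat (tmp i)) ∧ (∀ i < d, τ.fld i = σ.fld i) ∧
      τ.nat (tmp d) = S.var x ∧ τ.nat (tmp (d + 3)) = i ∧
      Represents τ (MState.iter x (F K) S i)) S.len (b S.len + 4) (by
      rintro i hi τ ⟨h1, h2, h3, h4, h5⟩
      have f2 := exec_natAdd (τ.setN (tmp (d + 2)) 0) (2 * x) (tmp (d + 3)) (tmp (d + 2))
      rw [RamState.setN_nat_self, RamState.setN_nat_ne _ _ _ _ (by simp only [tmp]; omega), h4,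
        add_zero] at f2
      have hr : Represents ((τ.setN (tmp (d + 2)) 0).setN (2 * x) i)
          ((MState.iter x (F K) S i).set x i) :=
        (h5.keep hd ((Keep.refl d τ).setN (by omega) 0)).setVar x i
      obtain ⟨T, hT, τ', hex, g1, g2, g3⟩ := hp K _ _ hr
      have hlen : (MState.iter x (F K) S i).len = S.len := by
        rw [← h5.len, ← hS.len]; exact h1 0 hd
      rw [MState.set_len, hlen] at hT
      refine ⟨_, ?_, _, .seq (exec_natConst _ _ _) (.seq f2 (.seq hex
        (.seq (exec_natConst _ _ _) (exec_natAdd _ _ _ _)))), ?_, fun v w => ⟨?_, ?_, ?_, ?_, ?_⟩⟩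
      · omega
      · simp (disch := (simp only [tmp]; omega)) only [RamState.setN_nat_ne]
        rw [g1 _ (by omega)]
        simp (disch := (simp only [tmp]; omega)) only [RamState.setN_nat_ne]
      · intro a ha
        simp (disch := (simp only [tmp]; omega)) only [RamState.setN_nat_ne]
        rw [g1 _ (by omega)]
        simp (disch := (simp only [tmp]; omega)) only [RamState.setN_nat_ne]
        exact h1 a ha
      · intro a ha
        exact (g2 a (by omega)).trans (h2 a ha)
      · simp (disch := (simp only [tmp]; omega)) only [RamState.setN_nat_ne]
        rw [g1 _ (by omega)]
        simp (disch := (simp only [tmp]; omega)) only [RamState.setN_nat_ne]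
        exact h3
      · simp (disch := (simp only [tmp]; omega)) only [RamState.setN_nat_ne,
          RamState.setN_nat_self]
        rw [g1 _ (by omega)]
        simp (disch := (simp only [tmp]; omega)) only [RamState.setN_nat_ne]
        rw [h4]
      · exact g3.keep hd (((((Keep.refl d τ').setN (by omega) _).setN (by omega) _).setN
          (by omega) _).setN (by omega) _))
    _ ⟨k3.tmp, k3.fld, by
      simp (disch := (simp only [tmp]; omega)) only [RamState.setN_nat_ne,
        RamState.setN_nat_self], by
      simp (disch := (simp only [tmp]; omega)) only [RamState.setN_nat_ne,
        RamState.setN_nat_self], hS.keep hd k3⟩ (by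
      simp (disch := (simp only [tmp]; omega)) only [RamState.setN_nat_self])
  have e6 := exec_natAdd (σ'.setN (tmp (d + 2)) 0) (2 * x) (tmp d) (tmp (d + 2))
  rw [RamState.setN_nat_self, RamState.setN_nat_ne _ _ _ _ (by simp only [tmp]; omega), h3,
    add_zero] at e6
  have k6 : Keep d σ' (σ'.setN (tmp (d + 2)) 0) := (Keep.refl d σ').setN (by omega) 0
  refine ⟨_, ?_, _, .seq e1 (.seq e2 (.seq e3 (.seq hex (.seq (exec_natConst _ _ _) e6)))),
    fun i hi => ?_, h2, (h5.keep hd k6).setVar x _⟩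
  · omega
  · rw [RamState.setN_nat_ne _ _ _ _ (by simp only [tmp]; omega)]
    exact (k6.tmp i hi).trans (h1 i hi)

end ImplS

/-! ## A small programming language -/

mutual

/-- Expressions for natural numbers. -/
inductive NExp : Type
  | const (c : ℕ)
  | var (x : ℕ)
  | len
  | add (a b : NExp)
  | sub (a b : NExp)
  | mul (a b : NExp)
  | div (a b : NExp)
  | sum (x : ℕ) (a : NExp)
  | isz (f : FExp)
  | ite (c a b : NExp)

/-- Expressions for field elements. -/
inductive FExp : Type
  | q
  | zero
  | one
  | add (f g : FExp)
  | sub (f g : FExp)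
  | mul (f g : FExp)
  | inv (f : FExp)
  | pow (f : FExp) (a : NExp)
  | ite (c : NExp) (f g : FExp)
  | sum (x : ℕ) (f : FExp)
  | load (k : ℕ) (a b : NExp)

end

open Classical in
mutual

/-- The value of an expression. Truncation at `len` bounds the running time. The result is lifted
to the universe of the field for the sake of the mutual recursion. -/
noncomputable def NExp.evalLift.{u} {K : Type u} [Field K] : NExp → MState K → ULift.{u} ℕ
  | .const c, _ => ⟨c⟩
  | .var x, S => ⟨S.var x⟩
  | .len, S => ⟨S.len⟩
  | .add a b, S => ⟨(a.evalLift S).down + (b.evalLift S).down⟩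
  | .sub a b, S => ⟨(a.evalLift S).down - (b.evalLift S).down⟩
  | .mul a b, S => ⟨(a.evalLift S).down * min (b.evalLift S).down S.len⟩
  | .div a b, S => ⟨if (b.evalLift S).down = 0 then S.len
      else min ((a.evalLift S).down / (b.evalLift S).down) S.len⟩
  | .sum x a, S => ⟨∑ z ∈ Finset.range S.len, (a.evalLift (S.set x z)).down⟩
  | .isz f, S => ⟨if f.eval S = 0 then 1 else 0⟩
  | .ite c a b, S => if (c.evalLift S).down ≠ 0 then a.evalLift S else b.evalLift S

/-- The value of an expression. -/
noncomputable def FExp.eval.{u} {K : Type u} [Field K] : FExp → MState K → K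
  | .q, S => S.q
  | .zero, _ => 0
  | .one, _ => 1
  | .add f g, S => f.eval S + g.eval S
  | .sub f g, S => f.eval S - g.eval S
  | .mul f g, S => f.eval S * g.eval S
  | .inv f, S => (f.eval S)⁻¹
  | .pow f a, S => f.eval S ^ min (a.evalLift S).down S.len
  | .ite c f g, S => if (c.evalLift S).down ≠ 0 then f.eval S else g.eval S
  | .sum x f, S => ∑ z ∈ Finset.range S.len, f.eval (S.set x z)
  | .load k a b, S => if (a.evalLift S).down < S.len ∧ (b.evalLift S).down < S.len then
      S.arr k (a.evalLift S).down (b.evalLift S).down else 0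

end

/-- The value of an expression. -/
noncomputable def NExp.eval {K : Type*} [Field K] (a : NExp) (S : MState K) : ℕ :=
  (a.evalLift S).down

section Eval

variable {K : Type*} [Field K] (S : MState K) (a b c : NExp) (f g : FExp) (x k : ℕ)

@[simp] theorem NExp.eval_const : (NExp.const k).eval S = k := rfl
@[simp] theorem NExp.eval_var : (NExp.var x).eval S = S.var x := rfl
@[simp] theorem NExp.eval_len : NExp.len.eval S = S.len := rfl
@[simp] theorem NExp.eval_add : (a.add b).eval S = a.eval S + b.eval S := rfl
@[simp] theorem NExp.eval_sub : (a.sub b).eval S = a.eval S - b.eval S := rfl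
theorem NExp.eval_mul : (a.mul b).eval S = a.eval S * min (b.eval S) S.len := rfl
theorem NExp.eval_div : (a.div b).eval S =
    if b.eval S = 0 then S.len else min (a.eval S / b.eval S) S.len := rfl
@[simp] theorem NExp.eval_sum : (NExp.sum x a).eval S =
    ∑ z ∈ Finset.range S.len, a.eval (S.set x z) := rfl
open Classical in
@[simp] theorem NExp.eval_isz : (NExp.isz f).eval S = if f.eval S = 0 then 1 else 0 := rfl
@[simp] theorem NExp.eval_ite : (NExp.ite c a b).eval S =
    if c.eval S ≠ 0 then a.eval S else b.eval S := by
  rw [NExp.eval, NExp.evalLift]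
  split_ifs with h h' h' <;> first | rfl | exact absurd h h' | exact absurd h' h
@[simp] theorem FExp.eval_q : FExp.q.eval S = S.q := rfl
@[simp] theorem FExp.eval_zero : FExp.zero.eval S = 0 := rfl
@[simp] theorem FExp.eval_one : FExp.one.eval S = 1 := rfl
@[simp] theorem FExp.eval_add : (f.add g).eval S = f.eval S + g.eval S := rfl
@[simp] theorem FExp.eval_sub : (f.sub g).eval S = f.eval S - g.eval S := rfl
@[simp] theorem FExp.eval_mul : (f.mul g).eval S = f.eval S * g.eval S := rfl
@[simp] theorem FExp.eval_inv : f.inv.eval S = (f.eval S)⁻¹ := rfl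
theorem FExp.eval_pow : (f.pow a).eval S = f.eval S ^ min (a.eval S) S.len := rfl
@[simp] theorem FExp.eval_ite : (FExp.ite c f g).eval S =
    if c.eval S ≠ 0 then f.eval S else g.eval S := by
  rw [NExp.eval, FExp.eval]
@[simp] theorem FExp.eval_sum : (FExp.sum x f).eval S =
    ∑ z ∈ Finset.range S.len, f.eval (S.set x z) := rfl
theorem FExp.eval_load : (FExp.load k a b).eval S =
    if a.eval S < S.len ∧ b.eval S < S.len then S.arr k (a.eval S) (b.eval S) else 0 := by
  rw [NExp.eval, NExp.eval, FExp.eval]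

end Eval

/-- The arrays with an even number (the others are auxiliary). -/
def MState.view {K : Type*} (S : MState K) : MState K := { S with arr := fun k => S.arr (2 * k) }

mutual

theorem NExp.impl.{u} (a : NExp) : ImplN.{u} fun _ _ S => a.eval S.view := by
  cases a with
  | const c => simp only [NExp.eval_const]; exact .const c
  | var x => simp only [NExp.eval_var]; exact .var x
  | len => simp only [NExp.eval_len]; exact .len
  | add a b => simp only [NExp.eval_add]; exact .add a.impl b.impl
  | sub a b => simp only [NExp.eval_sub]; exact .sub a.impl b.impl
  | mul a b => simp only [NExp.eval_mul]; exact .mul a.impl b.impl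
  | div a b => simp only [NExp.eval_div]; exact .div a.impl b.impl
  | sum x a => simp only [NExp.eval_sum]; exact .sum x a.impl
  | isz f => simp only [NExp.eval_isz]; exact ImplF.isz f.impl
  | ite c a b => simp only [NExp.eval_ite]; exact .ite c.impl a.impl b.impl

theorem FExp.impl.{u} (f : FExp) : ImplF.{u} fun _ _ S => f.eval S.view := by
  cases f with
  | q => simp only [FExp.eval_q]; exact .q
  | zero => simp only [FExp.eval_zero]; exact .zero
  | one => simp only [FExp.eval_one]; exact .one
  | add f g => simp only [FExp.eval_add]; exact .add f.impl g.impl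
  | sub f g => simp only [FExp.eval_sub]; exact .sub f.impl g.impl
  | mul f g => simp only [FExp.eval_mul]; exact .mul f.impl g.impl
  | inv f => simp only [FExp.eval_inv]; exact .inv f.impl
  | pow f a => simp only [FExp.eval_pow]; exact .pow f.impl a.impl
  | ite c f g => simp only [FExp.eval_ite]; exact .ite c.impl f.impl g.impl
  | sum x f => simp only [FExp.eval_sum]; exact .sum x f.impl
  | load k a b => simp only [FExp.eval_load]; exact .load (2 * k) a.impl b.impl

end

/-- Statements. -/
inductive Stmt : Type
  | assign (x : ℕ) (a : NExp)
  /-- filling the array `k`: the entry `(i, j)` becomes the value of `f`, for the value `i` of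
  the variable `4` and the value `j` of the variable `5` -/
  | tab (k : ℕ) (f : FExp)
  | seq (s t : Stmt)
  | loop (x : ℕ) (s : Stmt)

/-- Changing an array. -/
def MState.setArr {K : Type*} (S : MState K) (k : ℕ) (b : ℕ → ℕ → K) : MState K :=
  { S with arr := Function.update S.arr k fun i j =>
      if i < S.len ∧ j < S.len then b i j else S.arr k i j }

/-- The effect of a statement. -/
noncomputable def Stmt.exec {K : Type*} [Field K] : Stmt → MState K → MState K
  | .assign x a, S => S.set x (a.eval S)
  | .tab k f, S => S.setArr k fun i j => f.eval ((S.set 4 i).set 5 j)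
  | .seq s t, S => t.exec (s.exec S)
  | .loop x s, S => (MState.iter x s.exec S S.len).set x (S.var x)

section Fill

variable {K : Type*}

@[ext] theorem MState.ext' {S S' : MState K} (h1 : S.len = S'.len) (h2 : S.q = S'.q)
    (h3 : ∀ x, S.var x = S'.var x) (h4 : ∀ k i j, S.arr k i j = S'.arr k i j) : S = S' := by
  cases S
  cases S'
  simp only [MState.mk.injEq]
  exact ⟨h1, h2, funext h3, funext fun k => funext fun i => funext fun j => h4 k i j⟩

/-- The states differ in the variables `4` and `5` and in the array `k` only. -/
structure AgreeOff (k : ℕ) (S S' : MState K) : Prop where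
  len : S'.len = S.len
  q : S'.q = S.q
  var : ∀ z, z ≠ 4 → z ≠ 5 → S'.var z = S.var z
  arr : ∀ k', k' ≠ k → S'.arr k' = S.arr k'

theorem AgreeOff.set {k : ℕ} {S S' : MState K} (h : AgreeOff k S S') {x : ℕ} (hx : x = 4 ∨ x = 5)
    (v : ℕ) : AgreeOff k S (S'.set x v) :=
  ⟨h.len, h.q, fun z h4 h5 => (MState.set_var_ne _ _ _ _ (by omega)).trans (h.var z h4 h5), h.arr⟩

theorem AgreeOff.store {k : ℕ} {S S' : MState K} (h : AgreeOff k S S') (i j : ℕ) (c : K) :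
    AgreeOff k S (S'.store k i j c) :=
  ⟨h.len, h.q, h.var, fun k' hk' => by
    funext i' j'
    simp only [MState.store]
    rw [if_neg fun h => hk' h.1, h.arr k' hk']⟩

variable {k : ℕ} {S : MState K} {h : MState K → K} {c : ℕ → ℕ → K}
  (hc : ∀ S', AgreeOff k S S' → S'.var 4 < S.len → S'.var 5 < S.len →
    h S' = c (S'.var 4) (S'.var 5))

include hc in
theorem iter_store_row {S' : MState K} (hS : AgreeOff k S S') (h4 : S'.var 4 < S.len) (n : ℕ)
    (hn : n ≤ S.len) :
    AgreeOff k S (MState.iter 5 (fun S => S.store k (S.var 4) (S.var 5) (h S)) S' n) ∧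
    (MState.iter 5 (fun S => S.store k (S.var 4) (S.var 5) (h S)) S' n).var 4 = S'.var 4 ∧
    ∀ i j, (MState.iter 5 (fun S => S.store k (S.var 4) (S.var 5) (h S)) S' n).arr k i j =
      if i = S'.var 4 ∧ j < n then c i j else S'.arr k i j := by
  induction n with
  | zero => exact ⟨hS, rfl, fun i j => by simp [MState.iter]⟩
  | succ n ih =>
    obtain ⟨h1, h2, h3⟩ := ih (by omega)
    rw [MState.iter]
    set T := MState.iter 5 (fun S => S.store k (S.var 4) (S.var 5) (h S)) S' n
    have hT : AgreeOff k S (T.set 5 n) := h1.set (Or.inr rfl) n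
    have e4 : (T.set 5 n).var 4 = S'.var 4 := (MState.set_var_ne _ _ _ _ (by omega)).trans h2
    have e5 : (T.set 5 n).var 5 = n := MState.set_var_self ..
    refine ⟨hT.store _ _ _, e4, fun i j => ?_⟩
    have hv := hc _ hT (by rw [e4]; exact h4) (by rw [e5]; omega)
    simp only [MState.store, hv, e4, e5, hT.len, MState.set_arr, h3]
    by_cases hi : i = S'.var 4
    · by_cases hj : j = n
      · subst hj; subst hi
        rw [if_pos ⟨trivial, rfl, rfl, h4, by omega⟩, if_pos ⟨rfl, by omega⟩]
      · rw [if_neg fun h => hj h.2.2.1]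
        exact if_congr (by omega) rfl rfl
    · rw [if_neg fun h => hi h.2.1, if_neg fun h => hi h.1, if_neg fun h => hi h.1]

/-- Filling the array `k` with the values of `h`. -/
def MState.fill (k : ℕ) (h : MState K → K) (S : MState K) : MState K :=
  (MState.iter 4 (fun S => (MState.iter 5 (fun S => S.store k (S.var 4) (S.var 5) (h S)) S
    S.len).set 5 (S.var 5)) S S.len).set 4 (S.var 4)

include hc in
theorem fill_eq : S.fill k h = S.setArr k c := by
  have key : ∀ n ≤ S.len, ∀ T, T = MState.iter 4 (fun S => (MState.iter 5
      (fun S => S.store k (S.var 4) (S.var 5) (h S)) S S.len).set 5 (S.var 5)) S n →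
      AgreeOff k S T ∧ T.var 5 = S.var 5 ∧
        ∀ i j, T.arr k i j = if i < n ∧ j < S.len then c i j else S.arr k i j := by
    intro n
    induction n with
    | zero =>
      rintro - T rfl
      exact ⟨⟨rfl, rfl, fun _ _ _ => rfl, fun _ _ => rfl⟩, rfl, fun i j => by simp⟩
    | succ n ih =>
      rintro hn T rfl
      obtain ⟨h1, h2, h3⟩ := ih (by omega) _ rfl
      rw [MState.iter]
      set T := MState.iter 4 (fun S => (MState.iter 5
        (fun S => S.store k (S.var 4) (S.var 5) (h S)) S S.len).set 5 (S.var 5)) S n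
      have hT : AgreeOff k S (T.set 4 n) := h1.set (Or.inl rfl) n
      have e4 : (T.set 4 n).var 4 = n := MState.set_var_self ..
      have e5 : (T.set 4 n).var 5 = S.var 5 := (MState.set_var_ne _ _ _ _ (by omega)).trans h2
      obtain ⟨g1, g2, g3⟩ := iter_store_row hc hT (by rw [e4]; omega) S.len le_rfl
      simp only [hT.len, e5]
      refine ⟨g1.set (Or.inr rfl) _, MState.set_var_self .., fun i j => ?_⟩
      rw [MState.set_arr, g3, e4, MState.set_arr, h3]
      by_cases hj : j < S.len
      · by_cases hi : i = n
        · rw [if_pos ⟨hi, hj⟩, if_pos ⟨by omega, hj⟩]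
        · rw [if_neg fun h => hi h.1]
          exact if_congr (by omega) rfl rfl
      · rw [if_neg fun h => hj h.2, if_neg fun h => hj h.2, if_neg fun h => hj h.2]
  obtain ⟨h1, h2, h3⟩ := key S.len le_rfl _ rfl
  rw [MState.fill]
  refine MState.ext' h1.len h1.q (fun x => ?_) fun k' i j => ?_
  · by_cases h4 : x = 4
    · subst h4; rw [MState.set_var_self]; rfl
    · rw [MState.set_var_ne _ _ _ _ h4]
      by_cases h5 : x = 5
      · subst h5; exact h2
      · exact h1.var x h4 h5
  · rw [MState.set_arr, MState.setArr]
    by_cases hk : k' = k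
    · subst hk
      simp only [Function.update_self]
      exact h3 i j
    · simp only [Function.update_of_ne hk, h1.arr k' hk]

end Fill

theorem Stmt.impl.{u} (s : Stmt) : ∃ F : ∀ (K : Type u) [Field K], MState K → MState K,
    ImplS F ∧ ∀ (K : Type u) [Field K] (S : MState K), (F K S).view = s.exec S.view := by
  induction s with
  | assign x a => exact ⟨_, .assign x a.impl, fun _ _ _ => rfl⟩
  | tab k f =>
    refine ⟨fun K _ S => (S.fill 1 fun S => f.eval S.view).fill (2 * k)
      fun S => if S.var 4 < S.len ∧ S.var 5 < S.len then S.arr 1 (S.var 4) (S.var 5) else 0,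
      .seq (.loop 4 (.loop 5 (.store 1 (.var 4) (.var 5) f.impl)))
        (.loop 4 (.loop 5 (.store (2 * k) (.var 4) (.var 5) (.load 1 (.var 4) (.var 5))))),
      fun K _ S => ?_⟩
    beta_reduce
    rw [fill_eq (k := 1) (c := fun i j => f.eval ((S.view.set 4 i).set 5 j)) (h := fun S =>
        f.eval S.view),
      fill_eq (k := 2 * k) (c := fun i j => f.eval ((S.view.set 4 i).set 5 j))]
    · refine MState.ext' rfl rfl (fun _ => rfl) fun k' i j => ?_
      simp only [Stmt.exec, MState.view, MState.setArr]
      by_cases hk : k' = k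
      · subst hk
        rw [Function.update_self, Function.update_self,
          Function.update_of_ne (show 2 * k' ≠ 1 by omega)]
        rfl
      · rw [Function.update_of_ne hk, Function.update_of_ne (show 2 * k' ≠ 2 * k by omega),
          Function.update_of_ne (show 2 * k' ≠ 1 by omega)]
    · intro S' hS' h4 h5
      have hlen : S'.len = S.len := hS'.len
      have h4' : S'.var 4 < S.len := h4
      have h5' : S'.var 5 < S.len := h5
      rw [if_pos (by rw [hlen]; exact ⟨h4', h5'⟩), hS'.arr 1 (by omega)]
      simp only [MState.setArr, Function.update_self]
      rw [if_pos ⟨h4', h5'⟩]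
    · intro S' hS' _ _
      congr 1
      refine MState.ext' hS'.len hS'.q (fun x => ?_) fun k' i j => ?_
      · by_cases h5 : x = 5
        · subst h5; rw [MState.set_var_self]; rfl
        · rw [MState.set_var_ne _ _ _ _ h5]
          by_cases h4 : x = 4
          · subst h4; rw [MState.set_var_self]; rfl
          · rw [MState.set_var_ne _ _ _ _ h4]
            exact hS'.var x h4 h5
      · exact congrFun (congrFun (hS'.arr (2 * k') (by omega)) i) j
  | seq s t hs ht =>
    obtain ⟨F, hF, hF'⟩ := hs
    obtain ⟨G, hG, hG'⟩ := ht
    exact ⟨_, .seq hF hG, fun K _ S => by rw [hG', hF']; rfl⟩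
  | loop x s hs =>
    obtain ⟨F, hF, hF'⟩ := hs
    refine ⟨_, .loop x hF, fun K _ S => ?_⟩
    have key : ∀ n, (MState.iter x (F K) S n).view = MState.iter x s.exec S.view n := by
      intro n
      induction n with
      | zero => rfl
      | succ n ih => rw [MState.iter, hF', MState.iter, ← ih]; rfl
    change ((MState.iter x (F K) S S.len).view).set x _ = _
    rw [key]
    rfl

/-! ## Solving systems of linear equations -/

section LinearAlgebra

variable {K : Type*} [Field K]

/-- The rows of an array, as vectors. -/
def rowVec (L : ℕ) (b : ℕ → ℕ → K) (i : Fin L) : Fin L → K := fun j => b i j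

theorem span_range_reduce {V : Type*} [AddCommGroup V] [Module K V] {ι : Type*} {b b' : ι → V}
    {φ : V →ₗ[K] K} {P : ι} (hP : (∃ i, φ (b i) ≠ 0) → φ (b P) ≠ 0)
    (hb : ∀ i, b' i = b i - (φ (b i) * (φ (b P))⁻¹) • b P) :
    Submodule.span K (Set.range b') = Submodule.span K (Set.range b) ⊓ LinearMap.ker φ := by
  by_cases h0 : ∃ i, φ (b i) ≠ 0
  · have hP := hP h0
    refine le_antisymm (Submodule.span_le.mpr ?_) fun x hx => ?_
    · rintro _ ⟨i, rfl⟩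
      refine Submodule.mem_inf.mpr ⟨?_, ?_⟩
      · rw [hb]
        exact sub_mem (Submodule.subset_span ⟨i, rfl⟩)
          (Submodule.smul_mem _ _ (Submodule.subset_span ⟨P, rfl⟩))
      · rw [LinearMap.mem_ker, hb, map_sub, map_smul, smul_eq_mul, mul_assoc,
          inv_mul_cancel₀ hP, mul_one, sub_self]
    · have key : ∀ y ∈ Submodule.span K (Set.range b),
          y - (φ y * (φ (b P))⁻¹) • b P ∈ Submodule.span K (Set.range b') := by
        intro y hy
        induction hy using Submodule.span_induction with
        | mem y hy =>
          obtain ⟨i, rfl⟩ := hy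
          rw [← hb]
          exact Submodule.subset_span ⟨i, rfl⟩
        | zero => simp
        | add y z _ _ hy hz =>
          have := add_mem hy hz
          rw [map_add, add_mul, add_smul]
          convert this using 1
          abel
        | smul c y _ hy =>
          have := Submodule.smul_mem _ c hy
          rwa [smul_sub, smul_smul, ← mul_assoc, ← smul_eq_mul (a := c) (b := φ y),
            ← map_smul] at this
      obtain ⟨hx1, hx2⟩ := Submodule.mem_inf.mp hx
      have := key x hx1
      rwa [LinearMap.mem_ker.mp hx2, zero_mul, zero_smul, sub_zero] at this
  · push Not at h0
    have : b' = b := by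
      funext i
      rw [hb, h0, zero_mul, zero_smul, sub_zero]
    rw [this, eq_comm, inf_eq_left]
    refine Submodule.span_le.mpr ?_
    rintro _ ⟨i, rfl⟩
    exact h0 i

end LinearAlgebra

section Programs

variable {K : Type*}

/-- The states differ in the variables `4`, …, `9` and in arrays from the `κ`-th on only. -/
structure Frame (κ : ℕ) (S S' : MState K) : Prop where
  len : S'.len = S.len
  q : S'.q = S.q
  var : ∀ x, x < 4 ∨ 10 ≤ x → S'.var x = S.var x
  arr : ∀ k < κ, S'.arr k = S.arr k

namespace Frame

variable {κ : ℕ} {S S' S'' : MState K}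

theorem refl (κ : ℕ) (S : MState K) : Frame κ S S := ⟨rfl, rfl, fun _ _ => rfl, fun _ _ => rfl⟩

theorem trans (h : Frame κ S S') (h' : Frame κ S' S'') : Frame κ S S'' :=
  ⟨h'.len.trans h.len, h'.q.trans h.q, fun x hx => (h'.var x hx).trans (h.var x hx),
    fun k hk => (h'.arr k hk).trans (h.arr k hk)⟩

theorem mono {κ' : ℕ} (hκ : κ' ≤ κ) (h : Frame κ S S') : Frame κ' S S' :=
  ⟨h.len, h.q, h.var, fun k hk => h.arr k (hk.trans_le hκ)⟩

theorem set (h : Frame κ S S') {x : ℕ} (hx : 4 ≤ x) (hx' : x < 10) (v : ℕ) :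
    Frame κ S (S'.set x v) :=
  ⟨h.len, h.q, fun y hy => (MState.set_var_ne _ _ _ _ (by omega)).trans (h.var y hy), h.arr⟩

theorem setArr (h : Frame κ S S') {k : ℕ} (hk : κ ≤ k) (b : ℕ → ℕ → K) :
    Frame κ S (S'.setArr k b) :=
  ⟨h.len, h.q, h.var, fun k' hk' =>
    (Function.update_of_ne (by omega : k' ≠ k) _ _).trans (h.arr k' hk')⟩

end Frame

@[simp] theorem MState.setArr_len (S : MState K) (k : ℕ) (b : ℕ → ℕ → K) :
    (S.setArr k b).len = S.len := rfl

theorem MState.setArr_arr_self (S : MState K) (k : ℕ) (b : ℕ → ℕ → K) {i j : ℕ} (hi : i < S.len)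
    (hj : j < S.len) : (S.setArr k b).arr k i j = b i j := by
  simp only [MState.setArr, Function.update_self]
  rw [if_pos ⟨hi, hj⟩]

theorem MState.setArr_arr_ne (S : MState K) {k k' : ℕ} (h : k' ≠ k) (b : ℕ → ℕ → K) :
    (S.setArr k b).arr k' = S.arr k' := Function.update_of_ne h ..

variable [Field K]

/-- Variable `8` becomes a value of the variable `9` with the property `c`, if there is one. -/
def Stmt.find (c : NExp) : Stmt :=
  .seq (.assign 8 (.const 0)) (.loop 9 (.assign 8 (.ite c (.var 9) (.var 8))))

theorem Stmt.exec_find {c : NExp} {S : MState K} {g : ℕ → ℕ} (hL : 0 < S.len)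
    (hc : ∀ p v, v < S.len → c.eval ((S.set 8 p).set 9 v) = g v) :
    ∃ p < S.len, (Stmt.find c).exec S = S.set 8 p ∧ ((∃ i < S.len, g i ≠ 0) → g p ≠ 0) := by
  have key : ∀ n ≤ S.len, ∃ p < S.len, ∃ v,
      MState.iter 9 (Stmt.assign 8 (.ite c (.var 9) (.var 8))).exec (S.set 8 0) n =
        (S.set 8 p).set 9 v ∧ ((∃ i < n, g i ≠ 0) → g p ≠ 0) := by
    intro n
    induction n with
    | zero =>
      refine fun _ => ⟨0, hL, S.var 9, ?_, fun ⟨i, hi, _⟩ => absurd hi (Nat.not_lt_zero _)⟩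
      refine MState.ext' rfl rfl (fun x => ?_) fun _ _ _ => rfl
      by_cases h : x = 9
      · subst h; simp [MState.iter, MState.set]
      · rw [MState.set_var_ne _ _ _ _ h]; rfl
    | succ n ih =>
      intro hn
      obtain ⟨p, hp, v, h1, h2⟩ := ih (by omega)
      rw [MState.iter, h1]
      have e1 : ((S.set 8 p).set 9 v).set 9 n = (S.set 8 p).set 9 n :=
        MState.ext' rfl rfl (fun x => by simp [MState.set]) fun _ _ _ => rfl
      have e2 : ∀ p', ((S.set 8 p).set 9 n).set 8 p' = (S.set 8 p').set 9 n := by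
        intro p'
        refine MState.ext' rfl rfl (fun x => ?_) fun _ _ _ => rfl
        simp only [MState.set]
        by_cases h8 : x = 8
        · subst h8; simp
        · by_cases h9 : x = 9
          · subst h9; simp
          · simp [Function.update_of_ne, h8, h9]
      rw [e1, Stmt.exec, e2]
      have e3 : ((S.set 8 p).set 9 n).var 8 = p := by
        rw [MState.set_var_ne _ _ _ _ (by omega), MState.set_var_self]
      simp only [NExp.eval_ite, NExp.eval_var, hc p n (by omega), MState.set_var_self, e3]
      by_cases h0 : g n ≠ 0
      · rw [if_pos h0]
        exact ⟨n, by omega, n, rfl, fun _ => h0⟩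
      · rw [if_neg h0]
        refine ⟨p, hp, n, rfl, fun ⟨i, hi, hi'⟩ => h2 ⟨i, ?_, hi'⟩⟩
        rcases Nat.lt_succ_iff_lt_or_eq.mp hi with h | rfl
        · exact h
        · exact absurd hi' h0
  obtain ⟨p, hp, v, h1, h2⟩ := key S.len le_rfl
  refine ⟨p, hp, ?_, h2⟩
  simp only [Stmt.find, Stmt.exec, NExp.eval_const, MState.set_len] at h1 ⊢
  rw [h1]
  refine MState.ext' rfl rfl (fun x => ?_) fun _ _ _ => rfl
  simp only [MState.set]
  by_cases h9 : x = 9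
  · subst h9; simp
  · simp [Function.update_of_ne, h9]

/-- The product of the linear form `φ` with the row of the array `3` given by a variable. -/
def FExp.dotRow (φ : FExp) (x : ℕ) : FExp := .sum 7 (.mul φ (.load 3 (.var x) (.var 7)))

/-- Intersecting the span of the rows of the array `3` with the kernel of the linear form `φ`
(in the variable `7`). -/
def Stmt.imposeEq (φ : FExp) : Stmt :=
  .seq (.find (.sub (.const 1) (.isz (φ.dotRow 9))))
    (.tab 3 (.sub (.load 3 (.var 4) (.var 5))
      (.mul (.mul (φ.dotRow 4) (.inv (φ.dotRow 8))) (.load 3 (.var 8) (.var 5)))))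

/-- The linear form with given coefficients. -/
def linForm (L : ℕ) (a : ℕ → K) : (Fin L → K) →ₗ[K] K := ∑ u : Fin L, a u • LinearMap.proj u

theorem linForm_apply (L : ℕ) (a : ℕ → K) (x : Fin L → K) : linForm L a x = ∑ u : Fin L, a u * x u := by
  simp [linForm]

theorem FExp.eval_dotRow {φ : FExp} {S : MState K} {a : ℕ → K}
    (hφ : ∀ u < S.len, φ.eval (S.set 7 u) = a u) {x : ℕ} (hx : x ≠ 7) (hx' : S.var x < S.len) :
    (φ.dotRow x).eval S = linForm S.len a (rowVec S.len (S.arr 3) ⟨S.var x, hx'⟩) := by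
  rw [FExp.dotRow, FExp.eval_sum, linForm_apply, Finset.sum_range]
  refine Finset.sum_congr rfl fun u _ => ?_
  simp only [FExp.eval_mul, FExp.eval_load, NExp.eval_var, MState.set_var_ne _ _ _ _ hx,
    MState.set_var_self, MState.set_len, hφ u u.2, MState.set_arr]
  rw [if_pos ⟨hx', u.2⟩]
  rfl

theorem Stmt.exec_imposeEq {φ : FExp} {S : MState K} {a : ℕ → K} (hL : 0 < S.len)
    (hφ : ∀ S', Frame 3 S S' → S'.var 6 = S.var 6 → S'.var 7 < S.len → φ.eval S' = a (S'.var 7)) :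
    Frame 3 S ((Stmt.imposeEq φ).exec S) ∧ ((Stmt.imposeEq φ).exec S).var 6 = S.var 6 ∧
    Submodule.span K (Set.range (rowVec S.len (((Stmt.imposeEq φ).exec S).arr 3))) =
      Submodule.span K (Set.range (rowVec S.len (S.arr 3))) ⊓ LinearMap.ker (linForm S.len a) := by
  classical
  have hφ' : ∀ S', Frame 3 S S' → S'.var 6 = S.var 6 → ∀ u < S'.len, φ.eval (S'.set 7 u) = a u := by
    intro S' h h6 u hu
    rw [hφ _ (h.set (by omega) (by omega) u)
      ((MState.set_var_ne _ _ _ _ (by omega)).trans h6)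
      (by rw [MState.set_var_self, ← h.len]; exact hu), MState.set_var_self]
  let g : ℕ → ℕ := fun v => if h : v < S.len then
    if linForm S.len a (rowVec S.len (S.arr 3) ⟨v, h⟩) = 0 then 0 else 1 else 0
  obtain ⟨p, hp, h1, h2⟩ := Stmt.exec_find (c := .sub (.const 1) (.isz (φ.dotRow 9))) (S := S)
    (g := g) hL (by
      intro p v hv
      have hf : Frame 3 S ((S.set 8 p).set 9 v) :=
        ((Frame.refl 3 S).set (by omega) (by omega) p).set (by omega) (by omega) v
      have e := FExp.eval_dotRow (φ := φ) (S := (S.set 8 p).set 9 v) (a := a)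
        (hφ' _ hf rfl) (x := 9) (by omega) (by rw [MState.set_var_self]; exact hv)
      simp only [NExp.eval_sub, NExp.eval_const, NExp.eval_isz, e, MState.set_var_self,
        MState.set_arr, g, dif_pos hv, MState.set_len]
      split_ifs <;> first | rfl | contradiction)
  have h3 : ∀ i (h : i < S.len), g i ≠ 0 ↔ linForm S.len a (rowVec S.len (S.arr 3) ⟨i, h⟩) ≠ 0 := by
    intro i h
    simp only [g, dif_pos h]
    split_ifs with h' <;> simp [h']
  have hf8 : Frame 3 S (S.set 8 p) := (Frame.refl 3 S).set (by omega) (by omega) p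
  have h6 : (S.set 8 p).var 6 = S.var 6 := rfl
  rw [Stmt.imposeEq, Stmt.exec, h1, Stmt.exec]
  refine ⟨hf8.setArr le_rfl _, rfl, ?_⟩
  refine span_range_reduce (P := ⟨p, hp⟩) (fun ⟨i, hi⟩ => (h3 p hp).1 (h2 ⟨i, i.2, (h3 i i.2).2 hi⟩))
    fun i => ?_
  funext j
  rw [rowVec, MState.setArr_arr_self _ _ _ (by exact i.2) (by exact j.2)]
  have hf : Frame 3 S (((S.set 8 p).set 4 i).set 5 j) :=
    (hf8.set (by omega) (by omega) _).set (by omega) (by omega) _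
  have v4 : (((S.set 8 p).set 4 i).set 5 j).var 4 = i := by
    rw [MState.set_var_ne _ _ _ _ (by omega), MState.set_var_self]
  have v5 : (((S.set 8 p).set 4 i).set 5 j).var 5 = j := MState.set_var_self ..
  have v8 : (((S.set 8 p).set 4 i).set 5 j).var 8 = p := by
    rw [MState.set_var_ne _ _ _ _ (by omega), MState.set_var_ne _ _ _ _ (by omega),
      MState.set_var_self]
  have e4 := FExp.eval_dotRow (hφ' _ hf rfl) (x := 4) (by omega) (by rw [v4]; exact i.2)
  have e8 := FExp.eval_dotRow (hφ' _ hf rfl) (x := 8) (by omega) (by rw [v8]; exact hp)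
  simp only [FExp.eval_sub, FExp.eval_mul, FExp.eval_inv, e4, e8, FExp.eval_load, NExp.eval_var,
    v4, v5, v8, MState.set_len, MState.set_arr, i.2, j.2, hp, and_self, if_true, Pi.sub_apply,
    Pi.smul_apply, smul_eq_mul, rowVec]
  rfl

/-- Executing statements one after the other. -/
def Stmt.block : List Stmt → Stmt
  | [] => .assign 8 (.const 0)
  | s :: l => .seq s (Stmt.block l)

/-- Computing vectors which span the solutions of the linear equations `φ = 0` for all `φ` in the
list and all values of the variable `6`, supported on the indices with the property `valid`. -/
def Stmt.solve (valid : NExp) (φs : List FExp) : Stmt :=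
  .seq (.tab 3 (.ite valid (.ite (.sub (.var 4) (.var 5)) .zero
      (.ite (.sub (.var 5) (.var 4)) .zero .one)) .zero))
    (.loop 6 (.block (φs.map Stmt.imposeEq)))

theorem Stmt.exec_block_imposeEq {φs : List FExp} {S : MState K} {a : FExp → ℕ → K}
    (hL : 0 < S.len) : ∀ (T : MState K) (_ : Frame 3 S T)
    (_ : ∀ φ ∈ φs, ∀ S', Frame 3 S S' → S'.var 6 = T.var 6 → S'.var 7 < S.len →
      φ.eval S' = a φ (S'.var 7)),
    Frame 3 S ((Stmt.block (φs.map Stmt.imposeEq)).exec T) ∧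
    ∀ x, x ∈ Submodule.span K (Set.range (rowVec S.len
        (((Stmt.block (φs.map Stmt.imposeEq)).exec T).arr 3))) ↔
      x ∈ Submodule.span K (Set.range (rowVec S.len (T.arr 3))) ∧
        ∀ φ ∈ φs, ∑ u : Fin S.len, a φ u * x u = 0 := by
  induction φs with
  | nil => exact fun T hT _ => ⟨hT.set (by omega) (by omega) _, fun x => by simp [Stmt.block, Stmt.exec]⟩
  | cons φ l ih =>
    intro T hT hφ
    obtain ⟨h1, h2, h3⟩ := Stmt.exec_imposeEq (φ := φ) (S := T) (a := a φ) (by rw [hT.len]; exact hL)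
      (fun S' hS' h6 h7 => hφ φ (by simp) S' (hT.trans hS') h6 (by rwa [hT.len] at h7))
    obtain ⟨g1, g2⟩ := ih ((Stmt.imposeEq φ).exec T) (hT.trans h1)
      (fun ψ hψ S' hS' h6 h7 => hφ ψ (by simp [hψ]) S' hS' (h6.trans h2) h7)
    refine ⟨g1, fun x => ?_⟩
    rw [hT.len] at h3
    refine (g2 x).trans ?_
    rw [h3, Submodule.mem_inf, LinearMap.mem_ker, linForm_apply, List.forall_mem_cons, and_assoc]

theorem Stmt.exec_solve {valid : NExp} {φs : List FExp} {S : MState K} {V : ℕ → Prop}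
    {a : FExp → ℕ → ℕ → K} (hL : 0 < S.len)
    (hv : ∀ S', Frame 3 S S' → S'.var 4 < S.len → (valid.eval S' ≠ 0 ↔ V (S'.var 4)))
    (hφ : ∀ φ ∈ φs, ∀ S', Frame 3 S S' → S'.var 6 < S.len → S'.var 7 < S.len →
      φ.eval S' = a φ (S'.var 6) (S'.var 7)) :
    Frame 3 S ((Stmt.solve valid φs).exec S) ∧
    ∀ x, x ∈ Submodule.span K (Set.range (rowVec S.len (((Stmt.solve valid φs).exec S).arr 3))) ↔
      (∀ u : Fin S.len, ¬V u → x u = 0) ∧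
        ∀ z < S.len, ∀ φ ∈ φs, ∑ u : Fin S.len, a φ z u * x u = 0 := by
  classical
  set T := (Stmt.tab 3 (.ite valid (.ite (.sub (.var 4) (.var 5)) .zero
      (.ite (.sub (.var 5) (.var 4)) .zero .one)) .zero)).exec S with hT
  have hfT : Frame 3 S T := (Frame.refl 3 S).setArr le_rfl _
  have hrow : ∀ i : Fin S.len, rowVec S.len (T.arr 3) i = if V i then Pi.single i 1 else 0 := by
    intro i
    funext j
    rw [rowVec, hT, Stmt.exec, MState.setArr_arr_self _ _ _ i.2 j.2]
    have hf : Frame 3 S ((S.set 4 i).set 5 j) :=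
      ((Frame.refl 3 S).set (by omega) (by omega) _).set (by omega) (by omega) _
    have v4 : ((S.set 4 i).set 5 j).var 4 = i := by
      rw [MState.set_var_ne _ _ _ _ (by omega), MState.set_var_self]
    have v5 : ((S.set 4 i).set 5 j).var 5 = j := MState.set_var_self ..
    have := hv _ hf (by rw [v4]; exact i.2)
    simp only [FExp.eval_ite, this, v4, NExp.eval_sub, NExp.eval_var, v5, FExp.eval_zero,
      FExp.eval_one]
    by_cases hV : V i
    · rw [if_pos hV, if_pos hV, Pi.single_apply]
      by_cases hij : j = i
      · subst hij; simp
      · have : (i : ℕ) ≠ j := fun h => hij (Fin.ext h.symm)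
        rw [if_neg hij]
        split_ifs <;> first | rfl | omega
    · rw [if_neg hV, if_neg hV]; rfl
  have hspan : ∀ x, x ∈ Submodule.span K (Set.range (rowVec S.len (T.arr 3))) ↔
      ∀ u : Fin S.len, ¬V u → x u = 0 := by
    intro x
    constructor
    · intro hx u hu
      have : Submodule.span K (Set.range (rowVec S.len (T.arr 3))) ≤
          LinearMap.ker (LinearMap.proj (R := K) (φ := fun _ : Fin S.len => K) u) := by
        refine Submodule.span_le.mpr ?_
        rintro _ ⟨i, rfl⟩
        rw [hrow]
        split_ifs with hi
        · have : i ≠ u := fun h => hu (h ▸ hi)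
          simp [this.symm]
        · exact zero_mem _
      exact this hx
    · intro hx
      have : x = ∑ u, x u • rowVec S.len (T.arr 3) u := by
        rw [← Finset.univ_sum_single x]
        simp only [hrow]
        funext j
        simp only [Finset.sum_apply, Pi.smul_apply, smul_eq_mul]
        refine Finset.sum_congr rfl fun u _ => ?_
        by_cases hu : V u
        · rw [if_pos hu, Pi.single_apply, Pi.single_apply]
          split_ifs with h
          · subst h; simp [Pi.single_apply]
          · simp
        · rw [if_neg hu, hx u hu]; simp
      rw [this]
      exact Submodule.sum_mem _ fun u _ => Submodule.smul_mem _ _ (Submodule.subset_span ⟨u, rfl⟩)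
  have key : ∀ n ≤ S.len,
      Frame 3 S (MState.iter 6 (Stmt.block (φs.map Stmt.imposeEq)).exec T n) ∧
      ∀ x, x ∈ Submodule.span K (Set.range (rowVec S.len
        ((MState.iter 6 (Stmt.block (φs.map Stmt.imposeEq)).exec T n).arr 3))) ↔
      (∀ u : Fin S.len, ¬V u → x u = 0) ∧
        ∀ z < n, ∀ φ ∈ φs, ∑ u : Fin S.len, a φ z u * x u = 0 := by
    intro n
    induction n with
    | zero => exact fun _ => ⟨hfT, fun x => by simp [MState.iter, hspan x]⟩
    | succ n ih =>
      intro hn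
      obtain ⟨h1, h2⟩ := ih (by omega)
      rw [MState.iter]
      set R := MState.iter 6 (Stmt.block (φs.map Stmt.imposeEq)).exec T n
      obtain ⟨g1, g2⟩ := Stmt.exec_block_imposeEq (φs := φs) (S := S) (a := fun φ => a φ n) hL
        (R.set 6 n) (h1.set (by omega) (by omega) n) (by
          intro φ hφs S' hS' h6 h7
          rw [MState.set_var_self] at h6
          rw [hφ φ hφs S' hS' (by rw [h6]; omega) h7, h6])
      refine ⟨g1, fun x => (g2 x).trans ?_⟩
      rw [MState.set_arr, h2, and_assoc]
      refine and_congr_right fun _ => ⟨fun ⟨h, h'⟩ z hz => ?_, fun h => ⟨fun z hz => h z (by omega),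
        h n (by omega)⟩⟩
      rcases Nat.lt_succ_iff_lt_or_eq.mp hz with hz | rfl
      · exact h z hz
      · exact h'
  obtain ⟨h1, h2⟩ := key S.len le_rfl
  rw [Stmt.solve, Stmt.exec, ← hT, Stmt.exec, hfT.len]
  exact ⟨h1.set (by omega) (by omega) _, h2⟩

end Programs

/-! ## Polynomials with coefficients given by digits -/

section Digits

variable {m : ℕ}

/-- The digits of `e` in base `B`. -/
def digits (B e : ℕ) (j : Fin m) : ℕ := e / B ^ (j : ℕ) % B

theorem digits_lt {B : ℕ} (hB : 0 < B) (e : ℕ) (j : Fin m) : digits B e j < B := Nat.mod_lt _ hB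

theorem digits_finFunctionFinEquiv {B : ℕ} (f : Fin m → Fin B) :
    digits B (finFunctionFinEquiv f : ℕ) = fun j => (f j : ℕ) :=
  funext fun j => congrArg (fun g : Fin m → Fin B => (g j : ℕ)) (finFunctionFinEquiv.symm_apply_apply f)

theorem exists_digits_eq {B : ℕ} (f : Fin m → ℕ) (hf : ∀ j, f j < B) :
    ∃ e < B ^ m, digits B e = f :=
  ⟨_, (finFunctionFinEquiv fun j => (⟨f j, hf j⟩ : Fin B)).2, digits_finFunctionFinEquiv _⟩

theorem digits_injOn {B e e' : ℕ} (he : e < B ^ m) (he' : e' < B ^ m)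
    (h : (digits B e : Fin m → ℕ) = digits B e') : e = e' := by
  have : finFunctionFinEquiv.symm (⟨e, he⟩ : Fin (B ^ m)) =
      finFunctionFinEquiv.symm (⟨e', he'⟩ : Fin (B ^ m)) :=
    funext fun j => Fin.ext (congrFun h j)
  exact congrArg Fin.val (finFunctionFinEquiv.symm.injective this)

/-- The exponent of a monomial which is given by digits. -/
noncomputable def expo (m B e : ℕ) : Fin m →₀ ℕ := Finsupp.equivFunOnFinite.symm (digits B e)

theorem coe_expo (B e : ℕ) : ⇑(expo m B e) = digits B e := rfl

theorem expo_inj {B e e' : ℕ} (he : e < B ^ m) (he' : e' < B ^ m) :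
    expo m B e = expo m B e' ↔ e = e' :=
  ⟨fun h => digits_injOn he he' (congrArg DFunLike.coe h), fun h => h ▸ rfl⟩

theorem sum_range_mul (r H : ℕ) {M : Type*} [AddCommMonoid M] (g : ℕ → ℕ → M) :
    ∑ u ∈ Finset.range (r * H), g (u % r) (u / r) =
      ∑ i ∈ Finset.range r, ∑ h ∈ Finset.range H, g i h := by
  rcases Nat.eq_zero_or_pos r with rfl | hr
  · simp
  induction H with
  | zero => simp
  | succ H ih =>
    rw [Nat.mul_succ, Finset.sum_range_add, ih]
    simp only [Finset.sum_range_succ, Finset.sum_add_distrib]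
    congr 1
    refine Finset.sum_congr rfl fun i hi => ?_
    have hi := Finset.mem_range.mp hi
    rw [Nat.mul_add_mod, Nat.mod_eq_of_lt hi, Nat.mul_add_div hr, Nat.div_eq_of_lt hi, add_zero]

variable {K : Type*} [Field K]

/-- The polynomial in which `c h` is the coefficient of the monomial with the digits of `h` in base
`B` as its exponents. -/
noncomputable def digitPoly (m B : ℕ) (c : ℕ → K) : MvPolynomial (Fin m) K :=
  ∑ h ∈ Finset.range (B ^ m), MvPolynomial.monomial (expo m B h) (c h)

theorem coeff_digitPoly {B h : ℕ} (hh : h < B ^ m) (c : ℕ → K) :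
    (digitPoly m B c).coeff (expo m B h) = c h := by
  rw [digitPoly, MvPolynomial.coeff_sum, Finset.sum_eq_single h]
  · rw [MvPolynomial.coeff_monomial, if_pos rfl]
  · intro h' hh' hne
    rw [MvPolynomial.coeff_monomial, if_neg fun he => hne ((expo_inj (Finset.mem_range.mp hh') hh).mp he)]
  · exact fun h' => absurd (Finset.mem_range.mpr hh) h'

theorem eval_digitPoly (B : ℕ) (c : ℕ → K) (y : Fin m → K) :
    MvPolynomial.eval y (digitPoly m B c) =
      ∑ h ∈ Finset.range (B ^ m), c h * ∏ j, y j ^ digits B h j := by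
  rw [digitPoly, map_sum]
  refine Finset.sum_congr rfl fun h _ => ?_
  rw [MvPolynomial.eval_monomial, Finsupp.prod_fintype _ _ (by simp)]
  rfl

theorem totalDegree_digitPoly_le {B T : ℕ} {c : ℕ → K}
    (hc : ∀ h < B ^ m, T < ∑ j : Fin m, digits B h j → c h = 0) :
    (digitPoly m B c).totalDegree ≤ T := by
  refine (MvPolynomial.totalDegree_finsetSum _ _).trans (Finset.sup_le fun h hh => ?_)
  by_cases h0 : T < ∑ j : Fin m, digits B h j
  · rw [hc h (Finset.mem_range.mp hh) h0, MvPolynomial.monomial_zero, MvPolynomial.totalDegree_zero]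
    exact Nat.zero_le _
  · refine (MvPolynomial.totalDegree_monomial_le _ _).trans ?_
    rw [Finsupp.sum_fintype _ _ (by simp)]
    exact not_lt.mp h0

theorem eval_qDerivIter_digitPoly {Q : K} (hQ0 : Q ≠ 0) (hQ : Q ≠ 1) {a : Fin m → K}
    (ha : ∀ i, a i ≠ 0) (γ : Fin m → ℕ) (B : ℕ) (c : ℕ → K) :
    MvPolynomial.eval a (qDerivIter Q γ (digitPoly m B c)) =
      ∑ h ∈ Finset.range (B ^ m), c h * monoDerivVal Q a (digits B h) (idxList γ) 0 := by
  rw [← qDerivIterLin_apply, digitPoly, map_sum, map_sum]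
  refine Finset.sum_congr rfl fun h _ => ?_
  have h1 := monoDerivVal_eq hQ0 hQ ha (expo m B h) (idxList γ) 0
  rw [coe_expo, qPoint_zero, ← qDerivIter_eq_foldr, ← qDerivIterLin_apply] at h1
  rw [h1, ← MvPolynomial.smul_eval, ← map_smul, MvPolynomial.smul_monomial, smul_eq_mul, mul_one]

theorem eq_digitPoly {B : ℕ} {f : MvPolynomial (Fin m) K} (hf : f.totalDegree < B) :
    f = digitPoly m B fun h => f.coeff (expo m B h) := by
  refine MvPolynomial.ext _ _ fun e => ?_
  by_cases he : ∀ j, e j < B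
  · obtain ⟨h, hh, h1⟩ := exists_digits_eq e he
    have : e = expo m B h := DFunLike.coe_injective (by rw [coe_expo, h1])
    rw [this, coeff_digitPoly hh]
  · push Not at he
    obtain ⟨j, hj⟩ := he
    rw [MvPolynomial.coeff_eq_zero_of_totalDegree_lt]
    · rw [digitPoly, MvPolynomial.coeff_sum, Finset.sum_eq_zero]
      intro h _
      rw [MvPolynomial.coeff_monomial, if_neg]
      rintro rfl
      exact absurd (digits_lt (by omega) h j) (not_lt.mpr hj)
    · refine lt_of_lt_of_le hf (hj.trans ?_)
      by_cases h0 : e j = 0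
      · omega
      · exact Finset.single_le_sum (f := e) (fun _ _ => Nat.zero_le _) (Finsupp.mem_support_iff.mpr h0)

theorem digitPoly_smul (B : ℕ) (x : K) (c : ℕ → K) :
    digitPoly m B (fun h => x * c h) = x • digitPoly m B c := by
  rw [digitPoly, digitPoly, Finset.smul_sum]
  exact Finset.sum_congr rfl fun h _ => by rw [MvPolynomial.smul_monomial, smul_eq_mul]

end Digits

/-! ## Interpolation of a recurrence -/

section Interpolation

variable {K : Type*} [Field K] {m : ℕ}

/-- The coefficient of the `u`-th unknown in the interpolation condition at the point `Q^β a`, where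
`w` is the received symbol at `a`. The unknown `i + r h` is the coefficient of the monomial with
the digits of `h` in base `B` in the `i`-th polynomial. -/
noncomputable def interpCoeff (Q : K) (B r : ℕ) (l : Fin m) (a : Fin m → K) (w : (Fin m → ℕ) → K)
    (β : Fin m → ℕ) (u : ℕ) : K :=
  (∏ j, qPoint Q β a j ^ digits B (u / r) j) *
    shiftVal Q a w (idxList (β + Pi.single l (u % r))) 0

/-- The unknowns of the interpolation problem. -/
def IsInterpIdx (m B r T u : ℕ) : Prop := u < r * B ^ m ∧ ∑ j : Fin m, digits B (u / r) j ≤ T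

theorem sum_interpCoeff (Q : K) (B r : ℕ) (l : Fin m) (a : Fin m → K) (w : (Fin m → ℕ) → K)
    (β : Fin m → ℕ) (x : ℕ → K) :
    ∑ u ∈ Finset.range (r * B ^ m), interpCoeff Q B r l a w β u * x u =
      ∑ i ∈ Finset.range r, MvPolynomial.eval (qPoint Q β a)
        (digitPoly m B fun h => x (i + r * h)) * shiftVal Q a w (idxList (β + Pi.single l i)) 0 := by
  have h1 := sum_range_mul r (B ^ m) fun i h => (∏ j, qPoint Q β a j ^ digits B h j) *
    shiftVal Q a w (idxList (β + Pi.single l i)) 0 * x (i + r * h)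
  simp only [Nat.mod_add_div] at h1
  simp only [interpCoeff]
  rw [h1]
  refine Finset.sum_congr rfl fun i _ => ?_
  rw [eval_digitPoly, Finset.sum_mul]
  exact Finset.sum_congr rfl fun h _ => by ring

theorem totalDegree_interp_le {B r T i : ℕ} (hi : i < r) {x : ℕ → K}
    (hx : ∀ u, ¬IsInterpIdx m B r T u → x u = 0) :
    (digitPoly m B fun h => x (i + r * h)).totalDegree ≤ T := by
  refine totalDegree_digitPoly_le fun h _ hT => hx _ fun h1 => ?_
  have := h1.2
  rw [Nat.add_mul_div_left _ _ (by omega), Nat.div_eq_of_lt hi, zero_add] at this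
  omega

theorem exists_interp_ne_zero {B r T u : ℕ} {x : ℕ → K} (hu : IsInterpIdx m B r T u)
    (hx : x u ≠ 0) : ∃ i < r, (digitPoly m B fun h => x (i + r * h)) ≠ 0 := by
  have hr : 0 < r := Nat.pos_of_ne_zero fun h => by simp [IsInterpIdx, h] at hu
  refine ⟨u % r, Nat.mod_lt _ hr, fun h => hx ?_⟩
  have := coeff_digitPoly (m := m) (B := B) (h := u / r)
    (Nat.div_lt_of_lt_mul hu.1) (fun h => x (u % r + r * h))
  rwa [h, MvPolynomial.coeff_zero, Nat.mod_add_div, eq_comm] at this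

theorem exists_interp {N B r T M : ℕ} (hr : 1 ≤ r) (hB : T < B)
    (hcard : N * (simplex m M).card < r * (simplex m (T + 1)).card)
    (φ : ℕ → (Fin m → ℕ) → ℕ → K) :
    ∃ x : ℕ → K, (∀ u, ¬IsInterpIdx m B r T u → x u = 0) ∧ (∃ u, x u ≠ 0) ∧
      ∀ p < N, ∀ β ∈ simplex m M, ∑ u ∈ Finset.range (r * B ^ m), φ p β u * x u = 0 := by
  classical
  set I := (Finset.range (r * B ^ m)).filter fun u => ∑ j : Fin m, digits B (u / r) j ≤ T with hI
  have hIcard : r * (simplex m (T + 1)).card ≤ I.card := by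
    have hex : ∀ γ ∈ simplex m (T + 1), ∃ e < B ^ m, (digits B e : Fin m → ℕ) = γ := fun γ hγ =>
      exists_digits_eq γ fun j => by
        have := mem_simplex.mp hγ
        have := Finset.single_le_sum (f := γ) (fun _ _ => Nat.zero_le _) (Finset.mem_univ j)
        omega
    choose! code hcode1 hcode2 using hex
    have hc := Finset.card_product (Finset.range r) (simplex m (T + 1))
    rw [Finset.card_range] at hc
    rw [← hc]
    refine Finset.card_le_card_of_injOn (fun q => q.1 + r * code q.2) ?_ ?_
    · rintro ⟨i, γ⟩ h
      obtain ⟨h1, h2⟩ := Finset.mem_product.mp (Finset.mem_coe.mp h)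
      have h1 := Finset.mem_range.mp h1
      simp only at h1 h2
      have h3 : (i + r * code γ) / r = code γ := by
        rw [Nat.add_mul_div_left _ _ (by omega), Nat.div_eq_of_lt h1, zero_add]
      refine Finset.mem_coe.mpr (Finset.mem_filter.mpr ⟨Finset.mem_range.mpr ?_, ?_⟩)
      · have h4 := hcode1 γ h2
        calc i + r * code γ < r + r * code γ := by omega
          _ = r * (code γ + 1) := by ring
          _ ≤ r * B ^ m := Nat.mul_le_mul_left _ h4
      · simp only [h3, hcode2 γ h2]
        have := mem_simplex.mp h2
        omega
    · rintro ⟨i, γ⟩ h ⟨i', γ'⟩ h' heq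
      obtain ⟨h1, h2⟩ := Finset.mem_product.mp (Finset.mem_coe.mp h)
      obtain ⟨h1', h2'⟩ := Finset.mem_product.mp (Finset.mem_coe.mp h')
      have h1 := Finset.mem_range.mp h1
      have h1' := Finset.mem_range.mp h1'
      simp only at h1 h2 h1' h2' heq
      have e1 : i = i' := by
        have := congrArg (· % r) heq
        simpa [Nat.add_mul_mod_self_left, Nat.mod_eq_of_lt h1, Nat.mod_eq_of_lt h1'] using this
      have e2 : code γ = code γ' := by
        subst e1
        exact Nat.eq_of_mul_eq_mul_left (by omega) (Nat.add_left_cancel heq)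
      rw [Prod.mk.injEq]
      exact ⟨e1, by rw [← hcode2 γ h2, ← hcode2 γ' h2', e2]⟩
  let Φ : (I → K) →ₗ[K] (Fin N × simplex m M → K) :=
    LinearMap.pi fun q => ∑ u : I, φ q.1 q.2.1 u • LinearMap.proj u
  have hΦ : LinearMap.ker Φ ≠ ⊥ := by
    refine LinearMap.ker_ne_bot_of_finrank_lt ?_
    rw [Module.finrank_fintype_fun_eq_card, Module.finrank_fintype_fun_eq_card, Fintype.card_prod,
      Fintype.card_fin, Fintype.card_coe, Fintype.card_coe]
    exact hcard.trans_le hIcard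
  obtain ⟨y, hy, hy0⟩ := (Submodule.ne_bot_iff _).mp hΦ
  have hmem : ∀ u, u ∈ I ↔ IsInterpIdx m B r T u := fun u => by
    rw [hI, Finset.mem_filter, Finset.mem_range, IsInterpIdx]
  refine ⟨fun u => if h : u ∈ I then y ⟨u, h⟩ else 0, fun u hu => ?_, ?_, fun p hp β hβ => ?_⟩
  · exact dif_neg fun h => hu ((hmem u).mp h)
  · obtain ⟨u, hu⟩ := Function.ne_iff.mp hy0
    exact ⟨u, fun h => hu ((dif_pos u.2).symm.trans h)⟩
  · have h1 := congrFun (LinearMap.mem_ker.mp hy) (⟨p, hp⟩, ⟨β, hβ⟩)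
    simp only [Φ, LinearMap.pi_apply, LinearMap.sum_apply, LinearMap.smul_apply,
      LinearMap.proj_apply, smul_eq_mul, Pi.zero_apply] at h1
    refine Eq.trans ?_ h1
    rw [← Finset.sum_subset (Finset.filter_subset _ _ : I ⊆ _)]
    · rw [← Finset.sum_coe_sort I]
      exact Finset.sum_congr rfl fun u _ => congrArg _ (dif_pos u.2)
    · intro u _ hu
      exact (congrArg _ (dif_neg hu)).trans (mul_zero _)

end Interpolation

/-! ## Solving the recurrences -/

section Candidates

variable {K : Type*} [Field K] {m : ℕ}

/-- The `z`-th point of a grid of powers of `Q`. -/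
def powPoint (Q : K) (B z : ℕ) (j : Fin m) : K := Q ^ digits B z j

/-- The coefficients of the value of the `l`-th recurrence at the point `y`. The unknown `0` is an
auxiliary one, and the unknown `e + 1` is the coefficient of the monomial with the digits of `e`. -/
noncomputable def recurCoeff (Q : K) (B r : ℕ) (l : Fin m) (A : ℕ → MvPolynomial (Fin m) K)
    (y : Fin m → K) : ℕ → K
  | 0 => 0
  | e + 1 => ∑ i ∈ Finset.range r, MvPolynomial.eval y (A i) *
      ∏ j, qPoint Q (Pi.single l i) y j ^ digits B e j

/-- The coefficients of the condition that the `γ`-th derivative at `a` is `c` times the auxiliary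
unknown. -/
noncomputable def derivCoeff (Q : K) (B : ℕ) (a : Fin m → K) (γ : Fin m → ℕ) (c : K) : ℕ → K
  | 0 => -c
  | e + 1 => monoDerivVal Q a (digits B e) (idxList γ) 0

theorem sum_recurCoeff (Q : K) (B r : ℕ) (l : Fin m) (A : ℕ → MvPolynomial (Fin m) K)
    (y : Fin m → K) (x : ℕ → K) :
    ∑ u ∈ Finset.range (B ^ m + 1), recurCoeff Q B r l A y u * x u =
      MvPolynomial.eval y (recurLin Q l r A (digitPoly m B fun e => x (e + 1))) := by
  rw [Finset.sum_range_succ', recurCoeff, zero_mul, add_zero, eval_recurLin]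
  simp only [recurCoeff, Finset.sum_mul, eval_digitPoly, Finset.mul_sum]
  rw [Finset.sum_comm]
  exact Finset.sum_congr rfl fun _ _ => Finset.sum_congr rfl fun _ _ => by ring

theorem sum_derivCoeff {Q : K} (hQ0 : Q ≠ 0) (hQ : Q ≠ 1) {a : Fin m → K} (ha : ∀ i, a i ≠ 0)
    (B : ℕ) (γ : Fin m → ℕ) (c : K) (x : ℕ → K) :
    ∑ u ∈ Finset.range (B ^ m + 1), derivCoeff Q B a γ c u * x u =
      MvPolynomial.eval a (qDerivIter Q γ (digitPoly m B fun e => x (e + 1))) - c * x 0 := by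
  rw [Finset.sum_range_succ', derivCoeff, eval_qDerivIter_digitPoly hQ0 hQ ha]
  simp only [derivCoeff]
  rw [neg_mul, sub_eq_add_neg]
  congr 1
  exact Finset.sum_congr rfl fun _ _ => mul_comm _ _

theorem eq_zero_of_eval_powPoint {Q : K} {B : ℕ} (hQ : ∀ i < B, ∀ j < B, Q ^ i = Q ^ j → i = j)
    {f : MvPolynomial (Fin m) K} (hf : f.totalDegree < B)
    (h : ∀ z < B ^ m, MvPolynomial.eval (powPoint Q B z) f = 0) : f = 0 := by
  classical
  refine MvPolynomial.eq_zero_of_eval_zero_at_prod_finset f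
    (fun _ => (Finset.range B).image fun i => Q ^ i) (fun i => ?_) fun x hx => ?_
  · rw [Finset.card_image_of_injOn, Finset.card_range]
    · exact (MvPolynomial.degreeOf_le_totalDegree f i).trans_lt hf
    · intro i hi j hj hij
      exact hQ i (Finset.mem_range.mp hi) j (Finset.mem_range.mp hj) hij
  · have : ∀ i, ∃ d < B, Q ^ d = x i := fun i => by
      obtain ⟨d, hd, h⟩ := Finset.mem_image.mp (hx i)
      exact ⟨d, Finset.mem_range.mp hd, h⟩
    choose d hd hdx using this
    obtain ⟨z, hz, hzd⟩ := exists_digits_eq d hd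
    have : x = powPoint Q B z := funext fun i => by rw [powPoint, hzd, hdx]
    rw [this]
    exact h z hz

/-- The unknowns of the problem of finding a candidate. -/
def IsCandIdx (m B k : ℕ) : ℕ → Prop
  | 0 => True
  | e + 1 => e < B ^ m ∧ ∑ j : Fin m, digits B e j < k

theorem totalDegree_cand_lt {B k : ℕ} (hk : 1 ≤ k) {x : ℕ → K}
    (hx : ∀ u, ¬IsCandIdx m B k u → x u = 0) :
    (digitPoly m B fun e => x (e + 1)).totalDegree < k := by
  refine lt_of_le_of_lt (totalDegree_digitPoly_le (T := k - 1) fun h _ hT => hx _ fun h1 => ?_)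
    (by omega)
  have := h1.2
  omega

end Candidates

/-! ## Codewords near the received word -/

section NearWords

variable {F K : Type*} [Field F] [Field K] [Algebra F K] {m s : ℕ} {A : Finset F}

/-- A point of the grid. -/
def gridPoint (K : Type*) [Field K] [Algebra F K] (a : Fin m → A) : Fin m → K :=
  fun i => algebraMap F K (a i)

/-- Polynomials of which all derivatives of order less than `s` vanish at a point. -/
noncomputable def derivVanish (Q : K) (s : ℕ) (a : Fin m → K) :
    Submodule K (MvPolynomial (Fin m) K) where
  carrier := {f | ∀ γ : Fin m → ℕ, ∑ i, γ i < s → MvPolynomial.eval a (qDerivIter Q γ f) = 0}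
  add_mem' {f g} hf hg γ hγ := by
    rw [← qDerivIterLin_apply, map_add, map_add, qDerivIterLin_apply, qDerivIterLin_apply, hf γ hγ,
      hg γ hγ, add_zero]
  zero_mem' γ _ := by rw [← qDerivIterLin_apply, map_zero, map_zero]
  smul_mem' c f hf γ hγ := by
    rw [← qDerivIterLin_apply, map_smul, MvPolynomial.smul_eval, qDerivIterLin_apply, hf γ hγ,
      mul_zero]

/-- The parameters of the decoder. -/
structure DecoderParams (m s : ℕ) (δ ε : ℝ) (r Δ : ℕ) : Prop where
  one_le_m : 1 ≤ m
  δ_lt : δ < 1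
  ε_pos : 0 < ε
  ε_lt : ε < δ
  one_le_r : 1 ≤ r
  r_le : r ≤ s
  add_le : (Δ : ℝ) + r ≤ ε * s
  pow_le : (s + m) ^ m ≤ r * Δ ^ m

theorem DecoderParams.degree_bounds {δ ε : ℝ} {r Δ k n : ℕ} (hp : DecoderParams m s δ ε r Δ)
    (hn : 0 < n) (hk : k = ⌈(1 - δ) * ((s : ℝ) * (n : ℝ))⌉₊) :
    1 ≤ k ∧ ((k - 1 : ℕ) : ℝ) < (1 - δ) * (s * n) ∧ Δ * n + k ≤ s * n + 1 ∧
      ∀ c N : ℕ, 0 < N → (1 - (δ - ε)) * N ≤ c →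
        (Δ * n + (k - 1)) * N < n * ((s - r + 1) * c) ∧ (k - 1) * N < n * (s * c) := by
  have hs : (0 : ℝ) < s := by exact_mod_cast lt_of_lt_of_le hp.one_le_r hp.r_le
  have hn' : (0 : ℝ) < n := by exact_mod_cast hn
  have hδ : 0 < 1 - δ := by linarith [hp.δ_lt]
  have hpos : 0 < (1 - δ) * ((s : ℝ) * n) := by positivity
  have hk1 : 1 ≤ k := by rw [hk]; exact Nat.one_le_iff_ne_zero.mpr (Nat.ceil_pos.mpr hpos).ne'
  have hk2 : ((k - 1 : ℕ) : ℝ) < (1 - δ) * (s * n) := by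
    have := Nat.ceil_lt_add_one hpos.le
    rw [← hk] at this
    push_cast [Nat.cast_sub hk1]
    linarith
  have hε := hp.ε_pos
  have hεδ := hp.ε_lt
  have hr : (0 : ℝ) < r := by exact_mod_cast hp.one_le_r
  have hrs : (r : ℝ) ≤ s := by exact_mod_cast hp.r_le
  have hΔ : (Δ : ℝ) * n ≤ (ε * s - r) * n :=
    mul_le_mul_of_nonneg_right (by linarith [hp.add_le]) hn'.le
  refine ⟨hk1, hk2, ?_, fun c N hN hc => ?_⟩
  · have h1 : ((Δ * n + (k - 1) : ℕ) : ℝ) < ((s * n : ℕ) : ℝ) := by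
      push_cast
      have h2 : 0 < (δ - ε) * (s * n : ℝ) := by
        have : 0 < δ - ε := by linarith
        positivity
      nlinarith [mul_pos hr hn']
    have h2 : Δ * n + (k - 1) < s * n := by exact_mod_cast h1
    omega
  · have hN' : (0 : ℝ) < N := by exact_mod_cast hN
    have h3 : 0 < 1 - (δ - ε) := by linarith
    constructor
    · have h4' : ((Δ * n + (k - 1) : ℕ) : ℝ) < n * ((s - r + 1) * (1 - (δ - ε))) := by
        push_cast
        have h5 : 0 ≤ (δ - ε) * r := mul_nonneg (by linarith) hr.le
        have h6 : (n : ℝ) * ((1 - (δ - ε)) * s - r) ≤ n * ((s - r + 1) * (1 - (δ - ε))) :=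
          mul_le_mul_of_nonneg_left (by nlinarith) hn'.le
        nlinarith
      have h5 : (((Δ * n + (k - 1)) * N : ℕ) : ℝ) < ((n * ((s - r + 1) * c) : ℕ) : ℝ) := by
        calc (((Δ * n + (k - 1)) * N : ℕ) : ℝ) = ((Δ * n + (k - 1) : ℕ) : ℝ) * N := by
              push_cast; ring
          _ < n * ((s - r + 1) * (1 - (δ - ε))) * N := mul_lt_mul_of_pos_right h4' hN'
          _ = n * ((s - r + 1) * ((1 - (δ - ε)) * N)) := by ring
          _ ≤ n * ((s - r + 1) * c) := by
              have : (0 : ℝ) ≤ s - r + 1 := by linarith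
              gcongr
          _ = ((n * ((s - r + 1) * c) : ℕ) : ℝ) := by
              push_cast [Nat.cast_sub hp.r_le]; ring
      exact_mod_cast h5
    · have h5 : (((k - 1) * N : ℕ) : ℝ) < ((n * (s * c) : ℕ) : ℝ) := by
        calc (((k - 1) * N : ℕ) : ℝ) = ((k - 1 : ℕ) : ℝ) * N := by push_cast; ring
          _ < (1 - δ) * (s * n) * N := mul_lt_mul_of_pos_right hk2 hN'
          _ ≤ (1 - (δ - ε)) * (s * n) * N := by gcongr; linarith
          _ = n * (s * ((1 - (δ - ε)) * N)) := by ring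
          _ ≤ n * (s * c) := by gcongr
          _ = ((n * (s * c) : ℕ) : ℝ) := by push_cast; ring
      exact_mod_cast h5

/-- The polynomials `B l i` satisfy the interpolation conditions for the received word `v`. -/
structure IsInterpolant (Q : K) (s r T : ℕ) (A : Finset F) (v : (Fin m → A) → (Fin m → ℕ) → K)
    (B : Fin m → ℕ → MvPolynomial (Fin m) K) : Prop where
  degree : ∀ l, ∀ i < r, (B l i).totalDegree ≤ T
  ne_zero : ∀ l, ∃ i < r, B l i ≠ 0
  interp : ∀ l (a : Fin m → A), ∀ β ∈ simplex m (s - r + 1), ∑ i ∈ Finset.range r,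
    MvPolynomial.eval (qPoint Q β (gridPoint K a)) (B l i) *
      shiftVal Q (gridPoint K a) (v a) (idxList (β + Pi.single l i)) 0 = 0

variable {Q : K} {δ ε : ℝ} {r Δ k : ℕ} {w : QWord K m s A} {v : (Fin m → A) → (Fin m → ℕ) → K}
  {B : Fin m → ℕ → MvPolynomial (Fin m) K}

theorem IsInterpolant.recurLin_eq_zero (hA : A.Nonempty) (hQ1 : Q ≠ 1)
    (hx : ∀ i < s, ∀ j < s, ∀ a b : A,
      Q ^ i * algebraMap F K a = Q ^ j * algebraMap F K b → i = j ∧ a = b)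
    (hQ : ∀ i < s * A.card + 1, ∀ j < s * A.card + 1, Q ^ i = Q ^ j → i = j)
    (hp : DecoderParams m s δ ε r Δ) (hk : k = ⌈(1 - δ) * ((s : ℝ) * (A.card : ℝ))⌉₊)
    (hv : ∀ a (γ : MultiIdx m s), v a (fun i => γ.1 i) = w a γ)
    (hB : IsInterpolant Q s r (Δ * A.card) A v B) {f : MvPolynomial (Fin m) K}
    (hf : f.totalDegree < k) (hfw : relDist (qEncode Q s A f) w ≤ δ - ε) (l : Fin m) :
    recurLin Q l r (B l) f = 0 := by
  classical
  obtain ⟨h1, h2, h3, h4⟩ := hp.degree_bounds hA.card_pos hk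
  have hr := hp.one_le_r
  have hrs := hp.r_le
  have hM : s - r + 1 ≤ s := by omega
  refine recurLin_eq_zero_of_agree (x := fun b : A => algebraMap F K b) (M := s - r + 1)
    (D := Δ * A.card) (E := k - 1)
    (fun i hi j hj => hx i (by omega) j (by omega))
    (fun i hi j hj => hQ i (by omega) j (by omega)) (hB.degree l) (by omega)
    (Finset.univ.filter fun a => qEncode Q s A f a = w a) (fun a ha β hβ => ?_) ?_
  · have ha := (Finset.mem_filter.mp ha).2
    rw [← hB.interp l a β (mem_simplex.mpr hβ)]
    refine Finset.sum_congr rfl fun i hi => ?_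
    have hi := Finset.mem_range.mp hi
    rw [shiftVal_eq (s := s) (f := f) hQ1 (fun γ hγ => ?_) _ _ ?_, qDerivIter_zero]
    · simp only [count_idxList]
      rfl
    · rw [length_idxList]
      simp only [Pi.add_apply, Finset.sum_add_distrib, Finset.sum_pi_single', Finset.mem_univ,
        if_true, Pi.zero_apply, Finset.sum_const_zero]
      omega
    · have := congrFun ha (MultiIdx.ofSumLt γ hγ)
      exact (hv a (MultiIdx.ofSumLt γ hγ)).trans this.symm
  · rw [Fintype.card_coe]
    refine (h4 _ _ (pow_pos hA.card_pos m) ?_).1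
    have := card_agree_of_relDist_le hA hfw
    push_cast
    exact this

theorem IsInterpolant.exists_isolating (hA : A.Nonempty) (hQ1 : Q ≠ 1)
    (hx : ∀ i < s, ∀ j < s, ∀ a b : A,
      Q ^ i * algebraMap F K a = Q ^ j * algebraMap F K b → i = j ∧ a = b)
    (hQ : ∀ i < s * A.card + 1, ∀ j < s * A.card + 1, Q ^ i = Q ^ j → i = j)
    (hp : DecoderParams m s δ ε r Δ) (hk : k = ⌈(1 - δ) * ((s : ℝ) * (A.card : ℝ))⌉₊)
    (hv : ∀ a (γ : MultiIdx m s), v a (fun i => γ.1 i) = w a γ)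
    (hB : IsInterpolant Q s r (Δ * A.card) A v B) {f : MvPolynomial (Fin m) K}
    (hf : f.totalDegree < k) (hfw : relDist (qEncode Q s A f) w ≤ δ - ε) :
    ∃ y : Fin (r ^ m) → (Fin m → A), (∀ τ, qEncode Q s A f (y τ) = w (y τ)) ∧
      ∀ (g : MvPolynomial (Fin m) K) (c : K), g.totalDegree < k →
        (∀ l, recurLin Q l r (B l) g = 0) →
        (∀ τ (γ : MultiIdx m s), MvPolynomial.eval (gridPoint K (y τ))
          (qDerivIter Q (fun i => (γ.1 i : ℕ)) g) = c * w (y τ) γ) → g = c • f := by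
  classical
  obtain ⟨h1, h2, h3, h4⟩ := hp.degree_bounds hA.card_pos hk
  have hagree := card_agree_of_relDist_le hA hfw
  set S := Finset.univ.filter fun a => qEncode Q s A f a = w a with hS
  have hN : 0 < A.card ^ m := pow_pos hA.card_pos m
  have h5 := (h4 S.card _ hN (by push_cast; exact hagree)).2
  have hSne : Nonempty S := by
    rw [Finset.nonempty_coe_sort, ← Finset.card_pos]
    refine Nat.pos_of_ne_zero fun h => ?_
    rw [h] at h5
    simp at h5
  have hmem : ∀ a : S, qEncode Q s A f a = w a := fun a => (Finset.mem_filter.mp a.2).2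
  obtain ⟨hfin, hrank⟩ := finrank_recurSpace_le (Q := Q) (r := r) h1
    (fun i hi j hj => hQ i (by omega) j (by omega)) hB.ne_zero
  obtain ⟨y, hy⟩ := exists_fin_iInf_eq_bot
    (fun a : S => derivVanish Q s (gridPoint K (a : Fin m → A))) (r ^ m)
    (recurSpace Q r k B) hfin hrank (fun g hg hg0 => by
      by_contra hne
      have h6 := card_mul_card_mvVanish_le (x := fun b : A => algebraMap F K b) (D := k - 1) hx
        (fun i hi j hj => hQ i (by omega) j (by omega)) hne
        (by have := ((mem_recurSpace h1).mp hg).1; omega)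
      rw [Fintype.card_coe] at h6
      have h7 : S.card ≤ (Finset.univ.filter fun a : Fin m → A =>
          g ∈ mvVanish Q (fun b : A => algebraMap F K b) a s).card := by
        refine Finset.card_le_card fun a ha => Finset.mem_filter.mpr ⟨Finset.mem_univ _, ?_⟩
        exact mem_mvVanish_of_forall_qDerivIter hQ1 (hg0 ⟨a, ha⟩)
      have h8 := Nat.mul_le_mul_left A.card (Nat.mul_le_mul_left s h7)
      exact absurd (h5.trans_le (h8.trans h6)) (lt_irrefl _))
  refine ⟨fun τ => y τ, fun τ => hmem _, fun g c hg hrec hint => ?_⟩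
  have hsub : g - c • f ∈ recurSpace Q r k B := by
    refine sub_mem ((mem_recurSpace h1).mpr ⟨hg, hrec⟩) (Submodule.smul_mem _ _
      ((mem_recurSpace h1).mpr ⟨hf, fun l => ?_⟩))
    exact hB.recurLin_eq_zero hA hQ1 hx hQ hp hk hv hf hfw l
  refine sub_eq_zero.mp (hy _ hsub fun τ γ hγ => ?_)
  have h6 := hint τ (MultiIdx.ofSumLt γ hγ)
  have h7 := congrFun (hmem (y τ)) (MultiIdx.ofSumLt γ hγ)
  rw [← qDerivIterLin_apply, map_sub, map_sub, map_smul, MvPolynomial.smul_eval,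
    qDerivIterLin_apply, qDerivIterLin_apply, sub_eq_zero]
  refine h6.trans ?_
  rw [← h7]
  rfl

end NearWords

/-! ## Expressions of the decoder -/

section Solve

variable {K : Type*}

/-- The `i`-th row of the array `k`. -/
def MState.row (S : MState K) [Zero K] (k i u : ℕ) : K := if u < S.len then S.arr k i u else 0

theorem MState.row_congr [Zero K] {S S' : MState K} {k : ℕ} (hlen : S'.len = S.len)
    (harr : S'.arr k = S.arr k) : S'.row k = S.row k := by
  funext i u
  rw [MState.row, MState.row, hlen, harr]

variable [Field K]

theorem FExp.eval_load_of_lt {S : MState K} {k : ℕ} {a b : NExp} (ha : a.eval S < S.len) :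
    (FExp.load k a b).eval S = S.row k (a.eval S) (b.eval S) := by
  rw [FExp.eval_load, MState.row]
  exact if_congr (and_iff_right ha) rfl rfl

theorem Stmt.exec_solve_rows {valid : NExp} {φs : List FExp} {S : MState K} {V : ℕ → Prop}
    {a : FExp → ℕ → ℕ → K} (hL : 0 < S.len)
    (hv : ∀ S', Frame 3 S S' → S'.var 4 < S.len → (valid.eval S' ≠ 0 ↔ V (S'.var 4)))
    (hφ : ∀ φ ∈ φs, ∀ S', Frame 3 S S' → S'.var 6 < S.len → S'.var 7 < S.len →
      φ.eval S' = a φ (S'.var 6) (S'.var 7)) :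
    Frame 3 S ((Stmt.solve valid φs).exec S) ∧
    (∀ i < S.len, (∀ u, ¬V u → ((Stmt.solve valid φs).exec S).row 3 i u = 0) ∧
      ∀ z < S.len, ∀ φ ∈ φs,
        ∑ u ∈ Finset.range S.len, a φ z u * ((Stmt.solve valid φs).exec S).row 3 i u = 0) ∧
    ∀ x : ℕ → K, (∀ u, ¬V u → x u = 0) → (∀ z < S.len, ∀ φ ∈ φs,
      ∑ u ∈ Finset.range S.len, a φ z u * x u = 0) → ∀ j < S.len, x j ≠ 0 →
      ∃ i < S.len, ((Stmt.solve valid φs).exec S).row 3 i j ≠ 0 := by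
  obtain ⟨h1, h2⟩ := Stmt.exec_solve hL hv hφ
  set T := (Stmt.solve valid φs).exec S
  have hrow : ∀ i (u : Fin S.len), T.row 3 i u = T.arr 3 i u := fun i u => by
    rw [MState.row, h1.len, if_pos u.2]
  refine ⟨h1, fun i hi => ?_, fun x hx hx' j hj hxj => ?_⟩
  · obtain ⟨g1, g2⟩ := (h2 (rowVec S.len (T.arr 3) ⟨i, hi⟩)).mp (Submodule.subset_span ⟨_, rfl⟩)
    refine ⟨fun u hu => ?_, fun z hz φ hφ => ?_⟩
    · by_cases hu' : u < S.len
      · exact (hrow i ⟨u, hu'⟩).trans (g1 ⟨u, hu'⟩ hu)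
      · rw [MState.row, h1.len, if_neg hu']
    · rw [Finset.sum_range, ← g2 z hz φ hφ]
      exact Finset.sum_congr rfl fun u _ => by rw [hrow]; rfl
  · by_contra h0
    push Not at h0
    have h3 : (fun u : Fin S.len => x u) ∈
        Submodule.span K (Set.range (rowVec S.len (T.arr 3))) := by
      refine (h2 _).mpr ⟨fun u hu => hx u hu, fun z hz φ hφ => ?_⟩
      rw [← hx' z hz φ hφ, Finset.sum_range]
    have h4 : Submodule.span K (Set.range (rowVec S.len (T.arr 3))) ≤ LinearMap.ker
        (LinearMap.proj (R := K) (φ := fun _ : Fin S.len => K) ⟨j, hj⟩) := by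
      refine Submodule.span_le.mpr ?_
      rintro _ ⟨i, rfl⟩
      exact (hrow i ⟨j, hj⟩).symm.trans (h0 i i.2)
    exact hxj (h4 h3)

end Solve

namespace NExp

variable {K : Type*} [Field K] {S : MState K} {a b e : NExp}

/-- A power with a constant exponent. -/
def npow (b : NExp) : ℕ → NExp
  | 0 => .const 1
  | i + 1 => .mul (npow b i) b

theorem eval_npow (hb : b.eval S ≤ S.len) (i : ℕ) : (b.npow i).eval S = b.eval S ^ i := by
  induction i with
  | zero => rfl
  | succ i ih => rw [npow, eval_mul, ih, min_eq_left hb, pow_succ]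

theorem eval_mul_of_le (hb : b.eval S ≤ S.len) : (a.mul b).eval S = a.eval S * b.eval S := by
  rw [eval_mul, min_eq_left hb]

theorem eval_div_of_le (ha : a.eval S ≤ S.len) (hb : 0 < b.eval S) :
    (a.div b).eval S = a.eval S / b.eval S := by
  rw [eval_div, if_neg hb.ne', min_eq_left ((Nat.div_le_self _ _).trans ha)]

/-- The remainder of a division. -/
def rem (a b : NExp) : NExp := .sub a (.mul b (.div a b))

theorem eval_rem (ha : a.eval S ≤ S.len) (hb : 0 < b.eval S) :
    (a.rem b).eval S = a.eval S % b.eval S := by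
  rw [rem, eval_sub, eval_mul_of_le (by
    rw [eval_div_of_le ha hb]; exact (Nat.div_le_self _ _).trans ha), eval_div_of_le ha hb]
  have := Nat.mod_add_div (a.eval S) (b.eval S)
  omega

/-- A digit of `e` in base `b`. -/
def dig (b e : NExp) (j : ℕ) : NExp := .rem (.div e (b.npow j)) b

theorem eval_dig (he : e.eval S ≤ S.len) (hb : 0 < b.eval S) (hb' : b.eval S ≤ S.len) (j : ℕ) :
    (b.dig e j).eval S = e.eval S / b.eval S ^ j % b.eval S := by
  have h1 := eval_npow hb' j
  have h2 : 0 < (b.npow j).eval S := by rw [h1]; exact Nat.pow_pos hb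
  have h3 := eval_div_of_le he h2
  rw [dig, eval_rem (by rw [h3]; exact (Nat.div_le_self _ _).trans he) hb, h3, h1]

/-- Sums of several expressions. -/
def sumL : List NExp → NExp
  | [] => .const 0
  | a :: l => .add a (sumL l)

theorem eval_sumL (l : List NExp) : (sumL l).eval S = (l.map fun a => a.eval S).sum := by
  induction l with
  | nil => rfl
  | cons a l ih => rw [sumL, eval_add, ih]; rfl

theorem eval_sumL_fin {n : ℕ} (f : Fin n → NExp) :
    (sumL ((List.finRange n).map f)).eval S = ∑ j, (f j).eval S := by
  rw [eval_sumL, List.map_map, Fin.sum_univ_def]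
  rfl

/-- The condition `a < b`. -/
def lt (a b : NExp) : NExp := .sub b a

theorem eval_lt_ne_zero : (a.lt b).eval S ≠ 0 ↔ a.eval S < b.eval S := by
  rw [lt, eval_sub]; omega

/-- The value `c` if `a < b`, and `0` otherwise. -/
def ifLt (a b c : NExp) : NExp := .ite (.lt a b) c (.const 0)

theorem eval_ifLt (a b c : NExp) :
    (ifLt a b c).eval S = if a.eval S < b.eval S then c.eval S else 0 := by
  rw [ifLt, eval_ite]
  exact if_congr eval_lt_ne_zero rfl rfl

end NExp

namespace FExp

variable {K : Type*} [Field K] {S : MState K}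

/-- Sums of several expressions. -/
def sumL : List FExp → FExp
  | [] => .zero
  | f :: l => .add f (sumL l)

theorem eval_sumL (l : List FExp) : (sumL l).eval S = (l.map fun f => f.eval S).sum := by
  induction l with
  | nil => rfl
  | cons a l ih => rw [sumL, eval_add, ih]; rfl

theorem eval_sumL_fin {n : ℕ} (f : Fin n → FExp) :
    (sumL ((List.finRange n).map f)).eval S = ∑ j, (f j).eval S := by
  rw [eval_sumL, List.map_map, Fin.sum_univ_def]
  rfl

/-- Products of several expressions. -/
def prodL : List FExp → FExp
  | [] => .one
  | f :: l => .mul f (prodL l)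

theorem eval_prodL (l : List FExp) : (prodL l).eval S = (l.map fun f => f.eval S).prod := by
  induction l with
  | nil => rfl
  | cons a l ih => rw [prodL, eval_mul, ih]; rfl

theorem eval_prodL_fin {n : ℕ} (f : Fin n → FExp) :
    (prodL ((List.finRange n).map f)).eval S = ∏ j, (f j).eval S := by
  rw [eval_prodL, List.map_map, Fin.prod_univ_def]
  rfl

/-- Constant powers of `q`. -/
def qpow : ℕ → FExp
  | 0 => .one
  | i + 1 => .mul (qpow i) .q

theorem eval_qpow (i : ℕ) : (qpow i).eval S = S.q ^ i := by
  induction i with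
  | zero => rw [qpow, eval_one, pow_zero]
  | succ i ih => rw [qpow, eval_mul, ih, eval_q, pow_succ]

/-- The value `f` if `a = b`, and `0` otherwise. -/
def ifEq (a b : NExp) (f : FExp) : FExp := .ite (.sub a b) .zero (.ite (.sub b a) .zero f)

theorem eval_ifEq (a b : NExp) (f : FExp) :
    (ifEq a b f).eval S = if a.eval S = b.eval S then f.eval S else 0 := by
  rw [ifEq, eval_ite, eval_ite, NExp.eval_sub, NExp.eval_sub, eval_zero]
  split_ifs <;> first | rfl | omega

/-- The value `f` if `a < b`, and `0` otherwise. -/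
def ifLt (a b : NExp) (f : FExp) : FExp := .ite (.lt a b) f .zero

theorem eval_ifLt (a b : NExp) (f : FExp) :
    (ifLt a b f).eval S = if a.eval S < b.eval S then f.eval S else 0 := by
  rw [ifLt, eval_ite]
  exact if_congr NExp.eval_lt_ne_zero rfl rfl

theorem eval_pow_of_le {f : FExp} {a : NExp} (ha : a.eval S ≤ S.len) :
    (f.pow a).eval S = f.eval S ^ a.eval S := by
  rw [eval_pow, min_eq_left ha]

end FExp

/-! ## Size conditions -/

/-- The variable `3` holds the base for the encoding of exponents, and the size parameter is large
enough for the computations of the decoder. The variables `0`, `1`, `2` hold the number of elements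
of the grid in one direction, the number of errors and the degree parameter. -/
structure Ready {K : Type*} (m s r Δ D : ℕ) (S : MState K) : Prop where
  one_le_m : 1 ≤ m
  one_le_s : 1 ≤ s
  one_le_r : 1 ≤ r
  n_pos : 0 < S.var 0
  base : S.var 3 = Δ * S.var 0 + S.var 2
  k_pos : 0 < S.var 2
  m_le : m ≤ S.len
  grid_le : S.var 0 + S.var 0 ^ m * s ^ m ≤ S.len
  base_le : r * S.var 3 ^ m + 1 ≤ S.len
  out_le : (S.var 0 ^ m) ^ D * (S.var 0 ^ m * s ^ m) ≤ S.len

namespace Ready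

variable {K : Type*} {m s r Δ D : ℕ} {S S' : MState K}

theorem congr (h : Ready m s r Δ D S) (hlen : S'.len = S.len) (hvar : ∀ x < 4, S'.var x = S.var x) :
    Ready m s r Δ D S' := by
  obtain ⟨h1, h2, h3, h4, h5, h6, h7, h8, h9, h10⟩ := h
  rw [← hvar 0 (by omega)] at h4 h5 h8 h10
  rw [← hvar 3 (by omega)] at h5 h9
  rw [← hvar 2 (by omega)] at h5 h6
  rw [← hlen] at h7 h8 h9 h10
  exact ⟨h1, h2, h3, h4, h5, h6, h7, h8, h9, h10⟩

theorem frame {κ : ℕ} (h : Ready m s r Δ D S) (hf : Frame κ S S') : Ready m s r Δ D S' :=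
  h.congr hf.len fun x hx => hf.var x (Or.inl hx)

theorem set (h : Ready m s r Δ D S) {x : ℕ} (hx : 4 ≤ x) (v : ℕ) : Ready m s r Δ D (S.set x v) :=
  h.congr rfl fun _ hy => MState.set_var_ne _ _ _ _ (by omega)

variable (h : Ready m s r Δ D S)
include h

theorem grid_pos : 0 < S.var 0 ^ m := Nat.pow_pos h.n_pos

theorem sym_pos : 0 < s ^ m := Nat.pow_pos h.one_le_s

theorem n_le : S.var 0 ≤ S.len := (Nat.le_add_right _ _).trans h.grid_le

theorem grid_mul_le : S.var 0 ^ m * s ^ m ≤ S.len := (Nat.le_add_left _ _).trans h.grid_le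

theorem npow_le : S.var 0 ^ m ≤ S.len :=
  (Nat.le_mul_of_pos_right _ h.sym_pos).trans h.grid_mul_le

theorem sym_le : s ^ m ≤ S.len := (Nat.le_mul_of_pos_left _ h.grid_pos).trans h.grid_mul_le

theorem base_pos : 0 < S.var 3 := by rw [h.base]; have := h.k_pos; omega

theorem base_pow_le : S.var 3 ^ m ≤ r * S.var 3 ^ m := Nat.le_mul_of_pos_left _ h.one_le_r

theorem base_pow_lt : S.var 3 ^ m + 1 ≤ S.len := by
  have := h.base_pow_le
  have := h.base_le
  omega

theorem base_le_len : S.var 3 ≤ S.len := by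
  have h1 := Nat.pow_le_pow_right h.base_pos h.one_le_m
  rw [pow_one] at h1
  have := h.base_pow_lt
  omega

theorem len_pos : 0 < S.len := h.n_pos.trans_le h.n_le

theorem tuples_le : (S.var 0 ^ m) ^ D ≤ S.len :=
  (Nat.le_mul_of_pos_right _ (Nat.mul_pos h.grid_pos h.sym_pos)).trans h.out_le

end Ready

/-! ## The received word and the points of the grid -/

section Received

variable {K : Type*} [Field K] {m : ℕ}

/-- The number of a multi-index. -/
def symPos (s : ℕ) (γ : Fin m → ℕ) : ℕ := ∑ j, γ j * s ^ (j : ℕ)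

/-- The `p`-th point of the grid. -/
def MState.point (S : MState K) (p : ℕ) (j : Fin m) : K := S.row 1 0 (digits (S.var 0) p j)

/-- The symbol of the received word at the `p`-th point of the grid. -/
def MState.word (S : MState K) (s p : ℕ) (γ : Fin m → ℕ) : K :=
  S.row 1 0 (S.var 0 + (p * s ^ m + symPos s γ))

namespace FExp

variable {s r Δ D : ℕ} {S : MState K} {p : NExp}

/-- A coordinate of the `p`-th point of the grid. -/
def pt (p : NExp) (j : ℕ) : FExp := .load 1 (.const 0) (.dig (.var 0) p j)

theorem eval_pt (h : Ready m s r Δ D S) (hp : p.eval S ≤ S.len) (j : Fin m) :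
    (pt p j).eval S = S.point (p.eval S) j := by
  rw [pt, eval_load_of_lt (by exact h.len_pos), NExp.eval_dig hp (by exact h.n_pos)
    (by exact h.n_le)]
  rfl

end FExp

end Received

/-! ## The equations in the decoder -/

section Equations

variable {K : Type*} [Field K] {m s r Δ D : ℕ} {S : MState K} {p : NExp}

namespace FExp

/-- An entry of the received word. -/
def wordAt (s : ℕ) (p : NExp) (γ : Fin m → ℕ) : FExp :=
  .load 1 (.const 0) (.add (.var 0) (.add (.mul p (.const (s ^ m))) (.const (symPos s γ))))

theorem eval_wordAt (h : Ready m s r Δ D S) (γ : Fin m → ℕ) :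
    (wordAt s p γ).eval S = S.word s (p.eval S) γ := by
  rw [wordAt, eval_load_of_lt (by exact h.len_pos), NExp.eval_add, NExp.eval_add,
    NExp.eval_mul_of_le (by exact h.sym_le)]
  rfl

/-- A coordinate of the point `Q^β a`, where `a` is the `p`-th point of the grid. -/
def qPt (p : NExp) (β : Fin m → ℕ) (j : Fin m) : FExp := .mul (.qpow (β j)) (.pt p j)

theorem eval_qPt (h : Ready m s r Δ D S) (hp : p.eval S ≤ S.len) (β : Fin m → ℕ) (j : Fin m) :
    (qPt p β j).eval S = qPoint S.q β (S.point (p.eval S)) j := by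
  rw [qPt, eval_mul, eval_qpow, eval_pt h hp]
  rfl

/-- The value of a shifted received symbol. -/
def shifted (s : ℕ) (p : NExp) : List (Fin m) → (Fin m → ℕ) → FExp
  | [], γ => wordAt s p γ
  | j :: l, γ => .add (shifted s p l γ)
      (.mul (.mul (.sub .q .one) (qPt p (fun i => l.count i) j)) (shifted s p l (γ + Pi.single j 1)))

theorem eval_shifted (h : Ready m s r Δ D S) (hp : p.eval S ≤ S.len) (l : List (Fin m)) :
    ∀ γ, (shifted s p l γ).eval S =
      shiftVal S.q (S.point (p.eval S)) (S.word s (p.eval S)) l γ := by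
  induction l with
  | nil => exact fun γ => eval_wordAt h γ
  | cons j l ih =>
    intro γ
    rw [shifted, eval_add, eval_mul, eval_mul, eval_sub, eval_q, eval_one, eval_qPt h hp, ih, ih,
      shiftVal]

/-- A product of powers. -/
def powProd (f : Fin m → FExp) (e : Fin m → NExp) : FExp :=
  prodL ((List.finRange m).map fun j => .pow (f j) (e j))

theorem eval_powProd {f : Fin m → FExp} {e : Fin m → NExp} (he : ∀ j, (e j).eval S ≤ S.len) :
    (powProd f e).eval S = ∏ j, (f j).eval S ^ (e j).eval S := by
  rw [powProd, eval_prodL_fin]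
  exact Finset.prod_congr rfl fun j _ => eval_pow_of_le (he j)

/-- The value of a derivative of a monomial. -/
def monoDeriv (p : NExp) (e : Fin m → NExp) : List (Fin m) → (Fin m → ℕ) → FExp
  | [], β => powProd (qPt p β) e
  | j :: l, β => .mul (.sub (monoDeriv p e l (β + Pi.single j 1)) (monoDeriv p e l β))
      (.inv (.mul (.sub .q .one) (qPt p β j)))

theorem eval_monoDeriv (h : Ready m s r Δ D S) (hp : p.eval S ≤ S.len) {e : Fin m → NExp}
    (he : ∀ j, (e j).eval S ≤ S.len) (l : List (Fin m)) :
    ∀ β, (monoDeriv p e l β).eval S =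
      monoDerivVal S.q (S.point (p.eval S)) (fun j => (e j).eval S) l β := by
  induction l with
  | nil =>
    intro β
    rw [monoDeriv, eval_powProd he, monoDerivVal]
    exact Finset.prod_congr rfl fun j _ => by rw [eval_qPt h hp]
  | cons j l ih =>
    intro β
    rw [monoDeriv, eval_mul, eval_sub, eval_inv, eval_mul, eval_sub, eval_q, eval_one,
      eval_qPt h hp, ih, ih, monoDerivVal]

end FExp

/-- The digits in the base for exponents. -/
def NExp.expDig (e : NExp) (j : Fin m) : NExp := .dig (.var 3) e j

theorem NExp.eval_expDig (h : Ready m s r Δ D S) {e : NExp} (he : e.eval S ≤ S.len) (j : Fin m) :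
    (e.expDig j).eval S = digits (S.var 3) (e.eval S) j :=
  NExp.eval_dig he (by exact h.base_pos) (by exact h.base_le_len) j

theorem NExp.eval_expDig_le (h : Ready m s r Δ D S) {e : NExp} (he : e.eval S ≤ S.len)
    (j : Fin m) : (e.expDig j).eval S ≤ S.len := by
  rw [NExp.eval_expDig h he]
  exact (digits_lt h.base_pos _ _).le.trans h.base_le_len

theorem NExp.eval_basePow (h : Ready m s r Δ D S) (i : ℕ) :
    ((NExp.var 3).npow i).eval S = S.var 3 ^ i := NExp.eval_npow (by exact h.base_le_len) i

theorem NExp.eval_gridPow (h : Ready m s r Δ D S) (i : ℕ) :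
    ((NExp.var 0).npow i).eval S = S.var 0 ^ i := NExp.eval_npow (by exact h.n_le) i

/-- The condition that the variable `4` is one of the unknowns of the interpolation problem. -/
def NExp.interpIdx (m r Δ : ℕ) : NExp :=
  .ifLt (.var 4) (.mul (.const r) (.npow (.var 3) m))
    (.lt (.sumL ((List.finRange m).map fun j => NExp.expDig (.div (.var 4) (.const r)) j))
      (.add (.mul (.const Δ) (.var 0)) (.const 1)))

theorem NExp.eval_interpIdx (h : Ready m s r Δ D S) (h4 : S.var 4 < S.len) :
    (NExp.interpIdx m r Δ).eval S ≠ 0 ↔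
      IsInterpIdx m (S.var 3) r (Δ * S.var 0) (S.var 4) := by
  have hr : (0 : ℕ) < (NExp.const r).eval S := h.one_le_r
  have h1 : ((NExp.var 4).div (.const r)).eval S = S.var 4 / r :=
    NExp.eval_div_of_le (by exact h4.le) hr
  have h2 : ((NExp.var 4).div (.const r)).eval S ≤ S.len := by
    rw [h1]; exact (Nat.div_le_self _ _).trans h4.le
  have h3 : ((NExp.const r).mul (.npow (.var 3) m)).eval S = r * S.var 3 ^ m := by
    rw [NExp.eval_mul_of_le (by rw [NExp.eval_basePow h]; have := h.base_pow_lt; omega),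
      NExp.eval_basePow h, NExp.eval_const]
  have h5 : ((NExp.const Δ).mul (.var 0)).eval S = Δ * S.var 0 :=
    NExp.eval_mul_of_le (by exact h.n_le)
  rw [NExp.interpIdx, NExp.eval_ifLt, h3, NExp.eval_var, IsInterpIdx]
  by_cases h6 : S.var 4 < r * S.var 3 ^ m
  · rw [if_pos h6, NExp.eval_lt_ne_zero, NExp.eval_sumL_fin, NExp.eval_add, h5, NExp.eval_const]
    simp only [NExp.eval_expDig h h2, h1, h6, true_and]
    omega
  · rw [if_neg h6]
    simp [h6]

/-- The interpolation condition. The variable `6` is the number of a point, the variable `7` is the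
unknown. -/
def FExp.interpEq (s r : ℕ) (l : Fin m) (β : Fin m → ℕ) : FExp :=
  .ifLt (.var 6) (.npow (.var 0) m) (.mul
    (powProd (qPt (.var 6) β) fun j => NExp.expDig (.div (.var 7) (.const r)) j)
    (.sumL ((List.finRange r).map fun i : Fin r => .ifEq (.rem (.var 7) (.const r)) (.const i)
      (shifted s (.var 6) (idxList (β + Pi.single l (i : ℕ))) 0))))

theorem FExp.eval_interpEq (h : Ready m s r Δ D S) (h6 : S.var 6 < S.len) (h7 : S.var 7 < S.len)
    (l : Fin m) (β : Fin m → ℕ) : (FExp.interpEq s r l β).eval S =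
      if S.var 6 < S.var 0 ^ m then
        interpCoeff S.q (S.var 3) r l (S.point (S.var 6)) (S.word s (S.var 6)) β (S.var 7)
      else 0 := by
  have hr : (0 : ℕ) < (NExp.const r).eval S := h.one_le_r
  have h1 : ((NExp.var 7).div (.const r)).eval S = S.var 7 / r :=
    NExp.eval_div_of_le (by exact h7.le) hr
  have h1' : ((NExp.var 7).rem (.const r)).eval S = S.var 7 % r :=
    NExp.eval_rem (by exact h7.le) hr
  have h2 : ((NExp.var 7).div (.const r)).eval S ≤ S.len := by
    rw [h1]; exact (Nat.div_le_self _ _).trans h7.le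
  rw [interpEq, eval_ifLt, NExp.eval_gridPow h, NExp.eval_var, eval_mul,
    eval_powProd fun j => NExp.eval_expDig_le h h2 j, eval_sumL_fin]
  refine if_congr Iff.rfl ?_ rfl
  rw [interpCoeff]
  congr 1
  · refine Finset.prod_congr rfl fun j _ => ?_
    rw [eval_qPt h (by exact h6.le), NExp.eval_expDig h h2, h1]
    rfl
  · rw [Finset.sum_eq_single (⟨S.var 7 % r, Nat.mod_lt _ h.one_le_r⟩ : Fin r)]
    · rw [eval_ifEq, h1', NExp.eval_const, if_pos rfl, eval_shifted h (by exact h6.le)]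
      rfl
    · intro i _ hi
      rw [eval_ifEq, h1', NExp.eval_const, if_neg fun h => hi (Fin.ext h.symm)]
    · exact fun h => absurd (Finset.mem_univ _) h

/-- The value of a coefficient polynomial of the `l`-th recurrence at the point of the grid of
powers which is given by the variable `6`. -/
def FExp.recurCoef (r : ℕ) (l : Fin m) (i : ℕ) : FExp :=
  .sum 12 (.ifLt (.var 12) (.npow (.var 3) m) (.mul
    (.load 2 (.const l) (.add (.const i) (.mul (.const r) (.var 12))))
    (powProd (fun j : Fin m => .pow .q (NExp.expDig (.var 6) j))
      fun j => NExp.expDig (.var 12) j)))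

/-- The coefficients of the recurrences are stored in the array `2`. -/
noncomputable def MState.recur (S : MState K) (m r l i : ℕ) : MvPolynomial (Fin m) K :=
  digitPoly m (S.var 3) fun h => S.row 2 l (i + r * h)

theorem FExp.eval_recurCoef (h : Ready m s r Δ D S) (h6 : S.var 6 < S.len) (l : Fin m) (i : ℕ) :
    (FExp.recurCoef r l i).eval S =
      MvPolynomial.eval (powPoint S.q (S.var 3) (S.var 6)) (S.recur m r l i) := by
  rw [MState.recur, eval_digitPoly, recurCoef, eval_sum,
    ← Finset.sum_subset (Finset.range_mono (show S.var 3 ^ m ≤ S.len by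
      have := h.base_pow_lt; omega))]
  · refine Finset.sum_congr rfl fun e he => ?_
    have he := Finset.mem_range.mp he
    have hlt := h.base_pow_lt
    have hS : Ready m s r Δ D (S.set 12 e) := h.set (by omega) e
    have v12 : (NExp.var 12).eval (S.set 12 e) ≤ (S.set 12 e).len := by
      rw [NExp.eval_var, MState.set_var_self, MState.set_len]; omega
    have v6 : (NExp.var 6).eval (S.set 12 e) ≤ (S.set 12 e).len := by
      rw [NExp.eval_var, MState.set_var_ne _ _ _ _ (by omega), MState.set_len]; omega
    rw [eval_ifLt, NExp.eval_basePow hS, NExp.eval_var, MState.set_var_self,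
      MState.set_var_ne _ _ _ _ (by omega), if_pos he, eval_mul,
      eval_powProd fun j => NExp.eval_expDig_le hS v12 j,
      eval_load_of_lt (by exact l.2.trans_le h.m_le), NExp.eval_add,
      NExp.eval_mul_of_le v12]
    congr 1
    refine Finset.prod_congr rfl fun j _ => ?_
    rw [eval_pow_of_le (NExp.eval_expDig_le hS v6 j), NExp.eval_expDig hS v12,
      NExp.eval_expDig hS v6, NExp.eval_var, NExp.eval_var, MState.set_var_self,
      MState.set_var_ne _ _ _ _ (by omega), MState.set_var_ne _ _ _ _ (by omega)]
    rfl
  · intro e _ he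
    have hS : Ready m s r Δ D (S.set 12 e) := h.set (by omega) e
    rw [eval_ifLt, NExp.eval_basePow hS, NExp.eval_var, MState.set_var_self,
      MState.set_var_ne _ _ _ _ (by omega), if_neg (by simpa using he)]

/-- The recurrence at a point of the grid of powers. The variable `6` is the number of the point,
the variable `7` is the unknown. -/
def FExp.recurEq (r : ℕ) (l : Fin m) : FExp :=
  .ite (.var 7) (.ifLt (.var 6) (.npow (.var 3) m)
    (.sumL ((List.finRange r).map fun i : Fin r => .mul (recurCoef r l i)
      (powProd (fun j => .mul (.qpow (Pi.single (M := fun _ => ℕ) l (i : ℕ) j))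
          (.pow .q (NExp.expDig (.var 6) j)))
        fun j => NExp.expDig (.sub (.var 7) (.const 1)) j)))) .zero

theorem FExp.eval_recurEq (h : Ready m s r Δ D S) (h6 : S.var 6 < S.len) (h7 : S.var 7 < S.len)
    (l : Fin m) : (FExp.recurEq r l).eval S =
      if S.var 6 < S.var 3 ^ m then
        recurCoeff S.q (S.var 3) r l (S.recur m r l) (powPoint S.q (S.var 3) (S.var 6)) (S.var 7)
      else 0 := by
  have v6 : (NExp.var 6).eval S ≤ S.len := h6.le
  have v7 : ((NExp.var 7).sub (.const 1)).eval S ≤ S.len := by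
    rw [NExp.eval_sub, NExp.eval_var]; omega
  rw [recurEq, eval_ite, eval_ifLt, NExp.eval_basePow h, NExp.eval_var, NExp.eval_var, eval_zero]
  rcases Nat.eq_zero_or_pos (S.var 7) with h0 | h0
  · rw [h0, recurCoeff]; simp
  · obtain ⟨e, he⟩ := Nat.exists_eq_add_of_le' h0
    have e7 : ((NExp.var 7).sub (.const 1)).eval S = e := by
      rw [NExp.eval_sub, NExp.eval_var, NExp.eval_const]; omega
    rw [if_pos (by omega), eval_sumL_fin, he, recurCoeff, Finset.sum_range]
    refine if_congr Iff.rfl (Finset.sum_congr rfl fun i _ => ?_) rfl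
    rw [eval_mul, eval_recurCoef h h6, eval_powProd fun j => NExp.eval_expDig_le h v7 j]
    congr 1
    refine Finset.prod_congr rfl fun j _ => ?_
    rw [eval_mul, eval_qpow, eval_pow_of_le (NExp.eval_expDig_le h v6 j), NExp.eval_expDig h v7,
      NExp.eval_expDig h v6, e7]
    rfl

/-- One of the points which are given by the variable `10`. -/
def NExp.tuplePt (m τ : ℕ) : NExp := .dig (.npow (.var 0) m) (.var 10) τ

theorem NExp.eval_tuplePt (h : Ready m s r Δ D S) (h10 : S.var 10 < S.len) (τ : Fin D) :
    (NExp.tuplePt m τ).eval S = digits (S.var 0 ^ m) (S.var 10) τ := by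
  have h1 := NExp.eval_gridPow h m
  rw [tuplePt, NExp.eval_dig (by exact h10.le) (by rw [h1]; exact h.grid_pos)
    (by rw [h1]; exact h.npow_le), h1]
  rfl

/-- The condition for a derivative at one of the points which are given by the variable `10`. The
variable `7` is the unknown. -/
def FExp.derivEq (s τ : ℕ) (γ : Fin m → ℕ) : FExp :=
  .ite (.var 7) (monoDeriv (NExp.tuplePt m τ) (fun j => NExp.expDig (.sub (.var 7) (.const 1)) j)
    (idxList γ) 0) (.sub .zero (wordAt s (NExp.tuplePt m τ) γ))

theorem FExp.eval_derivEq (h : Ready m s r Δ D S) (h7 : S.var 7 < S.len) (h10 : S.var 10 < S.len)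
    (τ : Fin D) (γ : Fin m → ℕ) : (FExp.derivEq s τ γ).eval S =
      derivCoeff S.q (S.var 3) (S.point (digits (S.var 0 ^ m) (S.var 10) τ)) γ
        (S.word s (digits (S.var 0 ^ m) (S.var 10) τ) γ) (S.var 7) := by
  have v7 : ((NExp.var 7).sub (.const 1)).eval S ≤ S.len := by
    rw [NExp.eval_sub, NExp.eval_var]; omega
  have hτ := NExp.eval_tuplePt h h10 τ
  rw [derivEq, eval_ite, NExp.eval_var, eval_sub, eval_zero, eval_wordAt h, hτ]
  rcases Nat.eq_zero_or_pos (S.var 7) with h0 | h0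
  · rw [h0, derivCoeff]; simp
  · obtain ⟨e, he⟩ := Nat.exists_eq_add_of_le' h0
    have e7 : ((NExp.var 7).sub (.const 1)).eval S = e := by
      rw [NExp.eval_sub, NExp.eval_var, NExp.eval_const]; omega
    rw [if_pos (by omega), he, derivCoeff, eval_monoDeriv h
      (by rw [hτ]; exact (digits_lt h.grid_pos _ _).le.trans h.npow_le)
      fun j => NExp.eval_expDig_le h v7 j, hτ]
    congr 1
    funext j
    rw [NExp.eval_expDig h v7, e7]

/-- The condition that the variable `4` is one of the unknowns of the problem of finding a
candidate. -/
def NExp.candIdx (m : ℕ) : NExp :=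
  .ite (.var 4) (.ifLt (.sub (.var 4) (.const 1)) (.npow (.var 3) m)
    (.lt (.sumL ((List.finRange m).map fun j => NExp.expDig (.sub (.var 4) (.const 1)) j)) (.var 2)))
    (.const 1)

theorem NExp.eval_candIdx (h : Ready m s r Δ D S) (h4 : S.var 4 < S.len) :
    (NExp.candIdx m).eval S ≠ 0 ↔ IsCandIdx m (S.var 3) (S.var 2) (S.var 4) := by
  have v4 : ((NExp.var 4).sub (.const 1)).eval S ≤ S.len := by
    rw [NExp.eval_sub, NExp.eval_var]; omega
  rw [candIdx, NExp.eval_ite, NExp.eval_var]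
  rcases Nat.eq_zero_or_pos (S.var 4) with h0 | h0
  · rw [h0]; simp [IsCandIdx]
  · obtain ⟨e, he⟩ := Nat.exists_eq_add_of_le' h0
    have e4 : ((NExp.var 4).sub (.const 1)).eval S = e := by
      rw [NExp.eval_sub, NExp.eval_var, NExp.eval_const]; omega
    rw [if_pos (by omega), NExp.eval_ifLt, e4, NExp.eval_basePow h, he, IsCandIdx]
    by_cases h1 : e < S.var 3 ^ m
    · rw [if_pos h1, NExp.eval_lt_ne_zero, NExp.eval_sumL_fin, NExp.eval_var]
      simp only [NExp.eval_expDig h v4, e4, h1, true_and]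
    · rw [if_neg h1]
      simp [h1]

/-- The row of the array `3` given by the variable `8`, divided by its first entry, as a
polynomial. -/
noncomputable def MState.cand (S : MState K) (m : ℕ) : MvPolynomial (Fin m) K :=
  digitPoly m (S.var 3) fun e => S.row 3 (S.var 8) (e + 1) * (S.row 3 (S.var 8) 0)⁻¹

/-- A derivative of the candidate at the `p`-th point of the grid. -/
def FExp.candDeriv (p : NExp) (γ : Fin m → ℕ) : FExp :=
  .sum 7 (.ite (.var 7) (.ifLt (.sub (.var 7) (.const 1)) (.npow (.var 3) m)
    (.mul (.mul (.load 3 (.var 8) (.var 7)) (.inv (.load 3 (.var 8) (.const 0))))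
      (monoDeriv p (fun j => NExp.expDig (.sub (.var 7) (.const 1)) j) (idxList γ) 0))) .zero)

theorem FExp.eval_candDeriv (h : Ready m s r Δ D S) {v : ℕ} (hp : ∀ u, p.eval (S.set 7 u) = v)
    (hv : v ≤ S.len) (h8 : S.var 8 < S.len) (hQ0 : S.q ≠ 0) (hQ : S.q ≠ 1)
    (ha : ∀ j : Fin m, S.point v j ≠ 0) (γ : Fin m → ℕ) : (FExp.candDeriv p γ).eval S =
      MvPolynomial.eval (S.point v) (qDerivIter S.q γ (S.cand m)) := by
  rw [MState.cand, eval_qDerivIter_digitPoly hQ0 hQ ha, candDeriv, eval_sum]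
  have hlt := h.base_pow_lt
  rw [← Finset.sum_subset (Finset.range_mono hlt), Finset.sum_range_succ']
  · rw [eval_ite, NExp.eval_var, MState.set_var_self, if_neg (by omega), eval_zero, add_zero]
    refine Finset.sum_congr rfl fun e he => ?_
    have he := Finset.mem_range.mp he
    have hS : Ready m s r Δ D (S.set 7 (e + 1)) := h.set (by omega) _
    have e7 : ((NExp.var 7).sub (.const 1)).eval (S.set 7 (e + 1)) = e := by
      rw [NExp.eval_sub, NExp.eval_var, NExp.eval_const, MState.set_var_self]; omega
    have v7 : ((NExp.var 7).sub (.const 1)).eval (S.set 7 (e + 1)) ≤ (S.set 7 (e + 1)).len := by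
      rw [e7, MState.set_len]; omega
    have e8 : (NExp.var 8).eval (S.set 7 (e + 1)) = S.var 8 :=
      MState.set_var_ne S 7 8 (e + 1) (by omega)
    rw [eval_ite, NExp.eval_var, MState.set_var_self, if_pos (by omega), eval_ifLt,
      NExp.eval_basePow hS, MState.set_var_ne _ _ _ _ (by omega), e7, if_pos he, eval_mul, eval_mul,
      eval_inv, eval_load_of_lt (by rw [e8]; exact h8), eval_load_of_lt (by rw [e8]; exact h8), e8,
      eval_monoDeriv hS (by rw [hp]; exact hv) (fun j => NExp.eval_expDig_le hS v7 j), hp,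
      NExp.eval_var, MState.set_var_self]
    simp only [NExp.eval_expDig hS v7, e7]
    rfl
  · intro u _ hu
    have hu : S.var 3 ^ m < u := by simpa using hu
    have hS : Ready m s r Δ D (S.set 7 u) := h.set (by omega) _
    rw [eval_ite, NExp.eval_var, MState.set_var_self, if_pos (by omega), eval_ifLt,
      NExp.eval_basePow hS, MState.set_var_ne _ _ _ _ (by omega), NExp.eval_sub, NExp.eval_var,
      MState.set_var_self, NExp.eval_const, if_neg (by omega)]

end Equations

/-! ## Computing the recurrences -/

section InterpStep

variable {K : Type*} [Field K] {m s r Δ D : ℕ} {S : MState K}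

theorem Stmt.exec_solve_map {ι : Type*} {valid : NExp} {E : ι → FExp} {l : List ι} {S : MState K}
    {V : ℕ → Prop} {G : ι → ℕ → ℕ → K} (hL : 0 < S.len)
    (hv : ∀ S', Frame 3 S S' → S'.var 4 < S.len → (valid.eval S' ≠ 0 ↔ V (S'.var 4)))
    (hE : ∀ i ∈ l, ∀ S', Frame 3 S S' → S'.var 6 < S.len → S'.var 7 < S.len →
      (E i).eval S' = G i (S'.var 6) (S'.var 7)) :
    Frame 3 S ((Stmt.solve valid (l.map E)).exec S) ∧
    (∀ i < S.len, (∀ u, ¬V u → ((Stmt.solve valid (l.map E)).exec S).row 3 i u = 0) ∧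
      ∀ z < S.len, ∀ e ∈ l, ∑ u ∈ Finset.range S.len,
        G e z u * ((Stmt.solve valid (l.map E)).exec S).row 3 i u = 0) ∧
    ∀ x : ℕ → K, (∀ u, ¬V u → x u = 0) → (∀ z < S.len, ∀ e ∈ l,
      ∑ u ∈ Finset.range S.len, G e z u * x u = 0) → ∀ j < S.len, x j ≠ 0 →
      ∃ i < S.len, ((Stmt.solve valid (l.map E)).exec S).row 3 i j ≠ 0 := by
  have hf : ∀ z u, Frame 3 S ((S.set 6 z).set 7 u) := fun z u =>
    ((Frame.refl 3 S).set (by omega) (by omega) z).set (by omega) (by omega) u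
  have v6 : ∀ z u, ((S.set 6 z).set 7 u).var 6 = z := fun z u => by
    rw [MState.set_var_ne _ _ _ _ (by omega), MState.set_var_self]
  have v7 : ∀ z u, ((S.set 6 z).set 7 u).var 7 = u := fun z u => MState.set_var_self ..
  have hG : ∀ e ∈ l, ∀ z < S.len, ∀ u < S.len, (E e).eval ((S.set 6 z).set 7 u) = G e z u := by
    intro e he z hz u hu
    rw [hE e he _ (hf z u) (by rwa [v6]) (by rwa [v7]), v6, v7]
  have hsum : ∀ e ∈ l, ∀ z < S.len, ∀ x : ℕ → K,
      ∑ u ∈ Finset.range S.len, (E e).eval ((S.set 6 z).set 7 u) * x u =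
        ∑ u ∈ Finset.range S.len, G e z u * x u := fun e he z hz x =>
    Finset.sum_congr rfl fun u hu => by rw [hG e he z hz u (Finset.mem_range.mp hu)]
  obtain ⟨h1, h2, h3⟩ := Stmt.exec_solve_rows (valid := valid) (φs := l.map E)
    (a := fun φ z u => φ.eval ((S.set 6 z).set 7 u)) hL hv (by
      intro φ hφ S' hS' h6 h7
      obtain ⟨e, he, rfl⟩ := List.mem_map.mp hφ
      rw [hE e he S' hS' h6 h7, hG e he _ h6 _ h7])
  refine ⟨h1, fun i hi => ⟨(h2 i hi).1, fun z hz e he => ?_⟩, fun x hx hx' => h3 x hx ?_⟩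
  · rw [← hsum e he z hz]
    exact (h2 i hi).2 z hz _ (List.mem_map.mpr ⟨e, he, rfl⟩)
  · intro z hz φ hφ
    obtain ⟨e, he, rfl⟩ := List.mem_map.mp hφ
    rw [hsum e he z hz]
    exact hx' z hz e he

theorem MState.point_congr {S S' : MState K} (hlen : S'.len = S.len) (hvar : S'.var 0 = S.var 0)
    (harr : S'.arr 1 = S.arr 1) : (S'.point : ℕ → Fin m → K) = S.point := by
  funext p j
  rw [MState.point, MState.point, MState.row_congr hlen harr, hvar]

theorem MState.word_congr {S S' : MState K} (hlen : S'.len = S.len) (hvar : S'.var 0 = S.var 0)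
    (harr : S'.arr 1 = S.arr 1) : (S'.word s : ℕ → (Fin m → ℕ) → K) = S.word s := by
  funext p γ
  rw [MState.word, MState.word, MState.row_congr hlen harr, hvar]

/-- The coefficients `x` give polynomials which satisfy the `l`-th system of interpolation
conditions. -/
structure InterpRow (m s r Δ M : ℕ) (S : MState K) (l : Fin m) (x : ℕ → K) : Prop where
  support : ∀ u, ¬IsInterpIdx m (S.var 3) r (Δ * S.var 0) u → x u = 0
  ne_zero : ∃ u, x u ≠ 0
  interp : ∀ p < S.var 0 ^ m, ∀ β ∈ simplex m M, ∑ u ∈ Finset.range (r * S.var 3 ^ m),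
    interpCoeff S.q (S.var 3) r l (S.point p) (S.word s p) β u * x u = 0

/-- Computing the coefficients of the `l`-th recurrence. -/
noncomputable def Stmt.interpStep (s r Δ M : ℕ) (l : Fin m) : Stmt :=
  .seq (.solve (NExp.interpIdx m r Δ) ((simplex m M).toList.map (FExp.interpEq s r l)))
    (.seq (.find (.sum 7 (.sub (.const 1) (.isz (.load 3 (.var 9) (.var 7))))))
      (.tab 2 (.ite (.sub (.var 4) (.const l)) (.load 2 (.var 4) (.var 5))
        (.ite (.sub (.const l) (.var 4)) (.load 2 (.var 4) (.var 5))
          (.load 3 (.var 8) (.var 5))))))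

theorem Stmt.exec_interpStep {M : ℕ} (h : Ready m s r Δ D S)
    (hcard : S.var 0 ^ m * (simplex m M).card < r * (simplex m (Δ * S.var 0 + 1)).card)
    (l : Fin m) : Frame 2 S ((Stmt.interpStep s r Δ M l).exec S) ∧
      InterpRow m s r Δ M S l (((Stmt.interpStep s r Δ M l).exec S).row 2 l) ∧
      ∀ l' : Fin m, l' ≠ l → ((Stmt.interpStep s r Δ M l).exec S).row 2 l' = S.row 2 l' := by
  classical
  have hL := h.len_pos
  have hBL : r * S.var 3 ^ m ≤ S.len := by have := h.base_le; omega
  let G : (Fin m → ℕ) → ℕ → ℕ → K := fun β z u => if z < S.var 0 ^ m then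
    interpCoeff S.q (S.var 3) r l (S.point z) (S.word s z) β u else 0
  obtain ⟨h1, h2, h3⟩ := Stmt.exec_solve_map (valid := NExp.interpIdx m r Δ)
    (E := FExp.interpEq s r l) (l := (simplex m M).toList) (S := S)
    (V := IsInterpIdx m (S.var 3) r (Δ * S.var 0)) (G := G) hL
    (fun S' hS' h4 => by
      rw [← hS'.len] at h4
      rw [NExp.eval_interpIdx (h.frame hS') h4, hS'.var 3 (by omega), hS'.var 0 (by omega)])
    (fun β _ S' hS' h6 h7 => by
      rw [← hS'.len] at h6 h7
      rw [FExp.eval_interpEq (h.frame hS') h6 h7, hS'.var 3 (by omega), hS'.var 0 (by omega),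
        MState.point_congr hS'.len (hS'.var 0 (by omega)) (hS'.arr 1 (by omega)),
        MState.word_congr hS'.len (hS'.var 0 (by omega)) (hS'.arr 1 (by omega)), hS'.q])
  set T := (Stmt.solve (NExp.interpIdx m r Δ)
    ((simplex m M).toList.map (FExp.interpEq s r l))).exec S with hT
  have hsum : ∀ x : ℕ → K, (∀ u, ¬IsInterpIdx m (S.var 3) r (Δ * S.var 0) u → x u = 0) →
      ∀ p < S.var 0 ^ m, ∀ β, ∑ u ∈ Finset.range S.len, G β p u * x u =
        ∑ u ∈ Finset.range (r * S.var 3 ^ m),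
          interpCoeff S.q (S.var 3) r l (S.point p) (S.word s p) β u * x u := by
    intro x hx p hp β
    rw [← Finset.sum_subset (Finset.range_mono hBL)]
    · exact Finset.sum_congr rfl fun u _ => by simp only [G, if_pos hp]
    · intro u _ hu
      rw [hx u fun h => hu (Finset.mem_range.mpr h.1), mul_zero]
  obtain ⟨x, hx1, ⟨u₀, hx2⟩, hx3⟩ := exists_interp (B := S.var 3) (K := K) h.one_le_r
    (by rw [h.base]; have := h.k_pos; omega) hcard
    fun p β u => interpCoeff S.q (S.var 3) r l (S.point p) (S.word s p) β u
  have hu₀ : u₀ < S.len := by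
    by_contra h0
    exact hx2 (hx1 u₀ fun h' => h0 (h'.1.trans_le hBL))
  obtain ⟨i₀, hi₀, hne⟩ := h3 x hx1 (fun z hz β hβ => by
    by_cases hz' : z < S.var 0 ^ m
    · rw [hsum x hx1 z hz']
      exact hx3 z hz' β (Finset.mem_toList.mp hβ)
    · simp only [G, if_neg hz', zero_mul, Finset.sum_const_zero]) u₀ hu₀ hx2
  let g : ℕ → ℕ := fun i => ∑ u ∈ Finset.range S.len, (1 - if T.row 3 i u = 0 then 1 else 0)
  obtain ⟨P, hP, h4, h5⟩ := Stmt.exec_find (c := .sum 7 (.sub (.const 1)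
    (.isz (.load 3 (.var 9) (.var 7))))) (S := T) (g := g) (by rw [h1.len]; exact hL) (by
      intro p v hv
      simp only [NExp.eval_sum, MState.set_len, g, h1.len]
      refine Finset.sum_congr rfl fun u _ => ?_
      have e9 : (NExp.var 9).eval (((T.set 8 p).set 9 v).set 7 u) = v := by
        rw [NExp.eval_var, MState.set_var_ne _ _ _ _ (by omega), MState.set_var_self]
      rw [NExp.eval_sub, NExp.eval_isz, FExp.eval_load_of_lt (by rw [e9]; exact hv), e9,
        NExp.eval_var, MState.set_var_self]
      rfl)
  have hg : ∀ i, g i ≠ 0 ↔ ∃ u < S.len, T.row 3 i u ≠ 0 := by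
    intro i
    simp only [g, ne_eq, Finset.sum_eq_zero_iff, Finset.mem_range, not_forall, exists_prop]
    refine exists_congr fun u => and_congr_right fun _ => ?_
    split_ifs with h <;> simp [h]
  have hgP := (hg P).mp (h5 ⟨i₀, by rw [h1.len]; exact hi₀, (hg i₀).mpr ⟨u₀, hu₀, hne⟩⟩)
  have hf8 : Frame 3 S (T.set 8 P) := h1.set (by omega) (by omega) _
  rw [Stmt.interpStep, Stmt.exec, ← hT, Stmt.exec, h4, Stmt.exec]
  set b : ℕ → ℕ → K := fun i j => (FExp.ite (.sub (.var 4) (.const l)) (.load 2 (.var 4) (.var 5))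
        (.ite (.sub (.const l) (.var 4)) (.load 2 (.var 4) (.var 5))
          (.load 3 (.var 8) (.var 5)))).eval (((T.set 8 P).set 4 i).set 5 j) with hb
  have hrow : ∀ i < S.len, ((T.set 8 P).setArr 2 b).row 2 i =
      if i = l then T.row 3 P else S.row 2 i := by
    intro i hi
    funext j
    rw [MState.row, MState.setArr_len, MState.set_len, h1.len]
    by_cases hj : j < S.len
    · have v4 : (((T.set 8 P).set 4 i).set 5 j).var 4 = i := by
        rw [MState.set_var_ne _ _ _ _ (by omega), MState.set_var_self]
      have v5 : (((T.set 8 P).set 4 i).set 5 j).var 5 = j := MState.set_var_self ..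
      have v8 : (((T.set 8 P).set 4 i).set 5 j).var 8 = P := by
        rw [MState.set_var_ne _ _ _ _ (by omega), MState.set_var_ne _ _ _ _ (by omega),
          MState.set_var_self]
      have l4 : (((T.set 8 P).set 4 i).set 5 j).row 2 i j = S.row 2 i j := by
        rw [MState.row_congr (S := S) (by exact h1.len) (by exact h1.arr 2 (by omega))]
      rw [if_pos hj, MState.setArr_arr_self _ _ _ (by rw [MState.set_len, h1.len]; exact hi)
        (by rw [MState.set_len, h1.len]; exact hj), hb]
      simp only [FExp.eval_ite, NExp.eval_sub, NExp.eval_var, NExp.eval_const, v4]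
      rw [FExp.eval_load_of_lt (by rw [NExp.eval_var, v4]; exact hi.trans_eq h1.len.symm),
        FExp.eval_load_of_lt (by rw [NExp.eval_var, v8]; exact hP), NExp.eval_var, NExp.eval_var,
        NExp.eval_var, v4, v5, v8, l4]
      by_cases hil : i = l
      · rw [if_pos hil, if_neg (by omega), if_neg (by omega)]
        rfl
      · rw [if_neg hil]
        split_ifs <;> first | rfl | omega
    · rw [if_neg hj]
      split_ifs
      · rw [MState.row, if_neg (by rwa [h1.len])]
      · rw [MState.row, if_neg hj]
  have hl : ∀ l : Fin m, (l : ℕ) < S.len := fun l => l.2.trans_le h.m_le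
  obtain ⟨g1, g2⟩ := h2 P (by rwa [h1.len] at hP)
  refine ⟨(hf8.mono (by omega)).setArr le_rfl _, ?_, fun l' hl' => ?_⟩
  · rw [hrow l (hl l), if_pos rfl]
    refine ⟨g1, ?_, fun p hp β hβ => ?_⟩
    · obtain ⟨u, -, hu⟩ := hgP
      exact ⟨u, hu⟩
    · rw [← hsum _ g1 p hp]
      exact g2 p (hp.trans_le h.npow_le) β (Finset.mem_toList.mpr hβ)
  · rw [hrow l' (hl l'), if_neg fun h => hl' (Fin.ext h)]

theorem InterpRow.congr {M : ℕ} {S S' : MState K} (hf : Frame 2 S S') {l : Fin m} {x : ℕ → K}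
    (h : InterpRow m s r Δ M S' l x) : InterpRow m s r Δ M S l x := by
  obtain ⟨h1, h2, h3⟩ := h
  rw [hf.var 3 (by omega), hf.var 0 (by omega)] at h1
  rw [hf.var 3 (by omega), hf.var 0 (by omega), hf.q,
    MState.point_congr hf.len (hf.var 0 (by omega)) (hf.arr 1 (by omega)),
    MState.word_congr hf.len (hf.var 0 (by omega)) (hf.arr 1 (by omega))] at h3
  exact ⟨h1, h2, h3⟩

theorem Stmt.exec_interpSteps {M : ℕ} (h : Ready m s r Δ D S)
    (hcard : S.var 0 ^ m * (simplex m M).card < r * (simplex m (Δ * S.var 0 + 1)).card)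
    (ls : List (Fin m)) : ∀ T, Frame 2 S T →
      Frame 2 S ((Stmt.block (ls.map (Stmt.interpStep s r Δ M))).exec T) ∧ ∀ l,
      (l ∈ ls → InterpRow m s r Δ M S l
        (((Stmt.block (ls.map (Stmt.interpStep s r Δ M))).exec T).row 2 l)) ∧
      (l ∉ ls → ((Stmt.block (ls.map (Stmt.interpStep s r Δ M))).exec T).row 2 l = T.row 2 l) := by
  induction ls with
  | nil => exact fun T hT => ⟨hT.set (by omega) (by omega) _, fun l => ⟨by simp, fun _ => rfl⟩⟩
  | cons l₀ ls ih =>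
    intro T hT
    obtain ⟨h1, h2, h3⟩ := Stmt.exec_interpStep (M := M) (h.frame hT)
      (by rw [hT.var 0 (by omega)]; exact hcard) l₀
    obtain ⟨g1, g2⟩ := ih _ (hT.trans h1)
    refine ⟨g1, fun l => ⟨fun hl => ?_, fun hl => ?_⟩⟩
    · by_cases hl' : l ∈ ls
      · exact (g2 l).1 hl'
      · have e := (g2 l).2 hl'
        have : l = l₀ := by simpa [hl'] using hl
        subst this
        have e' : ((Stmt.block ((l :: ls).map (Stmt.interpStep s r Δ M))).exec T).row 2 l =
          ((Stmt.interpStep s r Δ M l).exec T).row 2 l := e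
        rw [e']
        exact h2.congr hT
    · have hl' : l ∉ ls := fun h => hl (List.mem_cons_of_mem _ h)
      exact ((g2 l).2 hl').trans (h3 l fun h => hl (h ▸ List.mem_cons_self))

end InterpStep

/-! ## The candidates -/

section Candidates

variable {K : Type*} {m s r Δ D : ℕ} {S S' : MState K}

theorem symPos_eq (γ : Fin m → ℕ) (hγ : ∀ j, γ j < s) :
    symPos s γ = (finFunctionFinEquiv fun j => (⟨γ j, hγ j⟩ : Fin s) : ℕ) := by
  rw [finFunctionFinEquiv_apply]
  rfl

theorem lt_of_mem_simplex {γ : Fin m → ℕ} (h : γ ∈ simplex m s) (j : Fin m) : γ j < s :=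
  (Finset.single_le_sum (fun _ _ => Nat.zero_le _) (Finset.mem_univ j)).trans_lt (mem_simplex.mp h)

theorem symPos_lt {γ : Fin m → ℕ} (h : γ ∈ simplex m s) : symPos s γ < s ^ m := by
  rw [symPos_eq γ (lt_of_mem_simplex h)]
  exact Fin.is_lt _

theorem symPos_inj {γ γ' : Fin m → ℕ} (h : γ ∈ simplex m s) (h' : γ' ∈ simplex m s)
    (he : symPos s γ = symPos s γ') : γ = γ' := by
  rw [symPos_eq γ (lt_of_mem_simplex h), symPos_eq γ' (lt_of_mem_simplex h'), Fin.val_inj,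
    finFunctionFinEquiv.apply_eq_iff_eq] at he
  funext j
  exact Fin.val_inj.mpr (congrFun he j)

/-- The states agree in the parameters, the received word and the recurrences. -/
structure Static (S S' : MState K) : Prop where
  len : S'.len = S.len
  q : S'.q = S.q
  var : ∀ x < 4, S'.var x = S.var x
  word : S'.arr 1 = S.arr 1
  recur : S'.arr 2 = S.arr 2

namespace Static

theorem refl (S : MState K) : Static S S := ⟨rfl, rfl, fun _ _ => rfl, rfl, rfl⟩

theorem trans {S'' : MState K} (h : Static S S') (h' : Static S' S'') : Static S S'' :=
  ⟨h'.len.trans h.len, h'.q.trans h.q, fun x hx => (h'.var x hx).trans (h.var x hx),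
    h'.word.trans h.word, h'.recur.trans h.recur⟩

theorem set (h : Static S S') {x : ℕ} (hx : 4 ≤ x) (v : ℕ) : Static S (S'.set x v) :=
  ⟨h.len, h.q, fun y hy => (MState.set_var_ne _ _ _ _ (by omega)).trans (h.var y hy), h.word,
    h.recur⟩

theorem setArr (h : Static S S') {k : ℕ} (h1 : 1 ≠ k) (h2 : 2 ≠ k) (b : ℕ → ℕ → K) :
    Static S (S'.setArr k b) :=
  ⟨h.len, h.q, h.var, (MState.setArr_arr_ne _ h1 _).trans h.word,
    (MState.setArr_arr_ne _ h2 _).trans h.recur⟩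

theorem ready (h : Static S S') (hS : Ready m s r Δ D S) : Ready m s r Δ D S' :=
  hS.congr h.len h.var

variable [Field K]

theorem point_eq (h : Static S S') : (S'.point : ℕ → Fin m → K) = S.point :=
  MState.point_congr h.len (h.var 0 (by omega)) h.word

theorem word_eq (h : Static S S') : (S'.word s : ℕ → (Fin m → ℕ) → K) = S.word s :=
  MState.word_congr h.len (h.var 0 (by omega)) h.word

theorem recur_eq (h : Static S S') (l i : ℕ) : S'.recur m r l i = S.recur m r l i := by
  rw [MState.recur, MState.recur, h.var 3 (by omega), MState.row_congr h.len h.recur]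

end Static

theorem Frame.static (h : Frame 3 S S') : Static S S' :=
  ⟨h.len, h.q, fun x hx => h.var x (Or.inl hx), h.arr 1 (by omega), h.arr 2 (by omega)⟩

variable [Field K]

/-- The polynomial `f` satisfies the recurrences and agrees with the received word at the points
with the numbers `p τ`, and these conditions determine it among its multiples. -/
structure Isolated (s r : ℕ) (S : MState K) (p : Fin D → ℕ)
    (f : MvPolynomial (Fin m) K) : Prop where
  degree : f.totalDegree < S.var 2
  recur : ∀ l : Fin m, recurLin S.q l r (S.recur m r l) f = 0
  agree : ∀ τ, ∀ γ ∈ simplex m s,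
    MvPolynomial.eval (S.point (p τ)) (qDerivIter S.q γ f) = S.word s (p τ) γ
  unique : ∀ (g : MvPolynomial (Fin m) K) (c : K), g.totalDegree < S.var 2 →
    (∀ l : Fin m, recurLin S.q l r (S.recur m r l) g = 0) →
    (∀ τ, ∀ γ ∈ simplex m s, MvPolynomial.eval (S.point (p τ)) (qDerivIter S.q γ g) =
      c * S.word s (p τ) γ) → g = c • f

theorem Isolated.static (h : Static S S') {p : Fin D → ℕ} {f : MvPolynomial (Fin m) K}
    (hf : Isolated s r S p f) : Isolated s r S' p f := by
  have hrec : ∀ l : Fin m, S'.recur m r l = S.recur m r l := fun l => funext fun i =>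
    h.recur_eq l i
  obtain ⟨h1, h2, h3, h4⟩ := hf
  constructor
  · rwa [h.var 2 (by omega)]
  · simpa only [h.q, hrec] using h2
  · simpa only [h.q, h.point_eq, h.word_eq] using h3
  · simpa only [h.q, h.point_eq, h.word_eq, hrec, h.var 2 (by omega)] using h4

/-- The conditions on the state before a candidate is computed. -/
structure CandReady (m s r Δ D : ℕ) (S : MState K) : Prop extends Ready m s r Δ D S where
  q_ne_zero : S.q ≠ 0
  q_ne_one : S.q ≠ 1
  q_pow : ∀ i < S.var 3, ∀ j < S.var 3, S.q ^ i = S.q ^ j → i = j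
  point_ne_zero : ∀ p < S.var 0 ^ m, ∀ j : Fin m, S.point p j ≠ 0
  degree_le : ∀ l : Fin m, ∀ i < r, (S.recur m r l i).totalDegree ≤ Δ * S.var 0

theorem CandReady.static (h : Static S S') (hS : CandReady m s r Δ D S) :
    CandReady m s r Δ D S' := by
  obtain ⟨h0, h1, h2, h3, h4, h5⟩ := hS
  exact ⟨h.ready h0, by rwa [h.q], by rwa [h.q], by rwa [h.q, h.var 3 (by omega)],
    by rwa [h.point_eq, h.var 0 (by omega)], by simpa only [h.recur_eq, h.var 0 (by omega)] using h5⟩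

/-- Computing the candidate which belongs to the points given by the variable `10`. -/
noncomputable def Stmt.candSolve (m s r D : ℕ) : Stmt :=
  .seq (.solve (NExp.candIdx m) (((Finset.univ : Finset (Fin m)).disjSum
      ((Finset.univ : Finset (Fin D)) ×ˢ simplex m s)).toList.map
        (Sum.elim (FExp.recurEq r) fun x => FExp.derivEq s x.1 x.2)))
    (.find (.sub (.const 1) (.isz (.load 3 (.var 9) (.const 0)))))

theorem Stmt.exec_candSolve (h : CandReady m s r Δ D S) (h10 : S.var 10 < S.len) :
    Frame 3 S ((Stmt.candSolve m s r D).exec S) ∧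
    ((Stmt.candSolve m s r D).exec S).var 8 < S.len ∧
    (((Stmt.candSolve m s r D).exec S).cand m).totalDegree < S.var 2 ∧
    ∀ f : MvPolynomial (Fin m) K,
      Isolated s r S (digits (m := D) (S.var 0 ^ m) (S.var 10)) f →
        ((Stmt.candSolve m s r D).exec S).cand m = f := by
  classical
  have hL := h.len_pos
  have hBL := h.base_pow_lt
  have hk := h.k_pos
  have hB := h.base
  let P : Fin D → ℕ := digits (S.var 0 ^ m) (S.var 10)
  have hP : ∀ τ, P τ < S.var 0 ^ m := fun τ => digits_lt h.grid_pos _ _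
  let G : Fin m ⊕ (Fin D × (Fin m → ℕ)) → ℕ → ℕ → K := Sum.elim
    (fun l z u => if z < S.var 3 ^ m then
      recurCoeff S.q (S.var 3) r l (S.recur m r l) (powPoint S.q (S.var 3) z) u else 0)
    (fun x _ u => derivCoeff S.q (S.var 3) (S.point (P x.1)) x.2 (S.word s (P x.1) x.2) u)
  obtain ⟨h1, h2, h3⟩ := Stmt.exec_solve_map (valid := NExp.candIdx m)
    (E := Sum.elim (FExp.recurEq r) fun x : Fin D × (Fin m → ℕ) => FExp.derivEq s x.1 x.2)
    (l := ((Finset.univ : Finset (Fin m)).disjSum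
      ((Finset.univ : Finset (Fin D)) ×ˢ simplex m s)).toList) (S := S)
    (V := IsCandIdx m (S.var 3) (S.var 2)) (G := G) hL
    (fun S' hS' h4 => by
      rw [← hS'.len] at h4
      rw [NExp.eval_candIdx (h.frame hS') h4, hS'.var 3 (by omega), hS'.var 2 (by omega)])
    (fun e _ S' hS' h6 h7 => by
      rw [← hS'.len] at h6 h7
      have hst := hS'.static
      have hrec : ∀ l : Fin m, S'.recur m r l = S.recur m r l := fun l => funext fun i =>
        hst.recur_eq l i
      rcases e with l | ⟨τ, γ⟩
      · simp only [Sum.elim_inl, G]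
        rw [FExp.eval_recurEq (h.frame hS') h6 h7, hS'.var 3 (by omega), hS'.q, hrec]
      · simp only [Sum.elim_inr, G, P]
        rw [FExp.eval_derivEq (h.frame hS') h7 (by rw [hS'.var 10 (by omega), hS'.len]; exact h10),
          hS'.var 3 (by omega), hS'.var 0 (by omega), hS'.var 10 (by omega), hS'.q, hst.point_eq,
          hst.word_eq])
  set l := ((Finset.univ : Finset (Fin m)).disjSum
      ((Finset.univ : Finset (Fin D)) ×ˢ simplex m s)).toList with hl
  set T := (Stmt.solve (NExp.candIdx m) (l.map (Sum.elim (FExp.recurEq r)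
    fun x : Fin D × (Fin m → ℕ) => FExp.derivEq s x.1 x.2))).exec S with hT
  have hml : ∀ i : Fin m, Sum.inl i ∈ l := fun i => by simp [hl]
  have hmr : ∀ (τ : Fin D), ∀ γ ∈ simplex m s, Sum.inr (τ, γ) ∈ l := fun τ γ hγ => by simp [hl, hγ]
  have hsum : ∀ (x a : ℕ → K), (∀ u, ¬IsCandIdx m (S.var 3) (S.var 2) u → x u = 0) →
      ∑ u ∈ Finset.range S.len, a u * x u =
        ∑ u ∈ Finset.range (S.var 3 ^ m + 1), a u * x u := by
    intro x a hx
    rw [← Finset.sum_subset (Finset.range_mono hBL)]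
    intro u _ hu
    rw [hx u fun h => hu ?_, mul_zero]
    rw [Finset.mem_range]
    rcases u with _ | e
    · omega
    · have := h.1; omega
  have hzero : ∀ x : ℕ → K, (∀ u, ¬IsCandIdx m (S.var 3) (S.var 2) u → x u = 0) →
      ((∀ z < S.len, ∀ e ∈ l, ∑ u ∈ Finset.range S.len, G e z u * x u = 0) ↔
      (∀ i : Fin m, recurLin S.q i r (S.recur m r i)
        (digitPoly m (S.var 3) fun e => x (e + 1)) = 0) ∧
      ∀ τ, ∀ γ ∈ simplex m s, MvPolynomial.eval (S.point (P τ)) (qDerivIter S.q γ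
        (digitPoly m (S.var 3) fun e => x (e + 1))) = x 0 * S.word s (P τ) γ) := by
    intro x hx
    have hdeg := totalDegree_cand_lt (by exact hk) hx
    constructor
    · intro h0
      refine ⟨fun i => ?_, fun τ γ hγ => ?_⟩
      · refine eq_zero_of_eval_powPoint h.q_pow ?_ fun z hz => ?_
        · refine (totalDegree_recurLin_le (h.degree_le i) (E := S.var 2 - 1)
            (by omega)).trans_lt (by omega)
        · rw [← sum_recurCoeff, ← hsum x _ hx, ← h0 z ?_ _ (hml i)]
          · simp only [G, Sum.elim_inl, if_pos hz]
          · omega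
      · have h4 := h0 0 hL _ (hmr τ γ hγ)
        rw [hsum x _ hx] at h4
        simp only [G, Sum.elim_inr] at h4
        rw [sum_derivCoeff h.q_ne_zero h.q_ne_one (h.point_ne_zero _ (hP τ)), sub_eq_zero] at h4
        rw [h4, mul_comm]
    · rintro ⟨h4, h5⟩ z _ e he
      rw [hsum x _ hx]
      rcases e with i | ⟨τ, γ⟩
      · simp only [G, Sum.elim_inl]
        by_cases hz : z < S.var 3 ^ m
        · simp only [if_pos hz]
          rw [sum_recurCoeff, h4, map_zero]
        · simp only [if_neg hz, zero_mul, Finset.sum_const_zero]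
      · simp only [G, Sum.elim_inr]
        have hγ : γ ∈ simplex m s := by simpa [hl] using he
        rw [sum_derivCoeff h.q_ne_zero h.q_ne_one (h.point_ne_zero _ (hP τ)), h5 τ γ hγ, mul_comm,
          sub_self]
  obtain ⟨p, hp, h4, h5⟩ := Stmt.exec_find (c := .sub (.const 1)
    (.isz (.load 3 (.var 9) (.const 0)))) (S := T)
    (g := fun i => 1 - if T.row 3 i 0 = 0 then 1 else 0) (by rw [h1.len]; exact hL) (by
      intro p v hv
      have e9 : (NExp.var 9).eval ((T.set 8 p).set 9 v) = v := by
        rw [NExp.eval_var, MState.set_var_self]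
      rw [NExp.eval_sub, NExp.eval_isz, FExp.eval_load_of_lt (by rw [e9]; exact hv), e9]
      rfl)
  have hp' : p < S.len := by rwa [h1.len] at hp
  have hg : ∀ i, 1 - (if T.row 3 i 0 = 0 then 1 else 0) ≠ 0 ↔ T.row 3 i 0 ≠ 0 := by
    intro i
    split_ifs with h <;> simp [h]
  rw [Stmt.candSolve, Stmt.exec, ← hT, h4]
  have hcand : (T.set 8 p).cand m = digitPoly m (S.var 3) fun e =>
      T.row 3 p (e + 1) * (T.row 3 p 0)⁻¹ := by
    rw [MState.cand, MState.set_var_self, MState.set_var_ne _ _ _ _ (by omega),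
      h1.var 3 (by omega)]
    rfl
  refine ⟨h1.set (by omega) (by omega) _, by rwa [MState.set_var_self], ?_, fun f hf => ?_⟩
  · rw [hcand]
    exact totalDegree_cand_lt (x := fun u => T.row 3 p u * (T.row 3 p 0)⁻¹) hk fun u hu => by
      rw [(h2 p hp').1 u hu, zero_mul]
  · have hfB : f.totalDegree < S.var 3 := hf.degree.trans_le (by omega)
    let x : ℕ → K := fun u => if IsCandIdx m (S.var 3) (S.var 2) u then
      (Nat.casesOn u 1 fun e => f.coeff (expo m (S.var 3) e) : K) else 0
    have hx : ∀ u, ¬IsCandIdx m (S.var 3) (S.var 2) u → x u = 0 := fun u hu => if_neg hu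
    have hx0 : x 0 = 1 := if_pos trivial
    have hxf : (digitPoly m (S.var 3) fun e => x (e + 1)) = f := by
      conv_rhs => rw [eq_digitPoly hfB]
      refine MvPolynomial.ext _ _ fun d => ?_
      rw [digitPoly, digitPoly]
      congr 1
      refine Finset.sum_congr rfl fun e he => ?_
      have he := Finset.mem_range.mp he
      congr 1
      simp only [x]
      split_ifs with hc
      · rfl
      · symm
        by_contra hne
        refine hc ⟨he, lt_of_le_of_lt ?_ hf.degree⟩
        have := MvPolynomial.le_totalDegree (MvPolynomial.mem_support_iff.mpr hne)
        rwa [Finsupp.sum_fintype _ _ fun _ => rfl] at this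
    obtain ⟨i, hi, hi0⟩ := h3 x hx ((hzero x hx).mpr ⟨fun i => by rw [hxf]; exact hf.recur i,
      fun τ γ hγ => by rw [hxf, hx0, one_mul]; exact hf.agree τ γ hγ⟩) 0 hL
      (by rw [hx0]; exact one_ne_zero)
    have hp0 := (hg p).mp (h5 ⟨i, by rw [h1.len]; exact hi, (hg i).mpr hi0⟩)
    obtain ⟨g1, g2⟩ := h2 p hp'
    obtain ⟨g3, g4⟩ := (hzero _ g1).mp g2
    have h6 := hf.unique _ _ (totalDegree_cand_lt hk g1) g3 g4
    rw [hcand]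
    simp only [mul_comm _ (T.row 3 p 0)⁻¹]
    rw [digitPoly_smul, h6, smul_smul, inv_mul_cancel₀ hp0, one_smul]

end Candidates

/-! ## Testing the candidates -/

section Output

variable {K : Type*} [Field K] {m s r Δ D : ℕ} {S S' : MState K}

open Classical in
/-- The number of points where the derivatives of a polynomial differ from the received word. -/
noncomputable def MState.err (S : MState K) (m s : ℕ) (g : MvPolynomial (Fin m) K) : ℕ :=
  ((Finset.range (S.var 0 ^ m)).filter fun p => ∃ γ ∈ simplex m s,
    MvPolynomial.eval (S.point p) (qDerivIter S.q γ g) ≠ S.word s p γ).card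

theorem Static.err_eq (h : Static S S') : (S'.err m s : MvPolynomial (Fin m) K → ℕ) = S.err m s := by
  funext g
  rw [MState.err, MState.err, h.point_eq, h.word_eq, h.q, h.var 0 (by omega)]

/-- The number of errors of the candidate. -/
noncomputable def NExp.errors (m s : ℕ) : NExp :=
  .sum 6 (.ifLt (.var 6) (.npow (.var 0) m) (.ite (.sumL ((simplex m s).toList.map fun γ =>
    .sub (.const 1) (.isz (.sub (FExp.candDeriv (.var 6) γ) (FExp.wordAt s (.var 6) γ)))))
      (.const 1) (.const 0)))

theorem NExp.eval_errors (h : CandReady m s r Δ D S) (h8 : S.var 8 < S.len) :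
    (NExp.errors m s).eval S = S.err m s (S.cand m) := by
  classical
  rw [errors, eval_sum, MState.err, Finset.card_filter,
    ← Finset.sum_subset (Finset.range_mono h.npow_le)]
  · refine Finset.sum_congr rfl fun p hp => ?_
    have hp := Finset.mem_range.mp hp
    have hst : Static S (S.set 6 p) := (Static.refl S).set (by omega) _
    have hS := hst.ready h.toReady
    have v6 : (S.set 6 p).var 6 = p := MState.set_var_self ..
    have v0 : (S.set 6 p).var 0 = S.var 0 := rfl
    have e : ∀ γ ∈ simplex m s, (NExp.sub (.const 1) (.isz (.sub (FExp.candDeriv (.var 6) γ)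
        (FExp.wordAt s (.var 6) γ)))).eval (S.set 6 p) =
        if MvPolynomial.eval (S.point p) (qDerivIter S.q γ (S.cand m)) ≠ S.word s p γ then 1
        else 0 := by
      intro γ _
      rw [eval_sub, eval_const, eval_isz, FExp.eval_sub, FExp.eval_wordAt hS,
        FExp.eval_candDeriv hS (v := p) (fun u => by
          rw [eval_var, MState.set_var_ne _ _ _ _ (by omega), v6])
          (hp.le.trans h.npow_le) h8 h.q_ne_zero h.q_ne_one (by
            rw [hst.point_eq]; exact h.point_ne_zero p hp), eval_var, v6, hst.point_eq, hst.word_eq,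
        sub_eq_zero]
      change 1 - (if MvPolynomial.eval (S.point p) (qDerivIter S.q γ (S.cand m)) = S.word s p γ
        then 1 else 0) = _
      split_ifs <;> first | rfl | contradiction
    rw [eval_ifLt, eval_gridPow hS, eval_var, v6, v0, if_pos hp, eval_ite, eval_sumL,
      List.map_map, eval_const, eval_const]
    refine if_congr ?_ rfl rfl
    have e' : ((simplex m s).toList.map ((fun a => a.eval (S.set 6 p)) ∘ fun γ =>
        NExp.sub (.const 1) (.isz (.sub (FExp.candDeriv (.var 6) γ)
        (FExp.wordAt s (.var 6) γ))))).sum = ∑ γ ∈ simplex m s,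
        if MvPolynomial.eval (S.point p) (qDerivIter S.q γ (S.cand m)) ≠ S.word s p γ then 1
        else 0 := by
      rw [Finset.sum_map_toList]
      exact Finset.sum_congr rfl e
    rw [e', ne_eq, Finset.sum_eq_zero_iff]
    push Not
    exact exists_congr fun γ => and_congr_right fun _ => by simp
  · intro p _ hp
    have hS : Ready m s r Δ D (S.set 6 p) := h.toReady.set (by omega) _
    rw [eval_ifLt, eval_gridPow hS, eval_var, MState.set_var_self,
      MState.set_var_ne _ _ _ _ (by omega), if_neg (by simpa using hp)]

/-- The condition that the candidate is near the received word. -/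
noncomputable def NExp.accepted (m s D : ℕ) : NExp :=
  .ifLt (.var 10) (.npow (.npow (.var 0) m) D)
    (.ite (.lt (.errors m s) (.add (.var 1) (.const 1))) (.const 1) (.const 0))

theorem NExp.eval_accepted (h : CandReady m s r Δ D S) (h8 : S.var 8 < S.len) :
    (NExp.accepted m s D).eval S =
      if S.var 10 < (S.var 0 ^ m) ^ D ∧ S.err m s (S.cand m) ≤ S.var 1 then 1 else 0 := by
  have h1 := eval_gridPow h.toReady m
  rw [accepted, eval_ifLt, eval_npow (by rw [h1]; exact h.npow_le), h1, eval_var, eval_ite, ite_and]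
  refine if_congr Iff.rfl (if_congr ?_ rfl rfl) rfl
  rw [eval_lt_ne_zero, eval_errors h h8, eval_add, eval_var, eval_const, Nat.lt_succ_iff]

/-- The array `0` with the evaluation of the candidate, if it is accepted, as the next block. -/
noncomputable def FExp.output (m s : ℕ) : FExp :=
  .ite (.var 12) (.ite (.var 4) (.load 0 (.var 4) (.var 5))
    (.ite (.lt (.var 5) (.mul (.mul (.var 11) (.npow (.var 0) m)) (.const (s ^ m))))
      (.load 0 (.var 4) (.var 5))
      (.ifLt (off m s) (.mul (.npow (.var 0) m) (.const (s ^ m)))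
        (.sumL ((simplex m s).toList.map fun γ => .ifEq (.rem (off m s) (.const (s ^ m)))
          (.const (symPos s γ)) (candDeriv (.div (off m s) (.const (s ^ m))) γ))))))
    (.load 0 (.var 4) (.var 5))
where
  /-- The position in the block. -/
  off (m s : ℕ) : NExp :=
    .sub (.var 5) (.mul (.mul (.var 11) (.npow (.var 0) m)) (.const (s ^ m)))

theorem NExp.eval_blockStart (h : Ready m s r Δ D S) :
    (NExp.mul (.mul (.var 11) (.npow (.var 0) m)) (.const (s ^ m))).eval S =
      S.var 11 * (S.var 0 ^ m * s ^ m) := by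
  have h1 := NExp.eval_gridPow h m
  rw [eval_mul_of_le (by exact h.sym_le), eval_mul_of_le (by rw [h1]; exact h.npow_le), h1,
    eval_var, eval_const, mul_assoc]

theorem FExp.eval_output_of_eq_zero (h12 : S.var 12 = 0) (h4 : S.var 4 < S.len) :
    (FExp.output m s).eval S = S.row 0 (S.var 4) (S.var 5) := by
  rw [output, eval_ite, NExp.eval_var, if_neg (by omega), eval_load_of_lt (by exact h4)]
  rfl

theorem FExp.eval_output_of_lt (h : Ready m s r Δ D S) (h4 : S.var 4 = 0)
    (h5 : S.var 5 < S.var 11 * (S.var 0 ^ m * s ^ m)) :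
    (FExp.output m s).eval S = S.row 0 (S.var 4) (S.var 5) := by
  have h6 := NExp.eval_blockStart h
  rw [output, eval_ite, eval_ite, eval_ite, eval_load_of_lt (by rw [NExp.eval_var, h4]; exact h.len_pos)]
  rw [if_pos (NExp.eval_lt_ne_zero.mpr (by rw [h6]; exact h5))]
  simp only [ite_self]
  rfl

theorem FExp.eval_output (h : CandReady m s r Δ D S) (h12 : S.var 12 ≠ 0) (h4 : S.var 4 = 0)
    (h8 : S.var 8 < S.len) {p : ℕ} (hp : p < S.var 0 ^ m) {γ : Fin m → ℕ} (hγ : γ ∈ simplex m s)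
    (h5 : S.var 5 = S.var 11 * (S.var 0 ^ m * s ^ m) + (p * s ^ m + symPos s γ))
    (h5' : S.var 5 < S.len) :
    (FExp.output m s).eval S = MvPolynomial.eval (S.point p) (qDerivIter S.q γ (S.cand m)) := by
  classical
  have h6 := NExp.eval_blockStart h.toReady
  have h7 := symPos_lt hγ
  have hoffS : ∀ S' : MState K, Ready m s r Δ D S' → S'.var 5 = S.var 5 → S'.var 11 = S.var 11 →
      S'.var 0 = S.var 0 → (output.off m s).eval S' = p * s ^ m + symPos s γ := by
    intro S' hS' e5 e11 e0
    rw [output.off, NExp.eval_sub, NExp.eval_blockStart hS', NExp.eval_var, e5, e11, e0, h5]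
    omega
  have hoff := hoffS S h.toReady rfl rfl rfl
  have hoff' : (output.off m s).eval S ≤ S.len := by rw [hoff]; omega
  have hs : (0 : ℕ) < (NExp.const (s ^ m)).eval S := h.sym_pos
  have hrem : ((output.off m s).rem (.const (s ^ m))).eval S = symPos s γ := by
    rw [NExp.eval_rem hoff' hs, hoff, NExp.eval_const, mul_comm p, Nat.mul_add_mod,
      Nat.mod_eq_of_lt h7]
  have hdiv : ∀ u, ((output.off m s).div (.const (s ^ m))).eval (S.set 7 u) = p := by
    intro u
    have h9 := hoffS (S.set 7 u) (h.toReady.set (by omega) u) rfl rfl rfl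
    rw [NExp.eval_div_of_le (by rw [h9, MState.set_len]; omega) (by exact hs), h9, NExp.eval_const,
      mul_comm p, Nat.mul_add_div h.sym_pos, Nat.div_eq_of_lt h7, add_zero]
  have hW : ((NExp.var 0).npow m |>.mul (.const (s ^ m))).eval S = S.var 0 ^ m * s ^ m := by
    rw [NExp.eval_mul_of_le (by exact h.sym_le), NExp.eval_gridPow h.toReady, NExp.eval_const]
  have hlt : p * s ^ m + symPos s γ < S.var 0 ^ m * s ^ m := by
    have := Nat.mul_le_mul_right (s ^ m) hp
    rw [Nat.succ_mul] at this
    omega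
  rw [output, eval_ite, if_pos (by exact h12), eval_ite, if_neg (by rw [NExp.eval_var]; omega),
    eval_ite, if_neg (by rw [NExp.eval_lt_ne_zero, h6, NExp.eval_var]; omega), eval_ifLt, hoff, hW,
    if_pos hlt, eval_sumL, List.map_map, Finset.sum_map_toList, Finset.sum_eq_single γ]
  · simp only [Function.comp_apply]
    rw [eval_ifEq, hrem, NExp.eval_const, if_pos rfl, eval_candDeriv h.toReady hdiv
      (hp.le.trans h.npow_le) h8 h.q_ne_zero h.q_ne_one (h.point_ne_zero p hp)]
  · intro γ' hγ' hne
    simp only [Function.comp_apply]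
    rw [eval_ifEq, hrem, NExp.eval_const, if_neg fun h => hne (symPos_inj hγ' hγ h.symm)]
  · exact fun h => absurd hγ h

/-- The `j`-th block of the array `0` holds the evaluation of the polynomial `g`. -/
def Block (m s : ℕ) (S : MState K) (j : ℕ) (g : MvPolynomial (Fin m) K) : Prop :=
  ∀ p < S.var 0 ^ m, ∀ γ ∈ simplex m s,
    S.row 0 0 (j * (S.var 0 ^ m * s ^ m) + (p * s ^ m + symPos s γ)) =
      MvPolynomial.eval (S.point p) (qDerivIter S.q γ g)

/-- Computing and testing a candidate. -/
noncomputable def Stmt.candStep (m s r D : ℕ) : Stmt :=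
  .seq (.candSolve m s r D) (.seq (.assign 12 (.accepted m s D))
    (.seq (.tab 0 (.output m s)) (.assign 11 (.add (.var 11) (.var 12)))))

theorem Stmt.exec_candStep (h : CandReady m s r Δ D S) (h10 : S.var 10 < S.len)
    (h11 : S.var 11 ≤ S.var 10) :
    Static S ((Stmt.candStep m s r D).exec S) ∧
    ∃ g : MvPolynomial (Fin m) K, g.totalDegree < S.var 2 ∧
      (∀ f, Isolated s r S (digits (m := D) (S.var 0 ^ m) (S.var 10)) f → g = f) ∧
      if S.var 10 < (S.var 0 ^ m) ^ D ∧ S.err m s g ≤ S.var 1 then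
        ((Stmt.candStep m s r D).exec S).var 11 = S.var 11 + 1 ∧
        Block m s ((Stmt.candStep m s r D).exec S) (S.var 11) g ∧
        ∀ J < S.var 11 * (S.var 0 ^ m * s ^ m),
          ((Stmt.candStep m s r D).exec S).row 0 0 J = S.row 0 0 J
      else ((Stmt.candStep m s r D).exec S).var 11 = S.var 11 ∧
        ∀ J, ((Stmt.candStep m s r D).exec S).row 0 0 J = S.row 0 0 J := by
  obtain ⟨h1, h2, h3, h4⟩ := Stmt.exec_candSolve h h10
  set T := (Stmt.candSolve m s r D).exec S with hT
  have hst := h1.static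
  have hTr := h.static hst
  have h8 : T.var 8 < T.len := by rwa [h1.len]
  set ok := (NExp.accepted m s D).eval T with hok
  have hok' : ok = if S.var 10 < (S.var 0 ^ m) ^ D ∧ S.err m s (T.cand m) ≤ S.var 1 then 1
      else 0 := by
    rw [hok, NExp.eval_accepted hTr h8, hst.err_eq, h1.var 10 (by omega), h1.var 0 (by omega),
      h1.var 1 (by omega)]
  set b : ℕ → ℕ → K := fun i j => (FExp.output m s).eval (((T.set 12 ok).set 4 i).set 5 j) with hb
  have hexec : (Stmt.candStep m s r D).exec S =
      ((T.set 12 ok).setArr 0 b).set 11 (S.var 11 + ok) := by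
    rw [Stmt.candStep, Stmt.exec, ← hT, Stmt.exec, Stmt.exec, Stmt.exec, Stmt.exec]
    congr 1
    change (T.set 12 ok).var 11 + (T.set 12 ok).var 12 = _
    rw [MState.set_var_self, MState.set_var_ne _ _ _ _ (by omega), h1.var 11 (by omega)]
  have hst' : Static S (((T.set 12 ok).setArr 0 b).set 11 (S.var 11 + ok)) :=
    ((hst.set (by omega) _).setArr (by omega) (by omega) _).set (by omega) _
  have hrow : ∀ J < S.len, (((T.set 12 ok).setArr 0 b).set 11 (S.var 11 + ok)).row 0 0 J =
      b 0 J := by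
    intro J hJ
    rw [MState.row, if_pos (by rwa [hst'.len]), MState.set_arr, MState.setArr_arr_self]
    · rw [MState.set_len, hst.len]; exact h.len_pos
    · rw [MState.set_len, hst.len]; exact hJ
  have hrow' : ∀ J, ¬J < S.len → ∀ T' : MState K, T'.len = S.len → T'.row 0 0 J = 0 := by
    intro J hJ T' hT'
    rw [MState.row, hT', if_neg hJ]
  have hs2 : ∀ J, Static T (((T.set 12 ok).set 4 0).set 5 J) := fun J =>
    (((Static.refl T).set (by omega) _).set (by omega) _).set (by omega) _
  have v12 : ∀ J, (((T.set 12 ok).set 4 0).set 5 J).var 12 = ok := fun J => by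
    rw [MState.set_var_ne _ _ _ _ (by omega), MState.set_var_ne _ _ _ _ (by omega),
      MState.set_var_self]
  have v4 : ∀ J, (((T.set 12 ok).set 4 0).set 5 J).var 4 = 0 := fun J => by
    rw [MState.set_var_ne _ _ _ _ (by omega), MState.set_var_self]
  have v5 : ∀ J, (((T.set 12 ok).set 4 0).set 5 J).var 5 = J := fun J => MState.set_var_self ..
  have v8 : ∀ J, (((T.set 12 ok).set 4 0).set 5 J).var 8 = T.var 8 := fun J => by
    simp (disch := omega) only [MState.set_var_ne]
  have v11 : ∀ J, (((T.set 12 ok).set 4 0).set 5 J).var 11 = S.var 11 := fun J => by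
    simp (disch := omega) only [MState.set_var_ne]
    exact h1.var 11 (by omega)
  have v0 : ∀ J, (((T.set 12 ok).set 4 0).set 5 J).var 0 = S.var 0 := fun J => by
    simp (disch := omega) only [MState.set_var_ne]
    exact h1.var 0 (by omega)
  have hr0 : ∀ J, (((T.set 12 ok).set 4 0).set 5 J).row 0 0 J = S.row 0 0 J := fun J => by
    rw [MState.row_congr (S := S) (k := 0) (by exact h1.len) (by exact h1.arr 0 (by omega))]
  rw [hexec]
  refine ⟨hst', T.cand m, h3, h4, ?_⟩
  split_ifs with hacc
  · rw [if_pos hacc] at hok'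
    refine ⟨by rw [MState.set_var_self, hok'], fun p hp γ hγ => ?_, fun J hJ => ?_⟩
    · rw [hst'.var 0 (by omega)] at hp ⊢
      rw [hst'.point_eq, hst'.q]
      have hJ : S.var 11 * (S.var 0 ^ m * s ^ m) + (p * s ^ m + symPos s γ) < S.len := by
        have h7 := symPos_lt hγ
        have h9 := Nat.mul_le_mul_right (s ^ m) hp
        have h9' := Nat.mul_le_mul_right (S.var 0 ^ m * s ^ m)
          (show S.var 11 + 1 ≤ (S.var 0 ^ m) ^ D by omega)
        have := h.out_le
        rw [Nat.succ_mul] at h9 h9'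
        omega
      rw [hrow _ hJ, hb]
      dsimp only
      rw [FExp.eval_output (hTr.static (hs2 _)) (by rw [v12, hok']; exact one_ne_zero) (v4 _)
        (by rw [v8]; exact h8) (p := p) (by rw [v0]; exact hp) hγ (by rw [v5, v11, v0])
        (by rw [v5, MState.set_len, MState.set_len, MState.set_len, h1.len]; exact hJ),
        (hs2 _).point_eq, hst.point_eq, (hs2 _).q, hst.q]
      rfl
    · by_cases hJ' : J < S.len
      · rw [hrow J hJ', hb]
        dsimp only
        rw [FExp.eval_output_of_lt ((hs2 J).ready hTr.toReady) (v4 J)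
          (by rw [v5, v11, v0]; exact hJ), v4, v5, hr0]
      · rw [hrow' J hJ' _ hst'.len, hrow' J hJ' _ rfl]
  · rw [if_neg hacc] at hok'
    refine ⟨by rw [MState.set_var_self, hok', add_zero], fun J => ?_⟩
    by_cases hJ' : J < S.len
    · rw [hrow J hJ', hb]
      dsimp only
      rw [FExp.eval_output_of_eq_zero (by rw [v12, hok']) (by
        rw [v4, MState.set_len, MState.set_len, MState.set_len, h1.len]; exact h.len_pos), v4, v5,
        hr0]
    · rw [hrow' J hJ' _ hst'.len, hrow' J hJ' _ rfl]

end Output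

/-! ## The decoder -/

section Decoder

variable {K : Type*} [Field K] {m s r Δ D : ℕ} {S S' : MState K}

theorem Block.static (h : Static S S') {c : ℕ}
    (hrow : ∀ J < c * (S.var 0 ^ m * s ^ m), S'.row 0 0 J = S.row 0 0 J) {j : ℕ} (hj : j < c)
    {g : MvPolynomial (Fin m) K} (hg : Block m s S j g) : Block m s S' j g := by
  intro p hp γ hγ
  rw [h.var 0 (by omega)] at hp ⊢
  rw [h.point_eq, h.q, ← hg p hp γ hγ]
  refine hrow _ ?_
  have h7 := symPos_lt hγ
  have h9 := Nat.mul_le_mul_right (s ^ m) hp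
  have h9' := Nat.mul_le_mul_right (S.var 0 ^ m * s ^ m) (show j + 1 ≤ c by omega)
  rw [Nat.succ_mul] at h9 h9'
  omega

theorem Stmt.iter_candStep (h : CandReady m s r Δ D S) (h11 : S.var 11 = 0) (n : ℕ)
    (hn : n ≤ S.len) {T : MState K} (hT : T = MState.iter 10 (Stmt.candStep m s r D).exec S n) :
    Static S T ∧ T.var 11 ≤ n ∧ T.var 11 ≤ (S.var 0 ^ m) ^ D ∧
    (∀ j < T.var 11, ∃ g, g.totalDegree < S.var 2 ∧ S.err m s g ≤ S.var 1 ∧ Block m s T j g) ∧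
    ∀ C < n, C < (S.var 0 ^ m) ^ D → ∀ f, Isolated s r S (digits (m := D) (S.var 0 ^ m) C) f →
      S.err m s f ≤ S.var 1 → ∃ j < T.var 11, Block m s T j f := by
  induction n generalizing T with
  | zero =>
    obtain rfl : T = S := hT
    rw [h11]
    exact ⟨Static.refl _, le_rfl, Nat.zero_le _, fun j hj => absurd hj (Nat.not_lt_zero _),
      fun j hj => absurd hj (Nat.not_lt_zero _)⟩
  | succ n ih =>
    rw [MState.iter] at hT
    obtain ⟨h1, h2, h3, h4, h5⟩ := ih (by omega) rfl
    set R := MState.iter 10 (Stmt.candStep m s r D).exec S n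
    have hR : Static R (R.set 10 n) := (Static.refl R).set (by omega) _
    have hSR := h1.trans hR
    have v10 : (R.set 10 n).var 10 = n := MState.set_var_self ..
    have v11 : (R.set 10 n).var 11 = R.var 11 := MState.set_var_ne _ _ _ _ (by omega)
    have v0 : (R.set 10 n).var 0 = S.var 0 := hSR.var 0 (by omega)
    have v1 : (R.set 10 n).var 1 = S.var 1 := hSR.var 1 (by omega)
    have v2 : (R.set 10 n).var 2 = S.var 2 := hSR.var 2 (by omega)
    obtain ⟨g1, g, g2, g3, g4⟩ := Stmt.exec_candStep (h.static hSR)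
      (by rw [v10, hSR.len]; omega) (by rwa [v10, v11])
    rw [← hT] at g1 g4
    rw [v10, v11, v0, v1, hSR.err_eq] at g4
    rw [v10, v0] at g3
    rw [v2] at g2
    have hRT : Static R T := hR.trans g1
    have hw0 : R.var 0 = S.var 0 := h1.var 0 (by omega)
    by_cases hacc : n < (S.var 0 ^ m) ^ D ∧ S.err m s g ≤ S.var 1
    · rw [if_pos hacc] at g4
      obtain ⟨c1, c2, c3⟩ := g4
      have hkeep : ∀ j < R.var 11, ∀ f, Block m s R j f → Block m s T j f := fun j hj f hf =>
        hf.static hRT (c := R.var 11) (by rw [hw0]; exact c3) hj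
      refine ⟨hSR.trans g1, by omega, by omega, fun j hj => ?_, fun C hC hCD f hf hfe => ?_⟩
      · rw [c1] at hj
        rcases Nat.lt_succ_iff_lt_or_eq.mp hj with hj | rfl
        · obtain ⟨g', a1, a2, a3⟩ := h4 j hj
          exact ⟨g', a1, a2, hkeep j hj _ a3⟩
        · exact ⟨g, g2, hacc.2, c2⟩
      · rcases Nat.lt_succ_iff_lt_or_eq.mp hC with hC | rfl
        · obtain ⟨j, hj, a⟩ := h5 C hC hCD f hf hfe
          exact ⟨j, by omega, hkeep j hj _ a⟩
        · rw [← g3 f (hf.static hSR)]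
          exact ⟨_, by omega, c2⟩
    · rw [if_neg hacc] at g4
      obtain ⟨c1, c2⟩ := g4
      have hkeep : ∀ j < R.var 11, ∀ f, Block m s R j f → Block m s T j f := fun j hj f hf =>
        hf.static hRT (c := R.var 11) (fun J _ => c2 J) hj
      refine ⟨hSR.trans g1, by omega, by omega, fun j hj => ?_, fun C hC hCD f hf hfe => ?_⟩
      · rw [c1] at hj
        obtain ⟨g', a1, a2, a3⟩ := h4 j hj
        exact ⟨g', a1, a2, hkeep j hj _ a3⟩
      · rcases Nat.lt_succ_iff_lt_or_eq.mp hC with hC | rfl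
        · obtain ⟨j, hj, a⟩ := h5 C hC hCD f hf hfe
          exact ⟨j, by omega, hkeep j hj _ a⟩
        · rw [← g3 f (hf.static hSR)] at hfe
          exact absurd ⟨hCD, hfe⟩ hacc

/-- The part of the decoder which computes the recurrences. -/
noncomputable def Stmt.recurrences (m s r Δ : ℕ) : Stmt :=
  .seq (.tab 1 (.load 0 (.var 4) (.var 5)))
    (.seq (.assign 3 (.add (.mul (.const Δ) (.var 0)) (.var 2)))
      (.seq (.block ((List.finRange m).map (Stmt.interpStep s r Δ (s - r + 1))))
        (.assign 11 (.const 0))))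

theorem Stmt.exec_recurrences (hm : 1 ≤ m) (hr : 1 ≤ r) (hrs : r ≤ s)
    (hpow : (s + m) ^ m ≤ r * Δ ^ m) (hn : 0 < S.var 0) (hk : 0 < S.var 2) (hL : m ≤ S.len)
    (h1 : S.var 0 + S.var 0 ^ m * s ^ m ≤ S.len)
    (h2 : r * (Δ * S.var 0 + S.var 2) ^ m + 1 ≤ S.len)
    (h3 : (S.var 0 ^ m) ^ D * (S.var 0 ^ m * s ^ m) ≤ S.len)
    {T : MState K} (hT : T = (Stmt.recurrences m s r Δ).exec S) :
    Ready m s r Δ D T ∧ T.len = S.len ∧ T.q = S.q ∧ (∀ x < 3, T.var x = S.var x) ∧ T.var 11 = 0 ∧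
    T.row 1 0 = S.row 0 0 ∧ ∀ l, InterpRow m s r Δ (s - r + 1) T l (T.row 2 l) := by
  set R := (S.setArr 1 fun i j => (FExp.load 0 (.var 4) (.var 5)).eval ((S.set 4 i).set 5 j)).set 3
    (Δ * S.var 0 + S.var 2) with hR
  have hRe : ((Stmt.assign 3 (.add (.mul (.const Δ) (.var 0)) (.var 2))).exec
      ((Stmt.tab 1 (.load 0 (.var 4) (.var 5))).exec S)) = R := by
    rw [hR, Stmt.exec, Stmt.exec, NExp.eval_add, NExp.eval_mul_of_le]
    · rfl
    · change S.var 0 ≤ S.len; omega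
  have hvR : ∀ x, x ≠ 3 → R.var x = S.var x := fun x hx => MState.set_var_ne _ _ _ _ hx
  have hR3 : R.var 3 = Δ * S.var 0 + S.var 2 := MState.set_var_self ..
  have hRr : Ready m s r Δ D R := by
    constructor <;> first | rw [hvR 0 (by omega)] | skip
    all_goals first | exact hm | exact hr | exact hn | omega | skip
    · rw [hR3, hvR 2 (by omega)]
    · rwa [hvR 2 (by omega)]
    · exact hL
    · exact h1
    · rw [hR3]; exact h2
    · exact h3
  obtain ⟨f1, f2⟩ := Stmt.exec_interpSteps (M := s - r + 1) hRr (card_simplex_lt hm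
    (by rw [hvR 0 (by omega)]; exact hn) (by omega) (by omega) hpow) (List.finRange m) R
      (Frame.refl 2 R)
  set Q := (Stmt.block ((List.finRange m).map (Stmt.interpStep s r Δ (s - r + 1)))).exec R with hQ
  have hTQ : T = Q.set 11 0 := by
    rw [hT, hQ, ← hRe]
    rfl
  have hTv : ∀ x < 4, T.var x = R.var x := fun x hx => by
    rw [hTQ, MState.set_var_ne _ _ _ _ (by omega), f1.var x (Or.inl hx)]
  have hTlen : T.len = R.len := by rw [hTQ]; exact f1.len
  refine ⟨hRr.congr hTlen hTv, hTlen, ?_, fun x hx => ?_, ?_, ?_, fun l => ?_⟩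
  · rw [hTQ]; exact f1.q
  · rw [hTv x (by omega), hvR x (by omega)]
  · rw [hTQ, MState.set_var_self]
  · have e1 : T.row 1 = R.row 1 := MState.row_congr hTlen (by rw [hTQ]; exact f1.arr 1 (by omega))
    rw [e1]
    funext J
    rw [MState.row, MState.row]
    refine if_ctx_congr Iff.rfl (fun hJ => ?_) fun _ => rfl
    have hL0 : 0 < S.len := by omega
    have hJ' : J < S.len := hJ
    rw [hR, MState.set_arr, MState.setArr_arr_self _ _ _ hL0 hJ', FExp.eval_load]
    have v4 : ((S.set 4 0).set 5 J).var 4 = 0 := by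
      rw [MState.set_var_ne _ _ _ _ (by omega), MState.set_var_self]
    rw [NExp.eval_var, NExp.eval_var, v4, MState.set_var_self]
    exact if_pos ⟨hL0, hJ'⟩
  · have e2 : T.row 2 = Q.row 2 := MState.row_congr (by rw [hTQ]; rfl) (by rw [hTQ]; rfl)
    rw [e2]
    obtain ⟨g1, g2, g3⟩ := ((f2 l).1 (List.mem_finRange l)).congr (S := Q) ⟨f1.len.symm, f1.q.symm,
      fun x hx => (f1.var x hx).symm, fun k hk => (f1.arr k hk).symm⟩
    rw [hTQ]
    exact ⟨g1, g2, g3⟩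

end Decoder

/-! ## Correctness of the decoder -/

section Correctness

variable {F : Type*} {m s r Δ k : ℕ} {A : Finset F} {e : Fin A.card ≃ A}

/-- The number of a point of the grid. -/
def pointIdx (e : Fin A.card ≃ A) (a : Fin m → A) : ℕ :=
  (finFunctionFinEquiv (fun j => e.symm (a j)) : ℕ)

theorem pointIdx_lt (a : Fin m → A) : pointIdx e a < A.card ^ m := Fin.is_lt _

theorem pointIdx_injective : Function.Injective (pointIdx (m := m) e) := by
  intro a b h
  have h1 := finFunctionFinEquiv.injective (Fin.val_injective h)
  funext j
  exact e.symm.injective (congrFun h1 j)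

theorem exists_pointIdx {p : ℕ} (hp : p < A.card ^ m) : ∃ a : Fin m → A, pointIdx e a = p := by
  refine ⟨fun j => e (finFunctionFinEquiv.symm ⟨p, hp⟩ j), ?_⟩
  simp [pointIdx]

theorem val_mem_simplex (γ : MultiIdx m s) : (fun j => (γ.1 j : ℕ)) ∈ simplex m s :=
  mem_simplex.mpr γ.2

theorem wordPos_eq (a : Fin m → A) (γ : MultiIdx m s) :
    wordPos e a γ = pointIdx e a * s ^ m + symPos s fun j => (γ.1 j : ℕ) := by
  rw [symPos_eq _ fun j => (γ.1 j).2]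
  rfl

theorem wordPos_lt (a : Fin m → A) (γ : MultiIdx m s) : wordPos e a γ < A.card ^ m * s ^ m := by
  rw [wordPos_eq]
  have h1 := symPos_lt (val_mem_simplex γ)
  have h2 := Nat.mul_le_mul_right (s ^ m) (pointIdx_lt (e := e) a)
  rw [Nat.succ_mul] at h2
  omega

variable {K : Type*} [Field F] [Field K] [Algebra F K] {w : QWord K m s A} {T : MState K}

/-- The row `x` holds the elements of `A` and the received word. -/
def HoldsRow (e : Fin A.card ≃ A) (w : QWord K m s A) (x : ℕ → K) : Prop :=
  (∀ i : Fin A.card, x i = algebraMap F K (e i)) ∧ ∀ a γ, x (A.card + wordPos e a γ) = w a γ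

namespace HoldsRow

theorem point_eq (h : HoldsRow e w (T.row 1 0)) (h0 : T.var 0 = A.card) (a : Fin m → A) :
    T.point (pointIdx e a) = gridPoint K a := by
  funext j
  rw [MState.point, h0, pointIdx, digits_finFunctionFinEquiv, h.1, Equiv.apply_symm_apply]
  rfl

theorem word_eq (h : HoldsRow e w (T.row 1 0)) (h0 : T.var 0 = A.card) (a : Fin m → A)
    (γ : MultiIdx m s) : T.word s (pointIdx e a) (fun j => (γ.1 j : ℕ)) = w a γ := by
  rw [MState.word, h0, ← wordPos_eq, h.2]

theorem err_eq [DecidableEq (MultiIdx m s → K)] (h : HoldsRow e w (T.row 1 0))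
    (h0 : T.var 0 = A.card) (g : MvPolynomial (Fin m) K) :
    T.err m s g = (Finset.univ.filter fun a => qEncode T.q s A g a ≠ w a).card := by
  classical
  rw [MState.err, ← Finset.card_image_of_injective _ (pointIdx_injective (m := m) (e := e))]
  congr 1
  ext p
  simp only [Finset.mem_filter, Finset.mem_range, Finset.mem_image, Finset.mem_univ, true_and, h0]
  have key : ∀ a : Fin m → A, (∃ γ ∈ simplex m s, MvPolynomial.eval (T.point (pointIdx e a))
      (qDerivIter T.q γ g) ≠ T.word s (pointIdx e a) γ) ↔ qEncode T.q s A g a ≠ w a := by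
    intro a
    rw [Function.ne_iff, h.point_eq h0]
    constructor
    · rintro ⟨γ, hγ, hne⟩
      refine ⟨MultiIdx.ofSumLt γ (mem_simplex.mp hγ), ?_⟩
      rw [← h.word_eq h0]
      exact hne
    · rintro ⟨γ, hγ⟩
      refine ⟨_, val_mem_simplex γ, ?_⟩
      rw [h.word_eq h0]
      exact hγ
  constructor
  · rintro ⟨hp, hγ⟩
    obtain ⟨a, rfl⟩ := exists_pointIdx (e := e) hp
    exact ⟨a, (key a).mp hγ, rfl⟩
  · rintro ⟨a, ha, rfl⟩
    exact ⟨pointIdx_lt a, (key a).mpr ha⟩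

theorem block_iff (h : HoldsRow e w (T.row 1 0)) (h0 : T.var 0 = A.card) {j : ℕ}
    {g : MvPolynomial (Fin m) K} : Block m s T j g ↔ ∀ (a : Fin m → A) (γ : MultiIdx m s),
      T.row 0 0 (j * (A.card ^ m * s ^ m) + wordPos e a γ) = qEncode T.q s A g a γ := by
  rw [Block, h0]
  constructor
  · intro hb a γ
    rw [wordPos_eq, hb _ (pointIdx_lt a) _ (val_mem_simplex γ), h.point_eq h0]
    rfl
  · intro hb p hp γ hγ
    obtain ⟨a, rfl⟩ := exists_pointIdx (e := e) hp
    have := hb a (MultiIdx.ofSumLt γ (mem_simplex.mp hγ))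
    rw [wordPos_eq] at this
    rw [h.point_eq h0]
    exact this

end HoldsRow

theorem isInterpolant_recur (h : HoldsRow e w (T.row 1 0))
    (h0 : T.var 0 = A.card)
    (hI : ∀ l, InterpRow m s r Δ (s - r + 1) T l (T.row 2 l)) :
    IsInterpolant T.q s r (Δ * A.card) A (fun a => T.word s (pointIdx e a))
      (fun l i => T.recur m r l i) := by
  constructor
  · intro l i hi
    rw [← h0]
    exact totalDegree_interp_le hi (hI l).support
  · intro l
    obtain ⟨u, hu⟩ := (hI l).ne_zero
    refine exists_interp_ne_zero (u := u) (T := Δ * T.var 0) ?_ hu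
    by_contra hn
    exact hu ((hI l).support u hn)
  · intro l a β hβ
    rw [← h.point_eq h0]
    have := (hI l).interp (pointIdx e a) (by rw [h0]; exact pointIdx_lt a) β hβ
    rwa [sum_interpCoeff] at this

/-- The list decoding algorithm. -/
noncomputable def Stmt.decode (m s r Δ : ℕ) : Stmt :=
  .seq (.recurrences m s r Δ) (.seq (.loop 10 (.candStep m s r (r ^ m))) (.assign 0 (.var 11)))

theorem Stmt.exec_decode [Fintype F] (h3 : Module.finrank F K = 3) (hs : s ≤ Fintype.card F)
    {Q : Kˣ} (hQ : ∀ x : Kˣ, x ∈ Subgroup.zpowers Q) (hA : A.Nonempty) (hA0 : (0 : F) ∉ A)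
    {δ ε : ℝ} (hp : DecoderParams m s δ ε r Δ) (hk : k = ⌈(1 - δ) * ((s : ℝ) * (A.card : ℝ))⌉₊)
    {S : MState K} (hq : S.q = Q) (h0 : S.var 0 = A.card)
    (h1 : S.var 1 = ⌊(δ - ε) * (A.card : ℝ) ^ m⌋₊) (h2 : S.var 2 = k)
    (hw : HoldsRow e w (S.row 0 0)) (hL : m ≤ S.len)
    (hL1 : A.card + A.card ^ m * s ^ m ≤ S.len) (hL2 : r * (Δ * A.card + k) ^ m + 1 ≤ S.len)
    (hL3 : (A.card ^ m) ^ (r ^ m) * (A.card ^ m * s ^ m) ≤ S.len)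
    (hT : T = (Stmt.decode m s r Δ).exec S) :
    T.len = S.len ∧ T.var 0 * (A.card ^ m * s ^ m) ≤ S.len ∧
      {u : QWord K m s A | ∃ j < T.var 0, ∀ a γ,
        u a γ = T.row 0 0 (j * (A.card ^ m * s ^ m) + wordPos e a γ)} =
      {u | u ∈ qMultCode (Q : K) m s A k ∧ relDist u w ≤ δ - ε} := by
  classical
  obtain ⟨k1, -, k2, -⟩ := hp.degree_bounds hA.card_pos hk
  have hx := generator_pow_mul_injective h3 Q hQ hs A hA0
  have hpow := generator_pow_injOn h3 Q hQ hs A hA0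
  have hQ1 := generator_ne_one h3 Q hQ
  set R := (Stmt.recurrences m s r Δ).exec S with hR
  obtain ⟨a1, a2, a3, a4, a5, a6, a7⟩ := Stmt.exec_recurrences (D := r ^ m) hp.one_le_m hp.one_le_r
    hp.r_le hp.pow_le (by rw [h0]; exact hA.card_pos) (by rw [h2]; exact k1) hL (by rwa [h0])
    (by rwa [h0, h2]) (by rwa [h0]) hR
  rw [← a6] at hw
  have b0 : R.var 0 = A.card := (a4 0 (by omega)).trans h0
  have b1 : R.var 1 = ⌊(δ - ε) * (A.card : ℝ) ^ m⌋₊ := (a4 1 (by omega)).trans h1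
  have b2 : R.var 2 = k := (a4 2 (by omega)).trans h2
  have bq : R.q = Q := a3.trans hq
  have hI := isInterpolant_recur hw b0 a7
  have hC : CandReady m s r Δ (r ^ m) R := by
    refine ⟨a1, by rw [bq]; exact Q.ne_zero, by rwa [bq], ?_, fun p hp j => ?_, fun l i hi => ?_⟩
    · rw [bq, a1.base, b0, b2]
      exact fun i hi j hj => hpow i (by omega) j (by omega)
    · rw [b0] at hp
      obtain ⟨a, rfl⟩ := exists_pointIdx (e := e) hp
      rw [hw.point_eq b0, gridPoint]
      refine (map_ne_zero _).mpr fun h => hA0 ?_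
      rw [← h]
      exact (a j).2
    · rw [b0]
      exact hI.degree l i hi
  set I := MState.iter 10 (Stmt.candStep m s r (r ^ m)).exec R R.len with hIt
  obtain ⟨c1, -, c3, c4, c5⟩ := Stmt.iter_candStep hC a5 R.len le_rfl hIt
  have hTI : T = (I.set 10 (R.var 10)).set 0 (I.var 11) := hT
  have hT0 : T.var 0 = I.var 11 := by rw [hTI, MState.set_var_self]
  have hTlen : T.len = S.len := by rw [hTI]; exact c1.len.trans a2
  have hTrow : T.row 0 0 = I.row 0 0 := by rw [hTI]; rfl
  have hwI : HoldsRow e w (I.row 1 0) := by rwa [MState.row_congr c1.len c1.word]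
  have d0 : I.var 0 = A.card := (c1.var 0 (by omega)).trans b0
  have dq : I.q = Q := c1.q.trans bq
  have herr : ∀ g : MvPolynomial (Fin m) K, R.err m s g ≤ R.var 1 ↔
      relDist (qEncode (Q : K) s A g) w ≤ δ - ε := by
    intro g
    rw [relDist_le_iff hA, hw.err_eq b0, b1, bq, Nat.le_floor_iff]
    have := hp.ε_lt
    exact mul_nonneg (by linarith) (by positivity)
  refine ⟨hTlen, ?_, ?_⟩
  · rw [hT0]
    rw [b0] at c3
    exact (Nat.mul_le_mul_right _ c3).trans hL3
  · rw [hT0, hTrow]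
    ext u
    constructor
    · rintro ⟨j, hj, hu⟩
      obtain ⟨g, g1, g2, g3⟩ := c4 j hj
      have hug : qEncode (Q : K) s A g = u := by
        funext a γ
        rw [hu, (hwI.block_iff d0).mp g3, dq]
      refine ⟨⟨g, by rwa [b2] at g1, hug⟩, ?_⟩
      rw [← hug]
      exact (herr g).mp g2
    · rintro ⟨⟨f, hf, rfl⟩, hfw⟩
      rw [bq] at hI
      obtain ⟨y, y1, y2⟩ := hI.exists_isolating hA hQ1 hx hpow hp hk (hw.word_eq b0) hf hfw
      obtain ⟨C, hC', hCd⟩ := exists_digits_eq (B := A.card ^ m) (fun τ => pointIdx e (y τ))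
        fun τ => pointIdx_lt _
      have hiso : Isolated s r R (digits (m := r ^ m) (R.var 0 ^ m) C) f := by
        rw [b0, hCd]
        constructor
        · rwa [b2]
        · intro l
          rw [bq]
          exact hI.recurLin_eq_zero hA hQ1 hx hpow hp hk (hw.word_eq b0) hf hfw l
        · intro τ γ hγ
          have e1 := congrFun (y1 τ) (MultiIdx.ofSumLt γ (mem_simplex.mp hγ))
          rw [← hw.word_eq b0] at e1
          rw [hw.point_eq b0, bq]
          exact e1
        · intro g c hg hrec hag
          rw [bq] at hrec hag
          refine y2 g c (by rwa [b2] at hg) hrec fun τ γ => ?_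
          rw [← hw.word_eq b0, ← hw.point_eq b0]
          exact hag τ _ (val_mem_simplex γ)
      have htup := a1.tuples_le
      rw [b0] at htup c5 c3
      rw [b0] at hiso
      obtain ⟨j, hj, hb⟩ := c5 C (by omega) hC' f hiso ((herr f).mpr hfw)
      refine ⟨j, hj, fun a γ => ?_⟩
      rw [(hwI.block_iff d0).mp hb, dq]

end Correctness

/-! ## The decoding program -/

namespace PolyBdd

theorem of_le {g h : ℕ → ℕ} (hg : PolyBdd g) (hle : ∀ L, h L ≤ g L) : PolyBdd h := by
  obtain ⟨c, hc⟩ := hg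
  exact ⟨c, fun L => (hle L).trans (hc L)⟩

theorem pow {g : ℕ → ℕ} (hg : PolyBdd g) (J : ℕ) : PolyBdd fun L => g L ^ J := by
  induction J with
  | zero => simpa using PolyBdd.const 1
  | succ J ih => simpa only [pow_succ] using ih.mul hg

theorem comp {g h : ℕ → ℕ} (hg : PolyBdd g) (hh : PolyBdd h) : PolyBdd fun L => g (h L) := by
  obtain ⟨c, hc⟩ := hg
  exact ((PolyBdd.const c).mul ((hh.add (.const 1)).pow c)).of_le fun L => hc (h L)

theorem exists_le_pow {g : ℕ → ℕ} (hg : PolyBdd g) {m : ℕ} (hm : 1 ≤ m) :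
    ∃ c, ∀ n, 0 < n → g n ≤ c * (n ^ m) ^ c := by
  obtain ⟨c, hc⟩ := hg
  refine ⟨c * 2 ^ c + c, fun n hn => ?_⟩
  have h1 : n ≤ n ^ m := Nat.le_self_pow (by omega) n
  calc g n ≤ c * (n + 1) ^ c := hc n
    _ ≤ c * (2 * n ^ m) ^ c := by gcongr; omega
    _ = c * 2 ^ c * (n ^ m) ^ c := by rw [mul_pow, mul_assoc]
    _ ≤ (c * 2 ^ c + c) * (n ^ m) ^ (c * 2 ^ c + c) :=
      Nat.mul_le_mul (Nat.le_add_right _ _) (Nat.pow_le_pow_right (Nat.pow_pos hn)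
        (Nat.le_add_left _ _))

end PolyBdd

section Program

/-- The structured view of a machine state. -/
def RamState.toMState {K : Type*} (σ : RamState K) : MState K where
  len := σ.nat 1
  q := σ.fld 0
  var x := σ.nat (2 * x)
  arr k i j := σ.fldMem ((k * σ.nat 1 + i) * σ.nat 1 + j)

theorem RamState.represents {K : Type*} (σ : RamState K) : Represents σ σ.toMState :=
  ⟨rfl, rfl, fun _ => rfl, fun _ _ _ _ _ => rfl⟩

/-- The size parameter can be made large. -/
theorem exists_prelude.{u} (C J : ℕ) : ∃ (p : RamProg) (g : ℕ → ℕ), PolyBdd g ∧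
    ∀ (K : Type u) [Field K] (σ : RamState K), ∃ T ≤ g (σ.nat 0), ∃ σ', RamExec p σ T σ' ∧
      σ'.nat 0 = σ.nat 0 ∧ σ'.nat 1 = (σ.nat 0 + C) ^ J ∧ σ'.nat 2 = σ.nat 2 ∧
      σ'.nat 4 = σ.nat 1 ∧ σ'.fld 0 = σ.fld 0 ∧ σ'.fldMem = σ.fldMem := by
  obtain ⟨p, g, hg, hp⟩ := (NExp.npow .len J).impl.{u} 1 le_rfl
  refine ⟨.seq (.instr (.natConst 3 0)) (.seq (.instr (.natAdd 4 1 3))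
    (.seq (.instr (.natConst 3 C)) (.seq (.instr (.natAdd 1 0 3)) (.seq p
      (.seq (.instr (.natConst 5 0)) (.instr (.natAdd 1 3 5))))))), fun L => g (L + C) + 6,
    (hg.comp (PolyBdd.id.add (.const C))).add (.const 6), fun K _ σ => ?_⟩
  have e1 := exec_natConst σ 3 0
  set σ₁ := σ.setN 3 0 with h1
  have e2 := exec_natAdd σ₁ 4 1 3
  set σ₂ := σ₁.setN 4 (σ₁.nat 1 + σ₁.nat 3) with h2
  have e3 := exec_natConst σ₂ 3 C
  set σ₃ := σ₂.setN 3 C with h3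
  have e4 := exec_natAdd σ₃ 1 0 3
  set σ₄ := σ₃.setN 1 (σ₃.nat 0 + σ₃.nat 3) with h4
  obtain ⟨T, hT, σ₅, e5, hk, hv⟩ := hp K σ₄ _ σ₄.represents
  have e6 := exec_natConst σ₅ 5 0
  set σ₆ := σ₅.setN 5 0 with h6
  have e7 := exec_natAdd σ₆ 1 3 5
  have n0 : σ₄.nat 0 = σ.nat 0 := rfl
  have n1 : σ₄.nat 1 = σ.nat 0 + C := rfl
  have n2 : σ₄.nat 2 = σ.nat 2 := rfl
  have n4 : σ₄.nat 4 = σ.nat 1 := rfl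
  have hlen : σ₄.toMState.len = σ.nat 0 + C := n1
  have hv' : σ₅.nat 3 = (σ.nat 0 + C) ^ J :=
    hv.trans (NExp.eval_npow (b := .len) (S := σ₄.toMState.view) (by exact le_rfl) J)
  rw [hlen] at hT
  refine ⟨_, ?_, _, .seq e1 (.seq e2 (.seq e3 (.seq e4 (.seq e5 (.seq e6 e7))))),
    (hk.var 0).trans n0, ?_, (hk.var 1).trans n2, (hk.var 2).trans n4, hk.fld 0 (by omega), hk.mem⟩
  · beta_reduce
    omega
  · rw [RamState.setN_nat_self, h6, RamState.setN_nat_self, RamState.setN_nat_ne _ _ _ _ (by omega),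
      hv', add_zero]

theorem size_bounds {m s r Δ n k D L : ℕ} (hn : 0 < n) (hs : 1 ≤ s) (hk : Δ * n + k ≤ s * n + 1)
    (hL : L = (n + (s + m + r + 1)) ^ (m * D + 2 * m + 2)) :
    m ≤ L ∧ n + n ^ m * s ^ m ≤ L ∧ r * (Δ * n + k) ^ m + 1 ≤ L ∧
      (n ^ m) ^ D * (n ^ m * s ^ m) ≤ L := by
  set M := n + (s + m + r + 1) with hM
  have hM1 : 1 ≤ M := by omega
  have hpow : ∀ i, i ≤ m * D + 2 * m + 2 → M ^ i ≤ L := fun i hi => by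
    rw [hL]
    exact Nat.pow_le_pow_right hM1 hi
  have hone : ∀ i, 1 ≤ M ^ i := fun i => Nat.pow_pos hM1
  have hsucc : ∀ i, 2 * M ^ i ≤ M ^ (i + 1) := fun i => by
    rw [pow_succ, mul_comm]
    exact Nat.mul_le_mul_left _ (by omega)
  have hns : n ^ m * s ^ m ≤ M ^ (2 * m) := by
    rw [two_mul, pow_add]
    exact Nat.mul_le_mul (Nat.pow_le_pow_left (by omega) _) (Nat.pow_le_pow_left (by omega) _)
  refine ⟨?_, ?_, ?_, ?_⟩
  · have := hpow 1 (by omega)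
    rw [pow_one] at this
    omega
  · have h1 := hpow (2 * m + 1) (by omega)
    rcases Nat.eq_zero_or_pos m with rfl | hm
    · simp only [pow_zero, mul_zero, zero_add, pow_one] at h1 ⊢
      omega
    · have h2 := hsucc (2 * m)
      have h3 : M ^ 1 ≤ M ^ (2 * m) := Nat.pow_le_pow_right hM1 (by omega)
      rw [pow_one] at h3
      omega
  · have h1 := hpow (2 * m + 2) (by omega)
    have h2 : 2 * M ^ (2 * m + 1) ≤ M ^ (2 * m + 2) := hsucc (2 * m + 1)
    have h3 := hone (2 * m + 1)
    have h4 : Δ * n + k ≤ M * M := by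
      calc Δ * n + k ≤ (s + 1) * n := by rw [add_mul]; omega
        _ ≤ M * M := Nat.mul_le_mul (by omega) (by omega)
    have h5 : r * (Δ * n + k) ^ m ≤ M ^ (2 * m + 1) := by
      calc r * (Δ * n + k) ^ m ≤ M * (M * M) ^ m :=
            Nat.mul_le_mul (by omega) (Nat.pow_le_pow_left h4 _)
        _ = M ^ (2 * m + 1) := by rw [← pow_two, ← pow_mul, pow_succ, mul_comm]
    omega
  · refine le_trans ?_ (hpow (m * D + 2 * m) (by omega))
    rw [pow_add, ← pow_mul]
    exact Nat.mul_le_mul (Nat.pow_le_pow_left (by omega) _) hns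

theorem exists_decoder.{u, v} {m s r Δ : ℕ} {δ ε : ℝ} (hp : DecoderParams m s δ ε r Δ) :
    ∃ (p : RamProg) (c : ℕ), ∀ (F : Type v) (K : Type u) [Field F] [Fintype F] [Field K]
      [Algebra F K], Module.finrank F K = 3 → s ≤ Fintype.card F →
      ∀ Q : Kˣ, (∀ x : Kˣ, x ∈ Subgroup.zpowers Q) →
      ∀ A : Finset F, A.Nonempty → (0 : F) ∉ A →
      ∀ k : ℕ, k = ⌈(1 - δ) * ((s : ℝ) * (A.card : ℝ))⌉₊ →
        ListDecodes p (Q : K) m s A k (δ - ε) (c * (A.card ^ m) ^ c) := by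
  obtain ⟨p₁, g₁, hg₁, hp₁⟩ := exists_prelude.{u} (s + m + r + 1) (m * r ^ m + 2 * m + 2)
  obtain ⟨G, hG, hGv⟩ := (Stmt.decode m s r Δ).impl.{u}
  obtain ⟨p₂, g₂, hg₂, hp₂⟩ := hG 1 le_rfl
  obtain ⟨c, hc⟩ := (hg₁.add (hg₂.comp ((PolyBdd.id.add (.const (s + m + r + 1))).pow
    (m * r ^ m + 2 * m + 2)))).exists_le_pow hp.one_le_m
  refine ⟨.seq p₁ p₂, c, fun F K _ _ _ _ h3 hs Q hQ A hA hA0 k hk e w σ hσ => ?_⟩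
  obtain ⟨i0, i1, i2, iQ, iA, iw⟩ := hσ
  obtain ⟨T₁, hT₁, σ₁, ex₁, a0, a1, a2, a4, aQ, amem⟩ := hp₁ K σ
  obtain ⟨T₂, hT₂, σ₂, ex₂, -, -, hR⟩ := hp₂ K σ₁ _ σ₁.represents
  have hlen : σ₁.toMState.len = (A.card + (s + m + r + 1)) ^ (m * r ^ m + 2 * m + 2) := by
    rw [← i0]; exact a1
  obtain ⟨b1, b2, b3, b4⟩ := size_bounds (D := r ^ m) hA.card_pos
    (hp.one_le_r.trans hp.r_le) (hp.degree_bounds hA.card_pos hk).2.2.1 hlen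
  have hrow : ∀ j < σ₁.toMState.len, σ₁.toMState.view.row 0 0 j = σ.fldMem j := by
    intro j hj
    rw [MState.row, if_pos (by exact hj), ← amem]
    simp [MState.view, RamState.toMState]
  have hw : HoldsRow e w (σ₁.toMState.view.row 0 0) := by
    refine ⟨fun i => ?_, fun a γ => ?_⟩
    · rw [hrow _ (by have := i.2; omega)]
      exact iA i
    · rw [hrow _ (by have := wordPos_lt (e := e) a γ; omega)]
      exact iw a γ
  obtain ⟨c1, c2, c3⟩ := Stmt.exec_decode (S := σ₁.toMState.view) h3 hs hQ hA hA0 hp hk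
    (aQ.trans iQ) (a0.trans i0) (a2.trans i2) (a4.trans i1) hw b1 b2 b3 b4 rfl
  rw [← hGv] at c1 c2 c3
  have hlen₂ : (G K σ₁.toMState).len = σ₁.toMState.len := c1
  refine ⟨_, ?_, σ₂, .seq ex₁ ex₂, ?_⟩
  · rw [hlen] at hT₂
    rw [i0] at hT₁
    exact (Nat.add_le_add hT₁ hT₂).trans (hc _ hA.card_pos)
  · rw [← c3, outputWords]
    have hn : σ₂.nat 0 = (G K σ₁.toMState).view.var 0 := hR.var 0
    rw [hn]
    ext u
    refine exists_congr fun j => and_congr_right fun hj => forall_congr' fun a =>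
      forall_congr' fun γ => ?_
    have hJ : j * (A.card ^ m * s ^ m) + wordPos e a γ < (G K σ₁.toMState).len := by
      have h5 := wordPos_lt (e := e) a γ
      have h6 := Nat.mul_le_mul_right (A.card ^ m * s ^ m) (show j + 1 ≤ _ from hj)
      rw [Nat.succ_mul] at h6
      rw [hlen₂]
      have h7 : _ ≤ σ₁.toMState.len := c2
      omega
    have h8 := hR.arr 0 0 _ (by omega) hJ
    simp only [zero_mul, zero_add] at h8
    rw [h8, MState.row, if_pos (by exact hJ)]
    rfl

end Program

theorem theorem1 :
    ∃ C₁ C₂ : ℝ, 0 < C₁ ∧ 0 < C₂ ∧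
      ∀ m : ℕ, 1 ≤ m → ∀ δ ε : ℝ, 0 < δ → δ < 1 → 0 < ε → ε < δ →
      ∀ s : ℕ, C₁ * (m : ℝ) ^ 2 / ε ^ (2 * m) ≤ (s : ℝ) →
      -- the program and the exponent depend on the constants `m`, `δ`, `ε`, `s` only
      ∃ (p : RamProg) (c : ℕ),
      ∀ (F K : Type*) [Field F] [Fintype F] [Field K] [Algebra F K],
        Module.finrank F K = 3 → s ≤ Fintype.card F →
      ∀ Q : Kˣ, (∀ x : Kˣ, x ∈ Subgroup.zpowers Q) →
      ∀ A : Finset F, A.Nonempty → (0 : F) ∉ A →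
      ∀ k : ℕ, k = ⌈(1 - δ) * ((s : ℝ) * (A.card : ℝ))⌉₊ →
        ListDecodes p (Q : K) m s A k (δ - ε) (c * (A.card ^ m) ^ c) ∧
        ∀ w : QWord K m s A, ∃ V : AffineSubspace K (QWord K m s A),
          (Module.finrank K V.direction : ℝ) ≤ C₂ * (m : ℝ) ^ 2 / ε ∧
          ∀ u ∈ qMultCode (Q : K) m s A k, relDist u w ≤ δ - ε → u ∈ V := by
  refine ⟨100, 3, by norm_num, by norm_num, fun m hm δ ε hδ hδ1 hε hεδ s hs => ?_⟩
  obtain ⟨r, Δ, h1, h2, h3, h4⟩ := exists_interpolation_params hm hε (hεδ.trans hδ1) hs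
  obtain ⟨p, c, hp⟩ := exists_decoder ⟨hm, hδ1, hε, hεδ, h1, h2, h3, h4⟩
  refine ⟨p, c, fun F K _ _ _ _ hF hsF Q hQ A hA hA0 k hk =>
    ⟨hp F K hF hsF Q hQ A hA hA0 k hk, fun w => ?_⟩⟩
  exact exists_affineSubspace_of_list hA (generator_ne_one hF Q hQ)
    (generator_pow_mul_injective hF Q hQ hsF A hA0) (generator_pow_injOn hF Q hQ hsF A hA0) hm hδ hδ1
    hε hεδ hs hk w
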